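/- **Proposition ($LGl(n,\mathbb C)/P_{LGl(n,\mathbb C)}$ as infinite chains of sheaves).** Let $LGl(n,\mathbb C)$ be the group of analytic loops $g$ in $GL(n,\mathbb C)$, i.e. maps on the circle $|z|=1$ that extend holomorphically to a neighbourhood of it. Let $\tilde\Delta_0\subsetneq\{1,\dots,n\}$, write $\{j_1<\dots<j_k\}=\{1,\dots,n\}\setminus\tilde\Delta_0$, and label the simple roots of the loop algebra $\alpha_1,\dots,\alpha_{n-1}$ and $\alpha_n:=\alpha_0=\delta-\theta$. Let $\chi$ be the $\mathbb Z$-linear function on the root lattice with $\chi(\alpha_i)=0$ for $i\in\tilde\Delta_0$ and $\chi(\alpha_i)=1$ otherwise, and let $P=P_{LGl(n,\mathbb C)}$ be the parabolic subgroup associated to $\tilde\Delta_0$: the group of loops $g$ such that $g$ and $g^{-1}$ only involve, in their Laurent expansions, terms $z^mE_{ab}$ with $\chi(m\delta+\varepsilon_a-\varepsilon_b)\ge 0$. (1) Using loops as transition functions gives a bijection between $LGl(n,\mathbb C)/P$ and the set of isomorphism classes of infinite chains $$\dots\subset E^{-1,j_k}\subset E^{0,j_1}\subset E^{0,j_2}\subset\dots\subset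 E^{0,j_k}\subset E^{1,j_1}\subset\dots$$ of coherent torsion-free sheaves of rank $n$ on $\mathbb P^1$, equipped with compatible trivialisations over (a neighbourhood of) $|z|\ge 1$, which are periodic, i.e. $E^{i-1,j}=zE^{i,j}$ near the origin as subsheaves of $E^{i,j}$ (and $E^{i-1,j}=E^{i,j}$ away from it), and such that $$E^{i,j_{\ell+1}}/E^{i,j_\ell}\cong\mathcal O_0^{\,j_{\ell+1}-j_\ell},\qquad E^{i+1,j_1}/E^{i,j_k}\cong\mathcal O_0^{\,n+j_1-j_k},$$ where $\mathcal O_0$ is the skyscraper sheaf with stalk $\mathbb C$ at $z=0$. Explicitly, the class of $g$ corresponds to the chain for which there is, on a neighbourhood of $|z|\le 1$, a basis $e_1,\dots,e_n$ (meromorphic at $0$) with $e_a=\sum_b g_{ba}t_b$ near $|z|=1$, where $t$ is the trivialisation, such that $z^{-i}e_1,\dots,z^{-i}e_j,z^{-i+1}e_{j+1},\dots,z^{-i+1}e_n$ is a frame of $E^{i,j}$ for all $i,j$. (2) For each $i\in\mathbb Z$ and each $s$, choosing $E^{i,j_s}$ as base bundle gives a bijection between isomorphism classes of such chains and isomorphism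 classes of holomorphic rank $n$ bundles $F$ on $\mathbb P^1$, trivialised over $|z|\ge 1$ and equipped with a flag of subspaces of the fibre at $0$ of dimensions $$j_{s+1}-j_s,\ j_{s+2}-j_s,\ \dots,\ j_k-j_s,\ n+j_1-j_s,\ \dots,\ n+j_{s-1}-j_s.$$ Here $F=E^{i,j_s}$ with its trivialisation, and the flag consists of the images, in the fibre of $E^{i,j_s}$ at $0$, of the fibres of the sheaves of the chain lying strictly between $E^{i-1,j_s}$ and $E^{i,j_s}$. If the chain corresponds to a loop $g$, and $w\in\mathbb Z$ is the winding number of $\det g$ around $0$ (every $g$ has exactly one), then $F$ has degree exactly $n(i-1)+j_s-w$; in particular the degree is $n(i-1)+j_s$ for loops with $\det g$ of winding number $0$. -/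

import Mathlib

open TopologicalSpace Topology

noncomputable section

namespace LoopFlag

/-! ## Analytic loops in `GL(n, ℂ)` and the parabolic subgroups -/

/-- The algebra of analytic loops: functions on the unit circle which extend holomorphically to a
neighbourhood of the circle in `ℂ`. -/
def Loop : Subalgebra ℂ (Circle → ℂ) where
  carrier := {f | ∃ F : ℂ → ℂ, AnalyticOnNhd ℂ F (Metric.sphere 0 1) ∧ ∀ z : Circle, f z = F z}
  mul_mem' := by
    rintro f g ⟨F, hF, hf⟩ ⟨G, hG, hg⟩
    exact ⟨F * G, hF.mul hG, fun z => by simp [hf, hg]⟩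
  add_mem' := by
    rintro f g ⟨F, hF, hf⟩ ⟨G, hG, hg⟩
    exact ⟨F + G, hF.add hG, fun z => by simp [hf, hg]⟩
  algebraMap_mem' c := ⟨fun _ => c, analyticOnNhd_const, fun z => by simp⟩

/-- The loop group `LGl(n, ℂ)`. -/
abbrev LoopGL (n : ℕ) : Type := Matrix.GeneralLinearGroup (Fin n) Loop

/-- The value `χ(α_i)` on the simple root `α_i`, `1 ≤ i ≤ n`, where the affine simple root
`α_0 = δ - θ` carries the label `n`: zero on `Δ`, one off `Δ`. -/
def simpleValue (Δ : Finset ℕ) (i : ℕ) : ℤ := if i ∈ Δ then 0 else 1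

/-- `χ(m δ + ε_a - ε_b)`, where `χ` is the `ℤ`-linear extension of `simpleValue` to the root lattice
and `z ^ m E_{ab}` spans the root space of `m δ + ε_a - ε_b`. Here `α_i = ε_i - ε_{i+1}` for
`1 ≤ i < n`, and `δ` is the sum of all the simple roots (`Fin n` is `{1, …, n}` shifted by one). -/
def chi (n : ℕ) (Δ : Finset ℕ) (m : ℤ) (a b : Fin n) : ℤ :=
  m * ∑ i ∈ Finset.Icc 1 n, simpleValue Δ i
    + ∑ i ∈ Finset.Icc 1 (b : ℕ), simpleValue Δ i
    - ∑ i ∈ Finset.Icc 1 (a : ℕ), simpleValue Δ i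

/-- Loops `f` whose expansion at the origin is a (convergent) series in the powers `z ^ m` with
`χ(m δ + ε_a - ε_b) ≥ 0`: `f = z ^ m H` with `H` holomorphic on `|z| ≤ 1` for such an `m`
(`χ` is non-decreasing in `m`). -/
def EntryCondition (n : ℕ) (Δ : Finset ℕ) (a b : Fin n) (f : Loop) : Prop :=
  ∃ m : ℤ, 0 ≤ chi n Δ m a b ∧ ∃ H : ℂ → ℂ, AnalyticOnNhd ℂ H (Metric.closedBall 0 1) ∧
    ∀ z : Circle, f.1 z = (z : ℂ) ^ m * H z

/-- Matrices of loops with an expansion in the root spaces with `χ ≥ 0` (and the Cartan subalgebra):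
the block upper triangular matrices of the `n`-periodic infinite matrix picture. -/
def InParabolicAlgebra (n : ℕ) (Δ : Finset ℕ) (A : Matrix (Fin n) (Fin n) Loop) : Prop :=
  ∀ a b, EntryCondition n Δ a b (A a b)

lemma simpleValue_nonneg (Δ : Finset ℕ) (i : ℕ) : 0 ≤ simpleValue Δ i := by
  unfold simpleValue; split_ifs <;> norm_num

lemma exists_chi_nonneg (n : ℕ) (Δ : Finset ℕ) (a b : Fin n) : 0 ≤ chi n Δ 1 a b := by
  have h1 : ∑ i ∈ Finset.Icc 1 (a : ℕ), simpleValue Δ i ≤ ∑ i ∈ Finset.Icc 1 n, simpleValue Δ i :=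
    Finset.sum_le_sum_of_subset_of_nonneg (Finset.Icc_subset_Icc le_rfl a.2.le)
      (fun i _ _ => simpleValue_nonneg Δ i)
  have h2 : 0 ≤ ∑ i ∈ Finset.Icc 1 (b : ℕ), simpleValue Δ i :=
    Finset.sum_nonneg (fun i _ => simpleValue_nonneg Δ i)
  unfold chi
  linarith

lemma EntryCondition.zero {n : ℕ} {Δ : Finset ℕ} {a b : Fin n} : EntryCondition n Δ a b 0 :=
  ⟨1, exists_chi_nonneg n Δ a b, 0, fun _ _ => analyticAt_const, fun z => by simp⟩

lemma EntryCondition.add {n : ℕ} {Δ : Finset ℕ} {a b : Fin n} {f g : Loop}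
    (hf : EntryCondition n Δ a b f) (hg : EntryCondition n Δ a b g) :
    EntryCondition n Δ a b (f + g) := by
  have key : ∀ {f g : Loop} {m l : ℤ}, m ≤ l → 0 ≤ chi n Δ m a b →
      (∃ H : ℂ → ℂ, AnalyticOnNhd ℂ H (Metric.closedBall 0 1) ∧
        ∀ z : Circle, f.1 z = (z : ℂ) ^ m * H z) →
      (∃ H : ℂ → ℂ, AnalyticOnNhd ℂ H (Metric.closedBall 0 1) ∧
        ∀ z : Circle, g.1 z = (z : ℂ) ^ l * H z) → EntryCondition n Δ a b (f + g) := by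
    rintro f g m l hml hm ⟨F, hF, hf⟩ ⟨G, hG, hg⟩
    refine ⟨m, hm, F + (fun z => z ^ (l - m).toNat) * G,
      hF.add (AnalyticOnNhd.mul (fun z _ => analyticAt_id.pow _) hG), fun z => ?_⟩
    have hz : (z : ℂ) ≠ 0 := z.coe_ne_zero
    have e : (z : ℂ) ^ l = (z : ℂ) ^ m * (z : ℂ) ^ (l - m).toNat := by
      rw [← zpow_natCast, ← zpow_add₀ hz]
      congr 1
      omega
    have : (f + g).1 z = f.1 z + g.1 z := rfl
    rw [this, hf, hg, e]
    simp only [Pi.add_apply, Pi.mul_apply]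
    ring
  obtain ⟨m, hm, hF⟩ := hf
  obtain ⟨l, hl, hG⟩ := hg
  rcases le_total m l with h | h
  · exact key h hm hF hG
  · rw [add_comm]
    exact key h hl hG hF

lemma EntryCondition.mul {n : ℕ} {Δ : Finset ℕ} {a b c : Fin n} {f g : Loop}
    (hf : EntryCondition n Δ a b f) (hg : EntryCondition n Δ b c g) :
    EntryCondition n Δ a c (f * g) := by
  obtain ⟨m, hm, F, hF, hf⟩ := hf
  obtain ⟨l, hl, G, hG, hg⟩ := hg
  refine ⟨m + l, ?_, F * G, hF.mul hG, fun z => ?_⟩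
  · unfold chi at *
    linarith
  · have : (f * g).1 z = f.1 z * g.1 z := rfl
    rw [this, hf, hg, zpow_add₀ z.coe_ne_zero]
    simp only [Pi.mul_apply]
    ring

lemma InParabolicAlgebra.one (n : ℕ) (Δ : Finset ℕ) : InParabolicAlgebra n Δ 1 := by
  intro a b
  by_cases h : a = b
  · subst h
    refine ⟨0, by simp [chi], 1, fun _ _ => analyticAt_const, fun z => ?_⟩
    simp
  · rw [Matrix.one_apply_ne h]
    exact EntryCondition.zero

lemma InParabolicAlgebra.mul {n : ℕ} {Δ : Finset ℕ} {A B : Matrix (Fin n) (Fin n) Loop}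
    (hA : InParabolicAlgebra n Δ A) (hB : InParabolicAlgebra n Δ B) :
    InParabolicAlgebra n Δ (A * B) := by
  intro a b
  rw [Matrix.mul_apply]
  exact Finset.sum_induction _ (EntryCondition n Δ a b) (fun _ _ => EntryCondition.add)
    EntryCondition.zero (fun c _ => (hA a c).mul (hB c b))

/-- The parabolic subgroup of `LGl(n, ℂ)` attached to `Δ ⊆ {1, …, n}`: the invertible elements of
the (completed) parabolic algebra of all root spaces with `χ ≥ 0`. -/
def parabolic (n : ℕ) (Δ : Finset ℕ) : Subgroup (LoopGL n) where
  carrier := {g | InParabolicAlgebra n Δ (g : Matrix (Fin n) (Fin n) Loop) ∧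
    InParabolicAlgebra n Δ ((g⁻¹ : LoopGL n) : Matrix (Fin n) (Fin n) Loop)}
  one_mem' := ⟨InParabolicAlgebra.one n Δ, by simpa using InParabolicAlgebra.one n Δ⟩
  mul_mem' := by
    rintro g h ⟨hg, hg'⟩ ⟨hh, hh'⟩
    refine ⟨?_, ?_⟩
    · simpa using hg.mul hh
    · rw [mul_inv_rev]
      exact hh'.mul hg'
  inv_mem' := by
    rintro g ⟨hg, hg'⟩
    exact ⟨hg', by simpa using hg⟩

/-- The nowhere vanishing loop `f` has winding number `w` around zero. -/
def HasWinding (f : Loop) (w : ℤ) : Prop :=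
  ∃ h : Loop, ∀ z : Circle, f.1 z = (z : ℂ) ^ w * Complex.exp (h.1 z)

/-! ## The Riemann sphere and its structure sheaf -/

/-- The projective line `ℙ¹ = ℂ ∪ {∞}`. -/
abbrev P1 : Type := OnePoint ℂ

/-- The point `z = 0`. -/
def zero : P1 := ((0 : ℂ) : P1)

/-- The chart `w = 1 / z` at infinity. -/
def chartInf (w : ℂ) : P1 := if w = 0 then OnePoint.infty else ((w⁻¹ : ℂ) : P1)

/-- Extension by zero outside `U`. -/
def ext {U : Opens P1} (f : U → ℂ) (x : P1) : ℂ :=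
  open Classical in if h : x ∈ U then f ⟨x, h⟩ else 0

/-- `f` is holomorphic on the open subset `U` of `ℙ¹`. -/
def IsHolo {U : Opens P1} (f : U → ℂ) : Prop :=
  (∀ z : ℂ, (z : P1) ∈ U → AnalyticAt ℂ (fun w : ℂ => ext f w) z) ∧
  (OnePoint.infty ∈ U → AnalyticAt ℂ (fun w : ℂ => ext f (chartInf w)) 0)

lemma continuousAt_chartInf : ContinuousAt chartInf 0 := by
  rw [continuousAt_iff_punctured_nhds]
  have h0 : chartInf 0 = OnePoint.infty := by simp [chartInf]
  rw [h0]
  have h1 : Filter.Tendsto (fun w : ℂ => ((w⁻¹ : ℂ) : P1)) (𝓝[≠] 0) (𝓝 OnePoint.infty) := by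
    have := (OnePoint.tendsto_nhds_infty (X := ℂ) (f := id) (l := 𝓝 OnePoint.infty)).1
      Filter.tendsto_id
    have h2 : Filter.Tendsto (fun z : ℂ => (z : P1)) (Filter.coclosedCompact ℂ)
        (𝓝 OnePoint.infty) := by
      rw [← OnePoint.comap_coe_nhds_infty]
      exact Filter.tendsto_comap
    refine h2.comp ?_
    rw [Filter.coclosedCompact_eq_cocompact, ← Metric.cobounded_eq_cocompact]
    exact Filter.tendsto_inv₀_nhdsNE_zero
  refine h1.congr' ?_
  filter_upwards [self_mem_nhdsWithin] with w hw
  have : w ≠ 0 := hw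
  simp [chartInf, this]

lemma eventually_coe {U : Opens P1} {z : ℂ} (h : (z : P1) ∈ U) : ∀ᶠ w : ℂ in 𝓝 z, (w : P1) ∈ U :=
  OnePoint.continuous_coe.continuousAt.eventually (U.isOpen.mem_nhds h)

lemma eventually_chartInf {U : Opens P1} (h : OnePoint.infty ∈ U) :
    ∀ᶠ w : ℂ in 𝓝 0, chartInf w ∈ U := by
  refine continuousAt_chartInf.eventually (U.isOpen.mem_nhds ?_)
  simpa [chartInf] using h

lemma IsHolo.restrict {U V : Opens P1} (h : U ≤ V) {f : V → ℂ} (hf : IsHolo f) :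
    IsHolo (fun x : U => f ⟨x, h x.2⟩) := by
  refine ⟨fun z hz => (hf.1 z (h hz)).congr ?_, fun hi => (hf.2 (h hi)).congr ?_⟩
  · filter_upwards [eventually_coe hz] with w hw
    simp [ext, hw, h hw]
  · filter_upwards [eventually_chartInf hi] with w hw
    simp [ext, hw, h hw]

/-- The ring `𝒪(U)` of holomorphic functions on `U`. -/
def Hol (U : Opens P1) : Subalgebra ℂ (U → ℂ) where
  carrier := {f | IsHolo f}
  mul_mem' := by
    intro f g hf hg
    have e : ∀ x, ext (f * g) x = ext f x * ext g x := by
      intro x; by_cases h : x ∈ U <;> simp [ext, h]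
    refine ⟨fun z hz => ?_, fun hi => ?_⟩
    · simp only [e]
      exact (hf.1 z hz).mul (hg.1 z hz)
    · simp only [e]
      exact (hf.2 hi).mul (hg.2 hi)
  add_mem' := by
    intro f g hf hg
    have e : ∀ x, ext (f + g) x = ext f x + ext g x := by
      intro x; by_cases h : x ∈ U <;> simp [ext, h]
    refine ⟨fun z hz => ?_, fun hi => ?_⟩
    · simp only [e]
      exact (hf.1 z hz).add (hg.1 z hz)
    · simp only [e]
      exact (hf.2 hi).add (hg.2 hi)
  algebraMap_mem' c := by
    refine ⟨fun z hz => (analyticAt_const (v := c)).congr ?_,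
      fun hi => (analyticAt_const (v := c)).congr ?_⟩
    · filter_upwards [eventually_coe hz] with w hw
      simp [ext, hw]
    · filter_upwards [eventually_chartInf hi] with w hw
      simp [ext, hw]

/-- Restriction of holomorphic functions. -/
def Hol.res {U V : Opens P1} (h : U ≤ V) : Hol V →ₐ[ℂ] Hol U where
  toFun f := ⟨fun x => f.1 ⟨x, h x.2⟩, IsHolo.restrict h f.2⟩
  map_one' := rfl
  map_mul' _ _ := rfl
  map_zero' := rfl
  map_add' _ _ := rfl
  commutes' _ := rfl

/-- The coordinate `z` on an open subset of `ℂ`. -/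
def coord (U : Opens P1) (hU : OnePoint.infty ∉ U) : Hol U :=
  ⟨fun x => (x : P1).elim 0 id, by
    refine ⟨fun z hz => analyticAt_id.congr ?_, fun hi => absurd hi hU⟩
    filter_upwards [eventually_coe hz] with w hw
    simp [ext, hw]⟩

/-! ## Sheaves of `𝒪`-modules on the Riemann sphere -/

/-- A sheaf of `𝒪`-modules on `ℙ¹`. -/
structure OMod : Type 1 where
  sec : Opens P1 → Type
  [grp : ∀ U, AddCommGroup (sec U)]
  [mod : ∀ U, Module (Hol U) (sec U)]
  res : ∀ {U V : Opens P1}, U ≤ V → sec V →+ sec U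
  res_smul : ∀ {U V : Opens P1} (h : U ≤ V) (f : Hol V) (s : sec V),
    res h (f • s) = Hol.res h f • res h s
  res_self : ∀ {U : Opens P1} (s : sec U), res le_rfl s = s
  res_res : ∀ {U V W : Opens P1} (h : U ≤ V) (h' : V ≤ W) (s : sec W),
    res h (res h' s) = res (h.trans h') s
  glue : ∀ {ι : Type} (U : ι → Opens P1) (s : ∀ i, sec (U i)),
    (∀ i j, res (inf_le_left : U i ⊓ U j ≤ U i) (s i) = res inf_le_right (s j)) →
    ∃! t : sec (⨆ i, U i), ∀ i, res (le_iSup U i) t = s i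

attribute [instance] OMod.grp OMod.mod

/-- Sections are complex vector spaces through the constant functions. -/
instance OMod.complexModule (E : OMod) (U : Opens P1) : Module ℂ (E.sec U) :=
  Module.compHom (E.sec U) (algebraMap ℂ (Hol U))

/-- A morphism of sheaves of `𝒪`-modules. -/
structure Hom (E F : OMod) where
  map : ∀ U, E.sec U →ₗ[Hol U] F.sec U
  naturality : ∀ {U V : Opens P1} (h : U ≤ V) (s : E.sec V),
    map U (E.res h s) = F.res h (map V s)

/-- The identity morphism. -/
def Hom.id (E : OMod) : Hom E E := ⟨fun _ => LinearMap.id, fun _ _ => rfl⟩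

/-- Composition: first `f`, then `g`. -/
def Hom.comp {E F G : OMod} (f : Hom E F) (g : Hom F G) : Hom E G :=
  ⟨fun U => (g.map U).comp (f.map U), fun h s => by simp [f.naturality, g.naturality]⟩

/-- Isomorphisms of sheaves. -/
def Hom.IsIso {E F : OMod} (f : Hom E F) : Prop := ∀ U, Function.Bijective (f.map U)

/-- The inverse of an isomorphism. -/
def Hom.inv {E F : OMod} (f : Hom E F) (hf : f.IsIso) : Hom F E where
  map U := (LinearEquiv.ofBijective (f.map U) (hf U)).symm.toLinearMap
  naturality {U V} h s := by
    apply (hf U).1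
    have e : ∀ W (y : F.sec W),
        f.map W ((LinearEquiv.ofBijective (f.map W) (hf W)).symm y) = y := fun W y =>
      (LinearEquiv.ofBijective (f.map W) (hf W)).apply_symm_apply y
    simp only [LinearEquiv.coe_coe]
    rw [e, f.naturality, e]

lemma Hom.map_inv {E F : OMod} (f : Hom E F) (hf : f.IsIso) (U : Opens P1) (y : F.sec U) :
    f.map U ((f.inv hf).map U y) = y :=
  (LinearEquiv.ofBijective (f.map U) (hf U)).apply_symm_apply y

lemma Hom.inv_map {E F : OMod} (f : Hom E F) (hf : f.IsIso) (U : Opens P1) (x : E.sec U) :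
    (f.inv hf).map U (f.map U x) = x :=
  (LinearEquiv.ofBijective (f.map U) (hf U)).symm_apply_apply x

lemma Hom.isIso_inv {E F : OMod} (f : Hom E F) (hf : f.IsIso) : (f.inv hf).IsIso := fun U =>
  (LinearEquiv.ofBijective (f.map U) (hf U)).symm.bijective

/-- `e` is a frame of `E` over `W`, that is, an isomorphism `𝒪^n|_W ≅ E|_W`. -/
def IsFrame {n : ℕ} (E : OMod) {W : Opens P1} (e : Fin n → E.sec W) : Prop :=
  ∀ (V : Opens P1) (h : V ≤ W),
    Function.Bijective (fun c : Fin n → Hol V => ∑ a, c a • E.res h (e a))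

/-- `E` is locally free of rank `n` (a holomorphic vector bundle). -/
def IsLocallyFree (n : ℕ) (E : OMod) : Prop :=
  ∀ x : P1, ∃ W : Opens P1, x ∈ W ∧ ∃ e : Fin n → E.sec W, IsFrame E e

/-- `E` has (generic) rank `n`. -/
def HasRank (n : ℕ) (E : OMod) : Prop :=
  ∃ U : Opens P1, Dense (U : Set P1) ∧
    ∀ x ∈ U, ∃ W : Opens P1, x ∈ W ∧ ∃ e : Fin n → E.sec W, IsFrame E e

/-- `E` is torsion free: a section killed by a function which vanishes identically on no non-empty
open set is zero. -/
def IsTorsionFree (E : OMod) : Prop :=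
  ∀ (U : Opens P1) (f : Hol U) (s : E.sec U),
    (∀ (V : Opens P1) (h : V ≤ U), V ≠ ⊥ → Hol.res h f ≠ 0) → f • s = 0 → s = 0

/-- `E` is coherent: locally there is an exact sequence `𝒪^a → 𝒪^b → E → 0`. -/
def IsCoherent (E : OMod) : Prop :=
  ∀ x : P1, ∃ W : Opens P1, x ∈ W ∧ ∃ (b a : ℕ) (s : Fin b → E.sec W) (A : Fin a → Fin b → Hol W),
    (∀ (V : Opens P1) (_ : V ≤ W) (t : E.sec V), ∀ y ∈ V, ∃ (V' : Opens P1) (h' : V' ≤ V)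
      (h : V' ≤ W) (c : Fin b → Hol V'), y ∈ V' ∧ E.res h' t = ∑ i, c i • E.res h (s i)) ∧
    (∀ k, ∑ i, A k i • s i = 0) ∧
    (∀ (V : Opens P1) (h : V ≤ W) (c : Fin b → Hol V), ∑ i, c i • E.res h (s i) = 0 →
      ∀ y ∈ V, ∃ (V' : Opens P1) (h' : V' ≤ V) (r : Fin a → Hol V'), y ∈ V' ∧
        ∀ i, Hol.res h' (c i) = ∑ k, r k * Hol.res (h'.trans h) (A k i))

/-- The skyscraper sheaf `𝒪_0^m`, with stalk `ℂ^m` at `z = 0`; functions act through their value at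
`0`. -/
def sky (m : ℕ) : OMod where
  sec U := PLift (zero ∈ U) → Fin m → ℂ
  mod U :=
    { smul := fun f v h => f.1 ⟨zero, h.down⟩ • v h
      one_smul := fun v => by funext h; exact one_smul ℂ (v h)
      mul_smul := fun f g v => by funext h; exact mul_smul (f.1 ⟨zero, h.down⟩) _ (v h)
      smul_zero := fun f => by funext h; exact smul_zero (f.1 ⟨zero, h.down⟩)
      smul_add := fun f v w => by funext h; exact smul_add (f.1 ⟨zero, h.down⟩) (v h) (w h)
      add_smul := fun f g v => by funext h; exact add_smul (f.1 ⟨zero, h.down⟩) _ (v h)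
      zero_smul := fun v => by funext h; exact zero_smul ℂ (v h) }
  res h :=
    { toFun := fun v k => v ⟨h k.down⟩
      map_zero' := rfl
      map_add' := fun _ _ => rfl }
  res_smul _ _ _ := rfl
  res_self _ := rfl
  res_res _ _ _ := rfl
  glue {ι} U s hs := by
    have key : ∀ k : PLift (zero ∈ ⨆ i, U i), ∃ i, zero ∈ U i := fun k =>
      Opens.mem_iSup.1 k.down
    refine ⟨fun k => s (key k).choose ⟨(key k).choose_spec⟩, fun i => ?_, fun t ht => ?_⟩
    · funext k
      have hk : zero ∈ ⨆ i, U i := Opens.mem_iSup.2 ⟨i, k.down⟩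
      exact congrFun (hs (key ⟨hk⟩).choose i) ⟨⟨(key ⟨hk⟩).choose_spec, k.down⟩⟩
    · funext k
      exact congrFun (ht (key k).choose) ⟨(key k).choose_spec⟩

/-- The quotient of the inclusion `ι : E' → E` is isomorphic to `𝒪_0^m`: there is an exact sequence
of sheaves `E' → E → 𝒪_0^m → 0`. -/
def QuotientIsSky {E' E : OMod} (ι : Hom E' E) (m : ℕ) : Prop :=
  ∃ q : Hom E (sky m),
    (∀ (U : Opens P1) (s : E.sec U), q.map U s = 0 ↔ ∃ r : E'.sec U, ι.map U r = s) ∧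
    (∀ (U : Opens P1) (v : (sky m).sec U), ∀ x ∈ U, ∃ (V : Opens P1) (h : V ≤ U) (s : E.sec V),
      x ∈ V ∧ q.map V s = (sky m).res h v)

/-- The section `s` lies in the subsheaf `I_0 E`, where `I_0` is the ideal sheaf of `z = 0` (a
principal ideal near `0`, and the unit ideal elsewhere). Near `0` this is the sheaf `z E`. -/
def VanishesAtZero {E : OMod} {U : Opens P1} (s : E.sec U) : Prop :=
  zero ∈ U → ∃ (V : Opens P1) (h : V ≤ U) (h0 : zero ∈ V) (f : Hol V) (u : E.sec V),
    f.1 ⟨zero, h0⟩ = 0 ∧ E.res h s = f • u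

/-! ## Trivialisations over `|z| ≥ 1` -/

/-- The closed disc `|z| ≥ 1` around `∞`. -/
def outerDisc : Set P1 := {x | ∀ z : ℂ, x = (z : P1) → 1 ≤ ‖z‖}

/-- A trivialisation of `E` over the closed disc `|z| ≥ 1`, that is, a frame over some open
neighbourhood of it. Only its germ along `|z| ≥ 1` matters: see `Hom.Respects`. -/
structure Framing (n : ℕ) (E : OMod) where
  dom : Opens P1
  outer_sub : outerDisc ⊆ dom
  frame : Fin n → E.sec dom
  isFrame : IsFrame E frame

/-- The morphism `f` is compatible with the trivialisations near `|z| ≥ 1`. -/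
def Hom.Respects {n : ℕ} {E F : OMod} (f : Hom E F) (t : Framing n E) (u : Framing n F) : Prop :=
  ∃ (V : Opens P1) (h : V ≤ t.dom) (h' : V ≤ u.dom), outerDisc ⊆ V ∧
    ∀ a, f.map V (E.res h (t.frame a)) = F.res h' (u.frame a)

lemma Hom.Respects.refl {n : ℕ} {E : OMod} (t : Framing n E) : (Hom.id E).Respects t t :=
  ⟨t.dom, le_rfl, le_rfl, t.outer_sub, fun _ => rfl⟩

lemma Hom.Respects.comp {n : ℕ} {E F G : OMod} {f : Hom E F} {g : Hom F G} {t : Framing n E}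
    {u : Framing n F} {v : Framing n G} (hf : f.Respects t u) (hg : g.Respects u v) :
    (f.comp g).Respects t v := by
  obtain ⟨V, h1, h2, h3, h4⟩ := hf
  obtain ⟨W, k1, k2, k3, k4⟩ := hg
  refine ⟨V ⊓ W, inf_le_left.trans h1, inf_le_right.trans k2, fun x hx => ⟨h3 hx, k3 hx⟩,
    fun a => ?_⟩
  have e1 := congrArg (F.res (inf_le_left : V ⊓ W ≤ V)) (h4 a)
  have e2 := congrArg (G.res (inf_le_right : V ⊓ W ≤ W)) (k4 a)
  rw [← f.naturality, E.res_res, F.res_res] at e1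
  rw [← g.naturality, F.res_res, G.res_res] at e2
  change g.map _ (f.map _ _) = _
  rw [e1, e2]

lemma Hom.Respects.inv {n : ℕ} {E F : OMod} {f : Hom E F} {t : Framing n E} {u : Framing n F}
    (hf : f.Respects t u) (hi : f.IsIso) : (f.inv hi).Respects u t := by
  obtain ⟨V, h1, h2, h3, h4⟩ := hf
  exact ⟨V, h2, h1, h3, fun a => by rw [← h4 a, f.inv_map]⟩

/-! ## Degree -/

/-- `E` is a vector bundle of rank `n` and degree `d` on `ℙ¹`, i.e. `det E ≅ 𝒪(d)`: there is a
section `σ` of `det E` over `ℙ¹ ∖ {0}`, holomorphic and nowhere zero, of order `d` at `0`. The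
section is given by its coefficient `σ e` with respect to `e_1 ∧ ⋯ ∧ e_n` for each local frame `e`;
a change of frame `e' = e M` changes the coefficients by `σ e = det M · σ e'`. -/
def HasDegree (n : ℕ) (E : OMod) (d : ℤ) : Prop :=
  IsLocallyFree n E ∧ ∃ σ : ∀ W : Opens P1, (Fin n → E.sec W) → P1 → ℂ,
    (∀ (W W' : Opens P1) (e : Fin n → E.sec W) (e' : Fin n → E.sec W'),
      IsFrame E e → IsFrame E e' →
      ∀ (V : Opens P1) (h : V ≤ W) (h' : V ≤ W') (M : Matrix (Fin n) (Fin n) (Hol V)),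
        (∀ b, E.res h' (e' b) = ∑ a, M a b • E.res h (e a)) →
        ∀ x : V, (x : P1) ≠ zero → σ W e x = M.det.1 x * σ W' e' x) ∧
    (∀ (W : Opens P1) (e : Fin n → E.sec W), IsFrame E e →
      IsHolo (U := W ⊓ ⟨{zero}ᶜ, isClosed_singleton.isOpen_compl⟩) (fun x => σ W e x) ∧
      (∀ x ∈ W, x ≠ zero → σ W e x ≠ 0) ∧
      (zero ∈ W → ∃ u : ℂ → ℂ, AnalyticAt ℂ u 0 ∧ u 0 ≠ 0 ∧
        ∀ᶠ z : ℂ in 𝓝[≠] 0, σ W e (z : P1) = z ^ d * u z))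

/-! ## Chains of sheaves -/

/-- Indices `(i, j)` with `i ∈ ℤ` and `j ∈ {1, …, n} ∖ Δ`. -/
structure Idx (n : ℕ) (Δ : Finset ℕ) where
  i : ℤ
  j : ℕ
  mem : j ∈ Finset.Icc 1 n \ Δ

/-- The position `n i + j`. As `1 ≤ j ≤ n`, ordering the indices by position is the lexicographic
order. -/
def Idx.pos {n : ℕ} {Δ : Finset ℕ} (p : Idx n Δ) : ℤ := n * p.i + p.j

/-- `(i, j) ↦ (i - 1, j)`. -/
def Idx.pred {n : ℕ} {Δ : Finset ℕ} (p : Idx n Δ) : Idx n Δ := ⟨p.i - 1, p.j, p.mem⟩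

lemma Idx.pred_le {n : ℕ} {Δ : Finset ℕ} (p : Idx n Δ) : p.pred.pos ≤ p.pos := by
  simp only [Idx.pos, Idx.pred]
  have : (0 : ℤ) ≤ n := Int.natCast_nonneg n
  linarith

/-- Periodic chains `⋯ ⊂ E^{i,j_1} ⊂ ⋯ ⊂ E^{i,j_k} ⊂ E^{i+1,j_1} ⊂ ⋯` of torsion free sheaves of
rank `n` on `ℙ¹`, with compatible trivialisations over `|z| ≥ 1`, where
`{j_1 < ⋯ < j_k} = {1, …, n} ∖ Δ`. -/
structure Chain (n : ℕ) (Δ : Finset ℕ) : Type 1 where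
  E : Idx n Δ → OMod
  coherent : ∀ p, IsCoherent (E p)
  torsionFree : ∀ p, IsTorsionFree (E p)
  rank : ∀ p, HasRank n (E p)
  framing : ∀ p, Framing n (E p)
  /-- the inclusions -/
  incl : ∀ p q : Idx n Δ, p.pos ≤ q.pos → Hom (E p) (E q)
  incl_injective : ∀ p q h U, Function.Injective ((incl p q h).map U)
  incl_self : ∀ p U s, (incl p p le_rfl).map U s = s
  incl_incl : ∀ p q r (h : p.pos ≤ q.pos) (h' : q.pos ≤ r.pos) U s,
    (incl q r h').map U ((incl p q h).map U s) = (incl p r (h.trans h')).map U s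
  incl_framing : ∀ p q h, (incl p q h).Respects (framing p) (framing q)
  /-- the quotient of two successive sheaves is `𝒪_0^m` with `m` the difference of the positions:
  `j_{l+1} - j_l`, respectively `n + j_1 - j_k` -/
  quotient : ∀ p q (h : p.pos < q.pos), (∀ r : Idx n Δ, ¬ (p.pos < r.pos ∧ r.pos < q.pos)) →
    QuotientIsSky (incl p q h.le) (q.pos - p.pos).toNat
  /-- periodicity: `E^{i-1,j} = z E^{i,j}` near the origin, as subsheaves of `E^{i,j}` -/
  periodic : ∀ (p : Idx n Δ) (U : Opens P1) (s : (E p).sec U),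
    (∃ r, (incl p.pred p p.pred_le).map U r = s) ↔ VanishesAtZero s

/-- Isomorphism of chains: isomorphisms of the sheaves which commute with the inclusions and are
compatible with the trivialisations. -/
def Chain.Iso {n : ℕ} {Δ : Finset ℕ} (c c' : Chain n Δ) : Prop :=
  ∃ f : ∀ p, Hom (c.E p) (c'.E p),
    (∀ p, (f p).IsIso ∧ (f p).Respects (c.framing p) (c'.framing p)) ∧
    ∀ p q h U s, (f q).map U ((c.incl p q h).map U s) = (c'.incl p q h).map U ((f p).map U s)

/-- Chains up to isomorphism. -/
instance chainSetoid (n : ℕ) (Δ : Finset ℕ) : Setoid (Chain n Δ) where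
  r := Chain.Iso
  iseqv :=
    { refl := fun c => ⟨fun p => Hom.id _, fun p =>
        ⟨fun _ => Function.bijective_id, Hom.Respects.refl _⟩, fun _ _ _ _ _ => rfl⟩
      symm := by
        rintro c c' ⟨f, hf, hc⟩
        refine ⟨fun p => (f p).inv (hf p).1, fun p =>
          ⟨(f p).isIso_inv _, (hf p).2.inv _⟩, fun p q h U s => ?_⟩
        apply ((hf q).1 U).1
        rw [Hom.map_inv, hc, Hom.map_inv]
      trans := by
        rintro c c' c'' ⟨f, hf, hc⟩ ⟨g, hg, hd⟩
        refine ⟨fun p => (f p).comp (g p), fun p =>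
          ⟨fun U => ((hg p).1 U).comp ((hf p).1 U), (hf p).2.comp (hg p).2⟩,
          fun p q h U s => ?_⟩
        change (g q).map U ((f q).map U _) = (c''.incl p q h).map U ((g p).map U ((f p).map U s))
        rw [hc, hd] }

/-- The exponent `m` such that `z ^ m e_a` belongs to the basis
`z^{-i} e_1, …, z^{-i} e_j, z^{-i+1} e_{j+1}, …, z^{-i+1} e_n` of `E^{i,j}` near the origin. -/
def expo {n : ℕ} {Δ : Finset ℕ} (p : Idx n Δ) (a : Fin n) : ℤ :=
  if (a : ℕ) + 1 ≤ p.j then -p.i else -p.i + 1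

/-- The chain `c` is the one obtained from the loop `g` by using `g` as transition function. Over a
neighbourhood `D` of `|z| ≤ 1` there is a basis `e_1, …, e_n`, meromorphic at the origin, such that
the `z ^ {expo (i,j) a} e_a` form a frame of `E^{i,j}`, i.e. `E^{i,j}` consists of the sections of
order at least `-i` whose coefficient of `z^{-i}` is in the span of `e_1, …, e_j`; and
`e_a = ∑ b, g_{ba} t_b` near the circle `|z| = 1`, with `t` the trivialisation. The frame
`z ^ {expo p a} e_a` of `E p` is called `e p a` below. -/
def Chain.HasTransition {n : ℕ} {Δ : Finset ℕ} (c : Chain n Δ) (g : LoopGL n) : Prop :=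
  ∃ (D : Opens P1) (hD : OnePoint.infty ∉ D) (e : ∀ p : Idx n Δ, Fin n → (c.E p).sec D),
    (∀ z : ℂ, ‖z‖ ≤ 1 → (z : P1) ∈ D) ∧
    (∀ p, IsFrame (c.E p) (e p)) ∧
    (∀ p q h a, (c.incl p q h).map D (e p a) = coord D hD ^ (expo p a - expo q a).toNat • e q a) ∧
    (∀ p, ∃ (V : Opens P1) (h : V ≤ D) (h' : V ≤ (c.framing p).dom)
      (hV : ∀ z : Circle, ((z : ℂ) : P1) ∈ V) (G : Matrix (Fin n) (Fin n) (Hol V)),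
      (∀ (b a : Fin n) (z : Circle),
        (G b a).1 ⟨((z : ℂ) : P1), hV z⟩ = (z : ℂ) ^ expo p a * (g.1 b a).1 z) ∧
      ∀ a, (c.E p).res h (e p a) = ∑ b, G b a • (c.E p).res h' ((c.framing p).frame b))

/-! ## Bundles with a flag in the fibre at `0` -/

/-- Open neighbourhoods of `0`, ordered by reverse inclusion. -/
abbrev Nhd0 : Type := {U : Opens P1 // zero ∈ U}ᵒᵈ

/-- Sections over a neighbourhood of `0`. -/
abbrev OMod.sec0 (E : OMod) (U : Nhd0) : Type := E.sec (OrderDual.ofDual U).1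

/-- Restriction as a complex linear map. -/
def OMod.res0 (E : OMod) (U V : Nhd0) (h : U ≤ V) : E.sec0 U →ₗ[ℂ] E.sec0 V where
  toFun := E.res (show (OrderDual.ofDual V).1 ≤ (OrderDual.ofDual U).1 from h)
  map_add' := map_add _
  map_smul' c s := E.res_smul _ (algebraMap ℂ _ c) s

open Classical in
/-- The stalk of `E` at `0`. -/
abbrev Stalk (E : OMod) : Type := Module.DirectLimit E.sec0 E.res0

open Classical in
/-- The germ at `0` of a section. -/
def germ (E : OMod) (U : Nhd0) : E.sec0 U →ₗ[ℂ] Stalk E := Module.DirectLimit.of ℂ Nhd0 E.sec0 E.res0 U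

/-- The subspace `m_0 E_0` of the stalk. -/
def maxIdealMul (E : OMod) : Submodule ℂ (Stalk E) :=
  Submodule.span ℂ {x | ∃ (U : Nhd0) (f : Hol (OrderDual.ofDual U).1) (s : E.sec0 U),
    f.1 ⟨zero, (OrderDual.ofDual U).2⟩ = 0 ∧ x = germ E U (f • s)}

/-- The fibre `E_0 / m_0 E_0` at the origin. -/
abbrev Fibre (E : OMod) : Type := Stalk E ⧸ maxIdealMul E

/-- A morphism on sections, as a complex linear map. -/
def Hom.map0 {E F : OMod} (f : Hom E F) (U : Nhd0) : E.sec0 U →ₗ[ℂ] F.sec0 U where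
  toFun := f.map _
  map_add' := map_add _
  map_smul' c s := (f.map _).map_smul (algebraMap ℂ _ c) s

open Classical in
/-- The map of stalks at `0` induced by a morphism. -/
def Hom.stalkMap {E F : OMod} (f : Hom E F) : Stalk E →ₗ[ℂ] Stalk F :=
  Module.DirectLimit.map f.map0 (fun U V h => by
    ext s
    exact f.naturality (show (OrderDual.ofDual V).1 ≤ (OrderDual.ofDual U).1 from h) s)

lemma Hom.stalkMap_germ {E F : OMod} (f : Hom E F) (U : Nhd0) (s : E.sec0 U) :
    f.stalkMap (germ E U s) = germ F U (f.map _ s) := by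
  classical
  exact Module.DirectLimit.map_apply_of f.map0 _ s

/-- The map of fibres at `0` induced by a morphism. -/
def Hom.fibreMap {E F : OMod} (f : Hom E F) : Fibre E →ₗ[ℂ] Fibre F :=
  Submodule.mapQ _ _ f.stalkMap (by
    refine Submodule.span_le.2 ?_
    rintro x ⟨U, φ, s, h0, rfl⟩
    refine Submodule.subset_span ⟨U, φ, f.map _ s, h0, ?_⟩
    rw [f.stalkMap_germ, map_smul])

/-- A holomorphic vector bundle of rank `n` on `ℙ¹`, trivialised over `|z| ≥ 1`, with a flag in its
fibre at `0` by subspaces whose dimensions are the elements of `dims`. -/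
structure FlaggedBundle (n : ℕ) (dims : Finset ℕ) : Type 1 where
  E : OMod
  locallyFree : IsLocallyFree n E
  framing : Framing n E
  flag : ∀ d ∈ dims, Submodule ℂ (Fibre E)
  finrank_flag : ∀ d hd, Module.finrank ℂ (flag d hd) = d
  flag_mono : ∀ d hd d' hd', d ≤ d' → flag d hd ≤ flag d' hd'

/-- Isomorphism of flagged bundles: compatible with trivialisations and flags. -/
def FlaggedBundle.Iso {n : ℕ} {dims : Finset ℕ} (F F' : FlaggedBundle n dims) : Prop :=
  ∃ f : Hom F.E F'.E, f.IsIso ∧ f.Respects F.framing F'.framing ∧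
    ∀ d hd, (F.flag d hd).map f.fibreMap = F'.flag d hd

lemma Fibre.induction {E : OMod} {P : Fibre E → Prop}
    (h : ∀ U s, P (Submodule.Quotient.mk (germ E U s))) (x : Fibre E) : P x := by
  classical
  obtain ⟨y, rfl⟩ := Submodule.Quotient.mk_surjective _ x
  have : Nonempty Nhd0 := ⟨OrderDual.toDual ⟨⊤, trivial⟩⟩
  have : IsDirectedOrder Nhd0 := ⟨fun U V =>
    ⟨OrderDual.toDual ⟨(OrderDual.ofDual U).1 ⊓ (OrderDual.ofDual V).1,
      (OrderDual.ofDual U).2, (OrderDual.ofDual V).2⟩,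
      (inf_le_left : (OrderDual.ofDual U).1 ⊓ (OrderDual.ofDual V).1 ≤ _),
      (inf_le_right : (OrderDual.ofDual U).1 ⊓ (OrderDual.ofDual V).1 ≤ _)⟩⟩
  obtain ⟨U, s, rfl⟩ := Module.DirectLimit.exists_of y
  exact h U s

lemma Hom.fibreMap_mk {E F : OMod} (f : Hom E F) (U : Nhd0) (s : E.sec0 U) :
    f.fibreMap (Submodule.Quotient.mk (germ E U s)) =
      Submodule.Quotient.mk (germ F U (f.map _ s)) := by
  rw [← f.stalkMap_germ]
  rfl

lemma Hom.fibreMap_id (E : OMod) : (Hom.id E).fibreMap = LinearMap.id := by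
  apply LinearMap.ext
  refine Fibre.induction (fun U s => ?_)
  exact Hom.fibreMap_mk _ U s

lemma Hom.fibreMap_comp {E F G : OMod} (f : Hom E F) (g : Hom F G) :
    (f.comp g).fibreMap = g.fibreMap.comp f.fibreMap := by
  apply LinearMap.ext
  refine Fibre.induction (fun U s => ?_)
  rw [LinearMap.comp_apply, Hom.fibreMap_mk, Hom.fibreMap_mk, Hom.fibreMap_mk]
  rfl

lemma Hom.inv_fibreMap {E F : OMod} (f : Hom E F) (hf : f.IsIso) :
    (f.inv hf).fibreMap.comp f.fibreMap = LinearMap.id := by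
  apply LinearMap.ext
  refine Fibre.induction (fun U s => ?_)
  rw [LinearMap.comp_apply, Hom.fibreMap_mk, Hom.fibreMap_mk, Hom.inv_map]
  rfl

/-- Flagged bundles up to isomorphism. -/
instance flaggedSetoid (n : ℕ) (dims : Finset ℕ) : Setoid (FlaggedBundle n dims) where
  r := FlaggedBundle.Iso
  iseqv :=
    { refl := fun F => ⟨Hom.id _, fun _ => Function.bijective_id, Hom.Respects.refl _,
        fun d hd => by rw [Hom.fibreMap_id, Submodule.map_id]⟩
      symm := by
        rintro F F' ⟨f, hi, hr, hf⟩
        refine ⟨f.inv hi, f.isIso_inv hi, hr.inv hi, fun d hd => ?_⟩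
        rw [← hf, ← Submodule.map_comp, Hom.inv_fibreMap, Submodule.map_id]
      trans := by
        rintro F F' F'' ⟨f, hi, hr, hf⟩ ⟨g, ki, kr, hg⟩
        refine ⟨f.comp g, fun U => (ki U).comp (hi U), hr.comp kr, fun d hd => ?_⟩
        rw [Hom.fibreMap_comp, Submodule.map_comp, hf, hg] }

/-- The dimensions `j_{s+1} - j_s, …, j_k - j_s, n + j_1 - j_s, …, n + j_{s-1} - j_s`, where `j_s` is
the member `j` of `{j_1 < ⋯ < j_k} = {1, …, n} ∖ Δ`. -/
def flagDims (n : ℕ) (Δ : Finset ℕ) (j : ℕ) : Finset ℕ :=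
  ((Finset.Icc 1 n \ Δ).filter (fun l => j < l)).image (fun l => l - j) ∪
  ((Finset.Icc 1 n \ Δ).filter (fun l => l < j)).image (fun l => n + l - j)

/-- `F` is the sheaf `E p` of the chain `c`, with its trivialisation, and with the flag in the fibre
at `0` formed by the images of the fibres of those sheaves `E q` of the chain which lie strictly
between `E p.pred = z E p` and `E p`; `E q` gives the subspace of dimension
`q.pos - p.pred.pos`. -/
def Chain.IsBase {n : ℕ} {Δ : Finset ℕ} (c : Chain n Δ) (p : Idx n Δ)
    (F : FlaggedBundle n (flagDims n Δ p.j)) : Prop :=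
  ∃ f : Hom F.E (c.E p), f.IsIso ∧ f.Respects F.framing (c.framing p) ∧
    ∀ (q : Idx n Δ) (h : q.pos ≤ p.pos) (d : ℕ) (hd : d ∈ flagDims n Δ p.j),
      q.pos = p.pred.pos + d →
      (F.flag d hd).map f.fibreMap = LinearMap.range (c.incl q p h).fibreMap

end LoopFlag

end

open LoopFlag

/-! Near the closed unit disc a chain has a frame. Compared with the trivialisation along the
circle, the frame is a loop, and the freedom in choosing it is exactly the parabolic subgroup. Both
bijections come from a relation (`Chain.HasTransition`, `Chain.IsBase`) by way of
`exists_equiv_of_relation`: every object on either side must be related to something, and for two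
related pairs equivalence on one side must be the same as equivalence on the other.

From loops to chains, `exists_chain` glues trivial bundles over two discs by the matrices `g ·
diag(z ^ expo p a)`. The inclusions are the identity in the outer frames and diagonal matrices of
powers of `z` in the inner ones, so the quotients and the periodicity can be read off.

From chains to loops lies the main difficulty. Coherent torsion free sheaves on a curve are locally
free (`exists_isFrame_of_isCoherent`): a relation divided by a power of a local parameter is still a
relation, and then one generator can be eliminated. A bundle is trivial near the closed disc
(`exists_isFrame_disc`): frames over small rectangles are patched by Cartan's lemma
`exists_factorization`. That lemma rests on a Newton iteration built on the additive Cauchy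
splitting, which factors functions close to one, and on Runge approximation by invertible entire
functions, which reduces the general case to that one. The skyscraper quotients force the
neighbouring sheaves to have images of the expected dimensions in the fibre of `E p` at the origin
(`Chain.finrank_fibreRange`). Hence a constant change of frame adapts the frame to this flag, and
periodicity spreads it over the chain (`Chain.exists_frames`).

Two loops `g`, `g'` of one chain differ by changes of frames that are holomorphic on the disc for
every member `p`, so that the entry `(a, b)` of `g⁻¹ g'` is `z ^ (expo p a - expo p b)` times a
function holomorphic there. For fixed `a`, `b` these exponents take at most two consecutive values
as `p` varies, and their maximum is the least `m` with `χ(m δ + ε_a - ε_b) ≥ 0`. This is the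
parabolic condition. In the other direction, sheaves with the same transition values on the circle
are isomorphic (`exists_iso_of_val`), and a morphism compatible with the trivialisations is unique
(`Hom.eq_of_respects`), so the isomorphisms commute with the inclusions. Together these give
`Chain.HasTransition.mem_parabolic_iff`.

For flagged bundles, a frame of the base adapted to the flag already determines a loop of the whole
chain (`Chain.hasTransition_of_adapted`). Isomorphic flagged bundles therefore have chains with a
common loop, and the chain of a loop read off from a flagged bundle has that bundle as its base.

For the degree, write `det g = z ^ w · exp h` and split `h = p(z) + q(1/z)`. The functions `exp
(q(1/z))` outside and `exp (-p)` times a power of `z` inside fit together to a section of the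
determinant, with order `-(w + ∑ expo) = n (i - 1) + j - w` at the origin (`hasDegree_of_val`).
Liouville's theorem shows that no other degree is possible. -/

noncomputable section
namespace LoopFlag

/-! ### Cauchy integrals along segments and Cauchy's formula for a rectangle. -/

section Cauchy

open Complex Set MeasureTheory

variable {𝔐 : Type*} [NormedAddCommGroup 𝔐] [NormedSpace ℂ 𝔐]

/-- The Cauchy integral of `f` along the segment `p + x v`, `s ≤ x ≤ t`. -/
def cauchySeg (p v : ℂ) (s t : ℝ) (f : ℂ → 𝔐) (z : ℂ) : 𝔐 :=
  ∫ x in s..t, (v / (p + x * v - z)) • f (p + x * v)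

lemma cauchySeg_continuousOn_integrand {p v : ℂ} {s t : ℝ} {f : ℂ → 𝔐}
    (hf : ContinuousOn (fun x : ℝ => f (p + x * v)) (uIcc s t)) {z : ℂ}
    (hz : ∀ x ∈ uIcc s t, p + (x : ℝ) * v ≠ z) :
    ContinuousOn (fun x : ℝ => (v / (p + x * v - z)) • f (p + x * v)) (uIcc s t) := by
  refine ContinuousOn.smul (ContinuousOn.div (by fun_prop) (by fun_prop) ?_) hf
  intro x hx
  exact sub_ne_zero.2 (hz x hx)

lemma norm_cauchySeg_le {p v : ℂ} {s t : ℝ} {f : ℂ → 𝔐} {M r : ℝ} (hr : 0 < r) {z : ℂ}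
    (hv : ‖v‖ = 1) (hM : ∀ x ∈ uIcc s t, ‖f (p + (x : ℝ) * v)‖ ≤ M)
    (hz : ∀ x ∈ uIcc s t, r ≤ ‖p + (x : ℝ) * v - z‖) :
    ‖cauchySeg p v s t f z‖ ≤ M / r * |t - s| := by
  refine intervalIntegral.norm_integral_le_of_norm_le_const (fun x hx => ?_)
  have hx' := uIoc_subset_uIcc hx
  rw [norm_smul, norm_div, hv]
  have h1 := hz x hx'
  have h0 : 0 ≤ M := (norm_nonneg _).trans (hM x hx')
  calc 1 / ‖p + x * v - z‖ * ‖f (p + x * v)‖ ≤ 1 / r * M := by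
        gcongr
        exact hM x hx'
    _ = M / r := by ring

/-- Differentiation under the integral sign. A point of `Ω` has a ball inside `Ω`; on the ball of
half the radius the segment stays at distance at least `r / 2`, which dominates the derivative of
the kernel by a constant. -/
lemma differentiableOn_cauchySeg [CompleteSpace 𝔐] {p v : ℂ} {s t : ℝ} {f : ℂ → 𝔐} {Ω : Set ℂ}
    (hΩ : IsOpen Ω)
    (hf : ContinuousOn (fun x : ℝ => f (p + x * v)) (uIcc s t))
    (hz : ∀ x ∈ uIcc s t, p + (x : ℝ) * v ∉ Ω) :
    DifferentiableOn ℂ (cauchySeg p v s t f) Ω := by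
  intro z hzΩ
  obtain ⟨r, hr, hball⟩ := Metric.isOpen_iff.1 hΩ z hzΩ
  have far : ∀ x ∈ uIcc s t, ∀ w ∈ Metric.ball z (r / 2), r / 2 ≤ ‖p + (x : ℝ) * v - w‖ := by
    intro x hx w hw
    by_contra h
    push Not at h
    refine hz x hx (hball ?_)
    rw [Metric.mem_ball] at *
    calc dist (p + x * v) z ≤ dist (p + x * v) w + dist w z := dist_triangle _ _ _
      _ < r / 2 + r / 2 := by
        rw [dist_eq_norm (p + x * v)]
        exact add_lt_add h hw
      _ = r := by ring
  obtain ⟨M, hM⟩ := isCompact_uIcc.exists_bound_of_continuousOn hf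
  have ne : ∀ x ∈ uIcc s t, ∀ w ∈ Metric.ball z (r / 2), p + (x : ℝ) * v ≠ w := by
    intro x hx w hw h
    have := far x hx w hw
    rw [h, sub_self, norm_zero] at this
    linarith
  have hzb : z ∈ Metric.ball z (r / 2) := Metric.mem_ball_self (by linarith)
  have key := intervalIntegral.hasDerivAt_integral_of_dominated_loc_of_deriv_le (𝕜 := ℂ)
    (μ := volume) (a := s) (b := t) (x₀ := z) (s := Metric.ball z (r / 2))
    (F := fun w x => (v / (p + x * v - w)) • f (p + x * v))
    (F' := fun w x => (v / (p + x * v - w) ^ 2) • f (p + x * v))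
    (bound := fun _ => ‖v‖ / (r / 2) ^ 2 * M)
    (Metric.ball_mem_nhds z (by linarith)) ?_ ?_ ?_ ?_ ?_ ?_
  · exact key.2.differentiableAt.differentiableWithinAt
  · filter_upwards [Metric.ball_mem_nhds z (show 0 < r / 2 by linarith)] with w hw
    exact ((cauchySeg_continuousOn_integrand hf (fun x hx => ne x hx w hw)).mono
      uIoc_subset_uIcc).aestronglyMeasurable measurableSet_uIoc
  · exact (cauchySeg_continuousOn_integrand hf (fun x hx => ne x hx z hzb)).intervalIntegrable
  · refine ContinuousOn.aestronglyMeasurable ?_ measurableSet_uIoc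
    refine ContinuousOn.mono ?_ uIoc_subset_uIcc
    refine ContinuousOn.smul (ContinuousOn.div (by fun_prop) (by fun_prop) ?_) hf
    intro x hx
    exact pow_ne_zero 2 (sub_ne_zero.2 (ne x hx z hzb))
  · refine Filter.Eventually.of_forall (fun x hx w hw => ?_)
    have hx' := uIoc_subset_uIcc hx
    rw [norm_smul, norm_div, norm_pow]
    have h1 := far x hx' w hw
    have h0 : 0 ≤ M := (norm_nonneg _).trans (hM x hx')
    gcongr
    exact hM x hx'
  · exact intervalIntegrable_const
  · refine Filter.Eventually.of_forall (fun x hx w hw => ?_)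
    have hx' := uIoc_subset_uIcc hx
    have hne := sub_ne_zero.2 (ne x hx' w hw)
    refine HasDerivAt.smul_const ?_ _
    have h1 : HasDerivAt (fun w => p + x * v - w) (-1) w := by
      simpa using (hasDerivAt_id w).const_sub (p + x * v)
    have h2 : HasDerivAt (fun w => v / (p + x * v - w))
        ((0 * (p + x * v - w) - v * -1) / (p + x * v - w) ^ 2) w :=
      (hasDerivAt_const w v).div h1 hne
    exact h2.congr_deriv (by simp)

/-- The integral of `v / (p + x v)` along a segment in a half plane. -/
lemma integral_inv_segment {p v ρ : ℂ} {s t : ℝ} (hρ : ρ ≠ 0)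
    (h : ∀ x ∈ uIcc s t, ρ * (p + (x : ℝ) * v) ∈ slitPlane) :
    ∫ x in s..t, v / (p + x * v) = log (ρ * (p + t * v)) - log (ρ * (p + s * v)) := by
  have hne : ∀ x ∈ uIcc s t, p + (x : ℝ) * v ≠ 0 := fun x hx h0 => by
    have := slitPlane_ne_zero (h x hx)
    rw [h0, mul_zero] at this
    exact this rfl
  -- The constant `ρ` turns the segment away from the cut of `log` and cancels from the logarithmic
  -- derivative.
  refine intervalIntegral.integral_eq_sub_of_hasDerivAt (f := fun x : ℝ => log (ρ * (p + x * v)))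
    (fun x hx => ?_) ?_
  · have h1 : HasDerivAt (fun x : ℝ => ρ * (p + x * v)) (ρ * v) x := by
      have := (((hasDerivAt_id x).ofReal_comp).mul_const v).const_add p |>.const_mul ρ
      simpa using this
    have := h1.clog_real (h x hx)
    exact this.congr_deriv (mul_div_mul_left _ _ hρ)
  · refine ContinuousOn.intervalIntegrable ?_
    exact ContinuousOn.div (by fun_prop) (by fun_prop) hne

/-- Each side has its own branch of the logarithm, rotated by `I`, `-I`, `1` or `-1`. At each corner
the branches of the two adjacent sides differ by a quarter turn, and the four quarter turns add up
to `2πi`. -/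
lemma integral_boundary_rect_inv {a b c d : ℝ} (ha : a < 0) (hb : 0 < b) (hc : c < 0)
    (hd : 0 < d) :
    (∫ x in a..b, (1 : ℂ) / (c * I + x * 1)) - (∫ x in a..b, (1 : ℂ) / (d * I + x * 1))
      + (∫ y in c..d, I / (b + y * I)) - (∫ y in c..d, I / (a + y * I)) = 2 * Real.pi * I := by
  have e1 := integral_inv_segment (p := c * I) (v := 1) (ρ := I) (s := a) (t := b) I_ne_zero
    (fun x _ => by left; simp; linarith)
  have e2 := integral_inv_segment (p := d * I) (v := 1) (ρ := -I) (s := a) (t := b) (by simp)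
    (fun x _ => by left; simp; linarith)
  have e3 := integral_inv_segment (p := b) (v := I) (ρ := 1) (s := c) (t := d) (by simp)
    (fun x _ => by left; simp; linarith)
  have e4 := integral_inv_segment (p := a) (v := I) (ρ := -1) (s := c) (t := d) (by simp)
    (fun x _ => by left; simp; linarith)
  rw [e1, e2, e3, e4]
  have hI : I ≠ 0 := I_ne_zero
  have rot : ∀ u : ℂ, 0 < u.re → u.im < 0 → log (I * u) = log u + Real.pi / 2 * I := by
    intro u hu hu'
    have hu0 : u ≠ 0 := fun h => by simp [h] at hu
    have h1 := (abs_arg_lt_pi_div_two_iff.2 (Or.inl hu))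
    have h2 : u.arg < 0 := arg_neg_iff.2 hu'
    rw [abs_lt] at h1
    rw [log_mul I_ne_zero hu0 (by
      rw [arg_I]; constructor <;> linarith [Real.pi_pos]), log_I, add_comm]
  have rot' : ∀ u : ℂ, 0 < u.re → 0 < u.im → log (-I * u) = log u - Real.pi / 2 * I := by
    intro u hu hu'
    have hu0 : u ≠ 0 := fun h => by simp [h] at hu
    have h1 := (abs_arg_lt_pi_div_two_iff.2 (Or.inl hu))
    have h2 : 0 ≤ u.arg := arg_nonneg_iff.2 hu'.le
    rw [abs_lt] at h1
    rw [log_mul (by simp) hu0 (by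
      rw [arg_neg_I]; constructor <;> linarith [Real.pi_pos]), log_neg_I]
    ring
  have r1 := rot (b + c * I) (by simpa) (by simpa)
  have r2 := rot' (b + d * I) (by simpa) (by simpa)
  have r3 := rot (-a - d * I) (by simpa) (by simpa)
  have r4 := rot' (-a - c * I) (by simpa) (by simpa)
  have s1 : I * (c * I + b * 1) = I * (b + c * I) := by ring
  have s2 : -I * (d * I + b * 1) = -I * (b + d * I) := by ring
  have s3 : -I * (d * I + a * 1) = I * (-a - d * I) := by ring
  have s4 : I * (c * I + a * 1) = -I * (-a - c * I) := by ring
  have s5 : -1 * ((a : ℂ) + d * I) = -a - d * I := by ring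
  have s6 : -1 * ((a : ℂ) + c * I) = -a - c * I := by ring
  rw [s1, s2, s3, s4, s5, s6, r1, r2, r3, r4]
  simp only [one_mul]
  ring

/-- **Cauchy's integral formula** for a rectangle. -/
theorem cauchySeg_rect [CompleteSpace 𝔐] {a b c d : ℝ} {f : ℂ → 𝔐} {U : Set ℂ} (hU : IsOpen U)
    (hf : DifferentiableOn ℂ f U)
    (hR : Icc a b ×ℂ Icc c d ⊆ U) {z : ℂ} (hz : z ∈ Ioo a b ×ℂ Ioo c d) :
    cauchySeg (c * I) 1 a b f z - cauchySeg (d * I) 1 a b f z + cauchySeg b I c d f z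
      - cauchySeg a I c d f z = (2 * Real.pi * I : ℂ) • f z := by
  obtain ⟨⟨hz1, hz2⟩, hz3, hz4⟩ := mem_reProdIm.1 hz
  have hab : a < b := hz1.trans hz2
  have hcd : c < d := hz3.trans hz4
  have hzU : z ∈ U := hR (mem_reProdIm.2 ⟨⟨hz1.le, hz2.le⟩, hz3.le, hz4.le⟩)
  -- The difference quotient has no singularity at `z`, so its integral over the boundary vanishes.
  -- This reduces the formula to the boundary integral of `1 / (ζ - z)`.
  have hg : DifferentiableOn ℂ (dslope f z) U :=
    (differentiableOn_dslope (hU.mem_nhds hzU)).2 hf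
  have G := integral_boundary_rect_eq_zero_of_differentiableOn (dslope f z) (a + c * I) (b + d * I)
    (hg.mono (by simpa [uIcc_of_le hab.le, uIcc_of_le hcd.le] using hR))
  simp only [add_re, ofReal_re, mul_re, I_re, mul_zero, ofReal_im, I_im, mul_one, sub_self,
    add_zero, add_im, mul_im, zero_add] at G
  have side : ∀ (p v : ℂ) (s t : ℝ), (∀ x ∈ uIcc s t, p + (x : ℝ) * v ∈ U ∧ p + x * v ≠ z) →
      v • ∫ x in s..t, dslope f z (p + x * v) =
        cauchySeg p v s t f z - (∫ x in s..t, v / ((p - z) + x * v)) • f z := by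
    intro p v s t h
    have hc : ContinuousOn (fun x : ℝ => f (p + x * v)) (uIcc s t) :=
      hf.continuousOn.comp (by fun_prop) (fun x hx => (h x hx).1)
    have hc2 : ContinuousOn (fun x : ℝ => v / ((p - z) + x * v)) (uIcc s t) :=
      ContinuousOn.div (by fun_prop) (by fun_prop) (fun x hx h0 => (h x hx).2 (by
        linear_combination h0))
    rw [← intervalIntegral.integral_smul, ← intervalIntegral.integral_smul_const, cauchySeg,
      ← intervalIntegral.integral_sub]
    · refine intervalIntegral.integral_congr (fun x hx => ?_)
      have h1 : p + x * v ≠ z := (h x hx).2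
      change v • dslope f z (p + x * v) = (v / (p + x * v - z)) • f (p + x * v) -
        (v / (p - z + x * v)) • f z
      rw [dslope_of_ne _ h1, slope_def_module, smul_smul, smul_sub]
      have : p - z + x * v = p + x * v - z := by ring
      rw [this, div_eq_mul_inv]
    · exact (cauchySeg_continuousOn_integrand hc (fun x hx => (h x hx).2)).intervalIntegrable
    · exact (ContinuousOn.smul hc2 continuousOn_const).intervalIntegrable
  have i1 := side (c * I) 1 a b (fun x hx => by
    rw [uIcc_of_le hab.le] at hx
    refine ⟨hR (mem_reProdIm.2 ⟨by simpa using hx, by simpa using hcd.le⟩), fun h => ?_⟩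
    have := congrArg im h
    simp at this
    linarith)
  have i2 := side (d * I) 1 a b (fun x hx => by
    rw [uIcc_of_le hab.le] at hx
    refine ⟨hR (mem_reProdIm.2 ⟨by simpa using hx, by simpa using hcd.le⟩), fun h => ?_⟩
    have := congrArg im h
    simp at this
    linarith)
  have i3 := side b I c d (fun x hx => by
    rw [uIcc_of_le hcd.le] at hx
    refine ⟨hR (mem_reProdIm.2 ⟨by simpa using hab.le, by simpa using hx⟩), fun h => ?_⟩
    have := congrArg re h
    simp at this
    linarith)
  have i4 := side a I c d (fun x hx => by
    rw [uIcc_of_le hcd.le] at hx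
    refine ⟨hR (mem_reProdIm.2 ⟨by simpa using hab.le, by simpa using hx⟩), fun h => ?_⟩
    have := congrArg re h
    simp at this
    linarith)
  -- Translation by `z` moves the pole to the origin.
  have N := integral_boundary_rect_inv (a := a - z.re) (b := b - z.re) (c := c - z.im)
    (d := d - z.im) (by linarith) (by linarith) (by linarith) (by linarith)
  have zz : z = z.re + z.im * I := (re_add_im z).symm
  have h1 : ∀ e : ℝ, ∫ x in (a - z.re)..(b - z.re), (1 : ℂ) / (((e - z.im : ℝ) : ℂ) * I + x * 1) =
      ∫ x in a..b, (1 : ℂ) / ((e * I - z) + x * 1) := by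
    intro e
    rw [← intervalIntegral.integral_comp_sub_right
      (fun x : ℝ => (1 : ℂ) / (((e - z.im : ℝ) : ℂ) * I + x * 1))]
    congr 1
    funext x
    congr 1
    conv_rhs => rw [zz]
    push_cast
    ring
  have h2 : ∀ e : ℝ, ∫ x in (c - z.im)..(d - z.im), I / (((e - z.re : ℝ) : ℂ) + x * I) =
      ∫ x in c..d, I / ((e - z) + x * I) := by
    intro e
    rw [← intervalIntegral.integral_comp_sub_right
      (fun x : ℝ => I / (((e - z.re : ℝ) : ℂ) + x * I))]
    congr 1
    funext x
    congr 1
    conv_rhs => rw [zz]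
    push_cast
    ring
  rw [h1, h1, h2, h2] at N
  have G' : (1 : ℂ) • (∫ x in a..b, dslope f z (c * I + x * 1)) -
      (1 : ℂ) • (∫ x in a..b, dslope f z (d * I + x * 1)) +
      I • (∫ y in c..d, dslope f z (b + y * I)) - I • (∫ y in c..d, dslope f z (a + y * I)) = 0 := by
    rw [← G]
    simp only [one_smul, mul_one, add_comm]
  rw [i1, i2, i3, i4] at G'
  rw [← N, sub_smul, add_smul, sub_smul]
  rw [← sub_eq_zero, ← G']
  abel

end Cauchy

end LoopFlag
end

noncomputable section
namespace LoopFlag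

/-! ### Additive splitting of a holomorphic function across a segment. -/

section Splitting

open Complex Set MeasureTheory

/-- The open `δ`-neighbourhood (for the sup norm) of the segment from `c i` to `d i`. -/
def stripQ (c d δ : ℝ) : Set ℂ := Ioo (-δ) δ ×ℂ Ioo (c - δ) (d + δ)

/-- The half strip to the left of `stripQ`. -/
def stripL (c d δ : ℝ) : Set ℂ := Iio δ ×ℂ Ioo (c - δ) (d + δ)

/-- The half strip to the right of `stripQ`. -/
def stripR (c d δ : ℝ) : Set ℂ := Ioi (-δ) ×ℂ Ioo (c - δ) (d + δ)

lemma mem_stripQ {c d δ : ℝ} {z : ℂ} :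
    z ∈ stripQ c d δ ↔ (-δ < z.re ∧ z.re < δ) ∧ c - δ < z.im ∧ z.im < d + δ := Iff.rfl

lemma mem_stripL {c d δ : ℝ} {z : ℂ} :
    z ∈ stripL c d δ ↔ z.re < δ ∧ c - δ < z.im ∧ z.im < d + δ := Iff.rfl

lemma mem_stripR {c d δ : ℝ} {z : ℂ} :
    z ∈ stripR c d δ ↔ -δ < z.re ∧ c - δ < z.im ∧ z.im < d + δ := Iff.rfl

lemma isOpen_stripQ (c d δ : ℝ) : IsOpen (stripQ c d δ) := isOpen_Ioo.reProdIm isOpen_Ioo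
lemma isOpen_stripL (c d δ : ℝ) : IsOpen (stripL c d δ) := isOpen_Iio.reProdIm isOpen_Ioo
lemma isOpen_stripR (c d δ : ℝ) : IsOpen (stripR c d δ) := isOpen_Ioi.reProdIm isOpen_Ioo

lemma stripQ_mono {c d δ δ' : ℝ} (h : δ' ≤ δ) : stripQ c d δ' ⊆ stripQ c d δ := by
  intro z hz
  rw [mem_stripQ] at *
  refine ⟨⟨?_, ?_⟩, ?_, ?_⟩ <;> linarith [hz.1.1, hz.1.2, hz.2.1, hz.2.2]

lemma stripL_mono {c d δ δ' : ℝ} (h : δ' ≤ δ) : stripL c d δ' ⊆ stripL c d δ := by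
  intro z hz
  rw [mem_stripL] at *
  refine ⟨?_, ?_, ?_⟩ <;> linarith [hz.1, hz.2.1, hz.2.2]

lemma stripR_mono {c d δ δ' : ℝ} (h : δ' ≤ δ) : stripR c d δ' ⊆ stripR c d δ := by
  intro z hz
  rw [mem_stripR] at *
  refine ⟨?_, ?_, ?_⟩ <;> linarith [hz.1, hz.2.1, hz.2.2]

lemma stripQ_subset_L {c d δ : ℝ} : stripQ c d δ ⊆ stripL c d δ := fun _ hz => ⟨hz.1.2, hz.2⟩
lemma stripQ_subset_R {c d δ : ℝ} : stripQ c d δ ⊆ stripR c d δ := fun _ hz => ⟨hz.1.1, hz.2⟩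

variable {𝔐 : Type*} [NormedAddCommGroup 𝔐] [NormedSpace ℂ 𝔐]

lemma cauchySeg_add {p v : ℂ} {s t u : ℝ} {f : ℂ → 𝔐} {z : ℂ} (hst : s ≤ t) (htu : t ≤ u)
    (hf : ContinuousOn (fun x : ℝ => f (p + x * v)) (Icc s u))
    (hz : ∀ x ∈ Icc s u, p + (x : ℝ) * v ≠ z) :
    cauchySeg p v s t f z + cauchySeg p v t u f z = cauchySeg p v s u f z := by
  have h1 : uIcc s t ⊆ Icc s u := by rw [uIcc_of_le hst]; exact Icc_subset_Icc le_rfl htu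
  have h2 : uIcc t u ⊆ Icc s u := by rw [uIcc_of_le htu]; exact Icc_subset_Icc hst le_rfl
  exact intervalIntegral.integral_add_adjacent_intervals
    (cauchySeg_continuousOn_integrand (hf.mono h1) (fun x hx => hz x (h1 hx))).intervalIntegrable
    (cauchySeg_continuousOn_integrand (hf.mono h2) (fun x hx => hz x (h2 hx))).intervalIntegrable

/-- Additive splitting across a segment, with bounds. -/
theorem exists_additive_splitting [CompleteSpace 𝔐] {c d δ δ' M : ℝ} (hcd : c ≤ d) (h0 : 0 < δ')
    (h : δ' < δ) (h1 : δ ≤ 1) {f : ℂ → 𝔐} (hf : DifferentiableOn ℂ f (stripQ c d δ))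
    (hM : ∀ z ∈ stripQ c d δ, ‖f z‖ ≤ M) :
    ∃ a b : ℂ → 𝔐, DifferentiableOn ℂ a (stripL c d δ') ∧ DifferentiableOn ℂ b (stripR c d δ') ∧
      (∀ z ∈ stripQ c d δ', f z = a z + b z) ∧
      (∀ z ∈ stripL c d δ', ‖a z‖ ≤ 2 * (d - c + 4) * M / (δ - δ')) ∧
      (∀ z ∈ stripR c d δ', ‖b z‖ ≤ 2 * (d - c + 4) * M / (δ - δ')) := by
  -- The contour is the boundary of the rectangle of intermediate size `σ`, cut in two along the
  -- imaginary axis. The right half defines `a` and the left half defines `b`; every point of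
  -- `stripL c d δ'` has distance at least `(δ - δ') / 2` from the right half, and symmetrically for
  -- `b`.
  obtain ⟨σ, hσ⟩ : ∃ σ, σ = (δ + δ') / 2 := ⟨_, rfl⟩
  have hM0 : 0 ≤ M := (norm_nonneg _).trans (hM (c * I) (by
    rw [mem_stripQ]; simp; constructor <;> linarith))
  have hor : ∀ e ∈ Icc (c - σ) (d + σ), ∀ x ∈ Icc (-σ) σ,
      ((e : ℝ) : ℂ) * I + (x : ℝ) * 1 ∈ stripQ c d δ := by
    rintro e ⟨he, he'⟩ x ⟨hx, hx'⟩
    rw [mem_stripQ]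
    simp
    constructor <;> [constructor; constructor] <;> linarith
  have ver : ∀ e ∈ Icc (-σ) σ, ∀ x ∈ Icc (c - σ) (d + σ),
      ((e : ℝ) : ℂ) + (x : ℝ) * I ∈ stripQ c d δ := by
    rintro e ⟨he, he'⟩ x ⟨hx, hx'⟩
    rw [mem_stripQ]
    simp
    constructor <;> [constructor; constructor] <;> linarith
  have horc : ∀ e ∈ Icc (c - σ) (d + σ),
      ContinuousOn (fun x : ℝ => f (((e : ℝ) : ℂ) * I + x * 1)) (Icc (-σ) σ) := fun e he =>
    hf.continuousOn.comp (by fun_prop) (hor e he)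
  have verc : ∀ e ∈ Icc (-σ) σ,
      ContinuousOn (fun x : ℝ => f (((e : ℝ) : ℂ) + x * I)) (Icc (c - σ) (d + σ)) := fun e he =>
    hf.continuousOn.comp (by fun_prop) (ver e he)
  have b1 : c - σ ∈ Icc (c - σ) (d + σ) := ⟨le_rfl, by linarith⟩
  have b2 : d + σ ∈ Icc (c - σ) (d + σ) := ⟨by linarith, le_rfl⟩
  have b3 : -σ ∈ Icc (-σ) σ := ⟨le_rfl, by linarith⟩
  have b4 : σ ∈ Icc (-σ) σ := ⟨by linarith, le_rfl⟩
  have s1 : uIcc 0 σ ⊆ Icc (-σ) σ := by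
    rw [uIcc_of_le (by linarith)]; exact Icc_subset_Icc (by linarith) le_rfl
  have s2 : uIcc (-σ) 0 ⊆ Icc (-σ) σ := by
    rw [uIcc_of_le (by linarith)]; exact Icc_subset_Icc le_rfl (by linarith)
  have s3 : uIcc (c - σ) (d + σ) = Icc (c - σ) (d + σ) := uIcc_of_le (by linarith)
  -- distances to the contour
  have dbot : ∀ z : ℂ, c - δ' < z.im → ∀ x : ℝ,
      (δ - δ') / 2 ≤ ‖((c - σ : ℝ) : ℂ) * I + x * 1 - z‖ := by
    intro z hz x
    refine le_trans ?_ (abs_im_le_norm _)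
    refine le_trans ?_ (neg_le_abs _)
    simp
    linarith
  have dtop : ∀ z : ℂ, z.im < d + δ' → ∀ x : ℝ,
      (δ - δ') / 2 ≤ ‖((d + σ : ℝ) : ℂ) * I + x * 1 - z‖ := by
    intro z hz x
    refine le_trans ?_ (abs_im_le_norm _)
    refine le_trans ?_ (le_abs_self _)
    simp
    linarith
  have dright : ∀ z : ℂ, z.re < δ' → ∀ x : ℝ, (δ - δ') / 2 ≤ ‖(σ : ℂ) + x * I - z‖ := by
    intro z hz x
    refine le_trans ?_ (abs_re_le_norm _)
    refine le_trans ?_ (le_abs_self _)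
    simp
    linarith
  have dleft : ∀ z : ℂ, -δ' < z.re → ∀ x : ℝ,
      (δ - δ') / 2 ≤ ‖((-σ : ℝ) : ℂ) + x * I - z‖ := by
    intro z hz x
    refine le_trans ?_ (abs_re_le_norm _)
    refine le_trans ?_ (neg_le_abs _)
    simp
    linarith
  have r0 : 0 < (δ - δ') / 2 := by linarith
  have ne_of : ∀ {w z : ℂ}, (δ - δ') / 2 ≤ ‖w - z‖ → w ≠ z := by
    rintro w z hw rfl
    rw [sub_self, norm_zero] at hw
    linarith
  have hk : ‖(2 * Real.pi * I : ℂ)⁻¹‖ ≤ 1 := by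
    rw [norm_inv]
    refine inv_le_one_of_one_le₀ ?_
    simp only [norm_mul, norm_I, mul_one, Complex.norm_real, Real.norm_eq_abs, abs_of_pos Real.pi_pos]
    norm_num
    linarith [Real.pi_gt_three]
  -- Source of the constant: two horizontal pieces of length at most `1` and a vertical one of
  -- length at most `d - c + 2`, all at distance at least `(δ - δ') / 2`. The factor `1 / 2π` is
  -- only bounded by one.
  have bound : ∀ u v w : 𝔐, ‖u‖ ≤ M / ((δ - δ') / 2) * 1 → ‖v‖ ≤ M / ((δ - δ') / 2) * 1 →
      ‖w‖ ≤ M / ((δ - δ') / 2) * (d - c + 2) → ∀ w' : 𝔐, ‖w'‖ ≤ ‖u‖ + ‖v‖ + ‖w‖ →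
      ‖(2 * Real.pi * I : ℂ)⁻¹ • w'‖ ≤ 2 * (d - c + 4) * M / (δ - δ') := by
    intro u v w hu hv hw w' hw'
    rw [norm_smul]
    calc ‖(2 * Real.pi * I : ℂ)⁻¹‖ * ‖w'‖ ≤ 1 * ‖w'‖ := by gcongr
      _ ≤ M / ((δ - δ') / 2) * 1 + M / ((δ - δ') / 2) * 1 +
          M / ((δ - δ') / 2) * (d - c + 2) := by linarith
      _ = 2 * (d - c + 4) * M / (δ - δ') := by field_simp; ring
  have l1 : |σ - 0| ≤ 1 := by rw [abs_le]; constructor <;> linarith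
  have l2 : |0 - (-σ)| ≤ 1 := by rw [abs_le]; constructor <;> linarith
  have l3 : |d + σ - (c - σ)| ≤ d - c + 2 := by rw [abs_le]; constructor <;> linarith
  have M0 : 0 ≤ M / ((δ - δ') / 2) := by positivity
  have v1 : ‖(1 : ℂ)‖ = 1 := norm_one
  refine ⟨fun z => (2 * Real.pi * I : ℂ)⁻¹ • (cauchySeg (((c - σ : ℝ) : ℂ) * I) 1 0 σ f z -
      cauchySeg (((d + σ : ℝ) : ℂ) * I) 1 0 σ f z + cauchySeg σ I (c - σ) (d + σ) f z),
    fun z => (2 * Real.pi * I : ℂ)⁻¹ • (cauchySeg (((c - σ : ℝ) : ℂ) * I) 1 (-σ) 0 f z -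
      cauchySeg (((d + σ : ℝ) : ℂ) * I) 1 (-σ) 0 f z -
      cauchySeg ((-σ : ℝ) : ℂ) I (c - σ) (d + σ) f z), ?_, ?_, ?_, ?_, ?_⟩
  · refine DifferentiableOn.const_smul (DifferentiableOn.add (DifferentiableOn.sub ?_ ?_) ?_) _
    · exact differentiableOn_cauchySeg (isOpen_stripL _ _ _) ((horc _ b1).mono s1)
        (fun x _ hx => ne_of (dbot _ hx.2.1 x) rfl)
    · exact differentiableOn_cauchySeg (isOpen_stripL _ _ _) ((horc _ b2).mono s1)
        (fun x _ hx => ne_of (dtop _ hx.2.2 x) rfl)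
    · exact differentiableOn_cauchySeg (isOpen_stripL _ _ _) (by rw [s3]; exact verc _ b4)
        (fun x _ hx => ne_of (dright _ hx.1 x) rfl)
  · refine DifferentiableOn.const_smul (DifferentiableOn.sub (DifferentiableOn.sub ?_ ?_) ?_) _
    · exact differentiableOn_cauchySeg (isOpen_stripR _ _ _) ((horc _ b1).mono s2)
        (fun x _ hx => ne_of (dbot _ hx.2.1 x) rfl)
    · exact differentiableOn_cauchySeg (isOpen_stripR _ _ _) ((horc _ b2).mono s2)
        (fun x _ hx => ne_of (dtop _ hx.2.2 x) rfl)
    · exact differentiableOn_cauchySeg (isOpen_stripR _ _ _) (by rw [s3]; exact verc _ b3)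
        (fun x _ hx => ne_of (dleft _ hx.1 x) rfl)
  · intro z hz
    obtain ⟨⟨hz1, hz2⟩, hz3, hz4⟩ := mem_stripQ.1 hz
    have C := cauchySeg_rect (a := -σ) (b := σ) (c := c - σ) (d := d + σ) (isOpen_stripQ c d δ) hf
      (by
        intro w hw
        obtain ⟨⟨_, _⟩, _, _⟩ := mem_reProdIm.1 hw
        rw [mem_stripQ]
        constructor <;> [constructor; constructor] <;> linarith) (z := z)
      (mem_reProdIm.2 ⟨⟨by linarith, by linarith⟩, by linarith, by linarith⟩)
    have A1 := cauchySeg_add (f := f) (z := z) (show -σ ≤ 0 by linarith) (show 0 ≤ σ by linarith)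
      (horc _ b1) (fun x _ => ne_of (dbot z hz3 x))
    have A2 := cauchySeg_add (f := f) (z := z) (show -σ ≤ 0 by linarith) (show 0 ≤ σ by linarith)
      (horc _ b2) (fun x _ => ne_of (dtop z hz4 x))
    rw [← A1, ← A2] at C
    have hpi : (2 * Real.pi * I : ℂ) ≠ 0 := by
      simp [Real.pi_ne_zero]
    rw [← smul_add, eq_inv_smul_iff₀ hpi, ← C]
    abel
  · intro z hz
    obtain ⟨hz2, hz3, hz4⟩ := mem_stripL.1 hz
    refine bound _ _ _ ?_ ?_ ?_ _ ((norm_add_le _ _).trans (add_le_add_left (norm_sub_le _ _) _))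
    · exact (norm_cauchySeg_le r0 v1 (fun x hx => hM _ (hor _ b1 x (s1 hx)))
        (fun x _ => dbot z hz3 x)).trans (by gcongr)
    · exact (norm_cauchySeg_le r0 v1 (fun x hx => hM _ (hor _ b2 x (s1 hx)))
        (fun x _ => dtop z hz4 x)).trans (by gcongr)
    · exact (norm_cauchySeg_le r0 norm_I (fun x hx => hM _ (ver _ b4 x (s3 ▸ hx)))
        (fun x _ => dright z hz2 x)).trans (by gcongr)
  · intro z hz
    obtain ⟨hz2, hz3, hz4⟩ := mem_stripR.1 hz
    refine bound _ _ _ ?_ ?_ ?_ _ ((norm_sub_le _ _).trans (add_le_add_left (norm_sub_le _ _) _))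
    · exact (norm_cauchySeg_le r0 v1 (fun x hx => hM _ (hor _ b1 x (s2 hx)))
        (fun x _ => dbot z hz3 x)).trans (by gcongr)
    · exact (norm_cauchySeg_le r0 v1 (fun x hx => hM _ (hor _ b2 x (s2 hx)))
        (fun x _ => dtop z hz4 x)).trans (by gcongr)
    · exact (norm_cauchySeg_le r0 norm_I (fun x hx => hM _ (ver _ b3 x (s3 ▸ hx)))
        (fun x _ => dleft z hz2 x)).trans (by gcongr)

end Splitting

end LoopFlag
end

noncomputable section
namespace LoopFlag

/-! ### Newton iteration: multiplicative splitting of functions close to one. -/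

section Newton

open Complex Set Filter

variable {𝔐 : Type*} [NormedRing 𝔐] [CompleteSpace 𝔐]

lemma isUnit_one_add_of_norm_lt_one {x : 𝔐} (h : ‖x‖ < 1) : IsUnit (1 + x) := by
  have := isUnit_one_sub_of_norm_lt_one (x := -x) (by rwa [norm_neg])
  rwa [sub_neg_eq_add] at this

/-- Since `(1 + x)⁻¹ = 1 - (1 + x)⁻¹ x`, the norm of the inverse is at most one plus half of itself.
-/
lemma norm_inverse_one_add_le [NormOneClass 𝔐] {x : 𝔐} (h : ‖x‖ ≤ 1 / 2) : ‖Ring.inverse (1 + x)‖ ≤ 2 := by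
  have hu : IsUnit (1 + x) := isUnit_one_add_of_norm_lt_one (by linarith)
  have e := Ring.inverse_mul_cancel _ hu
  have e2 : Ring.inverse (1 + x) = 1 - Ring.inverse (1 + x) * x := by
    rw [mul_add, mul_one] at e
    exact eq_sub_of_add_eq e
  have h3 : ‖Ring.inverse (1 + x)‖ ≤ 1 + ‖Ring.inverse (1 + x)‖ * (1 / 2) := by
    calc ‖Ring.inverse (1 + x)‖ = ‖1 - Ring.inverse (1 + x) * x‖ := by rw [← e2]
      _ ≤ ‖(1 : 𝔐)‖ + ‖Ring.inverse (1 + x) * x‖ := norm_sub_le _ _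
      _ ≤ 1 + ‖Ring.inverse (1 + x)‖ * ‖x‖ := by
        rw [norm_one]; gcongr; exact norm_mul_le _ _
      _ ≤ _ := by gcongr
  linarith

variable [NormedAlgebra ℂ 𝔐]

lemma differentiableOn_inverse {Ω : Set ℂ} {f : ℂ → 𝔐} (hf : DifferentiableOn ℂ f Ω)
    (hu : ∀ z ∈ Ω, IsUnit (f z)) : DifferentiableOn ℂ (fun z => Ring.inverse (f z)) Ω := by
  intro z hz
  obtain ⟨u, hu'⟩ := hu z hz
  have h : DifferentiableAt ℂ (Ring.inverse : 𝔐 → 𝔐) (f z) := by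
    rw [← hu']
    exact (hasFDerivAt_ringInverse (𝕜 := ℂ) u).differentiableAt
  exact h.comp_differentiableWithinAt z (hf z hz)

variable [NormOneClass 𝔐]

/-- Infinite products of holomorphic functions with rapidly decreasing factors; `F` is the
multiplication or its opposite. -/
lemma exists_infinite_product {Ω : Set ℂ} (hΩ : IsOpen Ω) (F : 𝔐 →L[ℂ] 𝔐 →L[ℂ] 𝔐)
    (hF : ∀ x y, ‖F x y‖ ≤ ‖x‖ * ‖y‖) {a : ℕ → ℂ → 𝔐}
    (ha : ∀ k, DifferentiableOn ℂ (a k) Ω) (hb : ∀ k, ∀ z ∈ Ω, ‖a k z‖ ≤ 1 / 16 * (1 / 2) ^ k) :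
    ∃ (A : ℂ → 𝔐) (P : ℕ → ℂ → 𝔐), DifferentiableOn ℂ A Ω ∧ (∀ z ∈ Ω, IsUnit (A z)) ∧
      (∀ z, P 0 z = 1) ∧ (∀ k z, P (k + 1) z = P k z + F (P k z) (a k z)) ∧
      (∀ z ∈ Ω, Tendsto (fun k => P k z) atTop (𝓝 (A z))) := by
  let P : ℕ → ℂ → 𝔐 := fun k => Nat.rec (fun _ => 1) (fun k p z => p z + F (p z) (a k z)) k
  have P0 : ∀ z, P 0 z = 1 := fun _ => rfl
  have P1 : ∀ k z, P (k + 1) z = P k z + F (P k z) (a k z) := fun _ _ => rfl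
  -- The bound `2 - 2⁻ᵏ` survives the induction because the new term has norm at most `2⁻ᵏ / 8`,
  -- less than the `2⁻ᵏ / 2` that becomes available.
  have Pb : ∀ k, ∀ z ∈ Ω, ‖P k z‖ ≤ 2 - (1 / 2) ^ k := by
    intro k z hz
    induction k with
    | zero => rw [P0, norm_one]; norm_num
    | succ k ih =>
      have h0 : (0 : ℝ) < (1 / 2) ^ k := by positivity
      rw [P1]
      calc ‖P k z + F (P k z) (a k z)‖ ≤ ‖P k z‖ + ‖P k z‖ * ‖a k z‖ :=
            (norm_add_le _ _).trans (by gcongr; exact hF _ _)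
        _ ≤ (2 - (1 / 2) ^ k) + 2 * (1 / 16 * (1 / 2) ^ k) := by
            gcongr
            · linarith
            · exact hb k z hz
        _ ≤ 2 - (1 / 2) ^ (k + 1) := by rw [pow_succ]; linarith
  have Pd : ∀ k, DifferentiableOn ℂ (P k) Ω := by
    intro k
    induction k with
    | zero => exact differentiableOn_const _
    | succ k ih => exact ih.add (fun z hz => (((F.differentiableAt.comp_differentiableWithinAt z
        (ih z hz))).clm_apply (ha k z hz)))
  have hle : ∀ k, ∀ z ∈ Ω, ‖F (P k z) (a k z)‖ ≤ 1 / 8 * (1 / 2) ^ k := by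
    intro k z hz
    have h0 : (0 : ℝ) < (1 / 2) ^ k := by positivity
    calc _ ≤ ‖P k z‖ * ‖a k z‖ := hF _ _
      _ ≤ 2 * (1 / 16 * (1 / 2) ^ k) := by
        gcongr
        · linarith [Pb k z hz]
        · exact hb k z hz
      _ = _ := by ring
  have hs : Summable (fun k : ℕ => (1 / 8 : ℝ) * (1 / 2) ^ k) :=
    summable_geometric_two.mul_left _
  -- The limit differs from one by at most `1 / 4`, hence it is invertible.
  have htot : ∑' k : ℕ, (1 / 8 : ℝ) * (1 / 2) ^ k = 1 / 4 := by
    rw [tsum_mul_left, tsum_geometric_two]; norm_num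
  refine ⟨fun z => 1 + ∑' k, F (P k z) (a k z), P, ?_, ?_, P0, P1, ?_⟩
  · refine (differentiableOn_const _).add (Complex.differentiableOn_tsum_of_summable_norm hs
      (fun k => ?_) hΩ hle)
    exact fun z hz => (((F.differentiableAt.comp_differentiableWithinAt z
        (Pd k z hz))).clm_apply (ha k z hz))
  · intro z hz
    refine isUnit_one_add_of_norm_lt_one ?_
    have := tsum_of_norm_bounded hs.hasSum (fun k => hle k z hz)
    linarith
  · intro z hz
    have hsum : Summable (fun k => F (P k z) (a k z)) := Summable.of_norm_bounded hs
      (fun k => hle k z hz)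
    have := hsum.hasSum.tendsto_sum_nat.const_add 1
    refine this.congr (fun k => ?_)
    induction k with
    | zero => simp [P0]
    | succ k ih => rw [Finset.sum_range_succ, ← add_assoc, ih, P1]

/-- With `E = a + b` split additively, `1 + E = (1 + a)(1 + b) - a b`, so after division by the two
outer factors the remaining error is `-(1 + a)⁻¹ a b (1 + b)⁻¹`. It is quadratic in `η`, and the
factor `4` bounds the two inverses. -/
lemma exists_newton_step {c d δ δ' ε η : ℝ} (hcd : c ≤ d) (h0 : 0 < δ')
    (h : δ' < δ) (h1 : δ ≤ 1) {E : ℂ → 𝔐} (hE : DifferentiableOn ℂ E (stripQ c d δ))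
    (hε : ∀ z ∈ stripQ c d δ, ‖E z‖ ≤ ε) (hη : 2 * (d - c + 4) * ε / (δ - δ') ≤ η)
    (hη2 : η ≤ 1 / 2) :
    ∃ a b E' : ℂ → 𝔐, DifferentiableOn ℂ a (stripL c d δ') ∧ DifferentiableOn ℂ b (stripR c d δ') ∧
      DifferentiableOn ℂ E' (stripQ c d δ') ∧
      (∀ z ∈ stripL c d δ', ‖a z‖ ≤ η) ∧ (∀ z ∈ stripR c d δ', ‖b z‖ ≤ η) ∧
      (∀ z ∈ stripQ c d δ', ‖E' z‖ ≤ 4 * η ^ 2) ∧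
      ∀ z ∈ stripQ c d δ', 1 + E z = (1 + a z) * (1 + E' z) * (1 + b z) := by
  obtain ⟨a, b, ha, hb, hab, na, nb⟩ := exists_additive_splitting hcd h0 h h1 hE hε
  have na' : ∀ z ∈ stripL c d δ', ‖a z‖ ≤ η := fun z hz => (na z hz).trans hη
  have nb' : ∀ z ∈ stripR c d δ', ‖b z‖ ≤ η := fun z hz => (nb z hz).trans hη
  have ua : ∀ z ∈ stripL c d δ', IsUnit (1 + a z) := fun z hz =>
    isUnit_one_add_of_norm_lt_one (by linarith [na' z hz])
  have ub : ∀ z ∈ stripR c d δ', IsUnit (1 + b z) := fun z hz =>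
    isUnit_one_add_of_norm_lt_one (by linarith [nb' z hz])
  have da : DifferentiableOn ℂ a (stripQ c d δ') := ha.mono stripQ_subset_L
  have db : DifferentiableOn ℂ b (stripQ c d δ') := hb.mono stripQ_subset_R
  have ia := differentiableOn_inverse (da.const_add 1) (fun z hz => ua z (stripQ_subset_L hz))
  have ib := differentiableOn_inverse (db.const_add 1) (fun z hz => ub z (stripQ_subset_R hz))
  refine ⟨a, b, fun z => -(Ring.inverse (1 + a z) * (a z * b z) * Ring.inverse (1 + b z)), ha, hb,
    ((ia.mul (da.mul db)).mul ib).neg, na', nb', fun z hz => ?_, fun z hz => ?_⟩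
  · have n1 := na' z (stripQ_subset_L hz)
    have n2 := nb' z (stripQ_subset_R hz)
    have i1 := norm_inverse_one_add_le (n1.trans hη2)
    have i2 := norm_inverse_one_add_le (n2.trans hη2)
    have η0 : 0 ≤ η := (norm_nonneg _).trans n1
    rw [norm_neg]
    calc _ ≤ ‖Ring.inverse (1 + a z)‖ * (‖a z‖ * ‖b z‖) * ‖Ring.inverse (1 + b z)‖ :=
          (norm_mul_le _ _).trans (by
            gcongr
            exact (norm_mul_le _ _).trans (by gcongr; exact norm_mul_le _ _))
      _ ≤ 2 * (η * η) * 2 := by gcongr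
      _ = _ := by ring
  · have e1 := Ring.mul_inverse_cancel _ (ua z (stripQ_subset_L hz))
    have e2 := Ring.inverse_mul_cancel _ (ub z (stripQ_subset_R hz))
    have : (1 + a z) * (1 + -(Ring.inverse (1 + a z) * (a z * b z) * Ring.inverse (1 + b z))) *
        (1 + b z) = (1 + a z) * (1 + b z) - ((1 + a z) * Ring.inverse (1 + a z)) * (a z * b z) *
        (Ring.inverse (1 + b z) * (1 + b z)) := by noncomm_ring
    rw [this, e1, e2, hab z hz]
    noncomm_ring

/-- Multiplicative splitting, across a segment, of functions close to one. -/
theorem exists_small_factorization {c d δ : ℝ} (hcd : c ≤ d) (h0 : 0 < δ) (h1 : δ ≤ 1) :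
    ∃ ε > 0, ∀ E : ℂ → 𝔐, DifferentiableOn ℂ E (stripQ c d δ) →
      (∀ z ∈ stripQ c d δ, ‖E z‖ ≤ ε) →
      ∃ A B : ℂ → 𝔐, DifferentiableOn ℂ A (stripL c d (δ / 2)) ∧
        DifferentiableOn ℂ B (stripR c d (δ / 2)) ∧
        (∀ z ∈ stripL c d (δ / 2), IsUnit (A z)) ∧ (∀ z ∈ stripR c d (δ / 2), IsUnit (B z)) ∧
        ∀ z ∈ stripQ c d (δ / 2), 1 + E z = A z * B z := by
  -- With the widths `δs` chosen below, the splitting constant at stage `k` is exactly `u * 2 ^ k`.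
  obtain ⟨u, hu⟩ : ∃ u, u = 8 * (d - c + 4) / δ := ⟨_, rfl⟩
  have hu32 : 32 ≤ u := by
    rw [hu, le_div_iff₀ h0]; nlinarith
  have u0 : 0 < u := by linarith
  -- The errors decrease by the factor `64` at each stage, and `1 / (256 u²)` is small enough for `4
  -- η_k² ≤ ε_{k+1}` in spite of the loss `u * 2 ^ k`. The widths decrease to `δ / 2`.
  let ε : ℕ → ℝ := fun k => 1 / (256 * u ^ 2) / 64 ^ k
  let δs : ℕ → ℝ := fun k => δ / 2 + δ / 2 ^ (k + 1)
  let η : ℕ → ℝ := fun k => u * ε k * 2 ^ k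
  have δ_lt : ∀ k, δs (k + 1) < δs k := fun k => by
    simp only [δs]
    gcongr <;> norm_num
  have δ_gt : ∀ k, δ / 2 < δs k := fun k => by
    simp only [δs]
    have : 0 < δ / 2 ^ (k + 1) := by positivity
    linarith
  have δ_le : ∀ k, δs k ≤ 1 := fun k => by
    have : δs k ≤ δs 0 := by
      induction k with
      | zero => exact le_rfl
      | succ k ih => exact (δ_lt k).le.trans ih
    refine this.trans ?_
    simp only [δs]
    norm_num
    linarith
  have ηε : ∀ k, 2 * (d - c + 4) * ε k / (δs k - δs (k + 1)) = η k := fun k => by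
    simp only [δs, η, hu]
    have : δ / 2 + δ / 2 ^ (k + 1) - (δ / 2 + δ / 2 ^ (k + 1 + 1)) = δ / 2 ^ (k + 2) := by
      rw [pow_succ, pow_succ]; field_simp; ring
    rw [this]
    field_simp
    ring
  have ηb : ∀ k, η k ≤ 1 / 16 * (1 / 2) ^ k := fun k => by
    simp only [η, ε]
    have e : u * (1 / (256 * u ^ 2) / 64 ^ k) * 2 ^ k = 1 / (256 * u) * (1 / 32) ^ k := by
      rw [show (64 : ℝ) = 2 * 32 by norm_num, mul_pow, one_div_pow]; field_simp
    rw [e]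
    have : 1 / (256 * u) ≤ 1 / 16 := by
      apply one_div_le_one_div_of_le <;> linarith
    gcongr
    norm_num
  have ηsq : ∀ k, 4 * η k ^ 2 ≤ ε (k + 1) := fun k => by
    simp only [η, ε]
    have e : 4 * (u * (1 / (256 * u ^ 2) / 64 ^ k) * 2 ^ k) ^ 2 =
        1 / (256 * u ^ 2) / 64 ^ (k + 1) * (1 / 16) ^ k := by
      have h2 : (0 : ℝ) < 2 ^ k := by positivity
      have h64 : (64 : ℝ) ^ k = 2 ^ k * 2 ^ k * 16 ^ k := by
        rw [← mul_pow, ← mul_pow]; norm_num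
      rw [show (64 : ℝ) ^ (k + 1) = 64 * (2 ^ k * 2 ^ k * 16 ^ k) by rw [pow_succ, h64]; ring, h64,
        one_div_pow]
      generalize (2 : ℝ) ^ k = x at *
      field_simp
      ring
    rw [e]
    have h16 : ((1 : ℝ) / 16) ^ k ≤ 1 := pow_le_one₀ (by norm_num) (by norm_num)
    have : 0 ≤ 1 / (256 * u ^ 2) / 64 ^ (k + 1) := by positivity
    nlinarith
  have ηhalf : ∀ k, η k ≤ 1 / 2 := fun k => (ηb k).trans (by
    have : ((1 : ℝ) / 2) ^ k ≤ 1 := pow_le_one₀ (by norm_num) (by norm_num)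
    linarith)
  refine ⟨ε 0, by positivity, fun E hE hEb => ?_⟩
  let Good : ℕ → (ℂ → 𝔐) → Prop := fun k E => DifferentiableOn ℂ E (stripQ c d (δs k)) ∧
    ∀ z ∈ stripQ c d (δs k), ‖E z‖ ≤ ε k
  have step : ∀ k (E : {E // Good k E}), ∃ (a b : ℂ → 𝔐) (E' : {E' // Good (k + 1) E'}),
      DifferentiableOn ℂ a (stripL c d (δs (k + 1))) ∧
      DifferentiableOn ℂ b (stripR c d (δs (k + 1))) ∧
      (∀ z ∈ stripL c d (δs (k + 1)), ‖a z‖ ≤ η k) ∧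
      (∀ z ∈ stripR c d (δs (k + 1)), ‖b z‖ ≤ η k) ∧
      ∀ z ∈ stripQ c d (δs (k + 1)), 1 + E.1 z = (1 + a z) * (1 + E'.1 z) * (1 + b z) := by
    rintro k ⟨E, hE, hEb⟩
    obtain ⟨a, b, E', ha, hb, hE', na, nb, nE, e⟩ := exists_newton_step hcd
      (by linarith [δ_gt (k + 1)]) (δ_lt k) (δ_le k) hE hEb (ηε k).le (ηhalf k)
    exact ⟨a, b, ⟨E', hE', fun z hz => (nE z hz).trans (ηsq k)⟩, ha, hb, na, nb, e⟩
  choose a b E' da db na nb e using step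
  have δ0 : δs 0 = δ := by simp only [δs]; norm_num
  have g0 : Good 0 E := ⟨by rw [δ0]; exact hE, by rw [δ0]; exact hEb⟩
  let Es : ∀ k, {E // Good k E} := fun k => Nat.rec ⟨E, g0⟩ (fun k E => E' k E) k
  have Es1 : ∀ k, Es (k + 1) = E' k (Es k) := fun _ => rfl
  obtain ⟨A, P, dA, uA, P0, P1, PA⟩ := exists_infinite_product (isOpen_stripL c d (δ / 2))
    (ContinuousLinearMap.mul ℂ 𝔐) (fun x y => norm_mul_le x y) (a := fun k => a k (Es k))
    (fun k => (da k (Es k)).mono (stripL_mono (δ_gt (k + 1)).le))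
    (fun k z hz => (na k (Es k) z (stripL_mono (δ_gt (k + 1)).le hz)).trans (ηb k))
  obtain ⟨B, Q, dB, uB, Q0, Q1, QB⟩ := exists_infinite_product (isOpen_stripR c d (δ / 2))
    (ContinuousLinearMap.mul ℂ 𝔐).flip (fun x y => by
      rw [mul_comm ‖x‖]; exact norm_mul_le y x) (a := fun k => b k (Es k))
    (fun k => (db k (Es k)).mono (stripR_mono (δ_gt (k + 1)).le))
    (fun k z hz => (nb k (Es k) z (stripR_mono (δ_gt (k + 1)).le hz)).trans (ηb k))
  refine ⟨A, B, dA, dB, uA, uB, fun z hz => ?_⟩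
  -- The error sits between the partial products. As the ring is not commutative, new left factors
  -- enter `P` on its right and new right factors enter `Q` on its left, which is why `Q` is built
  -- with the flipped multiplication.
  have inv : ∀ k, 1 + E z = P k z * (1 + (Es k).1 z) * Q k z := by
    intro k
    induction k with
    | zero =>
      rw [P0, Q0, one_mul, mul_one]
      rfl
    | succ k ih =>
      rw [ih, e k (Es k) z (stripQ_mono (δ_gt (k + 1)).le hz), P1, Q1, Es1]
      simp only [ContinuousLinearMap.mul_apply', ContinuousLinearMap.flip_apply]
      noncomm_ring
  have hlim : Tendsto (fun k => (Es k).1 z) atTop (𝓝 0) := by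
    refine squeeze_zero_norm (fun k => (Es k).2.2 z (stripQ_mono (δ_gt k).le hz)) ?_
    have : Tendsto (fun k : ℕ => 1 / (256 * u ^ 2) * (1 / 64 : ℝ) ^ k) atTop (𝓝 (1 / (256 * u ^ 2) * 0)) :=
      (tendsto_pow_atTop_nhds_zero_of_lt_one (by norm_num) (by norm_num)).const_mul _
    rw [mul_zero] at this
    refine this.congr (fun k => ?_)
    simp only [ε]
    rw [one_div_pow]; ring
  have hT := ((PA z (stripQ_subset_L hz)).mul (hlim.const_add 1)).mul (QB z (stripQ_subset_R hz))
  rw [add_zero, mul_one] at hT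
  exact tendsto_nhds_unique (tendsto_const_nhds.congr inv) hT

end Newton

end LoopFlag
end

noncomputable section
namespace LoopFlag

/-! ### Runge approximation by entire functions on a rectangle. -/

section Runge

open Complex Set Filter MeasureTheory

variable {𝔐 : Type*} [NormedRing 𝔐] [NormedAlgebra ℂ 𝔐]

/-- The restrictions to `K` of entire functions. -/
def entireOn (K : Set ℂ) (𝔐 : Type*) [NormedRing 𝔐] [NormedAlgebra ℂ 𝔐] :
    Subalgebra ℂ C(K, 𝔐) where
  carrier := {g | ∃ F : ℂ → 𝔐, Differentiable ℂ F ∧ ∀ z : K, g z = F z}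
  mul_mem' := by
    rintro f g ⟨F, hF, hf⟩ ⟨G, hG, hg⟩
    exact ⟨fun z => F z * G z, hF.mul hG, fun z => by simp [hf, hg]⟩
  add_mem' := by
    rintro f g ⟨F, hF, hf⟩ ⟨G, hG, hg⟩
    exact ⟨fun z => F z + G z, hF.add hG, fun z => by simp [hf, hg]⟩
  algebraMap_mem' c := ⟨fun _ => algebraMap ℂ 𝔐 c, differentiable_const _, fun z => rfl⟩

/-- The pole is pushed to infinity. Since `K` lies in a half plane at distance `g` from `ζ` in the
direction `-u`, it lies in the disc of radius `T` about `ζ - T u` once `T` is large. There `1 / (ζ -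
z)` is a convergent geometric series of polynomials. -/
lemma exists_pole_mem_closure [CompleteSpace 𝔐] {K : Set ℂ} [CompactSpace K]
    {ζ u : ℂ} {g : ℝ} (hu : ‖u‖ = 1) (hg : 0 < g)
    (h : ∀ z ∈ K, g ≤ ((ζ - z) * star u).re) (m : 𝔐) :
    ∃ f ∈ (entireOn K 𝔐).topologicalClosure, ∀ z : K, f z = (ζ - z : ℂ)⁻¹ • m := by
  obtain ⟨D, hD⟩ : ∃ D : ℝ, ∀ z ∈ K, ‖ζ - z‖ ≤ D :=
    (isCompact_iff_compactSpace.2 ‹_›).exists_bound_of_continuousOn (f := fun z => ζ - z)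
      (by fun_prop)
  -- The squared distance of `z` from `ζ - T u` is at most `D² - 2 T g + T²`; this `T` makes `D² < 2
  -- T g`.
  obtain ⟨T, hT⟩ : ∃ T : ℝ, T = D ^ 2 / (2 * g) + 1 := ⟨_, rfl⟩
  have T0 : 0 < T := by rw [hT]; positivity
  have hT' : D ^ 2 < 2 * T * g := by rw [hT]; field_simp; nlinarith
  have hTu : ‖(T * u : ℂ)‖ = T := by rw [norm_mul, hu, Complex.norm_real]; simp [abs_of_pos T0]
  have hTu0 : (T * u : ℂ) ≠ 0 := by rw [← norm_pos_iff, hTu]; exact T0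
  have near : ∀ z ∈ K, ‖(z - (ζ - T * u))‖ < T := by
    intro z hz
    have h1 := h z hz
    have h2 := hD z hz
    have e : ‖(z - (ζ - T * u))‖ ^ 2 = ‖ζ - z‖ ^ 2 - 2 * T * ((ζ - z) * star u).re + T ^ 2 := by
      have hu2 : u.re * u.re + u.im * u.im = 1 := by
        have := Complex.sq_norm u
        rw [hu, normSq_apply] at this
        linarith
      rw [Complex.sq_norm, Complex.sq_norm, normSq_apply, normSq_apply]
      simp
      linear_combination (T ^ 2) * hu2
    refine lt_of_pow_lt_pow_left₀ 2 T0.le ?_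
    rw [e]
    have h3 : ‖ζ - z‖ ^ 2 ≤ D ^ 2 := by gcongr
    nlinarith
  by_cases hK : Nonempty K
  swap
  · exact ⟨0, zero_mem _, fun z => (hK ⟨z⟩).elim⟩
  by_cases hM : Nontrivial 𝔐
  swap
  · have := not_nontrivial_iff_subsingleton.1 hM
    exact ⟨0, zero_mem _, fun z => Subsingleton.elim _ _⟩
  let sf : C(K, ℂ) := ⟨fun z => ((z - (ζ - T * u)) / (T * u) : ℂ), by fun_prop⟩
  have hs : ‖sf‖ < 1 := by
    rw [ContinuousMap.norm_lt_iff _ one_pos]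
    intro z
    change ‖((z - (ζ - T * u)) / (T * u) : ℂ)‖ < 1
    rw [norm_div, hTu, div_lt_one T0]
    exact near z z.2
  -- the geometric series
  let E := (entireOn K ℂ).topologicalClosure
  have hE : IsClosed (E : Set C(K, ℂ)) := Subalgebra.isClosed_topologicalClosure _
  have : CompleteSpace E := hE.completeSpace_coe
  have sfE : sf ∈ E := Subalgebra.le_topologicalClosure _
    ⟨fun z => (z - (ζ - T * u)) / (T * u), by fun_prop, fun z => rfl⟩
  -- Inverting inside the closed subalgebra, itself a Banach algebra, keeps the sum of the series in
  -- the closure of the entire functions.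
  obtain ⟨y, hy⟩ := isUnit_one_sub_of_norm_lt_one (x := (⟨sf, sfE⟩ : E)) hs
  have hy2 : ((↑y⁻¹ : E) : C(K, ℂ)) * (1 - sf) = 1 := by
    have := congrArg (fun x : E => (x : C(K, ℂ))) (Units.inv_mul y)
    rw [hy] at this
    exact this
  let Lm : C(K, ℂ) → C(K, 𝔐) := fun f => ⟨fun z => f z • ((T * u : ℂ)⁻¹ • m), by fun_prop⟩
  have Lmc : Continuous Lm := by
    refine continuous_iff_continuousAt.2 (fun f => ?_)
    have : LipschitzWith (‖((T * u : ℂ)⁻¹ • m)‖₊) Lm := by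
      refine LipschitzWith.of_dist_le_mul (fun f g => ?_)
      rw [ContinuousMap.dist_le (by positivity)]
      intro z
      rw [dist_eq_norm]
      change ‖f z • ((T * u : ℂ)⁻¹ • m) - g z • ((T * u : ℂ)⁻¹ • m)‖ ≤ _
      rw [← sub_smul, norm_smul, mul_comm, coe_nnnorm]
      gcongr
      rw [← dist_eq_norm]
      exact ContinuousMap.dist_apply_le_dist z
    exact this.continuous.continuousAt
  refine ⟨Lm (↑y⁻¹ : E), ?_, fun z => ?_⟩
  · have hmaps : MapsTo Lm (entireOn K ℂ : Set C(K, ℂ)) (entireOn K 𝔐 : Set C(K, 𝔐)) := by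
      rintro f ⟨F, hF, hf⟩
      exact ⟨fun z => F z • ((T * u : ℂ)⁻¹ • m), hF.smul_const _, fun z => by simp [Lm, hf]⟩
    exact hmaps.closure Lmc (↑y⁻¹ : E).2
  · have e1 : ((↑y⁻¹ : E) : C(K, ℂ)) z * (1 - (z - (ζ - T * u)) / (T * u)) = 1 :=
      congrArg (fun f : C(K, ℂ) => f z) hy2
    have e2 : (1 : ℂ) - (z - (ζ - T * u)) / (T * u) = (ζ - z) / (T * u) := by
      rw [one_sub_div hTu0]
      congr 1
      ring
    rw [e2] at e1
    change ((↑y⁻¹ : E) : C(K, ℂ)) z • ((T * u : ℂ)⁻¹ • m) = _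
    rw [smul_smul]
    congr 1
    have hz : (ζ - z : ℂ) ≠ 0 := by
      intro h0
      rw [h0, zero_div, mul_zero] at e1
      exact zero_ne_one e1
    refine eq_inv_of_mul_eq_one_left ?_
    rw [← e1]
    ring

/-- By currying, the integrand is a continuous curve in a closed subspace of `C(K, 𝔐)`. Its Bochner
integral stays in that subspace, and evaluation at a point of `K` commutes with the integral. -/
lemma exists_cauchySeg_mem_closure [CompleteSpace 𝔐] {K : Set ℂ} [CompactSpace K]
    {p v : ℂ} {s t : ℝ} (hst : s ≤ t) {f : ℂ → 𝔐}
    (hf : ContinuousOn (fun x : ℝ => f (p + x * v)) (Icc s t)) (hz : ∀ x ∈ Icc s t, p + (x : ℝ) * v ∉ K)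
    (hmem : ∀ x ∈ Icc s t, ∀ m : 𝔐, ∃ g ∈ (entireOn K 𝔐).topologicalClosure,
      ∀ z : K, g z = (p + (x : ℝ) * v - z : ℂ)⁻¹ • m) :
    ∃ g ∈ (entireOn K 𝔐).topologicalClosure, ∀ z : K, g z = cauchySeg p v s t f z := by
  let B := (entireOn K 𝔐).topologicalClosure.toSubmodule
  have hB : IsClosed (B : Set C(K, 𝔐)) := Subalgebra.isClosed_topologicalClosure _
  have : CompleteSpace B := hB.completeSpace_coe
  have hf' : Continuous (fun x : Icc s t => f (p + (x : ℝ) * v)) := continuousOn_iff_continuous_domRestrict.1 hf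
  let G : C(Icc s t × K, 𝔐) := ⟨fun q => (v / (p + (q.1 : ℝ) * v - q.2)) • f (p + (q.1 : ℝ) * v), by
    refine Continuous.smul (Continuous.div (by fun_prop) (by fun_prop) ?_)
      (hf'.comp continuous_fst)
    rintro ⟨x, z⟩ h0
    refine hz x x.2 ?_
    have : p + (x : ℝ) * v = z := sub_eq_zero.1 h0
    rw [this]; exact z.2⟩
  have GB : ∀ x : Icc s t, G.curry x ∈ B := by
    intro x
    obtain ⟨g, hg, hgz⟩ := hmem x x.2 (v • f (p + (x : ℝ) * v))
    have : G.curry x = g := by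
      ext z
      rw [hgz, smul_smul, mul_comm, ← div_eq_mul_inv]
      rfl
    rw [this]
    exact hg
  let φ : ℝ → B := IccExtend hst (fun x => ⟨G.curry x, GB x⟩)
  have hφ : Continuous φ := Continuous.Icc_extend' (by
    exact Continuous.subtype_mk G.curry.continuous _)
  refine ⟨(∫ x in s..t, φ x : B), (∫ x in s..t, φ x : B).2, fun z => ?_⟩
  let L : B →L[ℂ] 𝔐 := (ContinuousMap.evalCLM ℂ z).comp B.subtypeL
  change L (∫ x in s..t, φ x) = _
  rw [← ContinuousLinearMap.intervalIntegral_comp_comm _ (hφ.intervalIntegrable _ _)]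
  refine intervalIntegral.integral_congr (fun x hx => ?_)
  rw [uIcc_of_le hst] at hx
  simp only [φ, IccExtend_of_mem hst _ hx]
  rfl

/-- **Runge's theorem** for a rectangle. -/
theorem exists_mem_closure_entireOn [CompleteSpace 𝔐] {c d δ δ' : ℝ} (hcd : c ≤ d) (h0 : 0 < δ')
    (h : δ' < δ) {f : ℂ → 𝔐} (hf : DifferentiableOn ℂ f (stripQ c d δ))
    [CompactSpace (Icc (-δ') δ' ×ℂ Icc (c - δ') (d + δ') : Set ℂ)] :
    ∃ g ∈ (entireOn (Icc (-δ') δ' ×ℂ Icc (c - δ') (d + δ')) 𝔐).topologicalClosure,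
      ∀ z, g z = f z := by
  obtain ⟨σ, hσ⟩ : ∃ σ, σ = (δ + δ') / 2 := ⟨_, rfl⟩
  have hor : ∀ e ∈ Icc (c - σ) (d + σ), ∀ x ∈ Icc (-σ) σ,
      ((e : ℝ) : ℂ) * I + (x : ℝ) * 1 ∈ stripQ c d δ := by
    rintro e ⟨he, he'⟩ x ⟨hx, hx'⟩
    rw [mem_stripQ]
    simp
    constructor <;> [constructor; constructor] <;> linarith
  have ver : ∀ e ∈ Icc (-σ) σ, ∀ x ∈ Icc (c - σ) (d + σ),
      ((e : ℝ) : ℂ) + (x : ℝ) * I ∈ stripQ c d δ := by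
    rintro e ⟨he, he'⟩ x ⟨hx, hx'⟩
    rw [mem_stripQ]
    simp
    constructor <;> [constructor; constructor] <;> linarith
  have key : ∀ {ζ u : ℂ}, ‖u‖ = 1 →
      (∀ z ∈ (Icc (-δ') δ' ×ℂ Icc (c - δ') (d + δ') : Set ℂ), σ - δ' ≤ ((ζ - z) * star u).re) →
      (ζ ∉ (Icc (-δ') δ' ×ℂ Icc (c - δ') (d + δ') : Set ℂ)) ∧
      ∀ m : 𝔐, ∃ g ∈ (entireOn (Icc (-δ') δ' ×ℂ Icc (c - δ') (d + δ')) 𝔐).topologicalClosure,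
        ∀ z, g z = (ζ - z : ℂ)⁻¹ • m := by
    intro ζ u hu hz
    refine ⟨fun hmem => ?_, fun m => exists_pole_mem_closure hu (by linarith) hz m⟩
    have := hz ζ hmem
    simp at this
    linarith
  -- On each side of the contour the direction `u` is the outward normal, and the gap to the
  -- rectangle is `σ - δ'`.
  have kb : ∀ x : ℝ, _ := fun x => key (ζ := ((c - σ : ℝ) : ℂ) * I + x * 1) (u := -I) (by simp)
    (fun z hz => by obtain ⟨⟨_, _⟩, _, _⟩ := mem_reProdIm.1 hz; simp; linarith)
  have kt : ∀ x : ℝ, _ := fun x => key (ζ := ((d + σ : ℝ) : ℂ) * I + x * 1) (u := I) (by simp)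
    (fun z hz => by obtain ⟨⟨_, _⟩, _, _⟩ := mem_reProdIm.1 hz; simp; linarith)
  have kr : ∀ x : ℝ, _ := fun x => key (ζ := (σ : ℂ) + x * I) (u := 1) (by simp)
    (fun z hz => by obtain ⟨⟨_, _⟩, _, _⟩ := mem_reProdIm.1 hz; simp; linarith)
  have kl : ∀ x : ℝ, _ := fun x => key (ζ := ((-σ : ℝ) : ℂ) + x * I) (u := -1) (by simp)
    (fun z hz => by obtain ⟨⟨_, _⟩, _, _⟩ := mem_reProdIm.1 hz; simp; linarith)
  obtain ⟨g1, m1, e1⟩ := exists_cauchySeg_mem_closure (s := -σ) (t := σ) (by linarith)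
    (hf.continuousOn.comp (by fun_prop) (hor (c - σ) ⟨le_rfl, by linarith⟩))
    (fun x _ => (kb x).1) (fun x _ => (kb x).2)
  obtain ⟨g2, m2, e2⟩ := exists_cauchySeg_mem_closure (s := -σ) (t := σ) (by linarith)
    (hf.continuousOn.comp (by fun_prop) (hor (d + σ) ⟨by linarith, le_rfl⟩))
    (fun x _ => (kt x).1) (fun x _ => (kt x).2)
  obtain ⟨g3, m3, e3⟩ := exists_cauchySeg_mem_closure (s := c - σ) (t := d + σ) (by linarith)
    (hf.continuousOn.comp (by fun_prop) (ver σ ⟨by linarith, le_rfl⟩))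
    (fun x _ => (kr x).1) (fun x _ => (kr x).2)
  obtain ⟨g4, m4, e4⟩ := exists_cauchySeg_mem_closure (s := c - σ) (t := d + σ) (by linarith)
    (hf.continuousOn.comp (by fun_prop) (ver (-σ) ⟨le_rfl, by linarith⟩))
    (fun x _ => (kl x).1) (fun x _ => (kl x).2)
  refine ⟨(2 * Real.pi * I : ℂ)⁻¹ • (g1 - g2 + g3 - g4),
    Subalgebra.smul_mem _ (sub_mem (add_mem (sub_mem m1 m2) m3) m4) _, fun z => ?_⟩
  have hz := mem_reProdIm.1 z.2
  have C := cauchySeg_rect (a := -σ) (b := σ) (c := c - σ) (d := d + σ) (isOpen_stripQ c d δ) hf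
    (by
      intro w hw
      obtain ⟨⟨_, _⟩, _, _⟩ := mem_reProdIm.1 hw
      rw [mem_stripQ]
      constructor <;> [constructor; constructor] <;> linarith) (z := z)
    (by
      obtain ⟨⟨_, _⟩, _, _⟩ := hz
      exact mem_reProdIm.2 ⟨⟨by linarith, by linarith⟩, by linarith, by linarith⟩)
  have hpi : (2 * Real.pi * I : ℂ) ≠ 0 := by simp [Real.pi_ne_zero]
  rw [← e1, ← e2, ← e3, ← e4] at C
  rw [← inv_smul_eq_iff₀ hpi] at C
  exact C

end Runge

end LoopFlag
end

noncomputable section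
namespace LoopFlag

/-! ### Approximation by invertible entire functions and Cartan's lemma. -/

section Cartan

open Complex Set Filter

variable {𝔐 : Type*} [NormedRing 𝔐] [NormedAlgebra ℂ 𝔐]

/-- The restrictions to `K` of entire functions with values in the units. -/
def entireUnitsOn (K : Set ℂ) (𝔐 : Type*) [NormedRing 𝔐] [NormedAlgebra ℂ 𝔐] :
    Submonoid C(K, 𝔐) where
  carrier := {g | ∃ F : ℂ → 𝔐, Differentiable ℂ F ∧ (∀ z, IsUnit (F z)) ∧ ∀ z : K, g z = F z}
  mul_mem' := by
    rintro f g ⟨F, hF, uF, hf⟩ ⟨G, hG, uG, hg⟩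
    exact ⟨fun z => F z * G z, hF.mul hG, fun z => (uF z).mul (uG z), fun z => by simp [hf, hg]⟩
  one_mem' := ⟨fun _ => 1, differentiable_const _, fun _ => isUnit_one, fun z => rfl⟩

variable [CompleteSpace 𝔐]

lemma mem_eball_expSeries {𝔸 : Type*} [NormedRing 𝔸] [NormedAlgebra ℂ 𝔸] [CompleteSpace 𝔸] (x : 𝔸) :
    x ∈ Metric.eball (0 : 𝔸) (NormedSpace.expSeries ℂ 𝔸).radius :=
  (NormedSpace.expSeries_radius_eq_top ℂ 𝔸).symm ▸ edist_lt_top _ _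

lemma exp_mem_closure_entireUnitsOn {K : Set ℂ} [CompactSpace K] {l : C(K, 𝔐)}
    (hl : l ∈ (entireOn K 𝔐).topologicalClosure) :
    NormedSpace.exp l ∈ closure (entireUnitsOn K 𝔐 : Set C(K, 𝔐)) := by
  have hmaps : MapsTo NormedSpace.exp (entireOn K 𝔐 : Set C(K, 𝔐))
      (entireUnitsOn K 𝔐 : Set C(K, 𝔐)) := by
    rintro f ⟨F, hF, hf⟩
    refine ⟨fun z => NormedSpace.exp (F z),
      fun z => ((NormedSpace.exp_analytic (𝕂 := ℂ) (F z)).differentiableAt).comp z (hF z),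
      fun z => NormedSpace.isUnit_exp_of_mem_ball (𝕂 := ℂ) (mem_eball_expSeries _), fun z => ?_⟩
    change _ = NormedSpace.exp (F z)
    rw [← hf]
    let ev : C(K, 𝔐) →+* 𝔐 :=
      { toFun := fun f => f z, map_one' := rfl, map_mul' := fun _ _ => rfl, map_zero' := rfl,
        map_add' := fun _ _ => rfl }
    exact NormedSpace.map_exp_of_mem_ball (𝕂 := ℂ) ev (continuous_eval_const z) f
      (mem_eball_expSeries _)
  have hc : Continuous (NormedSpace.exp : C(K, 𝔐) → C(K, 𝔐)) :=
    continuous_iff_continuousAt.2 fun x => (NormedSpace.exp_analytic (𝕂 := ℂ) x).continuousAt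
  exact hmaps.closure hc hl

/-- In the Banach algebra of limits of entire functions, `exp` is a local homeomorphism at `0`. An
element near one is therefore the exponential of such a limit, and exponentials of entire functions
are entire and invertible. -/
lemma exists_ball_subset_closure_entireUnitsOn (K : Set ℂ) [CompactSpace K] :
    ∃ ρ > 0, ∀ x ∈ (entireOn K 𝔐).topologicalClosure, ‖x - 1‖ < ρ →
      x ∈ closure (entireUnitsOn K 𝔐 : Set C(K, 𝔐)) := by
  let B := (entireOn K 𝔐).topologicalClosure
  have hB : IsClosed (B : Set C(K, 𝔐)) := Subalgebra.isClosed_topologicalClosure _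
  have : CompleteSpace B := hB.completeSpace_coe
  have h := (hasStrictFDerivAt_exp_zero (𝕂 := ℂ) (𝔸 := B)).map_nhds_eq_of_equiv
    (f' := ContinuousLinearEquiv.refl ℂ B)
  have h1 : range (NormedSpace.exp : B → B) ∈ 𝓝 (1 : B) := by
    rw [NormedSpace.exp_zero] at h
    rw [← h]
    exact range_mem_map
  obtain ⟨ρ, hρ, hball⟩ := Metric.mem_nhds_iff.1 h1
  refine ⟨ρ, hρ, fun x hx hx1 => ?_⟩
  obtain ⟨l, hl⟩ := hball (show (⟨x, hx⟩ : B) ∈ Metric.ball 1 ρ by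
    rw [Metric.mem_ball, dist_eq_norm]; exact hx1)
  have e : ((NormedSpace.exp l : B) : C(K, 𝔐)) = NormedSpace.exp (l : C(K, 𝔐)) :=
    NormedSpace.map_exp_of_mem_ball (𝕂 := ℂ) B.val continuous_subtype_val l (mem_eball_expSeries _)
  rw [hl] at e
  rw [show x = NormedSpace.exp (l : C(K, 𝔐)) from e]
  exact exp_mem_closure_entireUnitsOn l.2

lemma convex_combination_mem_stripQ {c d δ s : ℝ} {z : ℂ} (hs : s ∈ Icc (0 : ℝ) 1)
    (hz : z ∈ stripQ c d δ) :
    (((c + d) / 2 : ℝ) : ℂ) * I + s * (z - ((c + d) / 2 : ℝ) * I) ∈ stripQ c d δ := by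
  obtain ⟨⟨h1, h2⟩, h3, h4⟩ := mem_stripQ.1 hz
  obtain ⟨hs0, hs1⟩ := hs
  rw [mem_stripQ]
  simp
  refine ⟨⟨?_, ?_⟩, ?_, ?_⟩ <;> nlinarith

/-- Holomorphic functions with values in the units, on a neighbourhood of a rectangle, are limits of
entire functions with values in the units. -/
lemma mem_closure_entireUnitsOn {c d δ δ' : ℝ} (hcd : c ≤ d) (h0 : 0 < δ') (h : δ' < δ)
    {G : ℂ → 𝔐} (hG : DifferentiableOn ℂ G (stripQ c d δ)) (uG : ∀ z ∈ stripQ c d δ, IsUnit (G z))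
    [CompactSpace (Icc (-δ') δ' ×ℂ Icc (c - δ') (d + δ') : Set ℂ)]
    (g : C((Icc (-δ') δ' ×ℂ Icc (c - δ') (d + δ') : Set ℂ), 𝔐)) (hg : ∀ z, g z = G z) :
    g ∈ closure (entireUnitsOn (Icc (-δ') δ' ×ℂ Icc (c - δ') (d + δ')) 𝔐 : Set _) := by
  obtain ⟨K, hK⟩ : ∃ K : Set ℂ, K = (Icc (-δ') δ' ×ℂ Icc (c - δ') (d + δ') : Set ℂ) := ⟨_, rfl⟩
  obtain ⟨z0, hz0⟩ : ∃ z0 : ℂ, z0 = (((c + d) / 2 : ℝ) : ℂ) * I := ⟨_, rfl⟩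
  obtain ⟨ρ, hρ, hball⟩ := exists_ball_subset_closure_entireUnitsOn (𝔐 := 𝔐)
    (Icc (-δ') δ' ×ℂ Icc (c - δ') (d + δ'))
  have KQ : ∀ z ∈ (Icc (-δ') δ' ×ℂ Icc (c - δ') (d + δ') : Set ℂ), z ∈ stripQ c d δ := by
    intro w hw
    obtain ⟨⟨_, _⟩, _, _⟩ := mem_reProdIm.1 hw
    rw [mem_stripQ]
    constructor <;> [constructor; constructor] <;> linarith
  have comb : ∀ (s : unitInterval) {z : ℂ}, z ∈ stripQ c d δ → z0 + s * (z - z0) ∈ stripQ c d δ :=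
    fun s z hz => by rw [hz0]; exact convex_combination_mem_stripQ s.2 hz
  have dcomb : ∀ s : unitInterval,
      DifferentiableOn ℂ (fun z => G (z0 + s * (z - z0))) (stripQ c d δ) := fun s =>
    hG.comp (by fun_prop) (fun z hz => comb s hz)
  let γ : C(unitInterval × (Icc (-δ') δ' ×ℂ Icc (c - δ') (d + δ') : Set ℂ), 𝔐) :=
    ⟨fun q => G (z0 + q.1 * (q.2 - z0)),
      hG.continuousOn.comp_continuous (by fun_prop) (fun q => comb q.1 (KQ q.2 q.2.2))⟩
  have hγc : Continuous γ.curry := γ.curry.continuous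
  -- Shrinking the argument towards the centre `z0` joins the constant `G z0` to `G`. The set of
  -- parameters at which approximation is possible is closed by definition; it is open because a
  -- nearby member differs by a factor close to one. Hence it is the whole interval.
  let T : Set unitInterval := {s | γ.curry s ∈ closure (entireUnitsOn
    (Icc (-δ') δ' ×ℂ Icc (c - δ') (d + δ')) 𝔐 : Set _)}
  have hTc : IsClosed T := isClosed_closure.preimage hγc
  have hmul : ∀ x y : C((Icc (-δ') δ' ×ℂ Icc (c - δ') (d + δ') : Set ℂ), 𝔐),
      x ∈ closure (entireUnitsOn (Icc (-δ') δ' ×ℂ Icc (c - δ') (d + δ')) 𝔐 : Set _) →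
      y ∈ closure (entireUnitsOn (Icc (-δ') δ' ×ℂ Icc (c - δ') (d + δ')) 𝔐 : Set _) →
      x * y ∈ closure (entireUnitsOn (Icc (-δ') δ' ×ℂ Icc (c - δ') (d + δ')) 𝔐 : Set _) :=
    fun x y hx hy => (entireUnitsOn (Icc (-δ') δ' ×ℂ Icc (c - δ') (d + δ')) 𝔐).topologicalClosure.mul_mem
      hx hy
  have hTo : IsOpen T := by
    rw [isOpen_iff_mem_nhds]
    intro s hs
    let y : C((Icc (-δ') δ' ×ℂ Icc (c - δ') (d + δ') : Set ℂ), 𝔐) :=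
      ⟨fun z => Ring.inverse (G (z0 + s * (z - z0))), by
        refine ContinuousOn.comp_continuous (differentiableOn_inverse hG uG).continuousOn
          (f := fun z : (Icc (-δ') δ' ×ℂ Icc (c - δ') (d + δ') : Set ℂ) => z0 + s * (z - z0))
          (by fun_prop) (fun z => comb s (KQ z z.2))⟩
    have e1 : ∀ t, γ.curry t * y * γ.curry s = γ.curry t := by
      intro t
      rw [mul_assoc]
      have : y * γ.curry s = 1 := by
        ext z
        exact Ring.inverse_mul_cancel _ (uG _ (comb s (KQ z z.2)))
      rw [this, mul_one]
    have e2 : γ.curry s * y = 1 := by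
      ext z
      exact Ring.mul_inverse_cancel _ (uG _ (comb s (KQ z z.2)))
    have hc : Continuous (fun t => γ.curry t * y - 1) := (hγc.mul_const y).sub continuous_const
    have : {t | ‖γ.curry t * y - 1‖ < ρ} ∈ 𝓝 s := by
      refine (isOpen_lt hc.norm continuous_const).mem_nhds ?_
      change ‖γ.curry s * y - 1‖ < ρ
      rw [e2, sub_self, norm_zero]
      exact hρ
    filter_upwards [this] with t ht
    change γ.curry t ∈ closure (entireUnitsOn (Icc (-δ') δ' ×ℂ Icc (c - δ') (d + δ')) 𝔐 : Set _)
    rw [← e1 t]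
    refine hmul _ _ (hball _ ?_ ht) hs
    -- The quotient of two members of the homotopy is holomorphic on the larger strip, so Runge's
    -- theorem applies to it.
    obtain ⟨f, hf, hfz⟩ := exists_mem_closure_entireOn hcd h0 h
      ((dcomb t).mul (differentiableOn_inverse (dcomb s) (fun z hz => uG _ (comb s hz))))
    convert hf using 1
    ext z
    rw [hfz]
    rfl
  have h0T : (0 : unitInterval) ∈ T := by
    refine subset_closure ⟨fun _ => G z0, differentiable_const _, fun _ => uG _ ?_, fun z => ?_⟩
    · rw [hz0, mem_stripQ]
      simp
      refine ⟨?_, ?_, ?_⟩ <;> linarith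
    · change G (z0 + ((0 : unitInterval) : ℝ) * (z - z0)) = G z0
      simp
  have hT : T = univ := IsClopen.eq_univ ⟨hTc, hTo⟩ ⟨0, h0T⟩
  have h1T : (1 : unitInterval) ∈ T := by rw [hT]; trivial
  have : γ.curry 1 = g := by
    ext z
    rw [hg]
    change G (z0 + ((1 : unitInterval) : ℝ) * (z - z0)) = G z
    simp
  rw [← this]
  exact h1T

/-- The approximant must be invertible, because it is the quotient `G P⁻¹` that has to be close to
one for `exists_small_factorization`. Continuity of inversion turns additive approximation into this
form. -/
lemma exists_entire_approximation {c d δ δ' ε : ℝ} (hcd : c ≤ d) (h0 : 0 < δ') (h : δ' < δ)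
    (hε : 0 < ε) {G : ℂ → 𝔐} (hG : DifferentiableOn ℂ G (stripQ c d δ))
    (uG : ∀ z ∈ stripQ c d δ, IsUnit (G z)) :
    ∃ P : ℂ → 𝔐, Differentiable ℂ P ∧ (∀ z, IsUnit (P z)) ∧
      ∀ z ∈ stripQ c d δ', ‖G z * Ring.inverse (P z) - 1‖ ≤ ε := by
  have : CompactSpace (Icc (-δ') δ' ×ℂ Icc (c - δ') (d + δ') : Set ℂ) :=
    isCompact_iff_compactSpace.1 (isCompact_Icc.reProdIm isCompact_Icc)
  have KQ : ∀ z ∈ (Icc (-δ') δ' ×ℂ Icc (c - δ') (d + δ') : Set ℂ), z ∈ stripQ c d δ := by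
    intro w hw
    obtain ⟨⟨_, _⟩, _, _⟩ := mem_reProdIm.1 hw
    rw [mem_stripQ]
    constructor <;> [constructor; constructor] <;> linarith
  let g : C((Icc (-δ') δ' ×ℂ Icc (c - δ') (d + δ') : Set ℂ), 𝔐) :=
    ⟨fun z => G z, hG.continuousOn.comp_continuous (by fun_prop) (fun z => KQ z z.2)⟩
  let y : C((Icc (-δ') δ' ×ℂ Icc (c - δ') (d + δ') : Set ℂ), 𝔐) :=
    ⟨fun z => Ring.inverse (G z),
      (differentiableOn_inverse hG uG).continuousOn.comp_continuous
        (f := fun z : (Icc (-δ') δ' ×ℂ Icc (c - δ') (d + δ') : Set ℂ) => (z : ℂ))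
        (by fun_prop) (fun z => KQ z z.2)⟩
  have hg := mem_closure_entireUnitsOn hcd h0 h hG uG g (fun _ => rfl)
  have e1 : g * y = 1 := by ext z; exact Ring.mul_inverse_cancel _ (uG _ (KQ z z.2))
  have e2 : y * g = 1 := by ext z; exact Ring.inverse_mul_cancel _ (uG _ (KQ z z.2))
  let u : (C((Icc (-δ') δ' ×ℂ Icc (c - δ') (d + δ') : Set ℂ), 𝔐))ˣ := ⟨g, y, e1, e2⟩
  have hcont : ContinuousAt (fun x => ‖g * Ring.inverse x - 1‖) g := by
    have := NormedRing.inverse_continuousAt u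
    exact ((continuousAt_const.mul this).sub continuousAt_const).norm
  have hunits : {x : C((Icc (-δ') δ' ×ℂ Icc (c - δ') (d + δ') : Set ℂ), 𝔐) |
      ‖g * Ring.inverse x - 1‖ < ε ∧ IsUnit x} ∈ 𝓝 g := by
    refine Filter.inter_mem (hcont.eventually_lt continuousAt_const ?_) (Units.nhds u)
    have : Ring.inverse g = y := Ring.inverse_unit u
    rw [this, e1, sub_self, norm_zero]
    exact hε
  obtain ⟨x, ⟨hx1, hx2⟩, P, hP, uP, hxP⟩ := mem_closure_iff_nhds.1 hg _ hunits
  refine ⟨P, hP, uP, fun z hz => ?_⟩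
  have hzK : z ∈ (Icc (-δ') δ' ×ℂ Icc (c - δ') (d + δ') : Set ℂ) :=
    ⟨⟨hz.1.1.le, hz.1.2.le⟩, hz.2.1.le, hz.2.2.le⟩
  have e3 : P z * (Ring.inverse x) ⟨z, hzK⟩ = 1 := by
    have := congrArg (fun f : C(_, 𝔐) => f ⟨z, hzK⟩) (Ring.mul_inverse_cancel x hx2)
    rw [← hxP ⟨z, hzK⟩]
    exact this
  have e4 : (Ring.inverse x) ⟨z, hzK⟩ = Ring.inverse (P z) := by
    rw [← one_mul ((Ring.inverse x) ⟨z, hzK⟩), ← Ring.inverse_mul_cancel _ (uP z), mul_assoc, e3,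
      mul_one]
  have := (ContinuousMap.norm_coe_le_norm (g * Ring.inverse x - 1) ⟨z, hzK⟩).trans hx1.le
  rw [← e4]
  exact this

/-- **Cartan's lemma**: a holomorphic function with values in the units, near a segment, is the
product of one that is holomorphic to the left and one that is holomorphic to the right. -/
theorem exists_factorization [NormOneClass 𝔐] {c d δ : ℝ} (hcd : c ≤ d) (h0 : 0 < δ) (h1 : δ ≤ 1)
    {G : ℂ → 𝔐} (hG : DifferentiableOn ℂ G (stripQ c d δ))
    (uG : ∀ z ∈ stripQ c d δ, IsUnit (G z)) :
    ∃ A B : ℂ → 𝔐, DifferentiableOn ℂ A (stripL c d (δ / 4)) ∧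
      DifferentiableOn ℂ B (stripR c d (δ / 4)) ∧
      (∀ z ∈ stripL c d (δ / 4), IsUnit (A z)) ∧ (∀ z ∈ stripR c d (δ / 4), IsUnit (B z)) ∧
      ∀ z ∈ stripQ c d (δ / 4), G z = A z * B z := by
  obtain ⟨ε, hε, hsmall⟩ := exists_small_factorization (𝔐 := 𝔐) hcd (show 0 < δ / 2 by linarith)
    (by linarith)
  obtain ⟨P, dP, uP, hP⟩ := exists_entire_approximation hcd (show 0 < δ / 2 by linarith)
    (show δ / 2 < δ by linarith) hε hG uG
  -- The quotient `G P⁻¹` splits as `A B`; the entire factor `P` is then absorbed on the right.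
  obtain ⟨A, B, dA, dB, uA, uB, hAB⟩ := hsmall (fun z => G z * Ring.inverse (P z) - 1)
    (((hG.mono (stripQ_mono (by linarith))).mul (differentiableOn_inverse dP.differentiableOn
      (fun z _ => uP z))).sub (differentiableOn_const _)) hP
  have e : δ / 2 / 2 = δ / 4 := by ring
  rw [e] at dA dB uA uB hAB
  refine ⟨A, fun z => B z * P z, dA, dB.mul dP.differentiableOn, uA,
    fun z hz => (uB z hz).mul (uP z), fun z hz => ?_⟩
  have := hAB z hz
  rw [add_sub_cancel] at this
  rw [← mul_assoc, ← this, mul_assoc, Ring.inverse_mul_cancel _ (uP z), mul_one]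

end Cartan

end LoopFlag
end

noncomputable section
namespace LoopFlag

/-! ### Holomorphic functions on open subsets of the sphere -/

section Hol

open Filter

lemma ext_of_mem {U : Opens P1} (f : U → ℂ) {x : P1} (h : x ∈ U) : ext f x = f ⟨x, h⟩ := by
  simp [ext, h]

lemma Hol.ext' {U : Opens P1} {f g : Hol U} (h : ∀ x (hx : x ∈ U), f.1 ⟨x, hx⟩ = g.1 ⟨x, hx⟩) :
    f = g := Subtype.ext (funext fun x => h x x.2)

@[simp] lemma Hol.res_val {U V : Opens P1} (h : U ≤ V) (f : Hol V) (x : U) :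
    (Hol.res h f).1 x = f.1 ⟨x, h x.2⟩ := rfl

@[simp] lemma Hol.res_res {U V W : Opens P1} (h : U ≤ V) (h' : V ≤ W) (f : Hol W) :
    Hol.res h (Hol.res h' f) = Hol.res (h.trans h') f := rfl

@[simp] lemma Hol.res_self {U : Opens P1} (f : Hol U) : Hol.res le_rfl f = f := rfl

@[simp] lemma Hol.mul_val {U : Opens P1} (f g : Hol U) (x : U) : (f * g).1 x = f.1 x * g.1 x := rfl
@[simp] lemma Hol.add_val {U : Opens P1} (f g : Hol U) (x : U) : (f + g).1 x = f.1 x + g.1 x := rfl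
@[simp] lemma Hol.sub_val {U : Opens P1} (f g : Hol U) (x : U) : (f - g).1 x = f.1 x - g.1 x := rfl
@[simp] lemma Hol.zero_val {U : Opens P1} (x : U) : (0 : Hol U).1 x = 0 := rfl
@[simp] lemma Hol.pow_val {U : Opens P1} (f : Hol U) (k : ℕ) (x : U) : (f ^ k).1 x = f.1 x ^ k := rfl
@[simp] lemma Hol.algebraMap_val {U : Opens P1} (c : ℂ) (x : U) : (algebraMap ℂ (Hol U) c).1 x = c := rfl

/-- Evaluation at a point, as a ring homomorphism. -/
def Hol.eval {U : Opens P1} {x : P1} (hx : x ∈ U) : Hol U →+* ℂ where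
  toFun f := f.1 ⟨x, hx⟩
  map_one' := rfl
  map_mul' _ _ := rfl
  map_zero' := rfl
  map_add' _ _ := rfl

lemma Hol.sum_val {U : Opens P1} {ι : Type*} (s : Finset ι) (f : ι → Hol U) (x : U) :
    (∑ i ∈ s, f i).1 x = ∑ i ∈ s, (f i).1 x :=
  map_sum (Hol.eval x.2) f s

lemma Hol.det_val {U : Opens P1} {n : ℕ} (M : Matrix (Fin n) (Fin n) (Hol U)) (x : U) :
    M.det.1 x = (M.map (Hol.eval x.2)).det := by
  have := (Hol.eval x.2).map_det M
  exact this

lemma isHolo_of_local {U : Opens P1} {f : U → ℂ}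
    (h : ∀ x ∈ U, ∃ (V : Opens P1) (hV : V ≤ U), x ∈ V ∧ IsHolo (fun y : V => f ⟨y, hV y.2⟩)) :
    IsHolo f := by
  refine ⟨fun z hz => ?_, fun hi => ?_⟩
  · obtain ⟨V, hV, hx, hf⟩ := h z hz
    refine (hf.1 z hx).congr ?_
    filter_upwards [eventually_coe hx] with w hw
    rw [ext_of_mem _ hw, ext_of_mem _ (hV hw)]
  · obtain ⟨V, hV, hx, hf⟩ := h _ hi
    refine (hf.2 hx).congr ?_
    filter_upwards [eventually_chartInf hx] with w hw
    rw [ext_of_mem _ hw, ext_of_mem _ (hV hw)]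

/-- Gluing of holomorphic functions. -/
lemma Hol.exists_glue {U : Opens P1} {ι : Type*} (V : ι → Opens P1)
    (hc : ∀ x ∈ U, ∃ i, x ∈ V i) (hV : ∀ i, V i ≤ U) (f : ∀ i, Hol (V i))
    (hf : ∀ i j x (hi : x ∈ V i) (hj : x ∈ V j), (f i).1 ⟨x, hi⟩ = (f j).1 ⟨x, hj⟩) :
    ∃ g : Hol U, ∀ i, Hol.res (hV i) g = f i := by
  choose i hi using hc
  have key : ∀ j (y : V j), (f (i y (hV j y.2))).1 ⟨y, hi _ _⟩ = (f j).1 y := fun j y => hf _ _ _ _ _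
  refine ⟨⟨fun x => (f (i x x.2)).1 ⟨x, hi x x.2⟩, isHolo_of_local fun x hx => ?_⟩, fun j => ?_⟩
  · refine ⟨V (i x hx), hV _, hi x hx, ?_⟩
    have : (fun y : V (i x hx) => (f (i y (hV _ y.2))).1 ⟨y, hi _ _⟩) = (f (i x hx)).1 :=
      funext fun y => key _ y
    rw [this]
    exact (f (i x hx)).2
  · exact Subtype.ext (funext fun y => key j y)

/-- Inversion takes the complement of a large compact set into a small neighbourhood of the origin,
so the chart `1 / z` detects neighbourhoods of `∞`. -/
lemma eventually_infty_of_chartInf {p : P1 → Prop} (h : ∀ᶠ w : ℂ in 𝓝 0, p (chartInf w)) :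
    ∀ᶠ x in 𝓝 (OnePoint.infty : P1), p x := by
  rw [OnePoint.nhds_infty_eq, eventually_sup, eventually_pure, eventually_map]
  refine ⟨?_, ?_⟩
  · have h1 : Tendsto (fun z : ℂ => z⁻¹) (coclosedCompact ℂ) (𝓝 0) := by
      rw [coclosedCompact_eq_cocompact, ← Metric.cobounded_eq_cocompact]
      exact tendsto_inv₀_cobounded
    have h2 : ∀ᶠ z : ℂ in coclosedCompact ℂ, z ≠ 0 := by
      rw [coclosedCompact_eq_cocompact]
      exact (isCompact_singleton (x := (0 : ℂ))).compl_mem_cocompact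
    filter_upwards [h1.eventually h, h2] with z hz hz0
    simpa [chartInf, hz0] using hz
  · simpa [chartInf] using h.self_of_nhds

lemma eventually_coe_of {p : P1 → Prop} {z : ℂ} (h : ∀ᶠ w : ℂ in 𝓝 z, p w) :
    ∀ᶠ x in 𝓝 (z : P1), p x := by
  rw [OnePoint.nhds_coe_eq, eventually_map]
  exact h

lemma chartInf_zero : chartInf 0 = OnePoint.infty := by simp [chartInf]

lemma eventually_ne_zero {U : Opens P1} (f : Hol U) {x : P1} (hx : x ∈ U) (h : f.1 ⟨x, hx⟩ ≠ 0) :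
    ∀ᶠ y in 𝓝 x, ext f.1 y ≠ 0 := by
  induction x using OnePoint.rec with
  | infty =>
    refine eventually_infty_of_chartInf (p := fun y => ext f.1 y ≠ 0) ?_
    refine (f.2.2 hx).continuousAt.eventually_ne ?_
    rw [chartInf_zero, ext_of_mem _ hx]
    exact h
  | coe z =>
    refine eventually_coe_of (p := fun y => ext f.1 y ≠ 0) ?_
    refine (f.2.1 z hx).continuousAt.eventually_ne ?_
    rw [ext_of_mem _ hx]
    exact h

/-- A neighbourhood on which a function which does not vanish at `x` has no zeros. -/
lemma Hol.exists_open_ne_zero {U : Opens P1} (f : Hol U) {x : P1} (hx : x ∈ U)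
    (h : f.1 ⟨x, hx⟩ ≠ 0) :
    ∃ (V : Opens P1) (hV : V ≤ U), x ∈ V ∧ ∀ y (hy : y ∈ V), f.1 ⟨y, hV hy⟩ ≠ 0 := by
  obtain ⟨t, ht, hto, hxt⟩ := eventually_nhds_iff.1 (eventually_ne_zero f hx h)
  refine ⟨⟨t, hto⟩ ⊓ U, inf_le_right, ⟨hxt, hx⟩, fun y hy => ?_⟩
  have := ht y hy.1
  rwa [ext_of_mem _ hy.2] at this

lemma Hol.isUnit_of_ne_zero {U : Opens P1} (f : Hol U) (h : ∀ x, f.1 x ≠ 0) : IsUnit f := by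
  refine IsUnit.of_mul_eq_one ⟨fun x => (f.1 x)⁻¹, fun z hz => ?_, fun hi => ?_⟩ ?_
  · refine ((f.2.1 z hz).inv ?_).congr ?_
    · rw [ext_of_mem _ hz]; exact h _
    · filter_upwards [eventually_coe hz] with w hw
      rw [ext_of_mem _ hw, Pi.inv_apply, ext_of_mem _ hw]
  · refine ((f.2.2 hi).inv ?_).congr ?_
    · rw [chartInf_zero, ext_of_mem _ hi]; exact h _
    · filter_upwards [eventually_chartInf hi] with w hw
      rw [ext_of_mem _ hw, Pi.inv_apply, ext_of_mem _ hw]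
  · exact Hol.ext' fun x hx => mul_inv_cancel₀ (h ⟨x, hx⟩)

lemma Hol.ne_zero_of_isUnit {U : Opens P1} {f : Hol U} (h : IsUnit f) (x : U) : f.1 x ≠ 0 :=
  (h.map (Hol.eval x.2)).ne_zero

/-- The function on an open subset of `ℂ` given by an analytic function. -/
def Hol.ofAnalytic (U : Opens P1) (hU : OnePoint.infty ∉ U) (F : ℂ → ℂ)
    (hF : ∀ z : ℂ, (z : P1) ∈ U → AnalyticAt ℂ F z) : Hol U :=
  ⟨fun x => (x : P1).elim 0 F, fun z hz => (hF z hz).congr (by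
    filter_upwards [eventually_coe hz] with w hw
    rw [ext_of_mem _ hw]
    rfl), fun hi => absurd hi hU⟩

lemma Hol.ofAnalytic_coe {U : Opens P1} {hU : OnePoint.infty ∉ U} {F : ℂ → ℂ}
    {hF : ∀ z : ℂ, (z : P1) ∈ U → AnalyticAt ℂ F z} {z : ℂ} (hz : (z : P1) ∈ U) :
    (Hol.ofAnalytic U hU F hF).1 ⟨z, hz⟩ = F z := rfl

lemma coord_coe {U : Opens P1} {hU : OnePoint.infty ∉ U} {z : ℂ} (hz : (z : P1) ∈ U) :
    (coord U hU).1 ⟨z, hz⟩ = z := rfl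

lemma exists_coe_eq {U : Opens P1} (hU : OnePoint.infty ∉ U) {x : P1} (hx : x ∈ U) :
    ∃ z : ℂ, (z : P1) = x := by
  induction x using OnePoint.rec with
  | infty => exact absurd hx hU
  | coe z => exact ⟨z, rfl⟩

lemma Hol.ext_coe {U : Opens P1} (hU : OnePoint.infty ∉ U) {f g : Hol U}
    (h : ∀ (z : ℂ) (hz : (z : P1) ∈ U), f.1 ⟨z, hz⟩ = g.1 ⟨z, hz⟩) : f = g := by
  refine Hol.ext' fun x hx => ?_
  obtain ⟨z, rfl⟩ := exists_coe_eq hU hx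
  exact h z hx

lemma coord_zero {U : Opens P1} {hU : OnePoint.infty ∉ U} (h0 : zero ∈ U) :
    (coord U hU).1 ⟨zero, h0⟩ = 0 := rfl

lemma coord_ne_zero {U : Opens P1} {hU : OnePoint.infty ∉ U} {x : P1} (hx : x ∈ U) (h0 : x ≠ zero) :
    (coord U hU).1 ⟨x, hx⟩ ≠ 0 := by
  obtain ⟨z, rfl⟩ := exists_coe_eq hU hx
  rw [coord_coe]
  rintro rfl
  exact h0 rfl

lemma isUnit_coord {U : Opens P1} {hU : OnePoint.infty ∉ U} (h0 : zero ∉ U) :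
    IsUnit (coord U hU) :=
  Hol.isUnit_of_ne_zero _ fun x => coord_ne_zero x.2 fun h => h0 (h ▸ x.2)

@[simp] lemma res_coord {U V : Opens P1} (h : U ≤ V) (hV : OnePoint.infty ∉ V) :
    Hol.res h (coord V hV) = coord U (fun hi => hV (h hi)) := rfl

/-- A function vanishing at the origin is divisible by the coordinate. -/
lemma Hol.exists_eq_coord_mul {U : Opens P1} (hU : OnePoint.infty ∉ U) (f : Hol U)
    (h : ∀ h0 : zero ∈ U, f.1 ⟨zero, h0⟩ = 0) : ∃ g : Hol U, f = coord U hU * g := by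
  by_cases h0 : zero ∈ U
  swap
  · obtain ⟨u, hu⟩ := isUnit_coord (hU := hU) h0
    exact ⟨↑u⁻¹ * f, by rw [← hu, Units.mul_inv_cancel_left]⟩
  let F : ℂ → ℂ := fun w => ext f.1 w
  have hF0 : F 0 = 0 := (ext_of_mem f.1 h0).trans (h h0)
  refine ⟨Hol.ofAnalytic U hU (dslope F 0) fun z hz => ?_, Hol.ext_coe hU fun z hz => ?_⟩
  · have hopen : IsOpen {w : ℂ | (w : P1) ∈ U} := U.isOpen.preimage OnePoint.continuous_coe
    have hd : DifferentiableOn ℂ F {w : ℂ | (w : P1) ∈ U} := fun w hw =>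
      (f.2.1 w hw).differentiableAt.differentiableWithinAt
    exact ((Complex.differentiableOn_dslope (hopen.mem_nhds h0)).2 hd).analyticAt (hopen.mem_nhds hz)
  · rw [Hol.mul_val, Hol.ofAnalytic_coe, coord_coe]
    have := sub_smul_dslope F 0 z
    rw [hF0, sub_zero, sub_zero, smul_eq_mul] at this
    rw [this]
    exact (ext_of_mem f.1 hz).symm

/-- Products of holomorphic functions: a function which vanishes identically on no non-empty open
set is not a zero divisor. -/
lemma Hol.eq_zero_of_mul_eq_zero {U : Opens P1} {f c : Hol U}
    (hf : ∀ (V : Opens P1) (h : V ≤ U), V ≠ ⊥ → Hol.res h f ≠ 0) (h : f * c = 0) : c = 0 := by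
  refine Hol.ext' fun x hx => ?_
  by_contra hc
  obtain ⟨V, hV, hxV, hne⟩ := Hol.exists_open_ne_zero c hx hc
  refine hf V hV (fun h0 => by rw [h0] at hxV; exact hxV) (Hol.ext' fun y hy => ?_)
  have : (f * c).1 ⟨y, hV hy⟩ = 0 := by rw [h]; rfl
  rw [Hol.mul_val] at this
  exact (mul_eq_zero.1 this).resolve_right (hne y hy)

/-- A non-empty open subset of `ℂ` has a point other than the origin. This is the condition under
which powers of the coordinate can be cancelled in a torsion free sheaf. -/
lemma res_coord_pow_ne_zero {U : Opens P1} (hU : OnePoint.infty ∉ U) (k : ℕ) (V : Opens P1)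
    (h : V ≤ U) (hV : V ≠ ⊥) : Hol.res h (coord U hU ^ k) ≠ 0 := by
  intro h0
  obtain ⟨x, hx⟩ := (Opens.ne_bot_iff_nonempty V).1 hV
  obtain ⟨z, rfl⟩ := exists_coe_eq hU (h hx)
  have ev : ∀ᶠ w : ℂ in 𝓝[≠] z, w ≠ 0 ∧ (w : P1) ∈ V := by
    refine Filter.Eventually.and ?_ (eventually_nhdsWithin_of_eventually_nhds (eventually_coe hx))
    by_cases hz : z = 0
    · subst hz; exact self_mem_nhdsWithin
    · exact eventually_nhdsWithin_of_eventually_nhds (isOpen_ne.mem_nhds hz)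
  obtain ⟨w, hw0, hw⟩ := ev.exists
  have : (Hol.res h (coord U hU ^ k)).1 ⟨w, hw⟩ = 0 := by rw [h0]; rfl
  rw [Hol.res_val, Hol.pow_val, coord_coe] at this
  exact pow_ne_zero k hw0 this

end Hol

end LoopFlag
end

noncomputable section
namespace LoopFlag

/-! ### Gluing sections and morphisms -/

section Gluing

namespace OMod

variable {E : OMod}

lemma res_sum {U V : Opens P1} (h : U ≤ V) {ι : Type*} (s : Finset ι) (f : ι → E.sec V) :
    E.res h (∑ i ∈ s, f i) = ∑ i ∈ s, E.res h (f i) := map_sum _ _ _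

lemma exists_glue {W : Opens P1} {ι : Type} (U : ι → Opens P1) (hU : ∀ i, U i ≤ W)
    (hc : ∀ x ∈ W, ∃ i, x ∈ U i) (s : ∀ i, E.sec (U i))
    (hs : ∀ i j, E.res (inf_le_left : U i ⊓ U j ≤ U i) (s i) = E.res inf_le_right (s j)) :
    ∃! t : E.sec W, ∀ i, E.res (hU i) t = s i := by
  obtain rfl : W = ⨆ i, U i := le_antisymm
    (fun x hx => Opens.mem_iSup.2 (hc x hx)) (iSup_le hU)
  exact E.glue U s hs

/-- Separatedness is the uniqueness half of the gluing axiom: both sections glue the restrictions of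
`s` to the open sets on which they agree. -/
lemma ext_of_local {W : Opens P1} {s t : E.sec W}
    (h : ∀ x ∈ W, ∃ (V : Opens P1) (hV : V ≤ W), x ∈ V ∧ E.res hV s = E.res hV t) : s = t := by
  let ι : Type := {V : Opens P1 // ∃ hV : V ≤ W, E.res hV s = E.res hV t}
  obtain ⟨u, _, hu⟩ := exists_glue (E := E) (fun i : ι => i.1) (fun i => i.2.1)
    (fun x hx => by
      obtain ⟨V, hV, hxV, e⟩ := h x hx
      exact ⟨⟨V, hV, e⟩, hxV⟩) (fun i => E.res i.2.1 s) (fun i j => by rw [E.res_res, E.res_res])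
  rw [hu s (fun _ => rfl), hu t (fun i => i.2.2.symm)]

lemma ext_of_cover₂ {W W₁ W₂ : Opens P1} (h₁ : W₁ ≤ W) (h₂ : W₂ ≤ W) (hc : W ≤ W₁ ⊔ W₂)
    {s t : E.sec W} (e₁ : E.res h₁ s = E.res h₁ t) (e₂ : E.res h₂ s = E.res h₂ t) : s = t :=
  ext_of_local fun x hx => (hc hx).elim (fun h => ⟨W₁, h₁, h, e₁⟩) (fun h => ⟨W₂, h₂, h, e₂⟩)

lemma exists_glue₂ {W W₁ W₂ : Opens P1} (h₁ : W₁ ≤ W) (h₂ : W₂ ≤ W) (hc : W ≤ W₁ ⊔ W₂)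
    (s₁ : E.sec W₁) (s₂ : E.sec W₂)
    (hs : E.res (inf_le_left : W₁ ⊓ W₂ ≤ W₁) s₁ = E.res inf_le_right s₂) :
    ∃ t : E.sec W, E.res h₁ t = s₁ ∧ E.res h₂ t = s₂ := by
  obtain ⟨t, ht, _⟩ := exists_glue (E := E) (W := W) (fun b : Bool => if b then W₁ else W₂)
    (fun b => by cases b <;> assumption)
    (fun x hx => (hc hx).elim (fun h => ⟨true, h⟩) (fun h => ⟨false, h⟩))
    (fun b => match b with
      | true => s₁
      | false => s₂)
    (by
      rintro (_ | _) (_ | _)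
      · rfl
      · have := congrArg (E.res (show W₂ ⊓ W₁ ≤ W₁ ⊓ W₂ from le_of_eq (inf_comm _ _))) hs
        rw [E.res_res, E.res_res] at this
        exact this.symm
      · exact hs
      · rfl)
  exact ⟨t, ht true, ht false⟩

end OMod

/-- A section which locally has a preimage under a monomorphism has one. -/
lemma Hom.exists_preimage_of_local {E F : OMod} (f : Hom E F)
    (hf : ∀ U, Function.Injective (f.map U)) {W : Opens P1} (s : F.sec W)
    (h : ∀ x ∈ W, ∃ (V : Opens P1) (hV : V ≤ W), x ∈ V ∧ ∃ r, f.map V r = F.res hV s) :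
    ∃ r, f.map W r = s := by
  let ι : Type := {V : Opens P1 // ∃ hV : V ≤ W, ∃ r, f.map V r = F.res hV s}
  have hι : ∀ i : ι, ∃ r, f.map i.1 r = F.res i.2.1 s := fun i => i.2.2
  choose r hr using hι
  obtain ⟨u, hu, _⟩ := OMod.exists_glue (E := E) (fun i : ι => i.1) (fun i => i.2.1)
    (fun x hx => by
      obtain ⟨V, hV, hxV, e⟩ := h x hx
      exact ⟨⟨V, hV, e⟩, hxV⟩) r (fun i j => hf _ (by
        rw [f.naturality, f.naturality, hr, hr, F.res_res, F.res_res]))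
  refine ⟨u, OMod.ext_of_local fun x hx => ?_⟩
  obtain ⟨V, hV, hxV, e⟩ := h x hx
  refine ⟨V, hV, hxV, ?_⟩
  rw [← f.naturality, hu ⟨V, hV, e⟩]
  exact hr ⟨V, hV, e⟩

/-- A morphism is an isomorphism if it is so locally. -/
lemma Hom.isIso_of_local {E F : OMod} (f : Hom E F)
    (h : ∀ x, ∃ W : Opens P1, x ∈ W ∧ ∀ V ≤ W, Function.Bijective (f.map V)) : f.IsIso := by
  have inj : ∀ U, Function.Injective (f.map U) := by
    intro U s t hst
    refine OMod.ext_of_local fun x hx => ?_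
    obtain ⟨W, hxW, hW⟩ := h x
    refine ⟨U ⊓ W, inf_le_left, ⟨hx, hxW⟩, (hW _ inf_le_right).1 ?_⟩
    rw [f.naturality, f.naturality, hst]
  refine fun U => ⟨inj U, fun s => f.exists_preimage_of_local inj s fun x hx => ?_⟩
  obtain ⟨W, hxW, hW⟩ := h x
  exact ⟨U ⊓ W, inf_le_left, ⟨hx, hxW⟩, (hW _ inf_le_right).2 _⟩

end Gluing

/-! ### Frames -/

section Frames

variable {n : ℕ} {E F : OMod}

/-- The coordinates of a section with respect to a frame. -/
def IsFrame.coords {W : Opens P1} {e : Fin n → E.sec W} (he : IsFrame E e) {V : Opens P1}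
    (h : V ≤ W) (s : E.sec V) : Fin n → Hol V :=
  (Equiv.ofBijective _ (he V h)).symm s

namespace IsFrame

variable {W : Opens P1} {e : Fin n → E.sec W} (he : IsFrame E e) {V : Opens P1} (h : V ≤ W)

lemma sum_coords (s : E.sec V) : ∑ a, he.coords h s a • E.res h (e a) = s :=
  (Equiv.ofBijective _ (he V h)).apply_symm_apply s

lemma coords_eq {s : E.sec V} {c : Fin n → Hol V} (hs : s = ∑ a, c a • E.res h (e a)) :
    he.coords h s = c := by
  rw [hs]
  exact (Equiv.ofBijective _ (he V h)).symm_apply_apply c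

lemma coords_sum (c : Fin n → Hol V) : he.coords h (∑ a, c a • E.res h (e a)) = c :=
  he.coords_eq h rfl

lemma coords_injective : Function.Injective (he.coords h) :=
  (Equiv.ofBijective _ (he V h)).symm.injective

lemma coords_add (s t : E.sec V) : he.coords h (s + t) = he.coords h s + he.coords h t := by
  refine he.coords_eq h ?_
  conv_lhs => rw [← he.sum_coords h s, ← he.sum_coords h t]
  simp only [Pi.add_apply, add_smul, Finset.sum_add_distrib]

lemma coords_smul (f : Hol V) (s : E.sec V) : he.coords h (f • s) = f • he.coords h s := by
  refine he.coords_eq h ?_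
  conv_lhs => rw [← he.sum_coords h s]
  simp only [Pi.smul_apply, smul_eq_mul, Finset.smul_sum, mul_smul]

lemma coords_zero : he.coords h 0 = 0 := he.coords_eq h (by simp)

lemma coords_res {V' : Opens P1} (h' : V' ≤ V) (s : E.sec V) (a : Fin n) :
    he.coords (h'.trans h) (E.res h' s) a = Hol.res h' (he.coords h s a) := by
  refine congrFun (he.coords_eq (h'.trans h) (c := fun a => Hol.res h' (he.coords h s a)) ?_) a
  conv_lhs => rw [← he.sum_coords h s]
  simp only [OMod.res_sum, E.res_smul, E.res_res]

lemma coords_frame (a b : Fin n) : he.coords h (E.res h (e a)) b = if b = a then 1 else 0 := by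
  refine congrFun (he.coords_eq h (c := fun b => if b = a then 1 else 0) ?_) b
  simp [ite_smul]

end IsFrame

lemma IsFrame.res_frame {W : Opens P1} {e : Fin n → E.sec W} (he : IsFrame E e) {V : Opens P1}
    (h : V ≤ W) : IsFrame E (fun a => E.res h (e a)) := by
  intro V' h'
  have := he V' (h'.trans h)
  simpa only [E.res_res] using this

/-- Local coordinates are unique, so they agree on overlaps and glue to coordinates over the whole
set. -/
lemma isFrame_of_local {W : Opens P1} {e : Fin n → E.sec W}
    (h : ∀ x ∈ W, ∃ (V : Opens P1) (hV : V ≤ W), x ∈ V ∧ IsFrame E (fun a => E.res hV (e a))) :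
    IsFrame E e := by
  intro U hU
  have loc : ∀ x ∈ U, ∃ (V : Opens P1) (_ : V ≤ W), x ∈ U ⊓ V ∧
      ∀ (V' : Opens P1) (h1 : V' ≤ W), V' ≤ V →
        Function.Bijective (fun c : Fin n → Hol V' => ∑ a, c a • E.res h1 (e a)) := by
    intro x hx
    obtain ⟨V, hV, hxV, hf⟩ := h x (hU hx)
    refine ⟨V, hV, ⟨hx, hxV⟩, fun V' h1 h2 => ?_⟩
    have := hf V' h2
    simpa only [E.res_res] using this
  constructor
  · intro c c' hcc
    funext a
    refine Hol.ext' fun x hx => ?_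
    obtain ⟨V, hV, hxV, hf⟩ := loc x hx
    have := (hf (U ⊓ V) (inf_le_left.trans hU) inf_le_right).1
      (a₁ := fun a => Hol.res inf_le_left (c a)) (a₂ := fun a => Hol.res inf_le_left (c' a)) (by
        have := congrArg (E.res (inf_le_left : U ⊓ V ≤ U)) hcc
        simpa only [OMod.res_sum, E.res_smul, E.res_res] using this)
    have := congrArg (fun f : Hol (U ⊓ V) => f.1 ⟨x, hxV⟩) (congrFun this a)
    exact this
  · intro s
    choose V hV hxV hf using loc
    have hsol : ∀ x : U, ∃ c : Fin n → Hol (U ⊓ V x x.2),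
        ∑ a, c a • E.res (inf_le_left.trans hU) (e a) = E.res inf_le_left s := fun x =>
      (hf x x.2 _ (inf_le_left.trans hU) inf_le_right).2 _
    choose c hc using hsol
    have hglue : ∀ a, ∃ g : Hol U, ∀ x : U, Hol.res inf_le_left g = c x a := by
      intro a
      refine Hol.exists_glue (fun x : U => U ⊓ V x x.2) (fun x hx => ⟨⟨x, hx⟩, hxV x hx⟩)
        (fun _ => inf_le_left) (fun x => c x a) ?_
      intro x x' y hy hy'
      have h1 : U ⊓ V x x.2 ⊓ V x' x'.2 ≤ U ⊓ V x x.2 := inf_le_left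
      have h2 : U ⊓ V x x.2 ⊓ V x' x'.2 ≤ U ⊓ V x' x'.2 :=
        le_inf (inf_le_left.trans inf_le_left) inf_le_right
      have := (hf x x.2 (U ⊓ V x x.2 ⊓ V x' x'.2) (h1.trans (inf_le_left.trans hU))
        (h1.trans inf_le_right)).1
        (a₁ := fun a => Hol.res h1 (c x a)) (a₂ := fun a => Hol.res h2 (c x' a)) (by
          have e1 := congrArg (E.res h1) (hc x)
          have e2 := congrArg (E.res h2) (hc x')
          simp only [OMod.res_sum, E.res_smul, E.res_res] at e1 e2
          simp only [e1, e2])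
      have := congrArg (fun f : Hol (U ⊓ V x x.2 ⊓ V x' x'.2) => f.1 ⟨y, hy, hy'.2⟩) (congrFun this a)
      exact this
    choose g hg using hglue
    refine ⟨g, OMod.ext_of_local fun x hx => ⟨U ⊓ V x hx, inf_le_left, hxV x hx, ?_⟩⟩
    have := hc ⟨x, hx⟩
    simp only [OMod.res_sum, E.res_smul, E.res_res, hg _ ⟨x, hx⟩]
    exact this

lemma IsFrame.of_matrix {W : Opens P1} {e : Fin n → E.sec W} (he : IsFrame E e)
    {M : Matrix (Fin n) (Fin n) (Hol W)} (hM : IsUnit M.det) {e' : Fin n → E.sec W}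
    (h : ∀ b, e' b = ∑ a, M a b • e a) : IsFrame E e' := by
  intro V hV
  let N : Matrix (Fin n) (Fin n) (Hol V) := M.map (Hol.res hV)
  have hN : IsUnit N.det := by
    have : N.det = Hol.res hV M.det := ((Hol.res hV).map_det M).symm
    rw [this]
    exact hM.map _
  have hbij : Function.Bijective (fun c : Fin n → Hol V => N.mulVec c) := by
    have hNu : IsUnit N := (Matrix.isUnit_iff_isUnit_det N).2 hN
    exact ⟨Matrix.mulVec_injective_of_isUnit hNu, Matrix.mulVec_surjective_iff_isUnit.2 hNu⟩
  have : (fun c : Fin n → Hol V => ∑ a, c a • E.res hV (e' a)) =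
      (fun c : Fin n → Hol V => ∑ a, c a • E.res hV (e a)) ∘ (fun c => N.mulVec c) := by
    funext c
    simp only [Function.comp, Matrix.mulVec, dotProduct, h, OMod.res_sum, E.res_smul,
      Finset.smul_sum, Finset.sum_smul, smul_smul]
    rw [Finset.sum_comm]
    refine Finset.sum_congr rfl fun a _ => Finset.sum_congr rfl fun b _ => ?_
    rw [mul_comm]
    rfl
  rw [this]
  exact (he V hV).comp hbij

/-- The matrix of a family of sections with respect to a frame. -/
def IsFrame.matrix {W : Opens P1} {e : Fin n → E.sec W} (he : IsFrame E e) {V : Opens P1}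
    (h : V ≤ W) (e' : Fin n → E.sec V) : Matrix (Fin n) (Fin n) (Hol V) :=
  fun a b => he.coords h (e' b) a

lemma IsFrame.eq_sum_matrix {W : Opens P1} {e : Fin n → E.sec W} (he : IsFrame E e) {V : Opens P1}
    (h : V ≤ W) (e' : Fin n → E.sec V) (b : Fin n) :
    e' b = ∑ a, he.matrix h e' a b • E.res h (e a) := (he.sum_coords h (e' b)).symm

/-- The matrices of the two changes of frame are inverse to each other. -/
lemma IsFrame.isUnit_matrix_det {W : Opens P1} {e : Fin n → E.sec W} (he : IsFrame E e)
    {V : Opens P1} (h : V ≤ W) {e' : Fin n → E.sec V} (he' : IsFrame E e') :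
    IsUnit (he.matrix h e').det := by
  have key : he.matrix h e' * he'.matrix le_rfl (fun a => E.res h (e a)) = 1 := by
    have : ∀ b, E.res h (e b) = ∑ a, (he.matrix h e' * he'.matrix le_rfl (fun a => E.res h (e a))) a b
        • E.res h (e a) := by
      intro b
      conv_lhs => rw [he'.eq_sum_matrix le_rfl (fun a => E.res h (e a)) b]
      simp only [Matrix.mul_apply, Finset.sum_smul]
      rw [Finset.sum_comm]
      refine Finset.sum_congr rfl fun c _ => ?_
      rw [E.res_self]
      conv_lhs => rw [he.eq_sum_matrix h e' c]
      rw [Finset.smul_sum]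
      refine Finset.sum_congr rfl fun a _ => ?_
      rw [smul_smul, mul_comm]
    ext1 a b
    have h1 := congrFun (he.coords_eq h (this b)) a
    rw [he.coords_frame h b a] at h1
    rw [← h1, Matrix.one_apply]
  have := congrArg Matrix.det key
  rw [Matrix.det_mul, Matrix.det_one] at this
  exact IsUnit.of_mul_eq_one _ this

lemma Hom.map_sum_frame (f : Hom E F) {W V : Opens P1} (h : V ≤ W) (e : Fin n → E.sec W)
    (c : Fin n → Hol V) :
    f.map V (∑ a, c a • E.res h (e a)) = ∑ a, c a • F.res h (f.map W (e a)) := by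
  rw [map_sum]
  refine Finset.sum_congr rfl fun a _ => ?_
  rw [map_smul, f.naturality]

lemma Hom.map_eq_sum_coords (f : Hom E F) {W V : Opens P1} (h : V ≤ W) {e : Fin n → E.sec W}
    (he : IsFrame E e) (s : E.sec V) :
    f.map V s = ∑ a, he.coords h s a • F.res h (f.map W (e a)) := by
  conv_lhs => rw [← he.sum_coords h s]
  exact f.map_sum_frame h e _

lemma Hom.bijective_of_isFrame (f : Hom E F) {W : Opens P1} {e : Fin n → E.sec W}
    (he : IsFrame E e) (hf : IsFrame F (fun a => f.map W (e a))) {V : Opens P1} (h : V ≤ W) :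
    Function.Bijective (f.map V) := by
  have : f.map V ∘ (fun c : Fin n → Hol V => ∑ a, c a • E.res h (e a)) =
      fun c : Fin n → Hol V => ∑ a, c a • F.res h (f.map W (e a)) :=
    funext fun c => f.map_sum_frame h e c
  have h2 := hf V h
  rw [← this] at h2
  exact (Function.Bijective.of_comp_iff _ (he V h)).1 h2

lemma IsFrame.map_of_isIso {W : Opens P1} {e : Fin n → E.sec W} (he : IsFrame E e) (f : Hom E F)
    (hf : f.IsIso) : IsFrame F (fun a => f.map W (e a)) := by
  intro V h
  have : (fun c : Fin n → Hol V => ∑ a, c a • F.res h (f.map W (e a))) =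
      f.map V ∘ (fun c : Fin n → Hol V => ∑ a, c a • E.res h (e a)) :=
    (funext fun c => f.map_sum_frame h e c).symm
  rw [this]
  exact (hf V).comp (he V h)

/-- A morphism is determined by its values on frames over a cover. -/
lemma Hom.map_congr_of_frames {f g : Hom E F} {W₁ W₂ : Opens P1} (hW : W₁ ⊔ W₂ = ⊤)
    {e₁ : Fin n → E.sec W₁} {e₂ : Fin n → E.sec W₂} (he₁ : IsFrame E e₁) (he₂ : IsFrame E e₂)
    (h₁ : ∀ a, f.map W₁ (e₁ a) = g.map W₁ (e₁ a)) (h₂ : ∀ a, f.map W₂ (e₂ a) = g.map W₂ (e₂ a))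
    (U : Opens P1) (s : E.sec U) : f.map U s = g.map U s := by
  refine OMod.ext_of_cover₂ (W₁ := U ⊓ W₁) (W₂ := U ⊓ W₂) inf_le_left inf_le_left ?_ ?_ ?_
  · rw [← inf_sup_left, hW, inf_top_eq]
  · rw [← f.naturality, ← g.naturality, f.map_eq_sum_coords inf_le_right he₁,
      g.map_eq_sum_coords inf_le_right he₁]
    simp only [h₁]
  · rw [← f.naturality, ← g.naturality, f.map_eq_sum_coords inf_le_right he₂,
      g.map_eq_sum_coords inf_le_right he₂]
    simp only [h₂]

/-- The morphism with prescribed values on frames over a cover. -/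
theorem Hom.exists_of_frames {W₁ W₂ : Opens P1} (hW : W₁ ⊔ W₂ = ⊤)
    {e₁ : Fin n → E.sec W₁} {e₂ : Fin n → E.sec W₂} (he₁ : IsFrame E e₁) (he₂ : IsFrame E e₂)
    (t₁ : Fin n → F.sec W₁) (t₂ : Fin n → F.sec W₂)
    (ht : ∀ b, F.res inf_le_right (t₂ b) = ∑ a,
      he₁.coords inf_le_left (E.res (inf_le_right : W₁ ⊓ W₂ ≤ W₂) (e₂ b)) a • F.res inf_le_left (t₁ a)) :
    ∃ f : Hom E F, (∀ a, f.map W₁ (e₁ a) = t₁ a) ∧ (∀ a, f.map W₂ (e₂ a) = t₂ a) := by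
  -- Over `U` the image of a section is forced on `U ⊓ W₁` and on `U ⊓ W₂` by linearity; the
  -- hypothesis `ht` makes the two values agree on the overlap.
  have ex : ∀ (U : Opens P1) (s : E.sec U), ∃! t : F.sec U,
      F.res (inf_le_left : U ⊓ W₁ ≤ U) t =
        ∑ a, he₁.coords inf_le_right (E.res inf_le_left s) a • F.res inf_le_right (t₁ a) ∧
      F.res (inf_le_left : U ⊓ W₂ ≤ U) t =
        ∑ a, he₂.coords inf_le_right (E.res inf_le_left s) a • F.res inf_le_right (t₂ a) := by
    intro U s
    have hc : U ≤ U ⊓ W₁ ⊔ U ⊓ W₂ := by rw [← inf_sup_left, hW, inf_top_eq]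
    obtain ⟨t, h1, h2⟩ := OMod.exists_glue₂ (E := F) (W := U) (W₁ := U ⊓ W₁) (W₂ := U ⊓ W₂)
      inf_le_left inf_le_left hc
      (∑ a, he₁.coords inf_le_right (E.res inf_le_left s) a • F.res inf_le_right (t₁ a))
      (∑ a, he₂.coords inf_le_right (E.res inf_le_left s) a • F.res inf_le_right (t₂ a)) (by
        simp only [OMod.res_sum, F.res_smul, F.res_res, ← IsFrame.coords_res, E.res_res]
        have hV1 : U ⊓ W₁ ⊓ (U ⊓ W₂) ≤ W₁ := inf_le_left.trans inf_le_right
        have hV2 : U ⊓ W₁ ⊓ (U ⊓ W₂) ≤ W₂ := inf_le_right.trans inf_le_right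
        have hV : U ⊓ W₁ ⊓ (U ⊓ W₂) ≤ W₁ ⊓ W₂ := le_inf hV1 hV2
        have hVU : U ⊓ W₁ ⊓ (U ⊓ W₂) ≤ U := inf_le_left.trans inf_le_left
        have e2 : ∀ b, F.res hV2 (t₂ b) = ∑ a, he₁.coords hV1 (E.res hV2 (e₂ b)) a • F.res hV1 (t₁ a) := by
          intro b
          have := congrArg (F.res hV) (ht b)
          simpa only [OMod.res_sum, F.res_smul, F.res_res, ← IsFrame.coords_res, E.res_res] using this
        simp only [e2, Finset.smul_sum, smul_smul]
        rw [Finset.sum_comm]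
        refine Finset.sum_congr rfl fun a _ => ?_
        rw [← Finset.sum_smul]
        congr 1
        have h3 : E.res hVU s = ∑ a, (∑ b, he₂.coords hV2 (E.res hVU s) b *
            he₁.coords hV1 (E.res hV2 (e₂ b)) a) • E.res hV1 (e₁ a) := by
          conv_lhs => rw [← he₂.sum_coords hV2 (E.res hVU s)]
          simp only [Finset.sum_smul, mul_smul]
          rw [Finset.sum_comm]
          refine Finset.sum_congr rfl fun b _ => ?_
          rw [← Finset.smul_sum, he₁.sum_coords]
        exact congrFun (he₁.coords_eq hV1 h3) a)
    refine ⟨t, ⟨h1, h2⟩, fun t' ht' => OMod.ext_of_cover₂ inf_le_left inf_le_left hc ?_ ?_⟩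
    · rw [h1, ht'.1]
    · rw [h2, ht'.2]
  choose φ hφ huniq using ex
  -- Additivity, linearity and compatibility with restriction all follow from uniqueness of the
  -- glued image.
  refine ⟨⟨fun U => ⟨⟨φ U, fun s t => ?_⟩, fun f s => ?_⟩, fun {U V} h s => ?_⟩, fun a => ?_, fun a => ?_⟩
  · refine (huniq _ _ _ ⟨?_, ?_⟩).symm
    · simp only [map_add, (hφ U s).1, (hφ U t).1, IsFrame.coords_add, Pi.add_apply, add_smul,
        Finset.sum_add_distrib]
    · simp only [map_add, (hφ U s).2, (hφ U t).2, IsFrame.coords_add, Pi.add_apply, add_smul,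
        Finset.sum_add_distrib]
  · refine (huniq _ _ _ ⟨?_, ?_⟩).symm
    · simp only [F.res_smul, E.res_smul, (hφ U s).1, IsFrame.coords_smul, Pi.smul_apply, smul_eq_mul,
        mul_smul, Finset.smul_sum, RingHom.id_apply]
    · simp only [F.res_smul, E.res_smul, (hφ U s).2, IsFrame.coords_smul, Pi.smul_apply, smul_eq_mul,
        mul_smul, Finset.smul_sum, RingHom.id_apply]
  · refine ((?_ : F.res h (φ V s) = φ U (E.res h s))).symm
    refine huniq _ _ _ ⟨?_, ?_⟩
    · have := congrArg (F.res (inf_le_inf_right W₁ h)) (hφ V s).1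
      simpa only [OMod.res_sum, F.res_smul, F.res_res, ← IsFrame.coords_res, E.res_res] using this
    · have := congrArg (F.res (inf_le_inf_right W₂ h)) (hφ V s).2
      simpa only [OMod.res_sum, F.res_smul, F.res_res, ← IsFrame.coords_res, E.res_res] using this
  · have := congrArg (F.res (le_inf le_rfl le_rfl : W₁ ≤ W₁ ⊓ W₁)) (hφ W₁ (e₁ a)).1
    simp only [OMod.res_sum, F.res_smul, F.res_res, ← IsFrame.coords_res, E.res_res] at this
    rw [F.res_self] at this
    refine this.trans ?_
    simp only [he₁.coords_frame le_rfl a, ite_smul, one_smul, zero_smul, Finset.sum_ite_eq',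
      Finset.mem_univ, if_true, F.res_self]
  · have := congrArg (F.res (le_inf le_rfl le_rfl : W₂ ≤ W₂ ⊓ W₂)) (hφ W₂ (e₂ a)).2
    simp only [OMod.res_sum, F.res_smul, F.res_res, ← IsFrame.coords_res, E.res_res] at this
    rw [F.res_self] at this
    refine this.trans ?_
    simp only [he₂.coords_frame le_rfl a, ite_smul, one_smul, zero_smul, Finset.sum_ite_eq',
      Finset.mem_univ, if_true, F.res_self]

/-- A morphism which maps frames over a cover to frames is an isomorphism. -/
lemma Hom.isIso_of_frames {f : Hom E F} {W₁ W₂ : Opens P1} (hW : W₁ ⊔ W₂ = ⊤)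
    {e₁ : Fin n → E.sec W₁} {e₂ : Fin n → E.sec W₂} (he₁ : IsFrame E e₁) (he₂ : IsFrame E e₂)
    (h₁ : IsFrame F (fun a => f.map W₁ (e₁ a))) (h₂ : IsFrame F (fun a => f.map W₂ (e₂ a))) :
    f.IsIso := by
  refine f.isIso_of_local fun x => ?_
  have hx : x ∈ W₁ ⊔ W₂ := by rw [hW]; trivial
  rcases hx with hx | hx
  · exact ⟨W₁, hx, fun V hV => f.bijective_of_isFrame he₁ h₁ hV⟩
  · exact ⟨W₂, hx, fun V hV => f.bijective_of_isFrame he₂ h₂ hV⟩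

end Frames

end LoopFlag
end

noncomputable section
namespace LoopFlag

/-! ### Coherent torsion free sheaves are locally free -/

section LocallyFree

variable {n : ℕ} {E : OMod}

/-- Without relations the coefficients that exist locally are unique, so they agree on overlaps and
glue. -/
lemma isFrame_of_generators {W : Opens P1} {e : Fin n → E.sec W}
    (hinj : ∀ (V : Opens P1) (h : V ≤ W) (c : Fin n → Hol V), ∑ a, c a • E.res h (e a) = 0 → c = 0)
    (hgen : ∀ (V : Opens P1) (_ : V ≤ W) (t : E.sec V), ∀ y ∈ V, ∃ (V' : Opens P1) (h' : V' ≤ V)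
      (h : V' ≤ W) (c : Fin n → Hol V'), y ∈ V' ∧ E.res h' t = ∑ i, c i • E.res h (e i)) :
    IsFrame E e := by
  have hinj' : ∀ (V : Opens P1) (h : V ≤ W),
      Function.Injective (fun c : Fin n → Hol V => ∑ a, c a • E.res h (e a)) := by
    intro V h c c' hcc
    refine sub_eq_zero.1 (hinj V h _ ?_)
    simp only [Pi.sub_apply, sub_smul, Finset.sum_sub_distrib]
    exact sub_eq_zero.2 hcc
  intro U hU
  refine ⟨hinj' U hU, fun s => ?_⟩
  choose V h' h c hxV hc using hgen U hU s
  have hglue : ∀ a, ∃ g : Hol U, ∀ x : U, Hol.res (h' x x.2) g = c x x.2 a := by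
    intro a
    refine Hol.exists_glue (fun x : U => V x x.2) (fun x hx => ⟨⟨x, hx⟩, hxV x hx⟩)
      (fun _ => h' _ _) (fun x => c x x.2 a) ?_
    intro x x' y hy hy'
    have := hinj' (V x x.2 ⊓ V x' x'.2) (inf_le_left.trans (h x x.2))
      (a₁ := fun a => Hol.res inf_le_left (c x x.2 a))
      (a₂ := fun a => Hol.res inf_le_right (c x' x'.2 a)) (by
        have e1 := congrArg (E.res (inf_le_left : V x x.2 ⊓ V x' x'.2 ≤ _)) (hc x x.2)
        have e2 := congrArg (E.res (inf_le_right : V x x.2 ⊓ V x' x'.2 ≤ _)) (hc x' x'.2)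
        simp only [OMod.res_sum, E.res_smul, E.res_res] at e1 e2
        simp only [← e1, ← e2])
    have := congrArg (fun f : Hol (V x x.2 ⊓ V x' x'.2) => f.1 ⟨y, hy, hy'⟩) (congrFun this a)
    exact this
  choose g hg using hglue
  refine ⟨g, OMod.ext_of_local fun x hx => ⟨V x hx, h' x hx, hxV x hx, ?_⟩⟩
  have := hc x hx
  simp only [OMod.res_sum, E.res_smul, E.res_res, hg _ ⟨x, hx⟩]
  exact this.symm

/-- The number of elements of a frame is well defined. -/
lemma IsFrame.card_eq {m : ℕ} {W W' V : Opens P1} {e : Fin n → E.sec W} {e' : Fin m → E.sec W'}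
    (he : IsFrame E e) (he' : IsFrame E e') (h : V ≤ W) (h' : V ≤ W') (hV : V ≠ ⊥) : n = m := by
  obtain ⟨x, hx⟩ := (Opens.ne_bot_iff_nonempty V).1 hV
  have : Nontrivial (Hol V) := ⟨0, 1, fun h0 => zero_ne_one (congrArg (Hol.eval hx) h0)⟩
  let φ : ∀ {k : ℕ} {U : Opens P1} (h : V ≤ U) {f : Fin k → E.sec U}, IsFrame E f →
      (Fin k → Hol V) ≃ₗ[Hol V] E.sec V := fun h f hf => LinearEquiv.ofBijective
    { toFun := fun c => ∑ a, c a • E.res h (f a)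
      map_add' := fun c d => by simp only [Pi.add_apply, add_smul, Finset.sum_add_distrib]
      map_smul' := fun r c => by
        simp only [Pi.smul_apply, smul_eq_mul, mul_smul, Finset.smul_sum, RingHom.id_apply] } (hf V h)
  simpa using card_eq_of_linearEquiv (Hol V) ((φ h he).trans (φ h' he').symm)

/-- The sections `s i`, `i ∈ I`, generate `E` over `W`, and the relations between them are
generated by the rows of `A`. -/
structure IsPresentation (E : OMod) {W : Opens P1} {b a : ℕ} (s : Fin b → E.sec W)
    (A : Fin a → Fin b → Hol W) (I : Finset (Fin b)) : Prop where
  gen : ∀ (V : Opens P1) (_ : V ≤ W) (t : E.sec V), ∀ y ∈ V, ∃ (V' : Opens P1) (h' : V' ≤ V)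
    (h : V' ≤ W) (c : Fin b → Hol V'), y ∈ V' ∧ (∀ i ∉ I, c i = 0) ∧
      E.res h' t = ∑ i, c i • E.res h (s i)
  rel : ∀ k, ∑ i, A k i • s i = 0
  supp : ∀ k, ∀ i ∉ I, A k i = 0
  relgen : ∀ (V : Opens P1) (h : V ≤ W) (c : Fin b → Hol V), (∀ i ∉ I, c i = 0) →
    ∑ i, c i • E.res h (s i) = 0 →
      ∀ y ∈ V, ∃ (V' : Opens P1) (h' : V' ≤ V) (r : Fin a → Hol V'), y ∈ V' ∧
        ∀ i, Hol.res h' (c i) = ∑ k, r k * Hol.res (h'.trans h) (A k i)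

lemma IsPresentation.restrict {W : Opens P1} {b a : ℕ} {s : Fin b → E.sec W}
    {A : Fin a → Fin b → Hol W} {I : Finset (Fin b)} (P : IsPresentation E s A I) {U : Opens P1}
    (hU : U ≤ W) :
    IsPresentation E (fun i => E.res hU (s i)) (fun k i => Hol.res hU (A k i)) I where
  gen V hV t y hy := by
    obtain ⟨V', h', h, c, hy', hc, e⟩ := P.gen V (hV.trans hU) t y hy
    refine ⟨V', h', h'.trans hV, c, hy', hc, ?_⟩
    simpa only [E.res_res] using e
  rel k := by
    have := congrArg (E.res hU) (P.rel k)
    simpa only [OMod.res_sum, E.res_smul, map_zero] using this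
  supp k i hi := by rw [P.supp k i hi, map_zero]
  relgen V h c hc e y hy := by
    obtain ⟨V', h', r, hy', e'⟩ := P.relgen V (h.trans hU) c hc (by simpa only [E.res_res] using e) y hy
    exact ⟨V', h', r, hy', e'⟩

/-- A generator with an invertible coefficient in a relation can be eliminated. -/
lemma IsPresentation.eliminate {W : Opens P1} {b a : ℕ} {s : Fin b → E.sec W}
    {A : Fin a → Fin b → Hol W} {I : Finset (Fin b)} (P : IsPresentation E s A I)
    {C : Fin b → Hol W} (hC : ∀ i ∉ I, C i = 0) (hs : ∑ i, C i • s i = 0) {i₀ : Fin b}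
    (h1 : C i₀ = 1) :
    IsPresentation E s (fun k i => A k i - A k i₀ * C i) (I.erase i₀) where
  gen V hV t y hy := by
    obtain ⟨V', h', h, c, hy', hc, e⟩ := P.gen V hV t y hy
    refine ⟨V', h', h, fun i => c i - c i₀ * Hol.res h (C i), hy', fun i hi => ?_, ?_⟩
    · by_cases hi0 : i = i₀
      · subst hi0; simp [h1]
      · have hiI : i ∉ I := fun hI => hi (Finset.mem_erase.2 ⟨hi0, hI⟩)
        simp [hc i hiI, hC i hiI]
    · have := congrArg (E.res h) hs
      simp only [OMod.res_sum, E.res_smul, map_zero] at this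
      simp only [sub_smul, mul_smul, Finset.sum_sub_distrib, ← Finset.smul_sum, this, smul_zero,
        sub_zero, e]
  rel k := by
    simp only [sub_smul, mul_smul, Finset.sum_sub_distrib, ← Finset.smul_sum, hs, smul_zero,
        sub_zero, P.rel]
  supp k i hi := by
    by_cases hi0 : i = i₀
    · subst hi0; simp [h1]
    · have hiI : i ∉ I := fun hI => hi (Finset.mem_erase.2 ⟨hi0, hI⟩)
      simp [P.supp k i hiI, hC i hiI]
  relgen V h c hc e y hy := by
    obtain ⟨V', h', r, hy', e'⟩ := P.relgen V h c
      (fun i hi => hc i fun h => hi (Finset.mem_of_mem_erase h)) e y hy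
    refine ⟨V', h', r, hy', fun i => ?_⟩
    -- The coefficient of the eliminated generator is zero, so the corrections `A k i₀ * C i`
    -- contribute nothing to the combination of relations.
    have h0 := e' i₀
    rw [hc i₀ (Finset.notMem_erase _ _), map_zero] at h0
    simp only [map_sub, map_mul, mul_sub, Finset.sum_sub_distrib, ← mul_assoc, ← Finset.sum_mul,
      ← h0, zero_mul, sub_zero]
    exact e' i

lemma res_coord_sub_pow_ne_zero {U : Opens P1} (hU : OnePoint.infty ∉ U) (z₀ : ℂ) (k : ℕ)
    (V : Opens P1) (h : V ≤ U) (hV : V ≠ ⊥) :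
    Hol.res h ((coord U hU - algebraMap ℂ _ z₀) ^ k) ≠ 0 := by
  intro h0
  obtain ⟨x, hx⟩ := (Opens.ne_bot_iff_nonempty V).1 hV
  obtain ⟨z, rfl⟩ := exists_coe_eq hU (h hx)
  have ev : ∀ᶠ w : ℂ in 𝓝[≠] z, w ≠ z₀ ∧ (w : P1) ∈ V := by
    refine Filter.Eventually.and ?_ (eventually_nhdsWithin_of_eventually_nhds (eventually_coe hx))
    by_cases hz : z = z₀
    · subst hz; exact self_mem_nhdsWithin
    · exact eventually_nhdsWithin_of_eventually_nhds (isOpen_ne.mem_nhds hz)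
  obtain ⟨w, hw0, hw⟩ := ev.exists
  have : (Hol.res h ((coord U hU - algebraMap ℂ _ z₀) ^ k)).1 ⟨w, hw⟩ = 0 := by rw [h0]; rfl
  rw [Hol.res_val, Hol.pow_val, Hol.sub_val, coord_coe, Hol.algebraMap_val] at this
  exact pow_ne_zero k (sub_ne_zero.2 hw0) this

/-- A neighbourhood of a point of `ℂ` on which an eventually valid property holds. -/
lemma exists_opens_of_eventually {W : Opens P1} {z₀ : ℂ} (hz : (z₀ : P1) ∈ W) {p : ℂ → Prop}
    (hp : ∀ᶠ z in 𝓝 z₀, p z) :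
    ∃ V : Opens P1, V ≤ W ∧ (z₀ : P1) ∈ V ∧ OnePoint.infty ∉ V ∧ ∀ z : ℂ, (z : P1) ∈ V → p z := by
  obtain ⟨t, ht, hto, hzt⟩ := eventually_nhds_iff.1 hp
  refine ⟨⟨(↑) '' t, OnePoint.isOpenEmbedding_coe.isOpenMap _ hto⟩ ⊓ W, inf_le_right,
    ⟨⟨z₀, hzt, rfl⟩, hz⟩, fun h => ?_, fun z hz' => ?_⟩
  · obtain ⟨w, _, hw⟩ := h.1
    exact OnePoint.coe_ne_infty w hw
  · obtain ⟨w, hw, hwz⟩ := hz'.1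
    rw [OnePoint.coe_injective hwz] at hw
    exact ht z hw

/-- Common powers of a local parameter can be divided out of a non-zero vector of functions. -/
lemma exists_eq_pow_mul {W : Opens P1} {z₀ : ℂ} (hz : (z₀ : P1) ∈ W) {b : ℕ} (A : Fin b → Hol W)
    (hA : ∃ i, ∀ (V : Opens P1) (h : V ≤ W), (z₀ : P1) ∈ V → Hol.res h (A i) ≠ 0) :
    ∃ (V : Opens P1) (h : V ≤ W) (hV : OnePoint.infty ∉ V) (m : ℕ) (C : Fin b → Hol V) (i₀ : Fin b),
      (z₀ : P1) ∈ V ∧ IsUnit (C i₀) ∧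
      ∀ i, Hol.res h (A i) = (coord V hV - algebraMap ℂ _ z₀) ^ m * C i := by
  obtain ⟨j, hj⟩ := hA
  let F : Fin b → ℂ → ℂ := fun i w => ext (A i).1 w
  have hF : ∀ i, AnalyticAt ℂ (F i) z₀ := fun i => (A i).2.1 z₀ hz
  have : Nonempty (Fin b) := ⟨j⟩
  -- An entry of least order of vanishing: its order `m` is finite, divides every entry, and leaves
  -- an invertible quotient at `i₀`.
  obtain ⟨i₀, hi₀⟩ := Finite.exists_min (fun i => analyticOrderAt (F i) z₀)
  have hjt : analyticOrderAt (F j) z₀ ≠ ⊤ := by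
    intro htop
    obtain ⟨V, hVW, hzV, -, hV⟩ := exists_opens_of_eventually hz (analyticOrderAt_eq_top.1 htop)
    obtain ⟨V', hV', hzV', hi, -⟩ := exists_opens_of_eventually hzV (p := fun _ => True) (by simp)
    refine hj V' (hV'.trans hVW) hzV' (Hol.ext_coe hi fun z hz' => ?_)
    have := hV z (hV' hz')
    rw [Hol.res_val, Hol.zero_val, ← this]
    exact (ext_of_mem _ _).symm
  have hfin : analyticOrderAt (F i₀) z₀ ≠ ⊤ := ne_top_of_le_ne_top hjt (hi₀ j)
  obtain ⟨m, hm⟩ := ENat.ne_top_iff_exists.1 hfin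
  have hle : ∀ i, (m : ℕ∞) ≤ analyticOrderAt (F i) z₀ := fun i => hm ▸ hi₀ i
  have hg : ∀ i, ∃ g : ℂ → ℂ, AnalyticAt ℂ g z₀ ∧ ∀ᶠ z in 𝓝 z₀, F i z = (z - z₀) ^ m • g z :=
    fun i => (natCast_le_analyticOrderAt (hF i)).1 (hle i)
  choose g hga hge using hg
  obtain ⟨g0, hg0a, hg0n, hg0e⟩ := ((hF i₀).analyticOrderAt_eq_natCast).1 hm.symm
  let g' : Fin b → ℂ → ℂ := fun i => if i = i₀ then g0 else g i
  have hga' : ∀ i, AnalyticAt ℂ (g' i) z₀ := by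
    intro i; by_cases h : i = i₀ <;> simp only [g', h, if_true, if_false, hg0a, hga]
  have hge' : ∀ i, ∀ᶠ z in 𝓝 z₀, F i z = (z - z₀) ^ m * g' i z := by
    intro i
    by_cases h : i = i₀
    · subst h; simpa only [g', if_true, smul_eq_mul] using hg0e
    · simpa only [g', h, if_false, smul_eq_mul] using hge i
  have hgn : g' i₀ z₀ ≠ 0 := by simpa [g'] using hg0n
  obtain ⟨V, hVW, hzV, hVi, hV⟩ := exists_opens_of_eventually hz
    (((Filter.eventually_all.2 hge').and
      (Filter.eventually_all.2 fun i => (hga' i).eventually_analyticAt)).and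
      ((hga' i₀).continuousAt.eventually_ne hgn))
  refine ⟨V, hVW, hVi, m, fun i => Hol.ofAnalytic V hVi (g' i) fun z hz => (hV z hz).1.2 i, i₀, hzV,
    Hol.isUnit_of_ne_zero _ fun x => ?_, fun i => Hol.ext_coe hVi fun z hz => ?_⟩
  · obtain ⟨x, hx⟩ := x
    obtain ⟨z, rfl⟩ := exists_coe_eq hVi hx
    exact (hV z hx).2
  · have := (hV z hz).1.1 i
    rw [Hol.mul_val, Hol.pow_val, Hol.sub_val, Hol.ofAnalytic_coe, coord_coe, Hol.algebraMap_val,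
      ← this]
    exact (ext_of_mem (A i).1 (hVW hz)).symm

/-- Induction on the number of generators. If some relation has a non-zero germ at `z₀`, divide it
by the largest power of `z - z₀` common to its entries; torsion freeness keeps the quotient a
relation, and an invertible coefficient eliminates a generator. If every relation vanishes near
`z₀`, the generators form a frame. -/
lemma IsPresentation.exists_isFrame (htf : IsTorsionFree E) {z₀ : ℂ} {b a : ℕ} (m : ℕ) :
    ∀ {W : Opens P1} (_ : (z₀ : P1) ∈ W) {s : Fin b → E.sec W} {A : Fin a → Fin b → Hol W}
      {I : Finset (Fin b)} (_ : I.card = m) (_ : IsPresentation E s A I),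
      ∃ (V : Opens P1) (k : ℕ) (e : Fin k → E.sec V), (z₀ : P1) ∈ V ∧ IsFrame E e := by
  induction m with
  | zero => ?_
  | succ m ih => ?_
  all_goals
    intro W hz s A I hI P
    by_cases hA : ∃ k i, ∀ (V : Opens P1) (h : V ≤ W), (z₀ : P1) ∈ V → Hol.res h (A k i) ≠ 0
  · obtain ⟨k, i, h⟩ := hA
    rw [Finset.card_eq_zero] at hI
    exact absurd (by rw [P.supp k i (by simp [hI]), map_zero]) (h W le_rfl hz)
  rotate_left
  · obtain ⟨k, hA⟩ := hA
    obtain ⟨V, hVW, hVi, l, C, i₀, hzV, hu, hC⟩ := exists_eq_pow_mul hz (A k) hA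
    have hCs : ∀ i ∉ I, C i = 0 := fun i hi =>
      Hol.eq_zero_of_mul_eq_zero (res_coord_sub_pow_ne_zero hVi z₀ l)
        (by rw [← hC, P.supp k i hi, map_zero])
    have hrel : ∑ i, C i • E.res hVW (s i) = 0 := by
      refine htf V _ _ (res_coord_sub_pow_ne_zero hVi z₀ l) ?_
      have := (P.restrict hVW).rel k
      simpa only [hC, mul_smul, ← Finset.smul_sum] using this
    have hi₀ : i₀ ∈ I := by
      by_contra h
      rw [hCs i₀ h] at hu
      exact Hol.ne_zero_of_isUnit hu ⟨_, hzV⟩ rfl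
    obtain ⟨u, hu⟩ := hu
    have P' := (P.restrict hVW).eliminate (C := fun i => ↑u⁻¹ * C i) (i₀ := i₀)
      (fun i hi => by rw [hCs i hi, mul_zero])
      (by simp only [mul_smul, ← Finset.smul_sum, hrel, smul_zero]) (by rw [← hu, Units.inv_mul])
    exact ih hzV (by rw [Finset.card_erase_of_mem hi₀, hI, Nat.add_sub_cancel]) P'
  -- What remains, with no generators or with `m + 1`, is the case in which every entry of `A`
  -- vanishes on a neighbourhood of `z₀`. The finitely many neighbourhoods are intersected.
  all_goals
    push Not at hA
    choose V hV hzV hVA using hA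
    let U : Opens P1 := W ⊓ ⟨⋂ k, ⋂ i, (V k i : Set P1), isOpen_iInter_of_finite fun k =>
      isOpen_iInter_of_finite fun i => (V k i).isOpen⟩
    have hUV : ∀ k i, U ≤ V k i := fun k i x hx => Set.mem_iInter.1 (Set.mem_iInter.1 hx.2 k) i
    have hUW : U ≤ W := inf_le_left
    have hzU : (z₀ : P1) ∈ U := ⟨hz, Set.mem_iInter.2 fun k => Set.mem_iInter.2 fun i => hzV k i⟩
    have P' := P.restrict hUW
    have hA0 : ∀ k i, Hol.res hUW (A k i) = 0 := fun k i => by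
      have := congrArg (Hol.res (hUV k i)) (hVA k i)
      rwa [Hol.res_res, map_zero] at this
    let φ : Fin I.card ≃ I := I.equivFin.symm
    have hsum : ∀ {T : Opens P1} (h : T ≤ U) (c : Fin b → Hol T), (∀ i ∉ I, c i = 0) →
        ∑ j, c (φ j) • E.res h (E.res hUW (s (φ j))) = ∑ i, c i • E.res h (E.res hUW (s i)) := by
      intro T h c hc
      rw [φ.sum_comp (fun i : I => c i • E.res h (E.res hUW (s i))),
        Finset.sum_coe_sort I (fun i => c i • E.res h (E.res hUW (s i)))]
      exact Finset.sum_subset (Finset.subset_univ _) fun i _ hi => by rw [hc i hi, zero_smul]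
    refine ⟨U, I.card, fun j => E.res hUW (s (φ j)), hzU, isFrame_of_generators ?_ ?_⟩
    · intro T h c hc
      let d : Fin b → Hol T := fun i => if hi : i ∈ I then c (φ.symm ⟨i, hi⟩) else 0
      have hd : ∀ i ∉ I, d i = 0 := fun i hi => dif_neg hi
      have hcd : ∀ j, c j = d (φ j) := fun j => by
        have : ((φ j : I) : Fin b) ∈ I := (φ j).2
        simp only [d, dif_pos this, Subtype.coe_eta, Equiv.symm_apply_apply]
      simp only [hcd] at hc
      rw [hsum h d hd] at hc
      funext j
      refine Hol.ext' fun x hx => ?_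
      obtain ⟨T', hT', r, hx', e⟩ := P'.relgen T h d hd hc x hx
      have : Hol.res hT' (c j) = 0 := by
        have e1 := e (φ j)
        rw [← hcd] at e1
        rw [e1]
        refine Finset.sum_eq_zero fun k _ => ?_
        have := congrArg (Hol.res (hT'.trans h)) (hA0 k (φ j))
        rw [map_zero] at this
        rw [this, mul_zero]
      exact congrArg (fun f : Hol T' => f.1 ⟨x, hx'⟩) this
    · intro T hT t y hy
      obtain ⟨T', h', h, c, hy', hc, e⟩ := P'.gen T hT t y hy
      exact ⟨T', h', h, fun j => c (φ j), hy', by rw [e, ← hsum h c hc]⟩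

/-- Coherent torsion free sheaves have frames near each point of `ℂ`. -/
theorem exists_isFrame_of_isCoherent (hc : IsCoherent E) (ht : IsTorsionFree E) (hr : HasRank n E)
    (z₀ : ℂ) : ∃ (V : Opens P1) (e : Fin n → E.sec V), (z₀ : P1) ∈ V ∧ IsFrame E e := by
  obtain ⟨W, hz, b, a, s, A, hgen, hrel, hrg⟩ := hc z₀
  have P : IsPresentation E s A Finset.univ :=
    { gen := fun V hV t y hy => by
        obtain ⟨V', h', h, c, hy', e⟩ := hgen V hV t y hy
        exact ⟨V', h', h, c, hy', by simp, e⟩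
      rel := hrel
      supp := by simp
      relgen := fun V h c _ => hrg V h c }
  obtain ⟨V, k, e, hzV, he⟩ := P.exists_isFrame ht _ hz rfl
  -- The size of the frame is compared with the generic rank at a point of the dense open set.
  obtain ⟨U, hU, hUr⟩ := hr
  obtain ⟨y, hyV, hyU⟩ := hU.inter_open_nonempty V V.isOpen ⟨_, hzV⟩
  obtain ⟨W', hyW', e', he'⟩ := hUr y hyU
  obtain rfl : k = n := he.card_eq he' (V := V ⊓ W') inf_le_left inf_le_right
    ((Opens.ne_bot_iff_nonempty _).2 ⟨y, hyV, hyW'⟩)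
  exact ⟨V, e, hzV, he⟩

end LocallyFree

end LoopFlag
end

noncomputable section
namespace LoopFlag

/-! ### Frames over a neighbourhood of the closed disc -/

section MatrixFactorization

open scoped Matrix.Norms.Operator in
/-- Cartan's lemma for holomorphic invertible matrices near a segment. -/
theorem exists_matrix_factorization {n : ℕ} [NeZero n] {c d δ : ℝ} (hcd : c ≤ d) (h0 : 0 < δ)
    (h1 : δ ≤ 1) {G : ℂ → Matrix (Fin n) (Fin n) ℂ}
    (hG : ∀ z ∈ stripQ c d δ, ∀ a b, AnalyticAt ℂ (fun w => G w a b) z)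
    (uG : ∀ z ∈ stripQ c d δ, IsUnit (G z)) :
    ∃ A B : ℂ → Matrix (Fin n) (Fin n) ℂ,
      (∀ z ∈ stripL c d (δ / 4), (∀ a b, AnalyticAt ℂ (fun w => A w a b) z) ∧ IsUnit (A z)) ∧
      (∀ z ∈ stripR c d (δ / 4), (∀ a b, AnalyticAt ℂ (fun w => B w a b) z) ∧ IsUnit (B z)) ∧
      ∀ z ∈ stripQ c d (δ / 4), G z = A z * B z := by
  have hGd : DifferentiableOn ℂ G (stripQ c d δ) := by
    have : G = fun w => ∑ a, ∑ b, G w a b • Matrix.single a b (1 : ℂ) := by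
      funext w
      conv_lhs => rw [Matrix.matrix_eq_sum_single (G w)]
      simp only [Matrix.smul_single, smul_eq_mul, mul_one]
    rw [this]
    refine DifferentiableOn.fun_sum fun a _ => DifferentiableOn.fun_sum fun b _ => ?_
    exact fun z hz => ((hG z hz a b).differentiableAt.smul_const _).differentiableWithinAt
  have entry : ∀ {U : Set ℂ} (_ : IsOpen U) {F : ℂ → Matrix (Fin n) (Fin n) ℂ}
      (_ : DifferentiableOn ℂ F U) (z) (_ : z ∈ U) (a b), AnalyticAt ℂ (fun w => F w a b) z := by
    intro U hU F hF z hz a b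
    have h := ((LinearMap.toContinuousLinearMap
      (Matrix.entryLinearMap ℂ ℂ a b : Matrix (Fin n) (Fin n) ℂ →ₗ[ℂ] ℂ)).differentiable.comp_differentiableOn hF)
    exact h.analyticAt (hU.mem_nhds hz)
  obtain ⟨A, B, hA, hB, uA, uB, e⟩ := exists_factorization hcd h0 h1 hGd uG
  exact ⟨A, B, fun z hz => ⟨entry (isOpen_stripL _ _ _) hA z hz, uA z hz⟩,
    fun z hz => ⟨entry (isOpen_stripR _ _ _) hB z hz, uB z hz⟩, e⟩

end MatrixFactorization

section Trivial

variable {n : ℕ} {E : OMod}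

/-- There is a frame over a neighbourhood of the subset `S` of `ℂ`. -/
def TrivialNear (n : ℕ) (E : OMod) (S : Set ℂ) : Prop :=
  ∃ U : Opens P1, OnePoint.infty ∉ U ∧ (∀ z ∈ S, (z : P1) ∈ U) ∧ ∃ e : Fin n → E.sec U, IsFrame E e

lemma TrivialNear.mono {S T : Set ℂ} (h : TrivialNear n E T) (hST : S ⊆ T) : TrivialNear n E S := by
  obtain ⟨U, hi, hU, he⟩ := h
  exact ⟨U, hi, fun z hz => hU z (hST hz), he⟩

lemma exists_isFrame_sup {U₁ U₂ : Opens P1} {e₁ : Fin n → E.sec U₁} {e₂ : Fin n → E.sec U₂}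
    (h₁ : IsFrame E e₁) (h₂ : IsFrame E e₂)
    (h : ∀ a, E.res (inf_le_left : U₁ ⊓ U₂ ≤ U₁) (e₁ a) = E.res inf_le_right (e₂ a)) :
    ∃ e : Fin n → E.sec (U₁ ⊔ U₂), IsFrame E e ∧ (∀ a, E.res le_sup_left (e a) = e₁ a) ∧
      ∀ a, E.res le_sup_right (e a) = e₂ a := by
  choose e he using fun a => OMod.exists_glue₂ (E := E) (W := U₁ ⊔ U₂) le_sup_left le_sup_right le_rfl
    (e₁ a) (e₂ a) (h a)
  refine ⟨e, isFrame_of_local fun x hx => ?_, fun a => (he a).1, fun a => (he a).2⟩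
  rcases hx with hx | hx
  · exact ⟨U₁, le_sup_left, hx, by simpa only [(he _).1] using h₁⟩
  · exact ⟨U₂, le_sup_right, hx, by simpa only [(he _).2] using h₂⟩

/-- The open subset of the sphere given by an open subset of `ℂ`. -/
def opensOf (S : Set ℂ) (hS : IsOpen S) : Opens P1 :=
  ⟨(↑) '' S, OnePoint.isOpenEmbedding_coe.isOpenMap _ hS⟩

@[simp] lemma coe_mem_opensOf {S : Set ℂ} {hS : IsOpen S} {z : ℂ} : (z : P1) ∈ opensOf S hS ↔ z ∈ S :=
  OnePoint.coe_injective.mem_set_image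

lemma infty_notMem_opensOf {S : Set ℂ} {hS : IsOpen S} : OnePoint.infty ∉ opensOf S hS := by
  rintro ⟨w, _, hw⟩
  exact OnePoint.coe_ne_infty w hw

/-- The matrix of holomorphic functions given by a matrix of analytic functions. -/
def holMatrix (U : Opens P1) (hU : OnePoint.infty ∉ U) (A : ℂ → Matrix (Fin n) (Fin n) ℂ)
    (hA : ∀ z : ℂ, (z : P1) ∈ U → ∀ a b, AnalyticAt ℂ (fun w => A w a b) z) :
    Matrix (Fin n) (Fin n) (Hol U) :=
  fun a b => Hol.ofAnalytic U hU (fun w => A w a b) fun z hz => hA z hz a b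

lemma holMatrix_coe {U : Opens P1} {hU : OnePoint.infty ∉ U} {A : ℂ → Matrix (Fin n) (Fin n) ℂ}
    {hA : ∀ z : ℂ, (z : P1) ∈ U → ∀ a b, AnalyticAt ℂ (fun w => A w a b) z} {z : ℂ}
    (hz : (z : P1) ∈ U) : (holMatrix U hU A hA).map (Hol.eval hz) = A z := rfl

lemma isUnit_holMatrix_det {U : Opens P1} {hU : OnePoint.infty ∉ U}
    {A : ℂ → Matrix (Fin n) (Fin n) ℂ}
    {hA : ∀ z : ℂ, (z : P1) ∈ U → ∀ a b, AnalyticAt ℂ (fun w => A w a b) z}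
    (h : ∀ z : ℂ, (z : P1) ∈ U → IsUnit (A z)) : IsUnit (holMatrix U hU A hA).det := by
  refine Hol.isUnit_of_ne_zero _ fun x => ?_
  obtain ⟨x, hx⟩ := x
  obtain ⟨z, rfl⟩ := exists_coe_eq hU hx
  rw [Hol.det_val, holMatrix_coe]
  exact ((Matrix.isUnit_iff_isUnit_det _).1 (h z hx)).ne_zero

lemma IsFrame.of_matrix_sum {W V : Opens P1} {e : Fin n → E.sec W} (he : IsFrame E e) (h : V ≤ W)
    {M : Matrix (Fin n) (Fin n) (Hol V)} (hM : IsUnit M.det) :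
    IsFrame E (fun b => ∑ a, M a b • E.res h (e a)) :=
  (he.res_frame h).of_matrix hM fun _ => rfl

/-- Frames on both sides of a segment, patched by Cartan's lemma. The affine map `z ↦ α z + β`
takes the common side to the imaginary axis. -/
lemma TrivialNear.union [NeZero n] {S₁ S₂ : Set ℂ} {α β : ℂ} (hα : α ≠ 0) {c d : ℝ} (hcd : c ≤ d)
    (t₁ : TrivialNear n E S₁) (t₂ : TrivialNear n E S₂)
    (h₁ : ∀ z ∈ S₁, (α * z + β).re ≤ 0 ∧ c ≤ (α * z + β).im ∧ (α * z + β).im ≤ d)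
    (h₂ : ∀ z ∈ S₂, 0 ≤ (α * z + β).re ∧ c ≤ (α * z + β).im ∧ (α * z + β).im ≤ d)
    (h₁₂ : ∀ z, (α * z + β).re = 0 → c ≤ (α * z + β).im → (α * z + β).im ≤ d → z ∈ S₁ ∧ z ∈ S₂) :
    TrivialNear n E (S₁ ∪ S₂) := by
  obtain ⟨U₁, hi₁, hU₁, f₁, hf₁⟩ := t₁
  obtain ⟨U₂, hi₂, hU₂, f₂, hf₂⟩ := t₂
  let T : ℂ → ℂ := fun z => α * z + β
  let T' : ℂ → ℂ := fun w => α⁻¹ * (w - β)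
  have hTT' : ∀ w, T (T' w) = w := fun w => by simp only [T, T']; field_simp; ring
  have hT'T : ∀ z, T' (T z) = z := fun z => by simp only [T, T']; field_simp; ring
  have hTc : Continuous T := by fun_prop
  have hT'c : Continuous T' := by fun_prop
  have hTa : ∀ z, AnalyticAt ℂ T z := fun z => by fun_prop
  have hT'a : ∀ z, AnalyticAt ℂ T' z := fun z => by fun_prop
  let N : Set ℂ := {w | (T' w : P1) ∈ U₁ ⊓ U₂}
  have hN : IsOpen N := (U₁ ⊓ U₂).isOpen.preimage (OnePoint.continuous_coe.comp hT'c)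
  have hK : IsCompact (({0} : Set ℝ) ×ℂ Set.Icc c d) := isCompact_singleton.reProdIm isCompact_Icc
  have hKN : (({0} : Set ℝ) ×ℂ Set.Icc c d) ⊆ N := by
    rintro w ⟨hw1, hw2, hw3⟩
    have := h₁₂ (T' w) (by rw [show α * T' w + β = w from hTT' w]; exact hw1)
      (by rw [show α * T' w + β = w from hTT' w]; exact hw2)
      (by rw [show α * T' w + β = w from hTT' w]; exact hw3)
    exact ⟨hU₁ _ this.1, hU₂ _ this.2⟩
  obtain ⟨δ₀, hδ₀, hth⟩ := hK.exists_thickening_subset_open hN hKN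
  -- A point of the strip differs from the nearest point of the segment by less than `δ` in each
  -- coordinate, hence by less than `2 δ` in norm.
  obtain ⟨δ, hδ, hδ1, hδ2⟩ : ∃ δ : ℝ, 0 < δ ∧ δ ≤ 1 ∧ 2 * δ ≤ δ₀ :=
    ⟨min 1 (δ₀ / 2), by positivity, min_le_left _ _, by
      have := min_le_right 1 (δ₀ / 2); linarith⟩
  have hQN : ∀ w ∈ stripQ c d δ, (T' w : P1) ∈ U₁ ⊓ U₂ := by
    intro w hw
    obtain ⟨⟨hw1, hw2⟩, hw3, hw4⟩ := mem_stripQ.1 hw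
    refine hth (Metric.mem_thickening_iff.2 ⟨⟨0, max c (min w.im d)⟩,
      ⟨rfl, le_max_left _ _, max_le hcd (min_le_right _ _)⟩, ?_⟩)
    rw [dist_eq_norm]
    refine lt_of_le_of_lt (Complex.norm_le_abs_re_add_abs_im _) ?_
    have e1 : |(w - ⟨0, max c (min w.im d)⟩ : ℂ).re| < δ := by
      simpa [abs_lt] using ⟨hw1, hw2⟩
    have e2 : |(w - ⟨0, max c (min w.im d)⟩ : ℂ).im| < δ := by
      simp only [Complex.sub_im, abs_lt]
      rcases le_total w.im d with h | h
      · rw [min_eq_left h]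
        rcases le_total c w.im with h' | h'
        · rw [max_eq_right h']; constructor <;> linarith
        · rw [max_eq_left h']; constructor <;> linarith
      · rw [min_eq_right h, max_eq_right hcd]; constructor <;> linarith
    linarith
  let g := hf₁.matrix (inf_le_left : U₁ ⊓ U₂ ≤ U₁) (fun a => E.res inf_le_right (f₂ a))
  have hg : IsUnit g.det := hf₁.isUnit_matrix_det inf_le_left (hf₂.res_frame inf_le_right)
  let G : ℂ → Matrix (Fin n) (Fin n) ℂ := fun w a b => ext (g a b).1 (T' w : P1)
  obtain ⟨A, B, hA, hB, hAB⟩ := exists_matrix_factorization (n := n) hcd hδ hδ1 (G := G)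
    (fun w hw a b => by
      have h1 : AnalyticAt ℂ (fun z : ℂ => ext (g a b).1 (z : P1)) (T' w) := (g a b).2.1 _ (hQN w hw)
      exact h1.fun_comp (hT'a w))
    (fun w hw => by
      have e : G w = g.map (Hol.eval (hQN w hw)) := by
        ext a b
        exact ext_of_mem _ (hQN w hw)
      rw [e, Matrix.isUnit_iff_isUnit_det, isUnit_iff_ne_zero]
      have := Hol.ne_zero_of_isUnit hg ⟨_, hQN w hw⟩
      rw [Hol.det_val] at this
      exact this)
  let V₁ : Opens P1 := U₁ ⊓ opensOf (T ⁻¹' stripL c d (δ / 4)) ((isOpen_stripL _ _ _).preimage hTc)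
  let V₂ : Opens P1 := U₂ ⊓ opensOf (T ⁻¹' stripR c d (δ / 4)) ((isOpen_stripR _ _ _).preimage hTc)
  have hiV₁ : OnePoint.infty ∉ V₁ := fun h => hi₁ h.1
  have hiV₂ : OnePoint.infty ∉ V₂ := fun h => hi₂ h.1
  have mV₁ : ∀ z : ℂ, (z : P1) ∈ V₁ → T z ∈ stripL c d (δ / 4) := fun z hz => by
    have := coe_mem_opensOf.1 hz.2
    exact this
  have mV₂ : ∀ z : ℂ, (z : P1) ∈ V₂ → T z ∈ stripR c d (δ / 4) := fun z hz => by
    have := coe_mem_opensOf.1 hz.2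
    exact this
  let MA := holMatrix V₁ hiV₁ (fun z => A (T z)) fun z hz a b =>
    ((hA _ (mV₁ z hz)).1 a b).fun_comp (hTa z)
  let MB := holMatrix V₂ hiV₂ (fun z => B (T z)) fun z hz a b =>
    ((hB _ (mV₂ z hz)).1 a b).fun_comp (hTa z)
  have uMA : IsUnit MA.det := isUnit_holMatrix_det fun z hz => (hA _ (mV₁ z hz)).2
  have uMB : IsUnit MB.det := isUnit_holMatrix_det fun z hz => (hB _ (mV₂ z hz)).2
  have uMB' : IsUnit (MB⁻¹).det := by
    rw [Matrix.det_nonsing_inv]; exact uMB.ringInverse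
  -- On the overlap `f₂ = f₁ g` and `g = A B`, so the frames `f₁ A` and `f₂ B⁻¹` agree there and
  -- glue.
  have e₁ := hf₁.of_matrix_sum (inf_le_left : V₁ ≤ U₁) uMA
  have e₂ := hf₂.of_matrix_sum (inf_le_left : V₂ ≤ U₂) uMB'
  obtain ⟨e, he, -, -⟩ := exists_isFrame_sup e₁ e₂ (by
    intro b
    have hW1 : V₁ ⊓ V₂ ≤ U₁ := inf_le_left.trans inf_le_left
    have hW2 : V₁ ⊓ V₂ ≤ U₂ := inf_le_right.trans inf_le_left
    have hW : V₁ ⊓ V₂ ≤ U₁ ⊓ U₂ := le_inf hW1 hW2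
    have hiV₁₂ : OnePoint.infty ∉ V₁ ⊓ V₂ := fun h => hiV₁ h.1
    have key : MA.map (Hol.res (inf_le_left : V₁ ⊓ V₂ ≤ V₁)) =
        g.map (Hol.res hW) * (MB⁻¹).map (Hol.res (inf_le_right : V₁ ⊓ V₂ ≤ V₂)) := by
      have k1 : g.map (Hol.res hW) = MA.map (Hol.res (inf_le_left : V₁ ⊓ V₂ ≤ V₁)) *
          MB.map (Hol.res (inf_le_right : V₁ ⊓ V₂ ≤ V₂)) := by
        ext1 i j
        refine Hol.ext_coe hiV₁₂ fun z hz => ?_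
        have hzQ : T z ∈ stripQ c d (δ / 4) := by
          have a1 := mem_stripL.1 (mV₁ z hz.1)
          have a2 := mem_stripR.1 (mV₂ z hz.2)
          exact mem_stripQ.2 ⟨⟨a2.1, a1.1⟩, a1.2⟩
        have a3 := congrFun (congrFun (hAB _ hzQ) i) j
        simp only [G, hT'T] at a3
        rw [ext_of_mem _ (hW hz)] at a3
        rw [Matrix.mul_apply, Hol.sum_val]
        refine a3.trans ?_
        rw [Matrix.mul_apply]
        rfl
      have k2 : MB.map (Hol.res (inf_le_right : V₁ ⊓ V₂ ≤ V₂)) *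
          (MB⁻¹).map (Hol.res (inf_le_right : V₁ ⊓ V₂ ≤ V₂)) = 1 := by
        have := congrArg (fun M => M.map (Hol.res (inf_le_right : V₁ ⊓ V₂ ≤ V₂)))
          (Matrix.mul_nonsing_inv MB uMB)
        simpa only [Matrix.map_mul, Matrix.map_one _ (map_zero _) (map_one _)] using this
      rw [k1, Matrix.mul_assoc, k2, Matrix.mul_one]
    have hf : ∀ a, E.res hW2 (f₂ a) = ∑ i, Hol.res hW (g i a) • E.res hW1 (f₁ i) := by
      intro a
      have := congrArg (E.res hW) (hf₁.eq_sum_matrix inf_le_left (fun a => E.res inf_le_right (f₂ a)) a)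
      simpa only [OMod.res_sum, E.res_smul, E.res_res] using this
    simp only [OMod.res_sum, E.res_smul, E.res_res, hf, Finset.smul_sum, smul_smul]
    rw [Finset.sum_comm]
    refine Finset.sum_congr rfl fun i _ => ?_
    rw [← Finset.sum_smul]
    congr 1
    have := congrFun (congrFun key i) b
    rw [Matrix.mul_apply] at this
    refine this.trans (Finset.sum_congr rfl fun j _ => mul_comm _ _))
  refine ⟨V₁ ⊔ V₂, fun h => h.elim hiV₁ hiV₂, ?_, e, he⟩
  have h4 : 0 < δ / 4 := by positivity
  rintro z (hz | hz)
  · have := h₁ z hz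
    exact Or.inl ⟨hU₁ z hz, coe_mem_opensOf.2 (mem_stripL.2 ⟨by show (α * z + β).re < _; linarith,
      by show _ < (α * z + β).im; linarith, by show (α * z + β).im < _; linarith⟩)⟩
  · have := h₂ z hz
    exact Or.inr ⟨hU₂ z hz, coe_mem_opensOf.2 (mem_stripR.2 ⟨by show _ < (α * z + β).re; linarith,
      by show _ < (α * z + β).im; linarith, by show (α * z + β).im < _; linarith⟩)⟩

/-- A property of intervals which holds locally and is compatible with concatenation holds. -/
lemma interval_induction {P : ℝ → ℝ → Prop} {a b : ℝ} (hab : a ≤ b)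
    (hloc : ∀ x ∈ Set.Icc a b, ∃ O : Set ℝ, IsOpen O ∧ x ∈ O ∧
      ∀ s t, s ≤ t → Set.Icc s t ⊆ O → P s t)
    (hmerge : ∀ s t u, s ≤ t → t ≤ u → P s t → P t u → P s u) : P a b := by
  choose O hO hxO hP using hloc
  obtain ⟨t, ht0, htm, ⟨m, hm⟩, ht⟩ := exists_monotone_Icc_subset_open_cover_Icc hab
    (c := fun x : Set.Icc a b => Subtype.val ⁻¹' O x x.2)
    (fun x => (hO x x.2).preimage continuous_subtype_val)
    (fun x _ => Set.mem_iUnion.2 ⟨x, hxO x x.2⟩)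
  have step : ∀ k, P (t k) (t (k + 1)) := by
    intro k
    obtain ⟨x, hx⟩ := ht k
    refine hP x x.2 _ _ (htm k.le_succ) fun y hy => ?_
    exact hx (a := ⟨y, (t k).2.1.trans hy.1, hy.2.trans (t (k + 1)).2.2⟩) ⟨hy.1, hy.2⟩
  have all : ∀ k, P (t 0) (t (k + 1)) := by
    intro k
    induction k with
    | zero => exact step 0
    | succ k ih => exact hmerge _ _ _ (htm (Nat.zero_le _)) (htm (Nat.le_succ _)) ih (step _)
  have := all m
  rwa [ht0, hm (m + 1) (Nat.le_succ m)] at this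

/-- A sheaf which has frames near each point has a frame near each closed rectangle. -/
theorem trivialNear_rectangle [NeZero n] (h : ∀ z : ℂ, TrivialNear n E {z}) {a b c d : ℝ}
    (hab : a ≤ b) (hcd : c ≤ d) : TrivialNear n E (Set.Icc a b ×ℂ Set.Icc c d) := by
  have seg : ∀ x, TrivialNear n E ({x} ×ℂ Set.Icc c d) := by
    intro x
    refine interval_induction (P := fun s t => TrivialNear n E ({x} ×ℂ Set.Icc s t)) hcd ?_ ?_
    · intro y _
      obtain ⟨U, hi, hU, e, he⟩ := h ⟨x, y⟩
      refine ⟨{y' : ℝ | ((⟨x, y'⟩ : ℂ) : P1) ∈ U}, ?_, hU _ rfl, fun s t _ hst => ⟨U, hi, ?_, e, he⟩⟩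
      · refine U.isOpen.preimage (OnePoint.continuous_coe.comp ?_)
        have : (fun y' : ℝ => (⟨x, y'⟩ : ℂ)) = fun y' : ℝ => (x : ℂ) + (y' : ℂ) * Complex.I := by
          funext y'; apply Complex.ext <;> simp
        have hcm : Continuous (fun y' : ℝ => (x : ℂ) + (y' : ℂ) * Complex.I) := by fun_prop
        rw [← this] at hcm
        exact hcm
      · rintro z ⟨hz1, hz2⟩
        have : z = ⟨x, z.im⟩ := Complex.ext hz1 rfl
        rw [this]
        exact hst hz2
    · intro s t u hst htu h1 h2
      -- The map `z ↦ -i z - t` makes the vertical segment horizontal. The common side shrinks to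
      -- the image of the point `x + i t`, hence `c = d = -x`.
      have := h1.union (α := -Complex.I) (β := -(t : ℂ)) (c := -x) (d := -x)
        (neg_ne_zero.2 Complex.I_ne_zero) le_rfl h2 ?_ ?_ ?_
      · refine this.mono ?_
        rintro z ⟨hz1, hz2, hz3⟩
        rcases le_total z.im t with h | h
        · exact Or.inl ⟨hz1, hz2, h⟩
        · exact Or.inr ⟨hz1, h, hz3⟩
      · rintro z ⟨hz1, hz2, hz3⟩
        have hz1 : z.re = x := hz1
        simp [hz1, hz3]
      · rintro z ⟨hz1, hz2, hz3⟩
        have hz1 : z.re = x := hz1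
        simp [hz1, hz2]
      · intro z hz1 hz2 hz3
        simp at hz1 hz2 hz3
        have e1 : z.im = t := by linarith
        have e2 : z.re = x := by linarith
        refine ⟨⟨e2, ?_⟩, e2, ?_⟩ <;> simp [e1, hst, htu]
  refine interval_induction (P := fun s t => TrivialNear n E (Set.Icc s t ×ℂ Set.Icc c d)) hab ?_ ?_
  · intro x _
    obtain ⟨U, hi, hU, e, he⟩ := seg x
    have hc : Continuous (fun p : ℝ × ℝ => (((p.1 : ℂ) + (p.2 : ℂ) * Complex.I : ℂ) : P1)) :=
      OnePoint.continuous_coe.comp (by fun_prop)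
    -- Tube lemma: a frame near a vertical segment is a frame near a thin rectangle around it.
    have ev : ∀ᶠ x' : ℝ in 𝓝 x, ∀ y : ℝ, y ∈ Set.Icc c d → (((x' : ℂ) + (y : ℂ) * Complex.I : ℂ) : P1) ∈ U := by
      refine isCompact_Icc.eventually_forall_of_forall_eventually fun y hy => ?_
      refine hc.continuousAt.eventually (U.isOpen.mem_nhds (hU _ ⟨?_, ?_⟩)) <;> simp [hy.1, hy.2]
    obtain ⟨O, hO, hOo, hxO⟩ := eventually_nhds_iff.1 ev
    refine ⟨O, hOo, hxO, fun s t _ hst => ⟨U, hi, ?_, e, he⟩⟩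
    rintro z ⟨hz1, hz2⟩
    have := hO _ (hst hz1) _ hz2
    rwa [Complex.re_add_im] at this
  · intro s t u hst htu h1 h2
    have := h1.union (α := 1) (β := -(t : ℂ)) (c := c) (d := d) one_ne_zero hcd h2 ?_ ?_ ?_
    · refine this.mono ?_
      rintro z ⟨⟨hz1, hz2⟩, hz3⟩
      rcases le_total z.re t with h | h
      · exact Or.inl ⟨⟨hz1, h⟩, hz3⟩
      · exact Or.inr ⟨⟨h, hz2⟩, hz3⟩
    · rintro z ⟨⟨hz1, hz2⟩, hz3, hz4⟩
      simp [hz2, hz3, hz4]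
    · rintro z ⟨⟨hz1, hz2⟩, hz3, hz4⟩
      simp [hz1, hz3, hz4]
    · intro z hz1 hz2 hz3
      simp at hz1 hz2 hz3
      have e1 : z.re = t := by linarith
      refine ⟨⟨⟨?_, ?_⟩, hz2, hz3⟩, ⟨?_, ?_⟩, hz2, hz3⟩ <;> simp [e1, hst, htu]

/-- A sheaf which has frames near each point of `ℂ` has a frame near the closed unit disc. -/
theorem exists_isFrame_disc [NeZero n]
    (h : ∀ z : ℂ, ∃ (V : Opens P1) (e : Fin n → E.sec V), (z : P1) ∈ V ∧ IsFrame E e) :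
    ∃ D : Opens P1, OnePoint.infty ∉ D ∧ (∀ z : ℂ, ‖z‖ ≤ 1 → (z : P1) ∈ D) ∧
      ∃ e : Fin n → E.sec D, IsFrame E e := by
  have h' : ∀ z : ℂ, TrivialNear n E {z} := by
    intro z
    obtain ⟨V, e, hz, he⟩ := h z
    obtain ⟨V', hV', hz', hi, -⟩ := exists_opens_of_eventually hz (p := fun _ => True) (by simp)
    exact ⟨V', hi, fun w hw => by rw [Set.mem_singleton_iff.1 hw]; exact hz',
      _, he.res_frame hV'⟩
  obtain ⟨D, hi, hD, e, he⟩ := trivialNear_rectangle h' (a := -1) (b := 1) (c := -1) (d := 1)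
    (by norm_num) (by norm_num)
  exact ⟨D, hi, fun z hz => hD z ⟨abs_le.1 ((Complex.abs_re_le_norm z).trans hz),
    abs_le.1 ((Complex.abs_im_le_norm z).trans hz)⟩, e, he⟩

end Trivial

end LoopFlag
end

noncomputable section
namespace LoopFlag

/-! ### Gluing trivial bundles -/

section Glued

variable {n : ℕ} {W₁ W₂ : Opens P1}

/-- Sections over `U` of the bundle with transition matrix `M`. -/
def gluedSec (M : Matrix (Fin n) (Fin n) (Hol (W₁ ⊓ W₂))) (U : Opens P1) :
    AddSubgroup ((Fin n → Hol (U ⊓ W₁)) × (Fin n → Hol (U ⊓ W₂))) where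
  carrier := {x | ∀ (b : Fin n) (y : P1) (hy : y ∈ U) (h₁ : y ∈ W₁) (h₂ : y ∈ W₂),
    (x.1 b).1 ⟨y, hy, h₁⟩ = ∑ a, (M b a).1 ⟨y, h₁, h₂⟩ * (x.2 a).1 ⟨y, hy, h₂⟩}
  zero_mem' := fun b y hy h₁ h₂ => by simp
  add_mem' := by
    intro x x' hx hx' b y hy h₁ h₂
    simp only [Prod.fst_add, Prod.snd_add, Pi.add_apply, Hol.add_val, hx b y hy h₁ h₂,
      hx' b y hy h₁ h₂, mul_add, Finset.sum_add_distrib]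
  neg_mem' := by
    intro x hx b y hy h₁ h₂
    have e : ∀ {U : Opens P1} (f : Hol U) (y : U), (-f).1 y = -f.1 y := fun _ _ => rfl
    simp only [Prod.fst_neg, Prod.snd_neg, Pi.neg_apply, e, hx b y hy h₁ h₂, mul_neg,
      Finset.sum_neg_distrib]

instance gluedModule (M : Matrix (Fin n) (Fin n) (Hol (W₁ ⊓ W₂))) (U : Opens P1) :
    Module (Hol U) (gluedSec M U) where
  smul f x := ⟨(fun b => Hol.res inf_le_left f * x.1.1 b, fun b => Hol.res inf_le_left f * x.1.2 b),
    fun b y hy h₁ h₂ => by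
      simp only [Hol.mul_val, Hol.res_val, x.2 b y hy h₁ h₂, Finset.mul_sum]
      exact Finset.sum_congr rfl fun a _ => mul_left_comm _ _ _⟩
  one_smul x := Subtype.ext (Prod.ext (funext fun b => Hol.ext' fun y hy => one_mul ((x.1.1 b).1 ⟨y, hy⟩))
    (funext fun b => Hol.ext' fun y hy => one_mul ((x.1.2 b).1 ⟨y, hy⟩)))
  mul_smul f g x := Subtype.ext (Prod.ext
    (funext fun b => Hol.ext' fun y hy => mul_assoc (f.1 ⟨y, hy.1⟩) (g.1 ⟨y, hy.1⟩) ((x.1.1 b).1 ⟨y, hy⟩))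
    (funext fun b => Hol.ext' fun y hy => mul_assoc (f.1 ⟨y, hy.1⟩) (g.1 ⟨y, hy.1⟩) ((x.1.2 b).1 ⟨y, hy⟩)))
  smul_zero f := Subtype.ext (Prod.ext
    (funext fun _ => Hol.ext' fun y hy => mul_zero (f.1 ⟨y, hy.1⟩))
    (funext fun _ => Hol.ext' fun y hy => mul_zero (f.1 ⟨y, hy.1⟩)))
  smul_add f x x' := Subtype.ext (Prod.ext
    (funext fun b => Hol.ext' fun y hy =>
      mul_add (f.1 ⟨y, hy.1⟩) ((x.1.1 b).1 ⟨y, hy⟩) ((x'.1.1 b).1 ⟨y, hy⟩))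
    (funext fun b => Hol.ext' fun y hy =>
      mul_add (f.1 ⟨y, hy.1⟩) ((x.1.2 b).1 ⟨y, hy⟩) ((x'.1.2 b).1 ⟨y, hy⟩)))
  add_smul f g x := Subtype.ext (Prod.ext
    (funext fun b => Hol.ext' fun y hy => add_mul (f.1 ⟨y, hy.1⟩) (g.1 ⟨y, hy.1⟩) ((x.1.1 b).1 ⟨y, hy⟩))
    (funext fun b => Hol.ext' fun y hy => add_mul (f.1 ⟨y, hy.1⟩) (g.1 ⟨y, hy.1⟩) ((x.1.2 b).1 ⟨y, hy⟩)))
  zero_smul x := Subtype.ext (Prod.ext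
    (funext fun b => Hol.ext' fun y hy => zero_mul ((x.1.1 b).1 ⟨y, hy⟩))
    (funext fun b => Hol.ext' fun y hy => zero_mul ((x.1.2 b).1 ⟨y, hy⟩)))

/-- The sheaf with transition matrix `M`. -/
def glued (M : Matrix (Fin n) (Fin n) (Hol (W₁ ⊓ W₂))) : OMod where
  sec U := gluedSec M U
  res {U V} h :=
    { toFun := fun x => ⟨(fun b => Hol.res (inf_le_inf_right _ h) (x.1.1 b),
        fun b => Hol.res (inf_le_inf_right _ h) (x.1.2 b)), fun b y hy h₁ h₂ => x.2 b y (h hy) h₁ h₂⟩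
      map_zero' := rfl
      map_add' := fun _ _ => rfl }
  res_smul _ _ _ := rfl
  res_self _ := rfl
  res_res _ _ _ := rfl
  glue {ι} U s hs := by
    have hle : ∀ i (W : Opens P1), U i ⊓ W ≤ (⨆ i, U i) ⊓ W := fun i W =>
      inf_le_inf_right _ (le_iSup U i)
    have hcov : ∀ (W : Opens P1), ∀ x ∈ (⨆ i, U i) ⊓ W, ∃ i, x ∈ U i ⊓ W := fun W x hx => by
      obtain ⟨i, hi⟩ := Opens.mem_iSup.1 hx.1
      exact ⟨i, hi, hx.2⟩
    choose u hu using fun b => Hol.exists_glue (U := (⨆ i, U i) ⊓ W₁) (fun i => U i ⊓ W₁) (hcov W₁)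
      (fun i => hle i W₁) (fun i => (s i).1.1 b) (fun i j x hi hj => by
        have := congrArg (fun t : gluedSec M (U i ⊓ U j) => (t.1.1 b).1 ⟨x, ⟨hi.1, hj.1⟩, hi.2⟩) (hs i j)
        exact this)
    choose v hv using fun b => Hol.exists_glue (U := (⨆ i, U i) ⊓ W₂) (fun i => U i ⊓ W₂) (hcov W₂)
      (fun i => hle i W₂) (fun i => (s i).1.2 b) (fun i j x hi hj => by
        have := congrArg (fun t : gluedSec M (U i ⊓ U j) => (t.1.2 b).1 ⟨x, ⟨hi.1, hj.1⟩, hi.2⟩) (hs i j)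
        exact this)
    refine ⟨⟨(u, v), fun b y hy h₁ h₂ => ?_⟩, fun i => ?_, fun t ht => ?_⟩
    · obtain ⟨i, hi⟩ := Opens.mem_iSup.1 hy
      have e1 : (u b).1 ⟨y, hy, h₁⟩ = ((s i).1.1 b).1 ⟨y, hi, h₁⟩ :=
        congrArg (fun f : Hol (U i ⊓ W₁) => f.1 ⟨y, hi, h₁⟩) (hu b i)
      have e2 : ∀ a, (v a).1 ⟨y, hy, h₂⟩ = ((s i).1.2 a).1 ⟨y, hi, h₂⟩ := fun a =>
        congrArg (fun f : Hol (U i ⊓ W₂) => f.1 ⟨y, hi, h₂⟩) (hv a i)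
      simp only [e1, e2]
      exact (s i).2 b y hi h₁ h₂
    · exact Subtype.ext (Prod.ext (funext fun b => hu b i) (funext fun b => hv b i))
    · refine Subtype.ext (Prod.ext (funext fun b => Hol.ext' fun x hx => ?_)
        (funext fun b => Hol.ext' fun x hx => ?_))
      · obtain ⟨i, hi⟩ := hcov _ x hx
        have e1 := congrArg (fun f : Hol (U i ⊓ W₁) => f.1 ⟨x, hi⟩) (hu b i)
        have e2 := congrArg (fun f : gluedSec M (U i) => (f.1.1 b).1 ⟨x, hi⟩) (ht i)
        exact e2.trans e1.symm
      · obtain ⟨i, hi⟩ := hcov _ x hx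
        have e1 := congrArg (fun f : Hol (U i ⊓ W₂) => f.1 ⟨x, hi⟩) (hv b i)
        have e2 := congrArg (fun f : gluedSec M (U i) => (f.1.2 b).1 ⟨x, hi⟩) (ht i)
        exact e2.trans e1.symm

/-- Existence of the bundle with a given transition matrix. -/
theorem exists_glued (M : Matrix (Fin n) (Fin n) (Hol (W₁ ⊓ W₂))) (hM : IsUnit M.det) :
    ∃ (E : OMod) (e₁ : Fin n → E.sec W₁) (e₂ : Fin n → E.sec W₂), IsFrame E e₁ ∧ IsFrame E e₂ ∧
      ∀ a, E.res inf_le_right (e₂ a) = ∑ b, M b a • E.res inf_le_left (e₁ b) := by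
  have hMN : M * M⁻¹ = 1 := Matrix.mul_nonsing_inv M hM
  have hNM : M⁻¹ * M = 1 := Matrix.nonsing_inv_mul M hM
  have hMN' : ∀ (b c : Fin n) (y : P1) (hy : y ∈ W₁ ⊓ W₂),
      ∑ a, (M b a).1 ⟨y, hy⟩ * (M⁻¹ a c).1 ⟨y, hy⟩ = if b = c then 1 else 0 := by
    intro b c y hy
    have := congrArg (fun f : Hol (W₁ ⊓ W₂) => f.1 ⟨y, hy⟩) (congrFun (congrFun hMN b) c)
    simp only [Matrix.mul_apply, Hol.sum_val, Hol.mul_val, Matrix.one_apply] at this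
    rw [this]
    split_ifs <;> rfl
  have hNM' : ∀ (b c : Fin n) (y : P1) (hy : y ∈ W₁ ⊓ W₂),
      ∑ a, (M⁻¹ b a).1 ⟨y, hy⟩ * (M a c).1 ⟨y, hy⟩ = if b = c then 1 else 0 := by
    intro b c y hy
    have := congrArg (fun f : Hol (W₁ ⊓ W₂) => f.1 ⟨y, hy⟩) (congrFun (congrFun hNM b) c)
    simp only [Matrix.mul_apply, Hol.sum_val, Hol.mul_val, Matrix.one_apply] at this
    rw [this]
    split_ifs <;> rfl
  have ite_val : ∀ {U : Opens P1} (p : Prop) [Decidable p] (x : U),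
      (if p then (1 : Hol U) else 0).1 x = if p then 1 else 0 := by
    intro U p _ x; split_ifs <;> rfl
  -- Standard basis over `W₁`, whose components over `W₂` are forced to be the columns of `M⁻¹`; for
  -- `e₂` the roles are exchanged, with the columns of `M`.
  let e₁ : Fin n → (glued M).sec W₁ := fun a =>
    ⟨(fun b => if b = a then 1 else 0, fun b => M⁻¹ b a), fun b y hy h₁ h₂ => by
      rw [ite_val]; exact (hMN' b a y ⟨h₁, h₂⟩).symm⟩
  let e₂ : Fin n → (glued M).sec W₂ := fun a =>
    ⟨(fun b => Hol.res (le_of_eq (inf_comm _ _)) (M b a), fun b => if b = a then 1 else 0),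
      fun b y hy h₁ h₂ => by
        simp only [ite_val, mul_ite, mul_one, mul_zero, Finset.sum_ite_eq', Finset.mem_univ, if_true]
        rfl⟩
  have sum_fst : ∀ {V W : Opens P1} (h : V ≤ W) (c : Fin n → Hol V) (e : Fin n → (glued M).sec W)
      (b : Fin n) (x : P1) (hx : x ∈ V) (h₁ : x ∈ W₁),
      ((∑ a, c a • (glued M).res h (e a) : (glued M).sec V).1.1 b).1 ⟨x, hx, h₁⟩ =
        ∑ a, (c a).1 ⟨x, hx⟩ * ((e a).1.1 b).1 ⟨x, h hx, h₁⟩ := by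
    intro V W h c e b x hx h₁
    let ψ : (glued M).sec V →+ ℂ :=
      { toFun := fun t => (t.1.1 b).1 ⟨x, hx, h₁⟩
        map_zero' := rfl
        map_add' := fun _ _ => rfl }
    exact map_sum ψ _ _
  have sum_snd : ∀ {V W : Opens P1} (h : V ≤ W) (c : Fin n → Hol V) (e : Fin n → (glued M).sec W)
      (b : Fin n) (x : P1) (hx : x ∈ V) (h₂ : x ∈ W₂),
      ((∑ a, c a • (glued M).res h (e a) : (glued M).sec V).1.2 b).1 ⟨x, hx, h₂⟩ =
        ∑ a, (c a).1 ⟨x, hx⟩ * ((e a).1.2 b).1 ⟨x, h hx, h₂⟩ := by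
    intro V W h c e b x hx h₂
    let ψ : (glued M).sec V →+ ℂ :=
      { toFun := fun t => (t.1.2 b).1 ⟨x, hx, h₂⟩
        map_zero' := rfl
        map_add' := fun _ _ => rfl }
    exact map_sum ψ _ _
  have f₁ : ∀ {V : Opens P1} (h : V ≤ W₁) (c : Fin n → Hol V) (b : Fin n) (x : P1) (hx : x ∈ V),
      ((∑ a, c a • (glued M).res h (e₁ a) : (glued M).sec V).1.1 b).1 ⟨x, hx, h hx⟩ =
        (c b).1 ⟨x, hx⟩ := by
    intro V h c b x hx
    refine (sum_fst h c e₁ b x hx (h hx)).trans ?_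
    simp only [e₁, ite_val, mul_ite, mul_one, mul_zero, Finset.sum_ite_eq, Finset.mem_univ, if_true]
  have f₂ : ∀ {V : Opens P1} (h : V ≤ W₂) (c : Fin n → Hol V) (b : Fin n) (x : P1) (hx : x ∈ V),
      ((∑ a, c a • (glued M).res h (e₂ a) : (glued M).sec V).1.2 b).1 ⟨x, hx, h hx⟩ =
        (c b).1 ⟨x, hx⟩ := by
    intro V h c b x hx
    refine (sum_snd h c e₂ b x hx (h hx)).trans ?_
    simp only [e₂, ite_val, mul_ite, mul_one, mul_zero, Finset.sum_ite_eq, Finset.mem_univ, if_true]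
  have ext_fst : ∀ {V : Opens P1} (_ : V ≤ W₁) {s t : (glued M).sec V},
      (∀ b x (hx : x ∈ V) (h₁ : x ∈ W₁), (s.1.1 b).1 ⟨x, hx, h₁⟩ = (t.1.1 b).1 ⟨x, hx, h₁⟩) →
      s = t := by
    intro V h s t hst
    refine Subtype.ext (Prod.ext (funext fun b => Hol.ext' fun x hx => hst b x hx.1 hx.2)
      (funext fun b => Hol.ext' fun x hx => ?_))
    have key : ∀ r : (glued M).sec V, (r.1.2 b).1 ⟨x, hx⟩ =
        ∑ a, (M⁻¹ b a).1 ⟨x, h hx.1, hx.2⟩ * (r.1.1 a).1 ⟨x, hx.1, h hx.1⟩ := by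
      intro r
      have e1 := fun a => r.2 a x hx.1 (h hx.1) hx.2
      have e2 := fun a => hNM' b a x ⟨h hx.1, hx.2⟩
      simp only [e1, Finset.mul_sum, ← mul_assoc]
      rw [Finset.sum_comm]
      simp only [← Finset.sum_mul, e2, ite_mul, one_mul, zero_mul, Finset.sum_ite_eq,
        Finset.mem_univ, if_true]
    rw [key s, key t]
    exact Finset.sum_congr rfl fun a _ => by rw [hst a x hx.1 (h hx.1)]
  have ext_snd : ∀ {V : Opens P1} (_ : V ≤ W₂) {s t : (glued M).sec V},
      (∀ b x (hx : x ∈ V) (h₂ : x ∈ W₂), (s.1.2 b).1 ⟨x, hx, h₂⟩ = (t.1.2 b).1 ⟨x, hx, h₂⟩) →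
      s = t := by
    intro V h s t hst
    refine Subtype.ext (Prod.ext (funext fun b => Hol.ext' fun x hx => ?_)
      (funext fun b => Hol.ext' fun x hx => hst b x hx.1 hx.2))
    rw [s.2 b x hx.1 hx.2 (h hx.1), t.2 b x hx.1 hx.2 (h hx.1)]
    exact Finset.sum_congr rfl fun a _ => by rw [hst a x hx.1 (h hx.1)]
  refine ⟨glued M, e₁, e₂, fun V h => ⟨fun c c' hcc => ?_, fun s => ?_⟩,
    fun V h => ⟨fun c c' hcc => ?_, fun s => ?_⟩, fun a => ?_⟩
  · funext b
    refine Hol.ext' fun x hx => ?_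
    rw [← f₁ h c b x hx, ← f₁ h c' b x hx]
    exact congrArg (fun t : (glued M).sec V => (t.1.1 b).1 ⟨x, hx, h hx⟩) hcc
  · refine ⟨fun b => Hol.res (le_inf le_rfl h) (s.1.1 b), ext_fst h fun b x hx h₁ => ?_⟩
    exact f₁ h _ b x hx
  · funext b
    refine Hol.ext' fun x hx => ?_
    rw [← f₂ h c b x hx, ← f₂ h c' b x hx]
    exact congrArg (fun t : (glued M).sec V => (t.1.2 b).1 ⟨x, hx, h hx⟩) hcc
  · refine ⟨fun b => Hol.res (le_inf le_rfl h) (s.1.2 b), ext_snd h fun b x hx h₁ => ?_⟩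
    exact f₂ h _ b x hx
  · refine ext_fst inf_le_left fun b x hx h₁ => ?_
    exact (f₁ inf_le_left (fun b => M b a) b x hx).symm

end Glued

/-! ### Sheaves with frames over a cover -/

section Cover

variable {n : ℕ} {E F : OMod}

lemma isLocallyFree_of_cover {W₁ W₂ : Opens P1} (hW : W₁ ⊔ W₂ = ⊤) {e₁ : Fin n → E.sec W₁}
    {e₂ : Fin n → E.sec W₂} (he₁ : IsFrame E e₁) (he₂ : IsFrame E e₂) : IsLocallyFree n E := by
  intro x
  have hx : x ∈ W₁ ⊔ W₂ := by rw [hW]; trivial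
  rcases hx with hx | hx
  · exact ⟨W₁, hx, e₁, he₁⟩
  · exact ⟨W₂, hx, e₂, he₂⟩

lemma IsLocallyFree.isCoherent (h : IsLocallyFree n E) : IsCoherent E := by
  intro x
  obtain ⟨W, hx, e, he⟩ := h x
  refine ⟨W, hx, n, 0, e, fun k => k.elim0, fun V hV t y hy => ?_, fun k => k.elim0,
    fun V hV c hc y hy => ?_⟩
  · exact ⟨V, le_rfl, hV, he.coords hV t, hy, by rw [he.sum_coords, E.res_self]⟩
  · have := (he V hV).1 (a₁ := c) (a₂ := 0) (by simpa using hc)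
    exact ⟨V, le_rfl, fun k => k.elim0, hy, fun i => by simp [this]⟩

lemma IsLocallyFree.isTorsionFree (h : IsLocallyFree n E) : IsTorsionFree E := by
  intro U f s hf hfs
  refine OMod.ext_of_local fun x hx => ?_
  obtain ⟨W, hxW, e, he⟩ := h x
  refine ⟨U ⊓ W, inf_le_left, ⟨hx, hxW⟩, ?_⟩
  rw [map_zero]
  have h1 : Hol.res (inf_le_left : U ⊓ W ≤ U) f • E.res (inf_le_left : U ⊓ W ≤ U) s = 0 := by
    rw [← E.res_smul, hfs, map_zero]
  have h2 := congrArg (he.coords inf_le_right) h1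
  rw [he.coords_smul, he.coords_zero] at h2
  apply he.coords_injective inf_le_right
  rw [he.coords_zero]
  funext a
  exact Hol.eq_zero_of_mul_eq_zero (fun V hV hne => hf V (hV.trans inf_le_left) hne) (congrFun h2 a)

lemma IsLocallyFree.hasRank (h : IsLocallyFree n E) : HasRank n E :=
  ⟨⊤, by simp, fun x _ => h x⟩

variable {W₁ W₂ : Opens P1} (hW : W₁ ⊔ W₂ = ⊤) (hi : OnePoint.infty ∉ W₂)
  {e₁ : Fin n → E.sec W₁} {e₂ : Fin n → E.sec W₂} (he₁ : IsFrame E e₁) (he₂ : IsFrame E e₂)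
  {f₁ : Fin n → F.sec W₁} {f₂ : Fin n → F.sec W₂} (hf₁ : IsFrame F f₁) (hf₂ : IsFrame F f₂)
  {φ : Hom E F} {k : Fin n → ℕ} (hφ₁ : ∀ a, φ.map W₁ (e₁ a) = f₁ a)
  (hφ₂ : ∀ a, φ.map W₂ (e₂ a) = coord W₂ hi ^ k a • f₂ a)

lemma le_sup_inf_of_cover {W₁ W₂ : Opens P1} (hW : W₁ ⊔ W₂ = ⊤) (U : Opens P1) :
    U ≤ U ⊓ W₁ ⊔ U ⊓ W₂ := by rw [← inf_sup_left, hW, inf_top_eq]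

section
variable {hi}

/-- In the inner frames `φ` is a diagonal matrix of powers of the coordinate. Together with the
identity in the outer frames, this is the local model of every inclusion of a chain. -/
lemma Hom.coords_map_of_diag (he₂ : IsFrame E e₂) (hf₂ : IsFrame F f₂)
    (hφ₂ : ∀ a, φ.map W₂ (e₂ a) = coord W₂ hi ^ k a • f₂ a) {V : Opens P1} (h : V ≤ W₂)
    (s : E.sec V) (a : Fin n) : hf₂.coords h (φ.map V s) a =
      coord V (fun h' => hi (h h')) ^ k a * he₂.coords h s a := by
  refine congrFun (hf₂.coords_eq h
    (c := fun a => coord V (fun h' => hi (h h')) ^ k a * he₂.coords h s a) ?_) a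
  rw [φ.map_eq_sum_coords h he₂]
  refine Finset.sum_congr rfl fun a _ => ?_
  rw [hφ₂, F.res_smul, smul_smul, mul_comm, map_pow, res_coord]

include hW he₁ he₂ hf₁ hf₂ hφ₁ hφ₂ in
lemma Hom.injective_of_diag (U : Opens P1) : Function.Injective (φ.map U) := by
  intro s t hst
  refine OMod.ext_of_cover₂ (W₁ := U ⊓ W₁) (W₂ := U ⊓ W₂) inf_le_left inf_le_left
    (le_sup_inf_of_cover hW U) ?_ ?_
  · have hb := φ.bijective_of_isFrame he₁ (by simpa only [hφ₁] using hf₁)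
      (inf_le_right : U ⊓ W₁ ≤ W₁)
    apply hb.1
    rw [φ.naturality, φ.naturality, hst]
  · apply he₂.coords_injective inf_le_right
    funext a
    have h1 : φ.map (U ⊓ W₂) (E.res inf_le_left s) = φ.map (U ⊓ W₂) (E.res inf_le_left t) := by
      rw [φ.naturality, φ.naturality, hst]
    have h2 := congrFun (congrArg (hf₂.coords inf_le_right) h1) a
    rw [φ.coords_map_of_diag he₂ hf₂ hφ₂, φ.coords_map_of_diag he₂ hf₂ hφ₂, ← sub_eq_zero,
      ← mul_sub] at h2
    exact sub_eq_zero.1 (Hol.eq_zero_of_mul_eq_zero (fun V h hV => res_coord_pow_ne_zero _ _ V h hV) h2)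

include hW he₁ he₂ hf₁ hf₂ hφ₁ hφ₂ in
-- Over `W₁` the morphism is an isomorphism, so divisibility of the inner coordinates is the only
-- condition; local preimages glue by injectivity.
lemma Hom.exists_preimage_of_diag {U : Opens P1} (s : F.sec U) (d : Fin n → Hol (U ⊓ W₂))
    (hd : ∀ a, hf₂.coords inf_le_right (F.res (inf_le_left : U ⊓ W₂ ≤ U) s) a =
      coord (U ⊓ W₂) (fun h' => hi h'.2) ^ k a * d a) : ∃ r, φ.map U r = s := by
  refine φ.exists_preimage_of_local
    (Hom.injective_of_diag hW he₁ he₂ hf₁ hf₂ hφ₁ hφ₂) s fun x hx => ?_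
  rcases le_sup_inf_of_cover hW U hx with h | h
  · have hb := φ.bijective_of_isFrame he₁ (by simpa only [hφ₁] using hf₁)
      (inf_le_right : U ⊓ W₁ ≤ W₁)
    exact ⟨U ⊓ W₁, inf_le_left, h, hb.2 _⟩
  · refine ⟨U ⊓ W₂, inf_le_left, h, ∑ a, d a • E.res inf_le_right (e₂ a), ?_⟩
    apply hf₂.coords_injective inf_le_right
    funext a
    rw [φ.coords_map_of_diag he₂ hf₂ hφ₂, he₂.coords_sum, hd]

include hW he₁ he₂ hf₁ hf₂ hφ₁ hφ₂ in
-- With all exponents equal to one, belonging to the image and lying in `I_0 F` both say that the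
-- inner coordinates vanish at the origin.
lemma Hom.exists_preimage_iff_vanishesAtZero (h0 : zero ∈ W₂) (hk : ∀ a, k a = 1) {U : Opens P1}
    (s : F.sec U) : (∃ r, φ.map U r = s) ↔ VanishesAtZero s := by
  constructor
  · rintro ⟨r, rfl⟩ hU
    refine ⟨U ⊓ W₂, inf_le_left, ⟨hU, h0⟩, coord (U ⊓ W₂) (fun h' => hi h'.2),
      ∑ a, he₂.coords inf_le_right (E.res inf_le_left r) a • F.res inf_le_right (f₂ a), rfl, ?_⟩
    rw [← φ.naturality, φ.map_eq_sum_coords inf_le_right he₂, Finset.smul_sum]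
    refine Finset.sum_congr rfl fun a _ => ?_
    rw [hφ₂, hk, pow_one, F.res_smul, smul_smul, smul_smul, mul_comm, res_coord]
  · intro hs
    have : ∀ a, ∃ g, hf₂.coords inf_le_right (F.res (inf_le_left : U ⊓ W₂ ≤ U) s) a =
        coord (U ⊓ W₂) (fun h' => hi h'.2) * g := by
      intro a
      refine Hol.exists_eq_coord_mul (U := U ⊓ W₂) _ _ fun hz => ?_
      obtain ⟨V, hV, hV0, f, u, hf, e⟩ := hs hz.1
      have e' := congrArg (F.res (inf_le_left : V ⊓ W₂ ≤ V)) e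
      rw [F.res_res, F.res_smul] at e'
      have h3 := hf₂.coords_res inf_le_right (inf_le_inf_right W₂ hV)
        (F.res (inf_le_left : U ⊓ W₂ ≤ U) s) a
      rw [F.res_res, e', hf₂.coords_smul] at h3
      have h4 := congrArg (fun f : Hol (V ⊓ W₂) => f.1 ⟨zero, hV0, h0⟩) h3
      refine h4.symm.trans ?_
      rw [Pi.smul_apply, smul_eq_mul, Hol.mul_val, Hol.res_val, hf, zero_mul]
    choose d hd using this
    exact Hom.exists_preimage_of_diag hW he₁ he₂ hf₁ hf₂ hφ₁ hφ₂ s d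
      (fun a => by rw [hk, pow_one, hd])

/-- Evaluation of sections of the skyscraper sheaf. -/
def skyEval {m : ℕ} {U : Opens P1} (h : zero ∈ U) (j : Fin m) : (sky m).sec U →+ ℂ where
  toFun v := v ⟨h⟩ j
  map_zero' := rfl
  map_add' _ _ := rfl

lemma skyEval_smul {m : ℕ} {U : Opens P1} (h : zero ∈ U) (j : Fin m) (f : Hol U)
    (v : (sky m).sec U) : skyEval h j (f • v) = f.1 ⟨zero, h⟩ * skyEval h j v := rfl

lemma sky_ext {m : ℕ} {U : Opens P1} {v w : (sky m).sec U}
    (h : ∀ (h : zero ∈ U) j, skyEval h j v = skyEval h j w) : v = w :=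
  funext fun ⟨k⟩ => funext fun j => h k j

include hW he₁ he₂ hf₁ hf₂ hφ₁ hφ₂ in
-- The quotient map records the values at the origin of the coordinates with exponent one. As no
-- exponent exceeds one, their vanishing is exactly the divisibility that characterises the image.
lemma Hom.quotientIsSky_of_diag (h0 : zero ∈ W₂) (h0' : zero ∉ W₁) (hk : ∀ a, k a ≤ 1) :
    QuotientIsSky φ (∑ a, k a) := by
  let I := {a // k a = 1}
  have hcard : Fintype.card I = ∑ a, k a := by
    rw [Fintype.card_subtype, Finset.card_filter]
    refine Finset.sum_congr rfl fun a _ => ?_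
    have := hk a
    split_ifs <;> omega
  let ι : Fin (∑ a, k a) ≃ I := (Fintype.equivFinOfCardEq hcard).symm
  -- The map has to be zero on the outer frame: sections of the skyscraper sheaf over `W₁` vanish
  -- because `W₁` misses the origin.
  obtain ⟨q, hq₁, hq₂⟩ := Hom.exists_of_frames (F := sky (∑ a, k a)) hW hf₁ hf₂ (fun _ => 0)
    (fun a _ j => if (ι j : Fin n) = a then 1 else 0)
    (fun b => sky_ext fun h => absurd h.1 h0')
  have hqe : ∀ {U : Opens P1} (hU : U ≤ W₂) (hz : zero ∈ U) (s : F.sec U) (j),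
      skyEval hz j (q.map U s) = (hf₂.coords hU s (ι j)).1 ⟨zero, hz⟩ := by
    intro U hU hz s j
    rw [q.map_eq_sum_coords hU hf₂, map_sum]
    simp only [skyEval_smul, hq₂]
    have : ∀ a, skyEval hz j ((sky (∑ a, k a)).res hU
        (fun _ j => if (ι j : Fin n) = a then 1 else 0)) = if (ι j : Fin n) = a then 1 else 0 :=
      fun a => rfl
    simp only [this, mul_ite, mul_one, mul_zero, Finset.sum_ite_eq, Finset.mem_univ, if_true]
  have hqe' : ∀ {U : Opens P1} (hz : zero ∈ U) (s : F.sec U) (j), skyEval hz j (q.map U s) =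
      (hf₂.coords (inf_le_right : U ⊓ W₂ ≤ W₂) (F.res inf_le_left s) (ι j)).1 ⟨zero, hz, h0⟩ := by
    intro U hz s j
    rw [← hqe inf_le_right ⟨hz, h0⟩, q.naturality]
    rfl
  refine ⟨q, fun U s => ⟨fun hs => ?_, ?_⟩, fun U v x hx => ?_⟩
  · have : ∀ a, ∃ d : Hol (U ⊓ W₂), hf₂.coords inf_le_right (F.res (inf_le_left : U ⊓ W₂ ≤ U) s) a =
        coord (U ⊓ W₂) (fun h' => hi h'.2) ^ k a * d := by
      intro a
      rcases Nat.le_one_iff_eq_zero_or_eq_one.1 (hk a) with h | h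
      · exact ⟨_, by rw [h, pow_zero, one_mul]⟩
      · rw [h, pow_one]
        refine Hol.exists_eq_coord_mul (U := U ⊓ W₂) _ _ fun hz => ?_
        have := hqe' hz.1 s (ι.symm ⟨a, h⟩)
        rw [hs, map_zero, Equiv.apply_symm_apply] at this
        exact this.symm
    choose d hd using this
    exact Hom.exists_preimage_of_diag hW he₁ he₂ hf₁ hf₂ hφ₁ hφ₂ s d hd
  · rintro ⟨r, rfl⟩
    refine sky_ext fun hz j => ?_
    rw [hqe', ← φ.naturality, φ.coords_map_of_diag he₂ hf₂ hφ₂, map_zero, (ι j).2, pow_one]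
    exact zero_mul _
  · by_cases hxz : x = zero
    · subst hxz
      refine ⟨U ⊓ W₂, inf_le_left, ∑ a, algebraMap ℂ (Hol (U ⊓ W₂))
        (if h : k a = 1 then v ⟨hx⟩ (ι.symm ⟨a, h⟩) else 0) • F.res inf_le_right (f₂ a),
        ⟨hx, h0⟩, sky_ext fun hz j => ?_⟩
      rw [hqe inf_le_right, hf₂.coords_sum, Hol.algebraMap_val, dif_pos (ι j).2]
      simp only [Subtype.coe_eta, Equiv.symm_apply_apply]
      rfl
    · exact ⟨U ⊓ ⟨{zero}ᶜ, isClosed_singleton.isOpen_compl⟩, inf_le_left, 0, ⟨hx, hxz⟩,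
        sky_ext fun hz => absurd rfl hz.2⟩

end

end Cover

end LoopFlag
end

noncomputable section
namespace LoopFlag

/-! ### The chain of a loop -/

/-! ### Positions in the chain and exponents of the frames. -/

section Idx

variable {n : ℕ} {Δ : Finset ℕ}

lemma Idx.one_le_j (p : Idx n Δ) : 1 ≤ p.j := (Finset.mem_Icc.1 (Finset.mem_sdiff.1 p.mem).1).1
lemma Idx.j_le (p : Idx n Δ) : p.j ≤ n := (Finset.mem_Icc.1 (Finset.mem_sdiff.1 p.mem).1).2

lemma Idx.i_le {p q : Idx n Δ} (h : p.pos ≤ q.pos) : p.i ≤ q.i := by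
  by_contra hlt
  have h1 : (n : ℤ) * (q.i + 1) ≤ n * p.i := mul_le_mul_of_nonneg_left (by omega) (by positivity)
  have h2 := p.one_le_j
  have h3 := q.j_le
  simp only [Idx.pos] at h
  rw [mul_add] at h1
  omega

/-- A larger sheaf admits more poles. Since `1 ≤ j ≤ n`, comparing positions means comparing `i`
first and then `j`. -/
lemma expo_le {p q : Idx n Δ} (h : p.pos ≤ q.pos) (a : Fin n) : expo q a ≤ expo p a := by
  have h1 := Idx.i_le h
  rcases eq_or_lt_of_le h1 with h2 | h2
  · simp only [Idx.pos, h2] at h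
    simp only [expo, h2]
    split_ifs <;> omega
  · simp only [expo]
    split_ifs <;> omega

/-- `(i, j) ↦ (i + 1, j)`. -/
def Idx.succ (p : Idx n Δ) : Idx n Δ := ⟨p.i + 1, p.j, p.mem⟩

lemma Idx.pos_succ (p : Idx n Δ) : p.succ.pos = p.pos + n := by
  simp only [Idx.pos, Idx.succ]; ring

lemma Idx.pos_pred (p : Idx n Δ) : p.pred.pos = p.pos - n := by
  simp only [Idx.pos, Idx.pred]; ring

lemma expo_succ (p : Idx n Δ) (a : Fin n) : expo p.succ a = expo p a - 1 := by
  have h : p.succ.j = p.j := rfl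
  have h' : p.succ.i = p.i + 1 := rfl
  simp only [expo, h, h']; split_ifs <;> ring

lemma expo_pred (p : Idx n Δ) (a : Fin n) : expo p.pred a = expo p a + 1 := by
  have h : p.pred.j = p.j := rfl
  have h' : p.pred.i = p.i - 1 := rfl
  simp only [expo, h, h']; split_ifs <;> ring

lemma expo_le_add_one {p q : Idx n Δ} (h : q.pos ≤ p.pos + n) (a : Fin n) :
    expo p a ≤ expo q a + 1 := by
  have := expo_le (p := q) (q := p.succ) (by rw [Idx.pos_succ]; exact h) a
  rw [expo_succ] at this
  omega

/-- This count governs both the lengths of the skyscraper quotients and the degree `n (i - 1) + j -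
w`. -/
lemma sum_expo (p : Idx n Δ) : ∑ a, expo p a = n - p.pos := by
  have h : ∀ a : Fin n, expo p a = (1 - p.i) - if (a : ℕ) < p.j then 1 else 0 := by
    intro a; simp only [expo]; split_ifs <;> omega
  simp only [h, Finset.sum_sub_distrib, Finset.sum_const, Finset.card_univ, Fintype.card_fin,
    Finset.sum_boole, nsmul_eq_mul, Idx.pos]
  have : (Finset.univ.filter fun a : Fin n => (a : ℕ) < p.j).card = p.j := by
    rw [Fin.card_filter_val_lt, min_eq_right p.j_le]
  rw [this]
  ring

lemma sum_toNat_expo {p q : Idx n Δ} (h : p.pos ≤ q.pos) :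
    ∑ a, (expo p a - expo q a).toNat = (q.pos - p.pos).toNat := by
  have : ∀ a, ((expo p a - expo q a).toNat : ℤ) = expo p a - expo q a := fun a =>
    Int.toNat_of_nonneg (by have := expo_le h a; omega)
  rw [← Nat.cast_inj (R := ℤ), Int.toNat_of_nonneg (by omega), Nat.cast_sum]
  simp only [this, Finset.sum_sub_distrib, sum_expo]
  ring

/-- The index `p.succ` lies `n` positions further on. Consequently the exponents of successive
sheaves differ by at most one. -/
lemma Idx.le_add_of_consecutive {p q : Idx n Δ}
    (hr : ∀ r : Idx n Δ, ¬ (p.pos < r.pos ∧ r.pos < q.pos)) : q.pos ≤ p.pos + n := by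
  by_contra h
  have hn : 1 ≤ n := p.one_le_j.trans p.j_le
  exact hr p.succ (by rw [Idx.pos_succ]; omega)

end Idx

/-! ### Extension of loops to an annulus and construction of the chain of a loop. -/

section Loop

variable {n : ℕ}

/-- Evaluation of loops. -/
def Loop.eval (z : Circle) : Loop →+* ℂ where
  toFun f := f.1 z
  map_one' := rfl
  map_mul' _ _ := rfl
  map_zero' := rfl
  map_add' _ _ := rfl

lemma LoopGL.isUnit_eval (g : LoopGL n) (z : Circle) : IsUnit (g.1.map (Loop.eval z)) := by
  have := g.isUnit.map (Loop.eval z).mapMatrix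
  exact this

/-- Extension of a loop to a neighbourhood of the circle. -/
lemma LoopGL.exists_extension (g : LoopGL n) :
    ∃ (S : Set ℂ) (G : ℂ → Matrix (Fin n) (Fin n) ℂ), IsOpen S ∧ (∀ z : Circle, (z : ℂ) ∈ S) ∧
      (∀ z ∈ S, z ≠ 0 ∧ (∀ a b, AnalyticAt ℂ (fun w => G w a b) z) ∧ IsUnit (G z)) ∧
      ∀ (z : Circle) a b, G z a b = (g.1 a b).1 z := by
  choose F hF hg using fun a b => (g.1 a b).2
  let G : ℂ → Matrix (Fin n) (Fin n) ℂ := fun z a b => F a b z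
  have hG : ∀ z : Circle, G z = g.1.map (Loop.eval z) := fun z => by
    ext a b; exact (hg a b z).symm
  let P : ℂ → Prop := fun z => z ≠ 0 ∧ (∀ a b, AnalyticAt ℂ (fun w => G w a b) z) ∧ IsUnit (G z)
  refine ⟨{z | ∀ᶠ w in 𝓝 z, P w}, G, isOpen_setOfPred_eventually_nhds, fun z => ?_,
    fun z hz => hz.self_of_nhds, fun z a b => (hg a b z).symm⟩
  have han : ∀ a b, AnalyticAt ℂ (fun w => G w a b) z := fun a b => hF a b z (mem_sphere_zero_iff_norm.2 z.norm_coe)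
  refine Filter.Eventually.and (isOpen_ne.mem_nhds z.coe_ne_zero) ?_
  refine (Filter.eventually_all.2 fun a => Filter.eventually_all.2 fun b =>
    (han a b).eventually_analyticAt).and ?_
  have hdet : ContinuousAt (fun w => (G w).det) z := by
    simp only [Matrix.det_apply]
    refine tendsto_finsetSum _ fun σ _ => Filter.Tendsto.const_smul ?_ _
    exact tendsto_finsetProd _ fun i _ => (han _ _).continuousAt
  have h0 : (G z).det ≠ 0 := by
    rw [hG]; exact ((Matrix.isUnit_iff_isUnit_det _).1 (g.isUnit_eval z)).ne_zero
  filter_upwards [hdet.eventually_ne h0] with w hw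
  exact (Matrix.isUnit_iff_isUnit_det _).2 hw.isUnit

/-- The standard cover of the sphere by neighbourhoods of two discs with intersection contained in
a given neighbourhood of the circle. -/
lemma exists_cover {S : Set ℂ} (hS : IsOpen S) (hc : ∀ z : Circle, (z : ℂ) ∈ S) (h0 : 0 ∉ S) :
    ∃ W₁ W₂ : Opens P1, W₁ ⊔ W₂ = ⊤ ∧ outerDisc ⊆ W₁ ∧ zero ∉ W₁ ∧ OnePoint.infty ∉ W₂ ∧
      (∀ z : ℂ, ‖z‖ ≤ 1 → (z : P1) ∈ W₂) ∧ ∀ z : ℂ, (z : P1) ∈ W₁ ⊓ W₂ → z ∈ S := by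
  have hcl : IsClosed ((↑) '' Metric.closedBall (0 : ℂ) 1 : Set P1) :=
    ((isCompact_closedBall (0 : ℂ) 1).image OnePoint.continuous_coe).isClosed
  have hc' : ∀ z : ℂ, ‖z‖ = 1 → z ∈ S := fun z hz => hc ⟨z, mem_sphere_zero_iff_norm.2 hz⟩
  let W₁ : Opens P1 := opensOf S hS ⊔ ⟨_, hcl.isOpen_compl⟩
  let W₂ : Opens P1 := opensOf (S ∪ Metric.ball 0 1) (hS.union Metric.isOpen_ball)
  have m₁ : ∀ z : ℂ, (z : P1) ∈ W₁ ↔ z ∈ S ∨ 1 < ‖z‖ := by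
    intro z
    have : (z : P1) ∈ ((↑) '' Metric.closedBall (0 : ℂ) 1 : Set P1) ↔ z ∈ Metric.closedBall (0 : ℂ) 1 :=
      OnePoint.coe_injective.mem_set_image
    rw [mem_closedBall_zero_iff] at this
    refine (or_congr coe_mem_opensOf ((not_congr this).trans not_le) :)
  have m₂ : ∀ z : ℂ, (z : P1) ∈ W₂ ↔ z ∈ S ∨ ‖z‖ < 1 := by
    intro z
    refine coe_mem_opensOf.trans ?_
    rw [Set.mem_union, mem_ball_zero_iff]
  have mi : OnePoint.infty ∈ W₁ := by
    refine Or.inr ?_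
    rintro ⟨w, _, hw⟩
    exact OnePoint.coe_ne_infty w hw
  refine ⟨W₁, W₂, ?_, ?_, ?_, infty_notMem_opensOf, ?_, ?_⟩
  · refine eq_top_iff.2 fun x _ => ?_
    induction x using OnePoint.rec with
    | infty => exact Or.inl mi
    | coe z =>
      rcases lt_trichotomy ‖z‖ 1 with h | h | h
      · exact Or.inr ((m₂ z).2 (Or.inr h))
      · exact Or.inr ((m₂ z).2 (Or.inl (hc' z h)))
      · exact Or.inl ((m₁ z).2 (Or.inr h))
  · intro x hx
    induction x using OnePoint.rec with
    | infty => exact mi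
    | coe z =>
      rcases (hx z rfl).eq_or_lt with h | h
      · exact (m₁ z).2 (Or.inl (hc' z h.symm))
      · exact (m₁ z).2 (Or.inr h)
  · intro h
    rcases (m₁ 0).1 h with h | h
    · exact h0 h
    · simp at h
      linarith
  · intro z hz
    rcases hz.eq_or_lt with h | h
    · exact (m₂ z).2 (Or.inl (hc' z h))
    · exact (m₂ z).2 (Or.inr h)
  · rintro z ⟨h1, h2⟩
    rcases (m₁ z).1 h1 with h | h
    · exact h
    · rcases (m₂ z).1 h2 with h' | h'
      · exact h'
      · linarith

/-- Every loop is the transition function of a chain. -/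
theorem exists_chain {Δ : Finset ℕ} (g : LoopGL n) : ∃ c : Chain n Δ, c.HasTransition g := by
  obtain ⟨S, G, hS, hcS, hSG, hGg⟩ := g.exists_extension
  obtain ⟨W₁, W₂, hW, hout, h01, hi, hdisc, hS12⟩ := exists_cover hS hcS fun h => (hSG 0 h).1 rfl
  have hi' : OnePoint.infty ∉ W₁ ⊓ W₂ := fun h => hi h.2
  have h02 : zero ∈ W₂ := hdisc 0 (by simp)
  -- The columns of `g` are multiplied by the powers of `z` which define the frame of `E p` near the
  -- origin.
  let M : Idx n Δ → Matrix (Fin n) (Fin n) (Hol (W₁ ⊓ W₂)) := fun p =>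
    holMatrix _ hi' (fun z => G z * Matrix.diagonal fun a => z ^ expo p a) fun z hz a b => by
      simp only [Matrix.mul_diagonal]
      exact ((hSG z (hS12 z hz)).2.1 a b).fun_mul
        (analyticAt_id.fun_zpow (hSG z (hS12 z hz)).1)
  have hM : ∀ p, IsUnit (M p).det := fun p => isUnit_holMatrix_det fun z hz => by
    refine (hSG z (hS12 z hz)).2.2.mul ?_
    rw [Matrix.isUnit_iff_isUnit_det, Matrix.det_diagonal, isUnit_iff_ne_zero]
    exact Finset.prod_ne_zero_iff.2 fun a _ => zpow_ne_zero _ (hSG z (hS12 z hz)).1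
  have hMv : ∀ p b a (z : ℂ) (hz : (z : P1) ∈ W₁ ⊓ W₂),
      (M p b a).1 ⟨z, hz⟩ = G z b a * z ^ expo p a := by
    intro p b a z hz
    exact Matrix.mul_diagonal _ _ _ _
  choose E e₁ e₂ he₁ he₂ hE using fun p => exists_glued (M p) (hM p)
  -- Identity outside, powers of `z` inside: these agree on the overlap because `M p` is `M q` times
  -- the diagonal matrix of the powers `z ^ (expo p a - expo q a)`.
  have hinc : ∀ p q : Idx n Δ, p.pos ≤ q.pos → ∃ φ : Hom (E p) (E q),
      (∀ a, φ.map W₁ (e₁ p a) = e₁ q a) ∧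
      ∀ a, φ.map W₂ (e₂ p a) = coord W₂ hi ^ (expo p a - expo q a).toNat • e₂ q a := by
    intro p q h
    refine Hom.exists_of_frames hW (he₁ p) (he₂ p) _ _ fun b => ?_
    rw [(he₁ p).coords_eq inf_le_left (hE p b), (E q).res_smul, hE q b, Finset.smul_sum]
    refine Finset.sum_congr rfl fun a _ => ?_
    rw [smul_smul]
    congr 1
    refine Hol.ext_coe hi' fun z hz => ?_
    rw [hMv, Hol.mul_val, hMv, map_pow, res_coord, Hol.pow_val, coord_coe]
    have := expo_le h b
    have hz0 := (hSG z (hS12 z hz)).1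
    rw [mul_left_comm, ← zpow_natCast, ← zpow_add₀ hz0, Int.toNat_of_nonneg (by omega),
      sub_add_cancel]
  choose φ hφ₁ hφ₂ using hinc
  have hlf : ∀ p, IsLocallyFree n (E p) := fun p => isLocallyFree_of_cover hW (he₁ p) (he₂ p)
  refine ⟨{
    E := E
    coherent := fun p => (hlf p).isCoherent
    torsionFree := fun p => (hlf p).isTorsionFree
    rank := fun p => (hlf p).hasRank
    framing := fun p => ⟨W₁, hout, e₁ p, he₁ p⟩
    incl := φ
    incl_injective := fun p q h =>
      Hom.injective_of_diag hW (he₁ p) (he₂ p) (he₁ q) (he₂ q) (hφ₁ p q h) (hφ₂ p q h)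
    incl_self := fun p U s => by
      refine Hom.map_congr_of_frames (g := Hom.id _) hW (he₁ p) (he₂ p) ?_ ?_ U s
      · intro a; rw [hφ₁]; rfl
      · intro a; rw [hφ₂]; simp [Hom.id]
    incl_incl := fun p q r h h' U s => by
      refine Hom.map_congr_of_frames (f := (φ p q h).comp (φ q r h')) hW (he₁ p) (he₂ p) ?_ ?_ U s
      · intro a
        change (φ q r h').map _ ((φ p q h).map _ _) = _
        rw [hφ₁, hφ₁, hφ₁]
      · intro a
        change (φ q r h').map _ ((φ p q h).map _ _) = _
        rw [hφ₂, map_smul, hφ₂, hφ₂, smul_smul, ← pow_add]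
        have h1 := expo_le h a
        have h2 := expo_le h' a
        congr 2
        omega
    incl_framing := fun p q h => ⟨W₁, le_rfl, le_rfl, hout, fun a => by
      rw [(φ p q h).naturality, hφ₁]⟩
    quotient := fun p q h hr => by
      have := Hom.quotientIsSky_of_diag hW (he₁ p) (he₂ p) (he₁ q) (he₂ q) (hφ₁ p q h.le)
        (hφ₂ p q h.le) h02 h01 (fun a => by
          have := expo_le_add_one (Idx.le_add_of_consecutive hr) a
          omega)
      rwa [sum_toNat_expo h.le] at this
    periodic := fun p U s => by
      refine Hom.exists_preimage_iff_vanishesAtZero hW (he₁ _) (he₂ _) (he₁ p) (he₂ p)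
        (hφ₁ _ p p.pred_le) (hφ₂ _ p p.pred_le) h02 (fun a => ?_) s
      rw [expo_pred, add_sub_cancel_left]
      rfl }, ?_⟩
  have hcirc : ∀ z : Circle, ((z : ℂ) : P1) ∈ W₁ ⊓ W₂ := fun z =>
    ⟨hout fun w hw => by rw [← OnePoint.coe_injective hw, z.norm_coe], hdisc _ z.norm_coe.le⟩
  refine ⟨W₂, hi, e₂, hdisc, he₂, fun p q h a => hφ₂ p q h a, fun p =>
    ⟨W₁ ⊓ W₂, inf_le_right, inf_le_left, hcirc, M p, fun b a z => ?_, hE p⟩⟩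
  rw [hMv, hGg, mul_comm]

end Loop

end LoopFlag
end

noncomputable section
namespace LoopFlag

/-! ### Fibres and frames -/

section Fibre

variable {n : ℕ} {E F : OMod}

/-- The class of a section in the fibre at the origin. -/
def fibreClass (E : OMod) {U : Opens P1} (h : zero ∈ U) : E.sec U →ₗ[ℂ] Fibre E :=
  (maxIdealMul E).mkQ.comp (germ E (OrderDual.toDual ⟨U, h⟩))

lemma exists_fibreClass_eq (x : Fibre E) : ∃ (U : Opens P1) (h : zero ∈ U) (s : E.sec U),
    fibreClass E h s = x :=
  Fibre.induction (P := fun x => ∃ (U : Opens P1) (h : zero ∈ U) (s : E.sec U),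
    fibreClass E h s = x) (fun U s => ⟨_, (OrderDual.ofDual U).2, s, rfl⟩) x

lemma fibreClass_res {U V : Opens P1} (h : V ≤ U) (hV : zero ∈ V) (s : E.sec U) :
    fibreClass E hV (E.res h s) = fibreClass E (h hV) s := by
  classical
  refine congrArg (maxIdealMul E).mkQ ?_
  exact Module.DirectLimit.of_f (R := ℂ) (ι := Nhd0) (G := E.sec0) (f := E.res0)
    (i := OrderDual.toDual ⟨U, h hV⟩) (j := OrderDual.toDual ⟨V, hV⟩) (hij := h) (x := s)

lemma Hom.fibreMap_fibreClass (f : Hom E F) {U : Opens P1} (h : zero ∈ U) (s : E.sec U) :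
    f.fibreMap (fibreClass E h s) = fibreClass F h (f.map U s) :=
  f.fibreMap_mk (OrderDual.toDual ⟨U, h⟩) s

lemma fibreClass_smul_eq_zero {U : Opens P1} (h : zero ∈ U) {f : Hol U} (hf : f.1 ⟨zero, h⟩ = 0)
    (s : E.sec U) : fibreClass E h (f • s) = 0 :=
  (Submodule.Quotient.mk_eq_zero _).2 (Submodule.subset_span ⟨OrderDual.toDual ⟨U, h⟩, f, s, hf, rfl⟩)

lemma VanishesAtZero.fibreClass_eq_zero {U : Opens P1} (h : zero ∈ U) {s : E.sec U}
    (hs : VanishesAtZero s) : fibreClass E h s = 0 := by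
  obtain ⟨V, hV, h0, f, u, hf, e⟩ := hs h
  rw [← fibreClass_res hV h0, e, fibreClass_smul_eq_zero h0 hf]

/-- The fibre at the origin has a basis given by a frame. -/
lemma IsFrame.exists_fibreEquiv {D : Opens P1} {e : Fin n → E.sec D} (he : IsFrame E e)
    (h0 : zero ∈ D) : ∃ ψ : Fibre E ≃ₗ[ℂ] (Fin n → ℂ), ∀ (U : Opens P1) (hU : zero ∈ U)
      (hUD : U ≤ D) (s : E.sec U) (a : Fin n),
      ψ (fibreClass E hU s) a = (he.coords hUD s a).1 ⟨zero, hU⟩ := by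
  classical
  -- Restricting to `U ⊓ D` first gives a functional on the sections over every neighbourhood of the
  -- origin, as the direct limit requires.
  let κ : ∀ U : Nhd0, E.sec0 U →ₗ[ℂ] (Fin n → ℂ) := fun U =>
    { toFun := fun s a => (he.coords (inf_le_right : (OrderDual.ofDual U).1 ⊓ D ≤ D)
        (E.res inf_le_left s) a).1 ⟨zero, (OrderDual.ofDual U).2, h0⟩
      map_add' := fun s t => by
        funext a
        rw [map_add, he.coords_add]
        rfl
      map_smul' := fun r s => by
        funext a
        have : E.res (inf_le_left : (OrderDual.ofDual U).1 ⊓ D ≤ _) (r • s) =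
          algebraMap ℂ (Hol ((OrderDual.ofDual U).1 ⊓ D)) r • E.res inf_le_left s :=
          E.res_smul _ (algebraMap ℂ _ r) s
        rw [this, he.coords_smul]
        rfl }
  have hκ : ∀ (U : Nhd0) (hUD : (OrderDual.ofDual U).1 ≤ D) (s : E.sec0 U) a,
      κ U s a = (he.coords hUD s a).1 ⟨zero, (OrderDual.ofDual U).2⟩ := by
    intro U hUD s a
    have := he.coords_res hUD (inf_le_left : (OrderDual.ofDual U).1 ⊓ D ≤ _) s a
    exact congrArg (fun f : Hol ((OrderDual.ofDual U).1 ⊓ D) =>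
      f.1 ⟨zero, (OrderDual.ofDual U).2, h0⟩) this
  let Λ : Stalk E →ₗ[ℂ] (Fin n → ℂ) := Module.DirectLimit.lift ℂ Nhd0 E.sec0 E.res0 κ (by
    intro U V h s
    funext a
    have h' : (OrderDual.ofDual V).1 ≤ (OrderDual.ofDual U).1 := h
    have h1 := he.coords_res (inf_le_right : (OrderDual.ofDual U).1 ⊓ D ≤ D)
      (inf_le_inf_right D h') (E.res inf_le_left s) a
    rw [E.res_res] at h1
    have h2 : κ V (E.res h' s) a = κ U s a := by
      change (he.coords (inf_le_right : (OrderDual.ofDual V).1 ⊓ D ≤ D)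
        (E.res inf_le_left (E.res h' s)) a).1 _ = _
      rw [E.res_res]
      exact congrArg (fun f : Hol ((OrderDual.ofDual V).1 ⊓ D) =>
        f.1 ⟨zero, (OrderDual.ofDual V).2, h0⟩) h1
    exact h2)
  have hΛ : ∀ U s, Λ (germ E U s) = κ U s := fun U s => Module.DirectLimit.lift_of _ _ _
  have hker : maxIdealMul E ≤ LinearMap.ker Λ := by
    refine Submodule.span_le.2 ?_
    rintro x ⟨U, f, s, hf, rfl⟩
    rw [SetLike.mem_coe, LinearMap.mem_ker, hΛ]
    funext a
    change (he.coords (inf_le_right : (OrderDual.ofDual U).1 ⊓ D ≤ D)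
        (E.res inf_le_left (f • s)) a).1 _ = 0
    rw [E.res_smul, he.coords_smul, Pi.smul_apply, smul_eq_mul]
    exact mul_eq_zero_of_left hf _
  let ψ : Fibre E →ₗ[ℂ] (Fin n → ℂ) := (maxIdealMul E).liftQ Λ hker
  have hψ : ∀ (U : Opens P1) (hU : zero ∈ U) (hUD : U ≤ D) (s : E.sec U) (a : Fin n),
      ψ (fibreClass E hU s) a = (he.coords hUD s a).1 ⟨zero, hU⟩ := by
    intro U hU hUD s a
    have : ψ (fibreClass E hU s) = κ (OrderDual.toDual ⟨U, hU⟩) s := hΛ (OrderDual.toDual ⟨U, hU⟩) s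
    rw [this]
    exact hκ (OrderDual.toDual ⟨U, hU⟩) hUD s a
  refine ⟨LinearEquiv.ofBijective ψ ⟨?_, fun v => ?_⟩, hψ⟩
  · refine (injective_iff_map_eq_zero ψ).2 fun x hx => ?_
    obtain ⟨U, hU, s, rfl⟩ := exists_fibreClass_eq x
    have hUD : zero ∈ U ⊓ D := ⟨hU, h0⟩
    rw [← fibreClass_res inf_le_left hUD] at hx ⊢
    rw [← he.sum_coords inf_le_right (E.res (inf_le_left : U ⊓ D ≤ U) s), map_sum]
    -- A section whose coordinates vanish at the origin is a combination of frame vectors with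
    -- coefficients in the maximal ideal, hence zero in the fibre.
    refine Finset.sum_eq_zero fun a _ => fibreClass_smul_eq_zero hUD ?_ _
    rw [← hψ _ hUD inf_le_right, hx]
    rfl
  · refine ⟨fibreClass E h0 (∑ a, algebraMap ℂ (Hol D) (v a) • E.res le_rfl (e a)), ?_⟩
    funext a
    rw [hψ D h0 le_rfl, he.coords_sum]
    rfl

lemma IsFrame.coords_eq_zero_of_fibreClass {D : Opens P1} {e : Fin n → E.sec D} (he : IsFrame E e)
    (h0 : zero ∈ D) {U : Opens P1} (hU : zero ∈ U) (hUD : U ≤ D) {s : E.sec U}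
    (hs : fibreClass E hU s = 0) (a : Fin n) : (he.coords hUD s a).1 ⟨zero, hU⟩ = 0 := by
  obtain ⟨ψ, hψ⟩ := he.exists_fibreEquiv h0
  rw [← hψ U hU hUD, hs, map_zero]
  rfl

lemma IsFrame.vanishesAtZero {D : Opens P1} {e : Fin n → E.sec D} (he : IsFrame E e)
    (hi : OnePoint.infty ∉ D) {U : Opens P1} (hUD : U ≤ D) {s : E.sec U}
    (hs : ∀ (hU : zero ∈ U) a, (he.coords hUD s a).1 ⟨zero, hU⟩ = 0) : VanishesAtZero s := by
  intro hU
  choose g hg using fun a => Hol.exists_eq_coord_mul (fun h => hi (hUD h)) (he.coords hUD s a)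
    (fun h => hs h a)
  refine ⟨U, le_rfl, hU, coord U (fun h => hi (hUD h)), ∑ a, g a • E.res hUD (e a), rfl, ?_⟩
  rw [E.res_self]
  conv_lhs => rw [← he.sum_coords hUD s]
  simp only [Finset.smul_sum, smul_smul, ← hg]

lemma IsFrame.linearIndependent_fibreClass {D : Opens P1} {e : Fin n → E.sec D} (he : IsFrame E e)
    (h0 : zero ∈ D) : LinearIndependent ℂ (fun a => fibreClass E h0 (e a)) := by
  obtain ⟨ψ, hψ⟩ := he.exists_fibreEquiv h0
  have : (fun a => ψ (fibreClass E h0 (e a))) = fun a => Pi.single a (1 : ℂ) := by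
    funext b a
    have h1 := he.coords_frame (le_refl D) b a
    rw [E.res_self] at h1
    rw [hψ D h0 le_rfl, h1, Pi.single_apply]
    split_ifs <;> rfl
  refine LinearIndependent.of_comp ψ.toLinearMap ?_
  have h2 := (Pi.basisFun ℂ (Fin n)).linearIndependent
  have h3 : (⇑(Pi.basisFun ℂ (Fin n)) : Fin n → Fin n → ℂ) = fun a => Pi.single a (1 : ℂ) := by
    funext a; simp
  rw [h3, ← this] at h2
  exact h2

lemma IsFrame.finrank_fibre {D : Opens P1} {e : Fin n → E.sec D} (he : IsFrame E e)
    (h0 : zero ∈ D) : Module.finrank ℂ (Fibre E) = n ∧ FiniteDimensional ℂ (Fibre E) := by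
  obtain ⟨ψ, -⟩ := he.exists_fibreEquiv h0
  exact ⟨by rw [ψ.finrank_eq, Module.finrank_fin_fun], ψ.symm.finiteDimensional⟩

/-- A basis adapted to a flag. -/
lemma exists_adapted_basis {V : Type*} [AddCommGroup V] [Module ℂ V] [FiniteDimensional ℂ V] {ι : Type*}
    (U : ι → Submodule ℂ V) (d : ι → ℕ) (hd : ∀ i, Module.finrank ℂ (U i) = d i)
    (hmono : ∀ i j, d i ≤ d j → U i ≤ U j) {m : ℕ} (hm : m ≤ Module.finrank ℂ V) :
    ∃ v : Fin m → V, LinearIndependent ℂ v ∧ ∀ i (t : Fin m), (t : ℕ) < d i → v t ∈ U i := by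
  induction m with
  | zero => exact ⟨Fin.elim0, linearIndependent_empty_type, fun i t => t.elim0⟩
  | succ m ih =>
    obtain ⟨v, hv, hvU⟩ := ih (by omega)
    have hspan : Module.finrank ℂ (Submodule.span ℂ (Set.range v)) = m := by
      rw [finrank_span_eq_card hv, Fintype.card_fin]
    -- The next vector is taken from the smallest member of the flag of dimension greater than `m`,
    -- or from `V` if there is none. This member lies in all the larger ones, and it is too big for
    -- the span of the vectors already chosen.
    have key : ∃ W : Submodule ℂ V, m < Module.finrank ℂ W ∧ ∀ i, m < d i → W ≤ U i := by
      by_cases h : ∃ k, ∃ i, m < d i ∧ d i = k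
      · classical
        obtain ⟨i, hi, hik⟩ := Nat.find_spec h
        refine ⟨U i, by rw [hd]; exact hi, fun j hj => hmono i j ?_⟩
        rw [hik]
        exact Nat.find_min' h ⟨j, hj, rfl⟩
      · push Not at h
        exact ⟨⊤, by rw [finrank_top]; omega, fun i hi => absurd rfl (h (d i) i hi)⟩
    obtain ⟨W, hW, hWU⟩ := key
    obtain ⟨x, hxW, hx⟩ : ∃ x ∈ W, x ∉ Submodule.span ℂ (Set.range v) := by
      by_contra! hcon
      have := Submodule.finrank_mono (show W ≤ Submodule.span ℂ (Set.range v) from hcon)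
      omega
    refine ⟨Fin.snoc v x, linearIndependent_finSnoc.2 ⟨hv, hx⟩, fun i t ht => ?_⟩
    induction t using Fin.lastCases with
    | last =>
      rw [Fin.snoc_last]
      exact hWU i (by simpa using ht) hxW
    | cast t =>
      rw [Fin.snoc_castSucc]
      exact hvU i t (by simpa using ht)

/-- A frame adapted to a flag in the fibre. -/
theorem exists_adapted_frame [NeZero n]
    (h : ∀ z : ℂ, ∃ (V : Opens P1) (e : Fin n → E.sec V), (z : P1) ∈ V ∧ IsFrame E e) {ι : Type*}
    (U : ι → Submodule ℂ (Fibre E)) (d : ι → ℕ) (hd : ∀ i, Module.finrank ℂ (U i) = d i)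
    (hmono : ∀ i j, d i ≤ d j → U i ≤ U j) {τ : Fin n → Fin n} (hτ : Function.Injective τ) :
    ∃ (D : Opens P1) (h0 : zero ∈ D) (e : Fin n → E.sec D), OnePoint.infty ∉ D ∧
      (∀ z : ℂ, ‖z‖ ≤ 1 → (z : P1) ∈ D) ∧ IsFrame E e ∧
      ∀ i, U i = Submodule.span ℂ ((fun a => fibreClass E h0 (e a)) '' {a | (τ a : ℕ) < d i}) := by
  obtain ⟨D, hi, hD, f, hf⟩ := exists_isFrame_disc h
  have h0 : zero ∈ D := hD 0 (by simp)
  obtain ⟨hn, hfd⟩ := hf.finrank_fibre h0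
  obtain ⟨ψ, hψ⟩ := hf.exists_fibreEquiv h0
  obtain ⟨v, hv, hvU⟩ := exists_adapted_basis U d hd hmono (m := n) hn.ge
  have hvτ : LinearIndependent ℂ (v ∘ τ) := hv.comp τ hτ
  -- A constant change of frame: the new frame takes the adapted basis, reindexed by `τ`, as its
  -- values at the origin.
  let C : Matrix (Fin n) (Fin n) ℂ := fun b a => ψ (v (τ a)) b
  have hC : IsUnit C := by
    rw [← Matrix.linearIndependent_cols_iff_isUnit]
    exact hvτ.map' ψ.toLinearMap ψ.ker
  let M : Matrix (Fin n) (Fin n) (Hol D) := C.map (algebraMap ℂ (Hol D))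
  have hM : IsUnit M.det := by
    have : M.det = algebraMap ℂ (Hol D) C.det := ((algebraMap ℂ (Hol D)).map_det C).symm
    rw [this]
    exact ((Matrix.isUnit_iff_isUnit_det _).1 hC).map _
  have he := hf.of_matrix_sum le_rfl hM
  have hcl : ∀ a, fibreClass E h0 (∑ b, M b a • E.res le_rfl (f b)) = v (τ a) := by
    intro a
    apply ψ.injective
    funext b
    rw [hψ D h0 le_rfl, hf.coords_sum]
    rfl
  refine ⟨D, h0, _, hi, hD, he, fun i => ?_⟩
  simp only [hcl]
  have hle : d i ≤ n := by rw [← hd i, ← hn]; exact Submodule.finrank_le _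
  symm
  refine Submodule.eq_of_le_of_finrank_eq ?_ ?_
  · refine Submodule.span_le.2 ?_
    rintro _ ⟨a, ha, rfl⟩
    exact hvU i _ ha
  · have h1 : LinearIndependent ℂ (fun a : {a // (τ a : ℕ) < d i} => v (τ a)) :=
      hvτ.comp Subtype.val Subtype.val_injective
    have h2 : (fun a => v (τ a)) '' {a | (τ a : ℕ) < d i} =
        Set.range (fun a : {a // (τ a : ℕ) < d i} => v (τ a)) := by
      rw [Set.image_eq_range]; rfl
    rw [h2, finrank_span_eq_card h1, hd]
    have hb : Function.Bijective τ := Finite.injective_iff_bijective.1 hτ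
    have h3 : Fintype.card {a // (τ a : ℕ) < d i} = Fintype.card {t : Fin n // (t : ℕ) < d i} :=
      Fintype.card_congr ((Equiv.ofBijective τ hb).subtypeEquiv fun a => Iff.rfl)
    rw [h3, Fintype.card_subtype, Fin.card_filter_val_lt, min_eq_right hle]

end Fibre

end LoopFlag
end

noncomputable section
namespace LoopFlag

/-! ### The structure of a chain near the origin -/

section ChainLocal

variable {n : ℕ} {Δ : Finset ℕ}

/-- Division by a function which is locally possible is possible. -/
lemma exists_smul_eq_of_local {E : OMod} (ht : IsTorsionFree E) {W : Opens P1} {f : Hol W}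
    (hf : ∀ (V : Opens P1) (h : V ≤ W), V ≠ ⊥ → Hol.res h f ≠ 0) (s : E.sec W)
    (h : ∀ x ∈ W, ∃ (V : Opens P1) (hV : V ≤ W), x ∈ V ∧ ∃ t, Hol.res hV f • t = E.res hV s) :
    ∃ t, f • t = s := by
  have hinj : ∀ {V : Opens P1} (hV : V ≤ W) {t t' : E.sec V}, Hol.res hV f • t = Hol.res hV f • t' →
      t = t' := by
    intro V hV t t' e
    refine sub_eq_zero.1 (ht V (Hol.res hV f) _ (fun V' h' hne => hf V' (h'.trans hV) hne) ?_)
    rw [smul_sub, e, sub_self]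
  let ι : Type := {V : Opens P1 // ∃ hV : V ≤ W, ∃ t, Hol.res hV f • t = E.res hV s}
  have hι : ∀ i : ι, ∃ t, Hol.res i.2.1 f • t = E.res i.2.1 s := fun i => i.2.2
  choose r hr using hι
  obtain ⟨u, hu, _⟩ := OMod.exists_glue (E := E) (fun i : ι => i.1) (fun i => i.2.1)
    (fun x hx => by
      obtain ⟨V, hV, hxV, e⟩ := h x hx
      exact ⟨⟨V, hV, e⟩, hxV⟩) r (fun i j => by
        refine hinj (inf_le_left.trans i.2.1) ?_
        have e1 := congrArg (E.res (inf_le_left : i.1 ⊓ j.1 ≤ i.1)) (hr i)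
        have e2 := congrArg (E.res (inf_le_right : i.1 ⊓ j.1 ≤ j.1)) (hr j)
        simp only [E.res_smul, E.res_res, Hol.res_res] at e1 e2
        exact e1.trans e2.symm)
  refine ⟨u, OMod.ext_of_local fun x hx => ?_⟩
  obtain ⟨V, hV, hxV, e⟩ := h x hx
  refine ⟨V, hV, hxV, ?_⟩
  rw [E.res_smul, hu ⟨V, hV, e⟩]
  exact hr ⟨V, hV, e⟩

lemma IsTorsionFree.coord_pow_cancel {E : OMod} (ht : IsTorsionFree E) {U : Opens P1}
    (hU : OnePoint.infty ∉ U) (k : ℕ) {s t : E.sec U} (h : coord U hU ^ k • s = coord U hU ^ k • t) :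
    s = t := by
  refine sub_eq_zero.1 (ht U _ _ (res_coord_pow_ne_zero hU k) ?_)
  rw [smul_sub, h, sub_self]

lemma IsTorsionFree.coord_cancel {E : OMod} (ht : IsTorsionFree E) {U : Opens P1}
    (hU : OnePoint.infty ∉ U) {s t : E.sec U} (h : coord U hU • s = coord U hU • t) : s = t :=
  ht.coord_pow_cancel hU 1 (by simpa only [pow_one] using h)

variable (c : Chain n Δ)

lemma Chain.exists_isFrame (p : Idx n Δ) (z : ℂ) :
    ∃ (V : Opens P1) (e : Fin n → (c.E p).sec V), (z : P1) ∈ V ∧ IsFrame (c.E p) e :=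
  exists_isFrame_of_isCoherent (c.coherent p) (c.torsionFree p) (c.rank p) z

lemma Chain.isLocallyFree (p : Idx n Δ) : IsLocallyFree n (c.E p) := by
  intro x
  induction x using OnePoint.rec with
  | infty => exact ⟨_, (c.framing p).outer_sub fun z hz => absurd hz.symm (OnePoint.coe_ne_infty z),
      _, (c.framing p).isFrame⟩
  | coe z =>
    obtain ⟨V, e, hz, he⟩ := c.exists_isFrame p z
    exact ⟨V, hz, e, he⟩

/-- A frame near the origin, over an open subset of `ℂ`. -/
lemma Chain.exists_isFrame_zero (p : Idx n Δ) :
    ∃ (V : Opens P1) (e : Fin n → (c.E p).sec V), zero ∈ V ∧ OnePoint.infty ∉ V ∧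
      IsFrame (c.E p) e := by
  obtain ⟨V, e, hz, he⟩ := c.exists_isFrame p 0
  obtain ⟨V', hV', hz', hi, -⟩ := exists_opens_of_eventually hz (p := fun _ => True) (by simp)
  exact ⟨V', _, hz', hi, he.res_frame hV'⟩

/-- For `E q` between `E p.pred` and `E p`: a section of `E p` belongs to `E q` if and only if its
value at the origin belongs to the image of the fibre of `E q`. -/
lemma Chain.exists_preimage_iff {p q : Idx n Δ} (h₁ : p.pred.pos ≤ q.pos) (h₂ : q.pos ≤ p.pos)
    {U : Opens P1} (s : (c.E p).sec U) : (∃ r, (c.incl q p h₂).map U r = s) ↔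
      ∀ h0 : zero ∈ U, fibreClass (c.E p) h0 s ∈ LinearMap.range (c.incl q p h₂).fibreMap := by
  constructor
  · rintro ⟨r, rfl⟩ h0
    exact ⟨fibreClass _ h0 r, (c.incl q p h₂).fibreMap_fibreClass h0 r⟩
  · intro hs
    -- By periodicity the sections of `E p` vanishing at the origin come from `E p.pred`, hence from
    -- `E q`. A section is thus only to be corrected at the origin by one coming from `E q`.
    have hpred : ∀ {V : Opens P1} (t : (c.E p).sec V), VanishesAtZero t →
        ∃ r, (c.incl q p h₂).map V r = t := by
      intro V t ht
      obtain ⟨r, rfl⟩ := (c.periodic p V t).2 ht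
      exact ⟨_, c.incl_incl p.pred q p h₁ h₂ V r⟩
    refine (c.incl q p h₂).exists_preimage_of_local (c.incl_injective q p h₂) s fun x hx => ?_
    by_cases hx0 : x = zero
    · subst hx0
      obtain ⟨y, hy⟩ := hs hx
      obtain ⟨U', hU', r, rfl⟩ := exists_fibreClass_eq y
      rw [(c.incl q p h₂).fibreMap_fibreClass] at hy
      obtain ⟨D, f, hD0, hDi, hf⟩ := c.exists_isFrame_zero p
      have hV0 : zero ∈ U ⊓ U' ⊓ D := ⟨⟨hx, hU'⟩, hD0⟩
      have hVU : U ⊓ U' ⊓ D ≤ U := inf_le_left.trans inf_le_left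
      have hVU' : U ⊓ U' ⊓ D ≤ U' := inf_le_left.trans inf_le_right
      have hz : fibreClass (c.E p) hV0 ((c.E p).res hVU s -
          (c.E p).res hVU' ((c.incl q p h₂).map U' r)) = 0 := by
        rw [map_sub, fibreClass_res, fibreClass_res, hy, sub_self]
      obtain ⟨r', hr'⟩ := hpred _ (hf.vanishesAtZero hDi inf_le_right fun hU a =>
        hf.coords_eq_zero_of_fibreClass hD0 hU inf_le_right hz a)
      refine ⟨U ⊓ U' ⊓ D, hVU, hV0, r' + (c.E q).res hVU' r, ?_⟩
      rw [map_add, hr', (c.incl q p h₂).naturality, sub_add_cancel]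
    -- Away from the origin the vanishing condition is vacuous.
    · exact ⟨U ⊓ ⟨{zero}ᶜ, isClosed_singleton.isOpen_compl⟩, inf_le_left, ⟨hx, hx0⟩,
        hpred _ fun h => absurd rfl h.2⟩

/-! #### Multiplication by the coordinate -/

lemma Chain.exists_incl_eq_coord_smul {p : Idx n Δ} {V : Opens P1} (hV : OnePoint.infty ∉ V)
    (s : (c.E p).sec V) : ∃ r, (c.incl p.pred p p.pred_le).map V r = coord V hV • s :=
  (c.periodic p V _).2 fun h0 => ⟨V, le_rfl, h0, coord V hV, s, rfl, by rw [(c.E p).res_self]⟩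

/-- Near the origin periodicity gives a multiple by a function divisible by the coordinate;
elsewhere the coordinate is invertible. The local quotients are unique by torsion freeness and glue.
With `Chain.exists_incl_eq_coord_smul`, this says that multiplication by `z` identifies `E p` with
`E p.pred` over open subsets of `ℂ`. -/
lemma Chain.exists_coord_smul_eq_incl {p : Idx n Δ} {V : Opens P1} (hV : OnePoint.infty ∉ V)
    (r : (c.E p.pred).sec V) : ∃ s, coord V hV • s = (c.incl p.pred p p.pred_le).map V r := by
  have h1 : ∀ (W : Opens P1) (h : W ≤ V), W ≠ ⊥ → Hol.res h (coord V hV) ≠ 0 := fun W h hne => by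
    simpa only [pow_one] using res_coord_pow_ne_zero hV 1 W h hne
  refine exists_smul_eq_of_local (c.torsionFree p) h1 _ fun x hx => ?_
  by_cases hx0 : x = zero
  · subst hx0
    obtain ⟨W, hW, hW0, f, u, hf, e⟩ := (c.periodic p V _).1 ⟨r, rfl⟩ hx
    obtain ⟨g, hg⟩ := Hol.exists_eq_coord_mul (fun h => hV (hW h)) f fun _ => hf
    exact ⟨W, hW, hW0, g • u, by rw [e, hg, mul_smul, res_coord]⟩
  · let N : Opens P1 := V ⊓ ⟨{zero}ᶜ, isClosed_singleton.isOpen_compl⟩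
    obtain ⟨u, hu⟩ := isUnit_coord (U := N) (hU := fun h => hV h.1) (fun h => h.2 rfl)
    refine ⟨N, inf_le_left, ⟨hx, hx0⟩, (↑u⁻¹ : Hol N) • (c.E p).res inf_le_left
      ((c.incl p.pred p p.pred_le).map V r), ?_⟩
    rw [res_coord, ← hu, smul_smul, Units.mul_inv, one_smul]

/-- Division of a frame by the periodicity. -/
lemma Chain.exists_isFrame_pred {p : Idx n Δ} {D : Opens P1} (hD : OnePoint.infty ∉ D)
    {e : Fin n → (c.E p).sec D} (he : IsFrame (c.E p) e) :
    ∃ e' : Fin n → (c.E p.pred).sec D, IsFrame (c.E p.pred) e' ∧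
      ∀ a, (c.incl p.pred p p.pred_le).map D (e' a) = coord D hD • e a := by
  choose e' he' using fun a => c.exists_incl_eq_coord_smul hD (e a)
  refine ⟨e', fun V hV => ?_, he'⟩
  have hVi : OnePoint.infty ∉ V := fun h => hD (hV h)
  have key : ∀ d : Fin n → Hol V, (c.incl p.pred p p.pred_le).map V
      (∑ a, d a • (c.E p.pred).res hV (e' a)) = coord V hVi • ∑ a, d a • (c.E p).res hV (e a) := by
    intro d
    rw [Hom.map_sum_frame, Finset.smul_sum]
    refine Finset.sum_congr rfl fun a _ => ?_
    rw [he', (c.E p).res_smul, smul_comm, res_coord]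
  constructor
  · intro d d' hdd
    refine (he V hV).1 ((c.torsionFree p).coord_cancel hVi ?_)
    rw [← key d, ← key d']
    exact congrArg _ hdd
  · intro r
    obtain ⟨s, hs⟩ := c.exists_coord_smul_eq_incl hVi r
    obtain ⟨d, rfl⟩ := (he V hV).2 s
    exact ⟨d, c.incl_injective _ _ p.pred_le V ((key d).trans hs)⟩

lemma Chain.exists_isFrame_of_pred {p : Idx n Δ} {D : Opens P1} (hD : OnePoint.infty ∉ D)
    {e' : Fin n → (c.E p.pred).sec D} (he' : IsFrame (c.E p.pred) e') :
    ∃ e : Fin n → (c.E p).sec D, IsFrame (c.E p) e ∧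
      ∀ a, coord D hD • e a = (c.incl p.pred p p.pred_le).map D (e' a) := by
  choose e he using fun a => c.exists_coord_smul_eq_incl hD (e' a)
  refine ⟨e, fun V hV => ?_, he⟩
  have hVi : OnePoint.infty ∉ V := fun h => hD (hV h)
  have key : ∀ d : Fin n → Hol V, (c.incl p.pred p p.pred_le).map V
      (∑ a, d a • (c.E p.pred).res hV (e' a)) = coord V hVi • ∑ a, d a • (c.E p).res hV (e a) := by
    intro d
    rw [Hom.map_sum_frame, Finset.smul_sum]
    refine Finset.sum_congr rfl fun a _ => ?_
    rw [← he, (c.E p).res_smul, smul_comm, res_coord]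
  constructor
  · intro d d' hdd
    refine (he' V hV).1 (c.incl_injective _ _ p.pred_le V ?_)
    refine (key d).trans (Eq.trans ?_ (key d').symm)
    exact congrArg (coord V hVi • ·) hdd
  · intro s
    obtain ⟨r, hr⟩ := c.exists_incl_eq_coord_smul hVi s
    obtain ⟨d, rfl⟩ := (he' V hV).2 r
    exact ⟨d, (c.torsionFree p).coord_cancel hVi ((key d).symm.trans hr)⟩

/-- Frames of the sheaves between `E p.pred` and `E p`. -/
lemma Chain.exists_isFrame_between {p q : Idx n Δ} (h₁ : p.pred.pos ≤ q.pos) (h₂ : q.pos ≤ p.pos)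
    {D : Opens P1} (hD : OnePoint.infty ∉ D) (h0 : zero ∈ D) {f : Fin n → (c.E p).sec D}
    (hf : IsFrame (c.E p) f) (k : Fin n → ℕ)
    (hq : LinearMap.range (c.incl q p h₂).fibreMap =
      Submodule.span ℂ ((fun a => fibreClass (c.E p) h0 (f a)) '' {a | k a = 0}))
    (hk : ∀ a, k a ≤ 1) :
    ∃ e : Fin n → (c.E q).sec D, IsFrame (c.E q) e ∧
      ∀ a, (c.incl q p h₂).map D (e a) = coord D hD ^ k a • f a := by
  have hex : ∀ a, ∃ r, (c.incl q p h₂).map D r = coord D hD ^ k a • f a := by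
    intro a
    refine (c.exists_preimage_iff h₁ h₂ _).2 fun _ => ?_
    rcases Nat.le_one_iff_eq_zero_or_eq_one.1 (hk a) with h | h
    · rw [h, pow_zero, one_smul, hq]
      exact Submodule.subset_span ⟨a, h, rfl⟩
    · rw [h, pow_one, fibreClass_smul_eq_zero h0 rfl]
      exact Submodule.zero_mem _
  choose e he using hex
  refine ⟨e, fun V hV => ?_, he⟩
  have hVi : OnePoint.infty ∉ V := fun h => hD (hV h)
  have key : ∀ d : Fin n → Hol V, (c.incl q p h₂).map V
      (∑ a, d a • (c.E q).res hV (e a)) = ∑ a, (d a * coord V hVi ^ k a) • (c.E p).res hV (f a) := by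
    intro d
    rw [Hom.map_sum_frame]
    refine Finset.sum_congr rfl fun a _ => ?_
    rw [he, (c.E p).res_smul, smul_smul, map_pow, res_coord]
  constructor
  · intro d d' hdd
    have h := (hf V hV).1 ((key d).symm.trans ((congrArg _ hdd).trans (key d')))
    funext a
    have h2 : d a * coord V hVi ^ k a = d' a * coord V hVi ^ k a := congrFun h a
    rw [mul_comm, mul_comm (d' a), ← sub_eq_zero, ← mul_sub] at h2
    exact sub_eq_zero.1 (Hol.eq_zero_of_mul_eq_zero (res_coord_pow_ne_zero hVi _) h2)
  · intro r
    obtain ⟨ψ, hψ⟩ := hf.exists_fibreEquiv h0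
    -- The image of `E q` in the fibre is spanned by the frame vectors with `k a = 0`, so every
    -- other coordinate vanishes at the origin and is divisible by `z`.
    have hvan : ∀ (hV0 : zero ∈ V) a, k a ≠ 0 →
        (hf.coords hV ((c.incl q p h₂).map V r) a).1 ⟨zero, hV0⟩ = 0 := by
      intro hV0 a ha
      have h1 := (c.exists_preimage_iff h₁ h₂ _).1 ⟨r, rfl⟩ hV0
      rw [hq] at h1
      rw [← hψ V hV0 hV]
      have h2 : Submodule.span ℂ ((fun a => fibreClass (c.E p) h0 (f a)) '' {a | k a = 0}) ≤
          LinearMap.ker ((LinearMap.proj a).comp ψ.toLinearMap) := by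
        refine Submodule.span_le.2 ?_
        rintro _ ⟨b, hb, rfl⟩
        rw [SetLike.mem_coe, LinearMap.mem_ker]
        have h3 := hf.coords_frame (le_refl D) b a
        rw [(c.E p).res_self] at h3
        refine (hψ D h0 le_rfl _ a).trans ?_
        rw [h3, if_neg (fun h => ha (by rw [h]; exact hb))]
        rfl
      exact h2 h1
    have hdiv : ∀ a, ∃ d : Hol V, hf.coords hV ((c.incl q p h₂).map V r) a = d * coord V hVi ^ k a := by
      intro a
      rcases Nat.le_one_iff_eq_zero_or_eq_one.1 (hk a) with h | h
      · exact ⟨_, by rw [h, pow_zero, mul_one]⟩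
      · obtain ⟨g, hg⟩ := Hol.exists_eq_coord_mul hVi _ fun h0 => hvan h0 a (by omega)
        exact ⟨g, by rw [h, pow_one, hg, mul_comm]⟩
    choose d hd using hdiv
    refine ⟨d, c.incl_injective q p h₂ V ((key d).trans ?_)⟩
    simp only [← hd, hf.sum_coords]

/-- The families `e` and `f` differ by the powers of the coordinate prescribed by `expo`. -/
def Chain.Compat {p q : Idx n Δ} {D : Opens P1} (hD : OnePoint.infty ∉ D)
    (f : Fin n → (c.E p).sec D) (e : Fin n → (c.E q).sec D) : Prop :=
  ∃ (T : Idx n Δ) (hq : q.pos ≤ T.pos) (hp : p.pos ≤ T.pos), ∀ a, ∃ A B : ℕ,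
    (B : ℤ) - A = expo q a - expo p a ∧
    coord D hD ^ A • (c.incl q T hq).map D (e a) = coord D hD ^ B • (c.incl p T hp).map D (f a)

variable {c} {p : Idx n Δ} {D : Opens P1} {hD : OnePoint.infty ∉ D} {f : Fin n → (c.E p).sec D}

lemma Chain.Compat.mono {q T : Idx n Δ} {e : Fin n → (c.E q).sec D} {a : Fin n} {A B : ℕ}
    {hq : q.pos ≤ T.pos} {hp : p.pos ≤ T.pos}
    (h : coord D hD ^ A • (c.incl q T hq).map D (e a) = coord D hD ^ B • (c.incl p T hp).map D (f a))
    {T' : Idx n Δ} (hT : T.pos ≤ T'.pos) :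
    coord D hD ^ A • (c.incl q T' (hq.trans hT)).map D (e a) =
      coord D hD ^ B • (c.incl p T' (hp.trans hT)).map D (f a) := by
  have := congrArg ((c.incl T T' hT).map D) h
  rwa [map_smul, map_smul, c.incl_incl, c.incl_incl] at this

lemma Idx.exists_ge (p q : Idx n Δ) : ∃ T : Idx n Δ, p.pos ≤ T.pos ∧ q.pos ≤ T.pos := by
  rcases le_total p.pos q.pos with h | h
  · exact ⟨q, h, le_rfl⟩
  · exact ⟨p, le_rfl, h⟩

/-- Inside a common larger sheaf both families are multiples of `f` by powers of `z`. Exponents may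
be negative, so denominators are cleared by `z ^ (A + B')` and torsion freeness cancels this factor.
-/
lemma Chain.Compat.incl_eq {q r : Idx n Δ} {e : Fin n → (c.E q).sec D} {e' : Fin n → (c.E r).sec D}
    (h : c.Compat hD f e) (h' : c.Compat hD f e') (hqr : q.pos ≤ r.pos) (a : Fin n) :
    (c.incl q r hqr).map D (e a) = coord D hD ^ (expo q a - expo r a).toNat • e' a := by
  obtain ⟨T, hq, hp, h⟩ := h
  obtain ⟨T', hr, hp', h'⟩ := h'
  obtain ⟨S, hS, hS'⟩ := Idx.exists_ge T T'
  obtain ⟨A, B, hAB, e1⟩ := h a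
  obtain ⟨A', B', hAB', e2⟩ := h' a
  replace e1 := Chain.Compat.mono e1 hS
  replace e2 := Chain.Compat.mono e2 hS'
  have hle := expo_le hqr a
  refine c.incl_injective r S (hr.trans hS') D ((c.torsionFree S).coord_pow_cancel hD (A + B') ?_)
  rw [c.incl_incl, map_smul, smul_smul, ← pow_add]
  have k1 := congrArg (coord D hD ^ B' • ·) e1
  have k2 := congrArg (coord D hD ^ B • ·) e2
  simp only [smul_smul, ← pow_add] at k1 k2
  have e3 : A + B' = B' + A := add_comm _ _
  have e4 : B' + B = B + B' := add_comm _ _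
  have e5 : A + B' + (expo q a - expo r a).toNat = B + A' := by omega
  rw [e3, k1, ← e3, e5, e4]
  exact k2.symm

/-- Multiplication by the coordinate raises every exponent by one, in agreement with `expo_pred`;
the next lemma is the inverse operation. -/
lemma Chain.Compat.exists_pred {q : Idx n Δ} {e : Fin n → (c.E q).sec D} (he : IsFrame (c.E q) e)
    (h : c.Compat hD f e) :
    ∃ e' : Fin n → (c.E q.pred).sec D, IsFrame (c.E q.pred) e' ∧ c.Compat hD f e' := by
  obtain ⟨e', he', hee⟩ := c.exists_isFrame_pred hD he
  obtain ⟨T, hq, hp, h⟩ := h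
  refine ⟨e', he', T, q.pred_le.trans hq, hp, fun a => ?_⟩
  obtain ⟨A, B, hAB, e1⟩ := h a
  refine ⟨A, B + 1, by rw [expo_pred]; push_cast; omega, ?_⟩
  rw [← c.incl_incl q.pred q T q.pred_le hq, hee, map_smul, smul_comm, e1, smul_smul, pow_succ']

lemma Chain.Compat.exists_of_pred {q : Idx n Δ} {e' : Fin n → (c.E q.pred).sec D}
    (he' : IsFrame (c.E q.pred) e') (h : c.Compat hD f e') :
    ∃ e : Fin n → (c.E q).sec D, IsFrame (c.E q) e ∧ c.Compat hD f e := by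
  obtain ⟨e, he, hee⟩ := c.exists_isFrame_of_pred hD he'
  obtain ⟨T, hq, hp, h⟩ := h
  obtain ⟨S, hS, hS'⟩ := Idx.exists_ge T q
  refine ⟨e, he, S, hS', hp.trans hS, fun a => ?_⟩
  obtain ⟨A, B, hAB, e1⟩ := h a
  replace e1 := Chain.Compat.mono e1 hS
  refine ⟨A + 1, B, by rw [expo_pred] at hAB; push_cast; omega, ?_⟩
  rw [pow_succ, mul_smul, ← map_smul, hee, c.incl_incl, e1]

/-- A frame of `E p` adapted to the flag in its fibre determines frames of all the sheaves of the
chain. -/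
theorem Chain.exists_frames (hD : OnePoint.infty ∉ D) (h0 : zero ∈ D) (hf : IsFrame (c.E p) f)
    (hflag : ∀ (q : Idx n Δ) (_ : p.pred.pos < q.pos) (h₂ : q.pos ≤ p.pos),
      LinearMap.range (c.incl q p h₂).fibreMap =
        Submodule.span ℂ ((fun a => fibreClass (c.E p) h0 (f a)) '' {a | expo q a = expo p a})) :
    ∃ e : ∀ q, Fin n → (c.E q).sec D, (∀ q, IsFrame (c.E q) (e q)) ∧
      (∀ q r h a, (c.incl q r h).map D (e q a) =
        coord D hD ^ (expo q a - expo r a).toNat • e r a) ∧ e p = f := by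
  -- Within one period, `p.pred < q ≤ p`, the exponents exceed those of `p` by zero or one, so the
  -- frame of `E q` comes from the flag in the fibre of `E p`.
  have hwin : ∀ (q : Idx n Δ) (_ : p.pred.pos < q.pos) (_ : q.pos ≤ p.pos),
      ∃ e : Fin n → (c.E q).sec D, IsFrame (c.E q) e ∧ c.Compat hD f e := by
    intro q h₁ h₂
    have hle : ∀ a, expo p a ≤ expo q a := fun a => expo_le h₂ a
    have hle' : ∀ a, expo q a ≤ expo p a + 1 := fun a =>
      expo_le_add_one (by rw [Idx.pos_pred] at h₁; omega) a
    obtain ⟨e, he, hee⟩ := c.exists_isFrame_between h₁.le h₂ hD h0 hf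
      (fun a => (expo q a - expo p a).toNat) (by
        rw [hflag q h₁ h₂]
        congr 2
        ext a
        have := hle a
        simp only [Set.mem_ofPred_eq]
        omega) (fun a => by have := hle' a; omega)
    refine ⟨e, he, p, h₂, le_rfl, fun a => ⟨0, (expo q a - expo p a).toNat, ?_, ?_⟩⟩
    · have := hle a
      omega
    · rw [pow_zero, one_smul, hee, c.incl_self]
  -- For each `j` some `(i₀, j)` lies in this period; induction on `i` in both directions then uses
  -- periodicity.
  have hall : ∀ q : Idx n Δ, ∃ e : Fin n → (c.E q).sec D, IsFrame (c.E q) e ∧ c.Compat hD f e := by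
    rintro ⟨i, j, hj⟩
    obtain ⟨i₀, h₁, h₂⟩ : ∃ i₀ : ℤ, p.pred.pos < (⟨i₀, j, hj⟩ : Idx n Δ).pos ∧
        (⟨i₀, j, hj⟩ : Idx n Δ).pos ≤ p.pos := by
      have k1 := (⟨0, j, hj⟩ : Idx n Δ).one_le_j
      have k2 := (⟨0, j, hj⟩ : Idx n Δ).j_le
      have k3 := p.one_le_j
      have k4 := p.j_le
      dsimp only at k1 k2
      rw [Idx.pos_pred]
      by_cases hjp : j ≤ p.j
      · refine ⟨p.i, ?_, ?_⟩ <;> simp only [Idx.pos] <;> omega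
      · refine ⟨p.i - 1, ?_, ?_⟩ <;> simp only [Idx.pos, mul_sub, mul_one] <;> omega
    induction i using Int.inductionOn' (b := i₀) with
    | zero => exact hwin _ h₁ h₂
    | succ k _ ih =>
      have hpr : (⟨k + 1, j, hj⟩ : Idx n Δ).pred = ⟨k, j, hj⟩ := by
        simp only [Idx.pred, add_sub_cancel_right]
      rw [← hpr] at ih
      obtain ⟨e', he', hc⟩ := ih
      exact hc.exists_of_pred he'
    | pred k _ ih =>
      obtain ⟨e', he', hc⟩ := ih
      exact hc.exists_pred he'
  choose e he hc using hall
  refine ⟨e, he, fun q r h a => (hc q).incl_eq (hc r) h a, funext fun a => ?_⟩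
  have hself : c.Compat hD f f := ⟨p, le_rfl, le_rfl, fun a => ⟨0, 0, by simp, rfl⟩⟩
  have := (hc p).incl_eq hself le_rfl a
  rwa [c.incl_self, sub_self, Int.toNat_zero, pow_zero, one_smul] at this

end ChainLocal

end LoopFlag
end

noncomputable section
namespace LoopFlag

/-! ### The flags of a chain -/

section ChainFlag

variable {n : ℕ} {Δ : Finset ℕ} (c : Chain n Δ)

lemma Idx.eq_of_pos {p q : Idx n Δ} (h : p.pos = q.pos) : p = q := by
  have hi : p.i = q.i := le_antisymm (Idx.i_le h.le) (Idx.i_le h.ge)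
  obtain ⟨i, j, hj⟩ := p
  obtain ⟨i', j', hj'⟩ := q
  dsimp only at hi
  subst hi
  simp only [Idx.pos] at h
  obtain rfl : j = j' := by omega
  rfl

/-- The subspace of the fibre of `E p` defined by `E q`. -/
def Chain.fibreRange {q p : Idx n Δ} (h : q.pos ≤ p.pos) : Submodule ℂ (Fibre (c.E p)) :=
  LinearMap.range (c.incl q p h).fibreMap

lemma Chain.mem_fibreRange {q p : Idx n Δ} (h : q.pos ≤ p.pos) {U : Opens P1} (hU : zero ∈ U)
    (s : (c.E q).sec U) : fibreClass (c.E p) hU ((c.incl q p h).map U s) ∈ c.fibreRange h :=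
  ⟨_, (c.incl q p h).fibreMap_fibreClass hU s⟩

lemma Chain.fibreRange_mono {q r p : Idx n Δ} (hq : q.pos ≤ p.pos) (hr : r.pos ≤ p.pos)
    (h : q.pos ≤ r.pos) : c.fibreRange hq ≤ c.fibreRange hr := by
  rintro _ ⟨x, rfl⟩
  obtain ⟨U, hU, s, rfl⟩ := exists_fibreClass_eq x
  rw [Hom.fibreMap_fibreClass, ← c.incl_incl q r p h hr]
  exact c.mem_fibreRange hr hU _

lemma Chain.finiteDimensional_fibre (p : Idx n Δ) :
    Module.finrank ℂ (Fibre (c.E p)) = n ∧ FiniteDimensional ℂ (Fibre (c.E p)) := by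
  obtain ⟨D, f, h0, -, hf⟩ := c.exists_isFrame_zero p
  exact hf.finrank_fibre h0

lemma Chain.fibreRange_self (p : Idx n Δ) : c.fibreRange (le_refl p.pos) = ⊤ := by
  refine eq_top_iff.2 fun x _ => ?_
  obtain ⟨U, hU, s, rfl⟩ := exists_fibreClass_eq x
  have := c.mem_fibreRange (le_refl p.pos) hU s
  rwa [c.incl_self] at this

lemma Chain.fibreRange_pred (p : Idx n Δ) : c.fibreRange p.pred_le = ⊥ := by
  refine eq_bot_iff.2 ?_
  rintro _ ⟨x, rfl⟩
  obtain ⟨U, hU, s, rfl⟩ := exists_fibreClass_eq x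
  rw [Hom.fibreMap_fibreClass]
  exact (((c.periodic p U _).1 ⟨s, rfl⟩).fibreClass_eq_zero hU)

/-- Lift the `m` basis sections of the skyscraper sheaf near the origin. Modulo sections of `E q`,
every section of `E r` is a combination of the lifts with constant coefficients, so the image in the
fibre grows by at most `m` dimensions. -/
lemma Chain.finrank_fibreRange_le_of_sky {q r p : Idx n Δ} (hq : q.pos ≤ p.pos) (hr : r.pos ≤ p.pos)
    (h : q.pos ≤ r.pos) {m : ℕ} (hs : QuotientIsSky (c.incl q r h) m) :
    Module.finrank ℂ (c.fibreRange hr) ≤ Module.finrank ℂ (c.fibreRange hq) + m := by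
  obtain ⟨-, hfd⟩ := c.finiteDimensional_fibre p
  obtain ⟨Q, hker, hsurj⟩ := hs
  let v : Fin m → (sky m).sec ⊤ := fun j _ i => if i = j then 1 else 0
  choose V hV y hV0 hy using fun j => hsurj ⊤ (v j) zero trivial
  let N : Opens P1 := ⟨⋂ j, (V j : Set P1), isOpen_iInter_of_finite fun j => (V j).isOpen⟩
  have hNV : ∀ j, N ≤ V j := fun j x hx => Set.mem_iInter.1 hx j
  have hN0 : zero ∈ N := Set.mem_iInter.2 hV0
  let w : Fin m → Fibre (c.E p) := fun j =>
    fibreClass (c.E p) (hV0 j) ((c.incl r p hr).map (V j) (y j))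
  have hle : c.fibreRange hr ≤ c.fibreRange hq ⊔ Submodule.span ℂ (Set.range w) := by
    rintro _ ⟨x, rfl⟩
    obtain ⟨U, hU, s, rfl⟩ := exists_fibreClass_eq x
    have hW0 : zero ∈ U ⊓ N := ⟨hU, hN0⟩
    let l : Fin m → ℂ := fun j => skyEval hU j (Q.map U s)
    let u : (c.E r).sec (U ⊓ N) := ∑ j, algebraMap ℂ (Hol (U ⊓ N)) (l j) •
      (c.E r).res (inf_le_right.trans (hNV j)) (y j)
    obtain ⟨t, ht⟩ := (hker (U ⊓ N) ((c.E r).res inf_le_left s - u)).1 (by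
      rw [map_sub, map_sum, sub_eq_zero]
      refine sky_ext fun h0 i => ?_
      rw [map_sum]
      simp only [map_smul, skyEval_smul, Q.naturality, hy]
      have : ∀ j, skyEval h0 i ((sky m).res (inf_le_right.trans (hNV j) : U ⊓ N ≤ V j)
          ((sky m).res (hV j) (v j))) = if i = j then 1 else 0 := fun j => rfl
      simp only [this, Hol.algebraMap_val, mul_ite, mul_one, mul_zero, Finset.sum_ite_eq,
        Finset.mem_univ, if_true]
      rfl)
    have e1 : (c.incl r p hr).map (U ⊓ N) ((c.E r).res inf_le_left s) =
        (c.incl q p hq).map (U ⊓ N) t + (c.incl r p hr).map (U ⊓ N) u := by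
      rw [← c.incl_incl q r p h hr, ht, ← map_add, sub_add_cancel]
    rw [Hom.fibreMap_fibreClass, ← fibreClass_res inf_le_left hW0, ← Hom.naturality, e1, map_add]
    refine Submodule.add_mem_sup (c.mem_fibreRange hq hW0 t) ?_
    rw [map_sum, map_sum]
    refine Submodule.sum_mem _ fun j _ => ?_
    have e2 : fibreClass (c.E p) hW0 ((c.incl r p hr).map (U ⊓ N)
        (algebraMap ℂ (Hol (U ⊓ N)) (l j) • (c.E r).res (inf_le_right.trans (hNV j)) (y j))) =
        l j • w j := by
      rw [map_smul, (c.incl r p hr).naturality]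
      refine Eq.trans ((fibreClass (c.E p) hW0).map_smul (l j) _) ?_
      rw [fibreClass_res]
    rw [e2]
    exact Submodule.smul_mem _ _ (Submodule.subset_span ⟨j, rfl⟩)
  calc Module.finrank ℂ (c.fibreRange hr)
      ≤ Module.finrank ℂ ↥(c.fibreRange hq ⊔ Submodule.span ℂ (Set.range w)) :=
        Submodule.finrank_mono hle
    _ ≤ Module.finrank ℂ (c.fibreRange hq) + Module.finrank ℂ (Submodule.span ℂ (Set.range w)) :=
        Submodule.finrank_add_le_finrank_add_finrank _ _
    _ ≤ _ := by
        have := finrank_range_le_card (R := ℂ) w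
        rw [Fintype.card_fin] at this
        exact Nat.add_le_add_left this _

/-- The bounds for successive sheaves add up; the natural number `k` bounds the difference of
positions and carries the induction. -/
lemma Chain.finrank_fibreRange_le {p : Idx n Δ} (k : ℕ) :
    ∀ {q r : Idx n Δ} (hq : q.pos ≤ p.pos) (hr : r.pos ≤ p.pos) (_ : q.pos ≤ r.pos)
      (_ : r.pos - q.pos ≤ k), (Module.finrank ℂ (c.fibreRange hr) : ℤ) ≤
        Module.finrank ℂ (c.fibreRange hq) + (r.pos - q.pos) := by
  induction k with
  | zero =>
    intro q r hq hr h hk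
    obtain rfl : q = r := Idx.eq_of_pos (by push_cast at hk; omega)
    omega
  | succ k ih =>
    intro q r hq hr h hk
    by_cases hc : ∃ s : Idx n Δ, q.pos < s.pos ∧ s.pos < r.pos
    · obtain ⟨s, h1, h2⟩ := hc
      have e1 := ih hq (h2.le.trans hr) h1.le (by push_cast at hk; omega)
      have e2 := ih (h2.le.trans hr) hr h2.le (by push_cast at hk; omega)
      omega
    · rcases h.eq_or_lt with h' | h'
      · obtain rfl : q = r := Idx.eq_of_pos h'
        omega
      · have := c.finrank_fibreRange_le_of_sky hq hr h (c.quotient q r h' fun s hs => hc ⟨s, hs⟩)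
        omega

/-- The image of `E p.pred` is zero and that of `E p` is the whole fibre, of dimension `n`. The
bounds from `p.pred` to `q` and from `q` to `p` add up to `n`, so both are equalities. -/
lemma Chain.finrank_fibreRange {q p : Idx n Δ} (h₁ : p.pred.pos ≤ q.pos) (h₂ : q.pos ≤ p.pos) :
    (Module.finrank ℂ (c.fibreRange h₂) : ℤ) = q.pos - p.pred.pos := by
  have e1 := c.finrank_fibreRange_le (p := p) (q.pos - p.pred.pos).toNat p.pred_le h₂ h₁ (by omega)
  have e2 := c.finrank_fibreRange_le (p := p) (p.pos - q.pos).toNat h₂ le_rfl h₂ (by omega)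
  rw [c.fibreRange_pred, finrank_bot] at e1
  rw [c.fibreRange_self, finrank_top, (c.finiteDimensional_fibre p).1] at e2
  have := p.pos_pred
  omega

/-- The cyclic order on the basis vectors which starts after the index `j` of `p`. -/
def Idx.cyc (p : Idx n Δ) (a : Fin n) : Fin n :=
  if h : (a : ℕ) < p.j then ⟨a + (n - p.j), by have := p.j_le; omega⟩
  else ⟨a - p.j, by have := a.2; omega⟩

lemma Idx.cyc_injective (p : Idx n Δ) : Function.Injective p.cyc := by
  intro a b h
  have h' := congrArg Fin.val h
  have := p.j_le
  have ha := a.2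
  have hb := b.2
  apply Fin.ext
  simp only [Idx.cyc] at h'
  split_ifs at h' <;> simp only at h' <;> omega

/-- Passing through one period from `p.pred`, basis vectors enter in cyclic order, starting just
after the first `p.j` of them. The vectors present at `q` are therefore the first `q.pos -
p.pred.pos` in this order. -/
lemma Idx.expo_eq_iff {p q : Idx n Δ} (h₁ : p.pred.pos < q.pos) (h₂ : q.pos ≤ p.pos) (a : Fin n) :
    expo q a = expo p a ↔ (p.cyc a : ℤ) < q.pos - p.pred.pos := by
  have i1 := Idx.i_le h₁.le
  have i2 := Idx.i_le h₂
  have k1 := p.one_le_j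
  have k2 := p.j_le
  have k3 := q.one_le_j
  have k4 := q.j_le
  have ha := a.2
  have i3 : p.pred.i = p.i - 1 := rfl
  rw [Idx.pos_pred] at *
  have hcyc : ((p.cyc a : ℕ) : ℤ) = if (a : ℕ) < p.j then (a : ℤ) + n - p.j else a - p.j := by
    simp only [Idx.cyc]
    split_ifs <;> simp only <;> omega
  rw [hcyc]
  rcases (show q.i = p.i ∨ q.i = p.i - 1 by omega) with h | h
  · simp only [Idx.pos, expo, h] at *
    split_ifs <;> constructor <;> intro <;> omega
  · simp only [Idx.pos, expo, h, mul_sub, mul_one] at *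
    split_ifs <;> constructor <;> intro <;> omega

/-- Existence of a frame of `E p` adapted to the flag. -/
theorem Chain.exists_adapted_frame [NeZero n] (p : Idx n Δ) :
    ∃ (D : Opens P1) (h0 : zero ∈ D) (f : Fin n → (c.E p).sec D), OnePoint.infty ∉ D ∧
      (∀ z : ℂ, ‖z‖ ≤ 1 → (z : P1) ∈ D) ∧ IsFrame (c.E p) f ∧
      ∀ (q : Idx n Δ) (_ : p.pred.pos < q.pos) (h₂ : q.pos ≤ p.pos),
        LinearMap.range (c.incl q p h₂).fibreMap =
          Submodule.span ℂ ((fun a => fibreClass (c.E p) h0 (f a)) '' {a | expo q a = expo p a}) := by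
  obtain ⟨D, h0, f, hi, hD, hf, hU⟩ := LoopFlag.exists_adapted_frame (c.exists_isFrame p)
    (ι := {q : Idx n Δ // p.pred.pos < q.pos ∧ q.pos ≤ p.pos})
    (fun q => c.fibreRange q.2.2) (fun q => (q.1.pos - p.pred.pos).toNat)
    (fun q => by
      have := c.finrank_fibreRange q.2.1.le q.2.2
      omega)
    (fun q r h => c.fibreRange_mono _ _ (by
      have h1 := q.2.1
      have h2 := r.2.1
      omega)) p.cyc_injective
  refine ⟨D, h0, f, hi, hD, hf, fun q h₁ h₂ => ?_⟩
  refine (hU ⟨q, h₁, h₂⟩).trans ?_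
  congr 2
  ext a
  rw [Set.mem_ofPred_eq, Set.mem_ofPred_eq, Idx.expo_eq_iff h₁ h₂]
  dsimp only
  omega

end ChainFlag

end LoopFlag
end

noncomputable section
namespace LoopFlag

/-! ### Transition functions of framed sheaves -/

lemma coe_mem_outerDisc {z : ℂ} (h : 1 ≤ ‖z‖) : (z : P1) ∈ outerDisc := fun w hw => by
  rwa [← OnePoint.coe_injective hw]

lemma circle_mem_outerDisc (z : Circle) : ((z : ℂ) : P1) ∈ outerDisc :=
  coe_mem_outerDisc z.norm_coe.ge

lemma infty_mem_outerDisc : OnePoint.infty ∈ outerDisc := fun z hz =>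
  absurd hz.symm (OnePoint.coe_ne_infty z)

section FramingVal

variable {n : ℕ} {E F : OMod} (t : Framing n E) {D : Opens P1}

/-- The value at `x` of the coordinates of a section with respect to a trivialisation. -/
def Framing.val (s : E.sec D) (x : P1) (b : Fin n) : ℂ :=
  ext (t.isFrame.coords (inf_le_right : D ⊓ t.dom ≤ t.dom) (E.res inf_le_left s) b).1 x

lemma Framing.circle_mem (z : Circle) : ((z : ℂ) : P1) ∈ t.dom := t.outer_sub (circle_mem_outerDisc z)

lemma Framing.val_eq {V : Opens P1} (h : V ≤ D) (h' : V ≤ t.dom) {s : E.sec D} {c : Fin n → Hol V}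
    (hs : E.res h s = ∑ b, c b • E.res h' (t.frame b)) {x : P1} (hx : x ∈ V) (b : Fin n) :
    t.val s x b = (c b).1 ⟨x, hx⟩ := by
  have hV : V ≤ D ⊓ t.dom := le_inf h h'
  have h1 := t.isFrame.coords_res (inf_le_right : D ⊓ t.dom ≤ t.dom) hV (E.res inf_le_left s) b
  rw [E.res_res, t.isFrame.coords_eq _ hs] at h1
  rw [Framing.val, ext_of_mem _ (hV hx), h1]
  rfl

lemma Framing.res_eq_sum (s : E.sec D) : E.res (inf_le_left : D ⊓ t.dom ≤ D) s =
    ∑ b, t.isFrame.coords inf_le_right (E.res inf_le_left s) b • E.res inf_le_right (t.frame b) :=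
  (t.isFrame.sum_coords _ _).symm

lemma Framing.val_res {V : Opens P1} (h : V ≤ D) (s : E.sec D) {x : P1} (hx : x ∈ V)
    (hx' : x ∈ t.dom) (b : Fin n) : t.val (E.res h s) x b = t.val s x b := by
  obtain ⟨c, h1⟩ : ∃ c : Fin n → Hol (V ⊓ t.dom), E.res inf_le_left (E.res h s) =
      ∑ b, c b • E.res inf_le_right (t.frame b) := ⟨_, t.res_eq_sum (E.res h s)⟩
  rw [t.val_eq _ _ h1 ⟨hx, hx'⟩]
  rw [E.res_res] at h1
  exact (t.val_eq _ _ h1 ⟨hx, hx'⟩ b).symm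

lemma Framing.val_sum_smul {m : ℕ} (c : Fin m → Hol D) (s : Fin m → E.sec D) {x : P1} (hx : x ∈ D)
    (hx' : x ∈ t.dom) (b : Fin n) :
    t.val (∑ a, c a • s a) x b = ∑ a, (c a).1 ⟨x, hx⟩ * t.val (s a) x b := by
  have h1 : E.res (inf_le_left : D ⊓ t.dom ≤ D) (∑ a, c a • s a) = ∑ b, (∑ a,
      Hol.res inf_le_left (c a) * t.isFrame.coords inf_le_right (E.res inf_le_left (s a)) b) •
        E.res inf_le_right (t.frame b) := by
    simp only [OMod.res_sum, E.res_smul, Finset.sum_smul, mul_smul]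
    rw [Finset.sum_comm]
    refine Finset.sum_congr rfl fun a _ => ?_
    rw [← Finset.smul_sum, ← t.res_eq_sum]
  rw [t.val_eq _ _ h1 ⟨hx, hx'⟩, Hol.sum_val]
  refine Finset.sum_congr rfl fun a _ => ?_
  rw [Framing.val, ext_of_mem _ (⟨hx, hx'⟩ : x ∈ D ⊓ t.dom)]
  rfl

lemma Framing.val_smul (f : Hol D) (s : E.sec D) {x : P1} (hx : x ∈ D)
    (hx' : x ∈ t.dom) (b : Fin n) : t.val (f • s) x b = f.1 ⟨x, hx⟩ * t.val s x b := by
  have := t.val_sum_smul (fun _ : Fin 1 => f) (fun _ => s) hx hx' b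
  simpa using this

lemma Framing.analyticAt_val (s : E.sec D) {z : ℂ} (hz : (z : P1) ∈ D) (hz' : (z : P1) ∈ t.dom)
    (b : Fin n) : AnalyticAt ℂ (fun w : ℂ => t.val s w b) z :=
  (t.isFrame.coords (inf_le_right : D ⊓ t.dom ≤ t.dom) (E.res inf_le_left s) b).2.1 z ⟨hz, hz'⟩

lemma Framing.isUnit_val {e : Fin n → E.sec D} (he : IsFrame E e) {x : P1} (hx : x ∈ D)
    (hx' : x ∈ t.dom) : IsUnit (Matrix.of fun b a => t.val (e a) x b).det := by
  have h1 := t.isFrame.isUnit_matrix_det (inf_le_right : D ⊓ t.dom ≤ t.dom)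
    (he.res_frame inf_le_left)
  have h2 := h1.map (Hol.eval (⟨hx, hx'⟩ : x ∈ D ⊓ t.dom))
  rw [RingHom.map_det] at h2
  convert h2 using 2
  ext b a
  exact ext_of_mem _ (⟨hx, hx'⟩ : x ∈ D ⊓ t.dom)

variable {t}

lemma Hom.Respects.val_eq {φ : Hom E F} {u : Framing n F} (h : φ.Respects t u) (s : E.sec D)
    {x : P1} (hx : x ∈ D) (hx' : x ∈ outerDisc) (b : Fin n) :
    u.val (φ.map D s) x b = t.val s x b := by
  obtain ⟨V, h1, h2, h3, h4⟩ := h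
  have hW : D ⊓ V ≤ D ⊓ t.dom := inf_le_inf_left _ h1
  have e1 := congrArg (E.res hW) (t.res_eq_sum s)
  simp only [OMod.res_sum, E.res_smul, E.res_res] at e1
  have e2 := congrArg (φ.map _) e1
  rw [φ.naturality, map_sum] at e2
  have e3 : ∀ a, φ.map _ (E.res (inf_le_right.trans h1 : D ⊓ V ≤ t.dom) (t.frame a)) =
      F.res (inf_le_right.trans h2) (u.frame a) := fun a => by
    have := congrArg (F.res (inf_le_right : D ⊓ V ≤ V)) (h4 a)
    rwa [← φ.naturality, E.res_res, F.res_res] at this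
  simp only [map_smul, e3] at e2
  rw [t.val_eq _ _ e1 ⟨hx, h3 hx'⟩, u.val_eq _ _ e2 ⟨hx, h3 hx'⟩]

end FramingVal

section Loops

variable {n : ℕ}

lemma Loop.isUnit_of_ne_zero (f : Loop) (h : ∀ z : Circle, f.1 z ≠ 0) : IsUnit f := by
  obtain ⟨F, hF, hf⟩ := f.2
  have hF0 : ∀ z ∈ Metric.sphere (0 : ℂ) 1, F z ≠ 0 := fun z hz h0 =>
    h ⟨z, hz⟩ ((hf ⟨z, hz⟩).trans h0)
  refine IsUnit.of_mul_eq_one ⟨fun z => (f.1 z)⁻¹, fun z => (F z)⁻¹, hF.inv hF0, fun z => congrArg Inv.inv (hf z)⟩ ?_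
  refine Subtype.ext (funext fun z => ?_)
  exact mul_inv_cancel₀ (h z)

lemma Loop.ext' {f g : Loop} (h : ∀ z, Loop.eval z f = Loop.eval z g) : f = g :=
  Subtype.ext (funext h)

/-- The transition function of a frame near the circle, divided by powers of `z`. -/
lemma Framing.exists_loop {E : OMod} (t : Framing n E) {D : Opens P1} (hD : ∀ z : Circle, ((z : ℂ) : P1) ∈ D)
    {e : Fin n → E.sec D} (he : IsFrame E e) (m : Fin n → ℤ) :
    ∃ g : LoopGL n, ∀ (z : Circle) b a, t.val (e a) (z : ℂ) b = (z : ℂ) ^ m a * (g.1 b a).1 z := by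
  let A : Matrix (Fin n) (Fin n) Loop := fun b a =>
    ⟨fun z => (z : ℂ) ^ (-m a) * t.val (e a) (z : ℂ) b, fun w => w ^ (-m a) * t.val (e a) (w : ℂ) b,
      fun z hz => by
        have hz0 : z ≠ 0 := by
          rintro rfl
          simp at hz
        exact (analyticAt_id.fun_zpow hz0).fun_mul
          (t.analyticAt_val (e a) (hD ⟨z, hz⟩) (t.circle_mem ⟨z, hz⟩) b), fun z => rfl⟩
  have hA : IsUnit A.det := by
    refine Loop.isUnit_of_ne_zero _ fun z => ?_
    have h1 : A.det.1 z = ((Loop.eval z).mapMatrix A).det := (Loop.eval z).map_det A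
    have h2 : (Loop.eval z).mapMatrix A = (Matrix.of fun b a => t.val (e a) (z : ℂ) b) *
        Matrix.diagonal (fun a => (z : ℂ) ^ (-m a)) := by
      ext b a
      rw [Matrix.mul_diagonal]
      exact mul_comm _ _
    rw [h1, h2, Matrix.det_mul, Matrix.det_diagonal]
    exact mul_ne_zero (t.isUnit_val he (hD z) (t.circle_mem z)).ne_zero
      (Finset.prod_ne_zero_iff.2 fun a _ => zpow_ne_zero _ z.coe_ne_zero)
  refine ⟨Matrix.GeneralLinearGroup.mk'' A hA, fun z b a => ?_⟩
  change _ = (z : ℂ) ^ m a * ((z : ℂ) ^ (-m a) * t.val (e a) (z : ℂ) b)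
  rw [← mul_assoc, ← zpow_add₀ z.coe_ne_zero, add_neg_cancel, zpow_zero, one_mul]

end Loops

/-! ### Transition loops of chains: existence and invariance. -/

section ChainTransition

variable {n : ℕ} {Δ : Finset ℕ} {c : Chain n Δ}

/-- The matrix over an unspecified neighbourhood of the circle is replaced by the coordinate values
on the circle, which do not depend on that neighbourhood. -/
lemma Chain.hasTransition_iff {g : LoopGL n} : c.HasTransition g ↔
    ∃ (D : Opens P1) (hD : OnePoint.infty ∉ D) (e : ∀ p : Idx n Δ, Fin n → (c.E p).sec D),
      (∀ z : ℂ, ‖z‖ ≤ 1 → (z : P1) ∈ D) ∧ (∀ p, IsFrame (c.E p) (e p)) ∧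
      (∀ p q h a, (c.incl p q h).map D (e p a) = coord D hD ^ (expo p a - expo q a).toNat • e q a) ∧
      ∀ p (z : Circle) b a, (c.framing p).val (e p a) (z : ℂ) b = (z : ℂ) ^ expo p a * (g.1 b a).1 z := by
  constructor
  · rintro ⟨D, hD, e, h1, h2, h3, h4⟩
    refine ⟨D, hD, e, h1, h2, h3, fun p z b a => ?_⟩
    obtain ⟨V, h, h', hV, G, hG, hs⟩ := h4 p
    rw [(c.framing p).val_eq h h' (hs a) (hV z), hG]
  · rintro ⟨D, hD, e, h1, h2, h3, h4⟩
    refine ⟨D, hD, e, h1, h2, h3, fun p => ⟨D ⊓ (c.framing p).dom, inf_le_left, inf_le_right,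
      fun z => ⟨h1 z z.norm_coe.le, (c.framing p).circle_mem z⟩, fun b a =>
      (c.framing p).isFrame.coords inf_le_right ((c.E p).res inf_le_left (e p a)) b,
      fun b a z => ?_, fun a => (c.framing p).res_eq_sum (e p a)⟩⟩
    rw [← h4]
    exact (ext_of_mem (U := D ⊓ (c.framing p).dom) _
      ⟨h1 z z.norm_coe.le, (c.framing p).circle_mem z⟩).symm

/-- The transition functions of compatible frames are the same up to powers of `z`. -/
lemma Chain.hasTransition_of_val {D : Opens P1} {hD : OnePoint.infty ∉ D}
    {e : ∀ p : Idx n Δ, Fin n → (c.E p).sec D} (hdisc : ∀ z : ℂ, ‖z‖ ≤ 1 → (z : P1) ∈ D)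
    (he : ∀ p, IsFrame (c.E p) (e p))
    (hc : ∀ p q h a, (c.incl p q h).map D (e p a) = coord D hD ^ (expo p a - expo q a).toNat • e q a)
    {p : Idx n Δ} {g : LoopGL n}
    (hg : ∀ (z : Circle) b a, (c.framing p).val (e p a) (z : ℂ) b = (z : ℂ) ^ expo p a * (g.1 b a).1 z) :
    c.HasTransition g := by
  have key : ∀ q r (h : q.pos ≤ r.pos) (z : Circle) b a, (c.framing q).val (e q a) (z : ℂ) b =
      (z : ℂ) ^ (expo q a - expo r a) * (c.framing r).val (e r a) (z : ℂ) b := by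
    intro q r h z b a
    have hz := hdisc z z.norm_coe.le
    rw [← (c.incl_framing q r h).val_eq (e q a) hz (circle_mem_outerDisc z), hc,
      Framing.val_smul _ _ _ hz ((c.framing r).circle_mem z), Hol.pow_val, coord_coe, ← zpow_natCast,
      Int.toNat_of_nonneg (sub_nonneg.2 (expo_le h a))]
  refine Chain.hasTransition_iff.2 ⟨D, hD, e, hdisc, he, hc, fun q z b a => ?_⟩
  -- The members `p` and `q` are compared inside a common larger sheaf.
  obtain ⟨T, h1, h2⟩ := Idx.exists_ge p q
  have e1 := hg z b a
  rw [key p T h1] at e1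
  have hz := z.coe_ne_zero
  have e2 : (c.framing T).val (e T a) (z : ℂ) b = (z : ℂ) ^ expo T a * (g.1 b a).1 z := by
    rw [show expo p a = (expo p a - expo T a) + expo T a by ring, zpow_add₀ hz, mul_assoc] at e1
    rw [add_sub_cancel_right] at e1
    exact mul_left_cancel₀ (zpow_ne_zero _ hz) e1
  rw [key q T h2, e2, ← mul_assoc, ← zpow_add₀ hz, sub_add_cancel]

/-- A frame of a single member adapted to the flag extends to the whole chain, so its transition
function alone determines a loop of the chain. -/
lemma Chain.hasTransition_of_adapted {D : Opens P1} (hD : OnePoint.infty ∉ D) (h0 : zero ∈ D)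
    (hdisc : ∀ z : ℂ, ‖z‖ ≤ 1 → (z : P1) ∈ D) {p : Idx n Δ} {f : Fin n → (c.E p).sec D}
    (hf : IsFrame (c.E p) f)
    (hflag : ∀ (q : Idx n Δ) (_ : p.pred.pos < q.pos) (h₂ : q.pos ≤ p.pos),
      LinearMap.range (c.incl q p h₂).fibreMap =
        Submodule.span ℂ ((fun a => fibreClass (c.E p) h0 (f a)) '' {a | expo q a = expo p a}))
    {g : LoopGL n}
    (hg : ∀ (z : Circle) b a, (c.framing p).val (f a) (z : ℂ) b = (z : ℂ) ^ expo p a * (g.1 b a).1 z) :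
    c.HasTransition g := by
  obtain ⟨e, he, hc, rfl⟩ := c.exists_frames hD h0 hf hflag
  exact Chain.hasTransition_of_val hdisc he hc hg

/-- Every chain has a transition function. -/
theorem Chain.exists_hasTransition [NeZero n] (c : Chain n Δ) (p : Idx n Δ) :
    ∃ g : LoopGL n, c.HasTransition g := by
  obtain ⟨D, h0, f, hD, hdisc, hf, hflag⟩ := c.exists_adapted_frame p
  obtain ⟨g, hg⟩ := (c.framing p).exists_loop (fun z => hdisc z z.norm_coe.le) hf (expo p)
  exact ⟨g, Chain.hasTransition_of_adapted hD h0 hdisc hf hflag hg⟩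

/-- The transition functions of a chain are those of all isomorphic chains. -/
lemma Chain.HasTransition.of_iso {c' : Chain n Δ} {g : LoopGL n} (h : c.HasTransition g)
    (hcc : c.Iso c') : c'.HasTransition g := by
  obtain ⟨φ, hφ, hcomm⟩ := hcc
  obtain ⟨D, hD, e, h1, h2, h3, h4⟩ := Chain.hasTransition_iff.1 h
  refine Chain.hasTransition_iff.2 ⟨D, hD, fun p a => (φ p).map D (e p a), h1,
    fun p => (h2 p).map_of_isIso _ (hφ p).1, fun p q h a => ?_, fun p z b a => ?_⟩
  · rw [← hcomm, h3, map_smul]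
  · rw [(hφ p).2.val_eq _ (h1 z z.norm_coe.le) (circle_mem_outerDisc z), h4]

end ChainTransition

end LoopFlag
end

noncomputable section
namespace LoopFlag

/-! ### Morphisms of sheaves with trivialisations -/

/-! ### The identity theorem along the unit circle. -/

section Circle

/-- The points `z e^{it}` with small `t ≠ 0` lie on the circle, differ from `z` and tend to it. The
circle thus has no isolated point, as the identity theorem needs. -/
lemma frequently_circle {z : ℂ} (hz : ‖z‖ = 1) : ∃ᶠ w in 𝓝[≠] z, ‖w‖ = 1 := by
  have hz0 : z ≠ 0 := fun h => by simp [h] at hz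
  have h1 : Filter.Tendsto (fun t : ℝ => z * Complex.exp (t * Complex.I)) (𝓝[≠] 0) (𝓝[≠] z) := by
    refine tendsto_nhdsWithin_iff.2 ⟨?_, ?_⟩
    · have : ContinuousAt (fun t : ℝ => z * Complex.exp (t * Complex.I)) 0 := by fun_prop
      have h2 := this.tendsto
      simp only [Complex.ofReal_zero, zero_mul, Complex.exp_zero, mul_one] at h2
      exact h2.mono_left nhdsWithin_le_nhds
    · have h3 : ∀ᶠ t : ℝ in 𝓝[≠] 0, t ∈ Set.Ioo (-1 : ℝ) 1 :=
        nhdsWithin_le_nhds (Ioo_mem_nhds (by norm_num) (by norm_num))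
      filter_upwards [h3, self_mem_nhdsWithin] with t ht ht0 h
      have h4 : Complex.exp (t * Complex.I) = 1 := by
        have := mul_left_cancel₀ hz0 (h.trans (mul_one z).symm)
        exact this
      have h5 := congrArg Complex.im h4
      rw [Complex.exp_ofReal_mul_I_im, Complex.one_im] at h5
      have h6 : (3 : ℝ) < Real.pi := Real.pi_gt_three
      exact ht0 ((Real.sin_eq_zero_iff_of_lt_of_lt (by linarith [ht.1]) (by linarith [ht.2])).1 h5)
  refine h1.frequently (Filter.Eventually.frequently (Filter.Eventually.of_forall fun t => ?_))
  rw [norm_mul, hz, Complex.norm_exp_ofReal_mul_I, mul_one]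

lemma eventually_eq_of_circle {f g : ℂ → ℂ} {z : ℂ} (hz : ‖z‖ = 1) (hf : AnalyticAt ℂ f z)
    (hg : AnalyticAt ℂ g z) (h : ∀ w, ‖w‖ = 1 → f w = g w) : ∀ᶠ w in 𝓝 z, f w = g w :=
  (hf.frequently_eq_iff_eventually_eq hg).1 ((frequently_circle hz).mono h)

lemma eqOn_closedBall_of_circle {f g : ℂ → ℂ} (hf : AnalyticOnNhd ℂ f (Metric.closedBall 0 1))
    (hg : AnalyticOnNhd ℂ g (Metric.closedBall 0 1)) (h : ∀ w, ‖w‖ = 1 → f w = g w) :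
    Set.EqOn f g (Metric.closedBall 0 1) :=
  hf.eqOn_of_preconnected_of_frequently_eq hg (convex_closedBall 0 1).isPreconnected
    (by simp : (1 : ℂ) ∈ Metric.closedBall 0 1) ((frequently_circle (by simp)).mono h)

/-- Equality of loops is a pointwise condition on the circle, whereas gluing needs equality over an
open set; the identity theorem bridges the two. -/
lemma exists_opens_eq_of_circle {U : Opens P1} (hU : ∀ z : ℂ, ‖z‖ = 1 → (z : P1) ∈ U) {ι : Type*}
    [Finite ι] (f g : ι → Hol U)
    (h : ∀ i (z : ℂ) (hz : ‖z‖ = 1), (f i).1 ⟨z, hU z hz⟩ = (g i).1 ⟨z, hU z hz⟩) :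
    ∃ (V : Opens P1) (hV : V ≤ U), (∀ z : ℂ, ‖z‖ = 1 → (z : P1) ∈ V) ∧
      ∀ i, Hol.res hV (f i) = Hol.res hV (g i) := by
  let S : Set ℂ := {z | ∀ᶠ w : ℂ in 𝓝 z, (w : P1) ∈ U ∧ ∀ i, ext (f i).1 (w : P1) = ext (g i).1 (w : P1)}
  have hS : ∀ z ∈ S, (z : P1) ∈ U ∧ ∀ i, ext (f i).1 (z : P1) = ext (g i).1 (z : P1) :=
    fun z hz => hz.self_of_nhds
  have hSo : IsOpen S := isOpen_iff_eventually.2 fun z hz => eventually_eventually_nhds.2 hz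
  have hV : opensOf S hSo ≤ U := by
    rintro x ⟨z, hz, rfl⟩
    exact (hS z hz).1
  refine ⟨_, hV, fun z hz => coe_mem_opensOf.2 ?_, fun i => Hol.ext_coe infty_notMem_opensOf fun z hz => ?_⟩
  · change ∀ᶠ w : ℂ in 𝓝 z, _
    refine (eventually_coe (hU z hz)).and (Filter.eventually_all.2 fun i => ?_)
    refine eventually_eq_of_circle hz ((f i).2.1 z (hU z hz)) ((g i).2.1 z (hU z hz)) fun w hw => ?_
    rw [ext_of_mem _ (hU w hw), ext_of_mem _ (hU w hw)]
    exact h i w hw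
  · have h1 := (hS z (coe_mem_opensOf.1 hz)).2 i
    rw [ext_of_mem _ (hV hz), ext_of_mem _ (hV hz)] at h1
    exact h1

lemma sup_eq_top_of_discs {W₁ W₂ : Opens P1} (h₁ : outerDisc ⊆ W₁)
    (h₂ : ∀ z : ℂ, ‖z‖ < 1 → (z : P1) ∈ W₂) : W₁ ⊔ W₂ = ⊤ := by
  refine eq_top_iff.2 fun x _ => ?_
  induction x using OnePoint.rec with
  | infty => exact Or.inl (h₁ infty_mem_outerDisc)
  | coe z =>
    rcases lt_or_ge ‖z‖ 1 with h | h
    · exact Or.inr (h₂ z h)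
    · exact Or.inl (h₁ (coe_mem_outerDisc h))

/-- Shrinking a cover of the sphere by neighbourhoods of two discs. -/
lemma exists_cover_le {U₁ U₂ V : Opens P1} (h₁ : outerDisc ⊆ U₁)
    (h₂ : ∀ z : ℂ, ‖z‖ ≤ 1 → (z : P1) ∈ U₂) (hV : ∀ z : ℂ, ‖z‖ = 1 → (z : P1) ∈ V) :
    ∃ W₁ W₂ : Opens P1, W₁ ≤ U₁ ∧ W₂ ≤ U₂ ∧ W₁ ⊔ W₂ = ⊤ ∧ outerDisc ⊆ W₁ ∧
      (∀ z : ℂ, ‖z‖ ≤ 1 → (z : P1) ∈ W₂) ∧ OnePoint.infty ∉ W₂ ∧ zero ∉ W₁ ∧ W₁ ⊓ W₂ ≤ V := by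
  have hS : IsOpen ({z : ℂ | (z : P1) ∈ V} ∩ {0}ᶜ) :=
    (V.isOpen.preimage OnePoint.continuous_coe).inter isOpen_compl_singleton
  obtain ⟨W₁, W₂, -, k1, k2, k3, k4, k5⟩ := exists_cover hS
    (fun z => ⟨hV z z.norm_coe, z.coe_ne_zero⟩) (fun h => h.2 rfl)
  have m1 : outerDisc ⊆ (W₁ ⊓ U₁ : Opens P1) := fun x hx => ⟨k1 hx, h₁ hx⟩
  have m2 : ∀ z : ℂ, ‖z‖ ≤ 1 → (z : P1) ∈ W₂ ⊓ U₂ := fun z hz => ⟨k4 z hz, h₂ z hz⟩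
  refine ⟨W₁ ⊓ U₁, W₂ ⊓ U₂, inf_le_right, inf_le_right,
    sup_eq_top_of_discs m1 fun z hz => m2 z hz.le, m1, m2, fun h => k3 h.1, fun h => k2 h.1, ?_⟩
  rintro x ⟨hx1, hx2⟩
  obtain ⟨z, rfl⟩ := exists_coe_eq k3 hx2.1
  exact (k5 z ⟨hx1.1, hx2.1⟩).1

end Circle

/-! ### Uniqueness and existence of morphisms compatible with the trivialisations. -/

section Rigidity

variable {n : ℕ} {E F : OMod} {t : Framing n E} {u : Framing n F} {D D' : Opens P1}

/-- A morphism is determined by its restriction to a neighbourhood of `|z| ≥ 1`. -/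
theorem Hom.eq_of_respects {φ ψ : Hom E F} (hφ : φ.Respects t u) (hψ : ψ.Respects t u)
    (hD : ∀ z : ℂ, ‖z‖ ≤ 1 → (z : P1) ∈ D) {e : Fin n → E.sec D} (he : IsFrame E e)
    (hD' : ∀ z : ℂ, ‖z‖ ≤ 1 → (z : P1) ∈ D') {f : Fin n → F.sec D'} (hf : IsFrame F f)
    (U : Opens P1) (s : E.sec U) : φ.map U s = ψ.map U s := by
  obtain ⟨V, h1, h2, h3, h4⟩ := hφ
  obtain ⟨V', k1, k2, k3, k4⟩ := hψ
  have hVframe : IsFrame E fun a => E.res (inf_le_left.trans h1 : V ⊓ V' ≤ t.dom) (t.frame a) :=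
    t.isFrame.res_frame _
  have hV : ∀ a, φ.map (V ⊓ V') (E.res (inf_le_left.trans h1 : V ⊓ V' ≤ t.dom) (t.frame a)) =
      ψ.map (V ⊓ V') (E.res (inf_le_left.trans h1 : V ⊓ V' ≤ t.dom) (t.frame a)) := by
    intro a
    have e1 := congrArg (F.res (inf_le_left : V ⊓ V' ≤ V)) (h4 a)
    have e2 := congrArg (F.res (inf_le_right : V ⊓ V' ≤ V')) (k4 a)
    rw [← φ.naturality, E.res_res, F.res_res] at e1
    rw [← ψ.naturality, E.res_res, F.res_res] at e2
    rw [e1, e2]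
  let B : Opens P1 := opensOf (Metric.ball 0 1) Metric.isOpen_ball
  have hB : B ≤ D ⊓ D' := by
    rintro x ⟨z, hz, rfl⟩
    have := (mem_ball_zero_iff.1 hz).le
    exact ⟨hD z this, hD' z this⟩
  have hvv : ∀ W (hW : W ≤ V ⊓ V') (s : E.sec W), φ.map W s = ψ.map W s := by
    intro W hW s
    rw [φ.map_eq_sum_coords hW hVframe, ψ.map_eq_sum_coords hW hVframe]
    simp only [hV]
  refine Hom.map_congr_of_frames (W₁ := V ⊓ V') (W₂ := B)
    (sup_eq_top_of_discs (fun x hx => ⟨h3 hx, k3 hx⟩) fun z hz =>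
      coe_mem_opensOf.2 (mem_ball_zero_iff.2 hz)) hVframe (he.res_frame (hB.trans inf_le_left)) hV
    (fun a => ?_) U s
  -- Both morphisms agree near `|z| ≥ 1`, hence their coordinates agree on the circle and, being
  -- holomorphic near the closed disc, inside it.
  let c := hf.coords inf_le_right (φ.map (D ⊓ D') (E.res inf_le_left (e a)))
  let c' := hf.coords inf_le_right (ψ.map (D ⊓ D') (E.res inf_le_left (e a)))
  have hcc : ∀ b, Hol.res hB (c b) = Hol.res hB (c' b) := by
    intro b
    have hd : ∀ z : ℂ, ‖z‖ ≤ 1 → (z : P1) ∈ D ⊓ D' := fun z hz => ⟨hD z hz, hD' z hz⟩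
    refine Hol.ext_coe infty_notMem_opensOf fun z hz => ?_
    have hz' : ‖z‖ ≤ 1 := (mem_ball_zero_iff.1 (coe_mem_opensOf.1 hz)).le
    have key : ext (c b).1 (z : P1) = ext (c' b).1 (z : P1) := by
      refine eqOn_closedBall_of_circle (f := fun w : ℂ => ext (c b).1 (w : P1))
        (g := fun w : ℂ => ext (c' b).1 (w : P1))
        (fun w hw => (c b).2.1 w (hd w (mem_closedBall_zero_iff.1 hw)))
        (fun w hw => (c' b).2.1 w (hd w (mem_closedBall_zero_iff.1 hw))) (fun w hw => ?_)
        (mem_closedBall_zero_iff.2 hz')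
      have hw1 : (w : P1) ∈ D ⊓ D' := hd w hw.le
      have hw2 : (w : P1) ∈ V ⊓ V' := ⟨h3 (coe_mem_outerDisc hw.ge), k3 (coe_mem_outerDisc hw.ge)⟩
      have hle : D ⊓ D' ⊓ (V ⊓ V') ≤ D ⊓ D' := inf_le_left
      have e1 := hvv _ inf_le_right (E.res hle (E.res inf_le_left (e a)))
      rw [φ.naturality, ψ.naturality] at e1
      have e2 := congrFun (congrArg (hf.coords (hle.trans inf_le_right)) e1) b
      rw [hf.coords_res, hf.coords_res] at e2
      have e3 := congrArg (Hol.eval (⟨hw1, hw2⟩ : (w : P1) ∈ D ⊓ D' ⊓ (V ⊓ V'))) e2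
      simp only [ext_of_mem _ hw1]
      exact e3
    rw [ext_of_mem _ (hd z hz'), ext_of_mem _ (hd z hz')] at key
    exact key
  have e1 : E.res hB (E.res inf_le_left (e a)) = E.res (hB.trans inf_le_left) (e a) := E.res_res _ _ _
  rw [← e1, φ.naturality, ψ.naturality]
  refine hf.coords_injective (hB.trans inf_le_right) (funext fun b => ?_)
  rw [hf.coords_res, hf.coords_res]
  exact hcc b

/-- Sheaves with the same transition function are isomorphic. -/
theorem exists_iso_of_val (hD : ∀ z : ℂ, ‖z‖ ≤ 1 → (z : P1) ∈ D) {e : Fin n → E.sec D}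
    (he : IsFrame E e) (hD' : ∀ z : ℂ, ‖z‖ ≤ 1 → (z : P1) ∈ D') {f : Fin n → F.sec D'}
    (hf : IsFrame F f) (hval : ∀ (z : Circle) b a, t.val (e a) (z : ℂ) b = u.val (f a) (z : ℂ) b) :
    ∃ φ : Hom E F, φ.IsIso ∧ φ.Respects t u ∧ ∃ (W : Opens P1) (h : W ≤ D) (h' : W ≤ D'),
      (∀ z : ℂ, ‖z‖ ≤ 1 → (z : P1) ∈ W) ∧ ∀ a, φ.map W (E.res h (e a)) = F.res h' (f a) := by
  let O : Opens P1 := D ⊓ t.dom ⊓ (D' ⊓ u.dom)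
  have hO₁ : O ≤ D ⊓ t.dom := inf_le_left
  have hO₂ : O ≤ D' ⊓ u.dom := inf_le_right
  let A : Fin n × Fin n → Hol O := fun i =>
    t.isFrame.coords (hO₁.trans inf_le_right) (E.res (hO₁.trans inf_le_left) (e i.2)) i.1
  let B : Fin n × Fin n → Hol O := fun i =>
    u.isFrame.coords (hO₂.trans inf_le_right) (F.res (hO₂.trans inf_le_left) (f i.2)) i.1
  have hA : ∀ a, E.res (hO₁.trans inf_le_left) (e a) =
      ∑ b, A (b, a) • E.res (hO₁.trans inf_le_right) (t.frame b) := fun a =>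
    (t.isFrame.sum_coords _ _).symm
  have hB : ∀ a, F.res (hO₂.trans inf_le_left) (f a) =
      ∑ b, B (b, a) • F.res (hO₂.trans inf_le_right) (u.frame b) := fun a =>
    (u.isFrame.sum_coords _ _).symm
  have hcirc : ∀ z : ℂ, ‖z‖ = 1 → (z : P1) ∈ O := fun z hz =>
    ⟨⟨hD z hz.le, t.outer_sub (coe_mem_outerDisc hz.ge)⟩,
      ⟨hD' z hz.le, u.outer_sub (coe_mem_outerDisc hz.ge)⟩⟩
  -- The two transition matrices agree on the circle, hence on a neighbourhood of it, to which the
  -- overlap of the cover is shrunk.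
  obtain ⟨V, hV, hVc, hAB⟩ := exists_opens_eq_of_circle hcirc A B (by
    rintro ⟨b, a⟩ z hz
    rw [← t.val_eq _ _ (hA a) (hcirc z hz), ← u.val_eq _ _ (hB a) (hcirc z hz)]
    exact hval ⟨z, mem_sphere_zero_iff_norm.2 hz⟩ b a)
  obtain ⟨W₁, W₂, l1, l2, hW, hout, hin, -, -, hle⟩ := exists_cover_le (U₁ := t.dom ⊓ u.dom)
    (U₂ := D ⊓ D') (fun x hx => ⟨t.outer_sub hx, u.outer_sub hx⟩) (fun z hz => ⟨hD z hz, hD' z hz⟩) hVc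
  have hWO : W₁ ⊓ W₂ ≤ O := hle.trans hV
  have e1 := t.isFrame.res_frame (l1.trans inf_le_left)
  have e2 := he.res_frame (l2.trans inf_le_left)
  obtain ⟨φ, hφ₁, hφ₂⟩ := Hom.exists_of_frames hW e1 e2
    (fun a => F.res (l1.trans inf_le_right) (u.frame a)) (fun a => F.res (l2.trans inf_le_right) (f a)) (by
      intro b
      have r1 := congrArg (E.res hWO) (hA b)
      have r2 := congrArg (F.res hWO) (hB b)
      simp only [OMod.res_sum, E.res_smul, E.res_res] at r1
      simp only [OMod.res_sum, F.res_smul, F.res_res] at r2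
      have r3 : ∀ i, Hol.res hWO (A i) = Hol.res hWO (B i) := fun i =>
        congrArg (Hol.res hle) (hAB i)
      rw [E.res_res, F.res_res, e1.coords_eq (c := fun a => Hol.res hWO (A (a, b))) _ (by
        simp only [E.res_res]; exact r1), r2]
      simp only [r3, F.res_res])
  refine ⟨φ, Hom.isIso_of_frames hW e1 e2 ?_ ?_, ⟨W₁, _, _, hout, hφ₁⟩,
    W₂, l2.trans inf_le_left, l2.trans inf_le_right, hin, hφ₂⟩
  · simp only [hφ₁]
    exact u.isFrame.res_frame _
  · simp only [hφ₂]
    exact hf.res_frame _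

end Rigidity

end LoopFlag
end

noncomputable section
namespace LoopFlag

/-! ### Loops with isomorphic chains -/

/-! ### The condition `χ ≥ 0` in terms of the exponents of the chain. -/

section Chi

variable {n : ℕ} {Δ : Finset ℕ}

lemma sum_simpleValue {b : ℕ} (hb : b ≤ n) : ∑ i ∈ Finset.Icc 1 b, simpleValue Δ i =
    ∑ i ∈ Finset.Icc 1 n \ Δ, if i ≤ b then 1 else 0 := by
  rw [Finset.sdiff_eq_filter, Finset.sum_filter]
  have : Finset.Icc 1 b = (Finset.Icc 1 n).filter (fun i => i ≤ b) := by
    ext i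
    simp only [Finset.mem_Icc, Finset.mem_filter]
    omega
  rw [this, Finset.sum_filter]
  refine Finset.sum_congr rfl fun i _ => ?_
  unfold simpleValue
  split_ifs <;> simp_all

/-- The `j`-th summand is `m` minus the difference of the exponents of `a` and `b` in a sheaf
`E^{i,j}`. This links the root data to the chain. -/
lemma chi_eq_sum (m : ℤ) (a b : Fin n) : chi n Δ m a b = ∑ j ∈ Finset.Icc 1 n \ Δ,
    (m - ((if j ≤ (a : ℕ) then 1 else 0) - (if j ≤ (b : ℕ) then 1 else 0))) := by
  unfold chi
  rw [sum_simpleValue le_rfl, sum_simpleValue a.2.le, sum_simpleValue b.2.le, Finset.mul_sum,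
    ← Finset.sum_add_distrib, ← Finset.sum_sub_distrib]
  refine Finset.sum_congr rfl fun j hj => ?_
  have : j ≤ n := (Finset.mem_Icc.1 (Finset.mem_sdiff.1 hj).1).2
  rw [if_pos this]
  ring

lemma expo_sub_expo (p : Idx n Δ) (a b : Fin n) : expo p a - expo p b =
    (if p.j ≤ (a : ℕ) then 1 else 0) - (if p.j ≤ (b : ℕ) then 1 else 0) := by
  unfold expo
  split_ifs <;> omega

/-- For fixed `a` and `b` the exponent differences take at most two consecutive values. If `m` were
smaller than one of them, no summand of `χ` would be positive and one would be negative. -/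
lemma expo_sub_le_of_chi_nonneg {m : ℤ} {a b : Fin n} (h : 0 ≤ chi n Δ m a b) (p : Idx n Δ) :
    expo p a - expo p b ≤ m := by
  by_contra hm
  rw [expo_sub_expo] at hm
  rw [chi_eq_sum] at h
  refine absurd h (not_le.2 (Finset.sum_neg' (fun j _ => ?_) ⟨p.j, p.mem, ?_⟩))
  · split_ifs at hm ⊢ <;> omega
  · omega

/-- Choose a `j` at which the exponent difference is largest: then every summand of `χ` is
non-negative. Here the complement of `Δ` has to be non-empty. -/
lemma exists_chi_expo_nonneg (h : (Finset.Icc 1 n \ Δ).Nonempty) (a b : Fin n) :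
    ∃ p : Idx n Δ, 0 ≤ chi n Δ (expo p a - expo p b) a b := by
  obtain ⟨j, hj, hmax⟩ := Finset.exists_max_image (Finset.Icc 1 n \ Δ) (fun j =>
    ((if j ≤ (a : ℕ) then 1 else 0) - (if j ≤ (b : ℕ) then 1 else 0) : ℤ)) h
  refine ⟨⟨0, j, hj⟩, ?_⟩
  rw [chi_eq_sum, expo_sub_expo]
  exact Finset.sum_nonneg fun i hi => sub_nonneg.2 (hmax i hi)

end Chi

/-! ### Cosets of the parabolic subgroup and isomorphism classes of chains. -/

section Classes

variable {n : ℕ} {Δ : Finset ℕ}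

lemma LoopGL.eval_mul (g h : LoopGL n) (z : Circle) :
    (g * h).1.map (Loop.eval z) = g.1.map (Loop.eval z) * h.1.map (Loop.eval z) := by
  rw [Units.val_mul, Matrix.map_mul]

/-- For each `p` the change between the two frames of `E p` is holomorphic near the disc, so the
entry `(a, b)` of `g⁻¹ g'` is `z ^ (expo p a - expo p b)` times a holomorphic function. The member
`p` is chosen for each entry so that this exponent satisfies `χ ≥ 0`. -/
lemma Chain.HasTransition.inParabolicAlgebra {c : Chain n Δ} {g g' : LoopGL n}
    (hJ : (Finset.Icc 1 n \ Δ).Nonempty) (h : c.HasTransition g) (h' : c.HasTransition g') :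
    InParabolicAlgebra n Δ (g⁻¹ * g' : LoopGL n).1 := by
  obtain ⟨D, hD, e, h1, h2, -, h4⟩ := Chain.hasTransition_iff.1 h
  obtain ⟨D', hD', e', h1', h2', -, h4'⟩ := Chain.hasTransition_iff.1 h'
  have hdisc : ∀ z : ℂ, ‖z‖ ≤ 1 → (z : P1) ∈ D ⊓ D' := fun z hz => ⟨h1 z hz, h1' z hz⟩
  intro a b
  obtain ⟨p, hp⟩ := exists_chi_expo_nonneg hJ a b
  let N := (h2 p).matrix (inf_le_left : D ⊓ D' ≤ D) (fun b => (c.E p).res inf_le_right (e' p b))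
  refine ⟨_, hp, fun w => ext (N a b).1 (w : P1), fun w hw =>
    (N a b).2.1 w (hdisc w (mem_closedBall_zero_iff.1 hw)), fun z => ?_⟩
  have hz := hdisc z z.norm_coe.le
  have hzt := (c.framing p).circle_mem z
  have hz0 := z.coe_ne_zero
  let M : Matrix (Fin n) (Fin n) ℂ := fun a b =>
    (z : ℂ) ^ (expo p a - expo p b) * (N a b).1 ⟨(z : ℂ), hz⟩
  have key : g'.1.map (Loop.eval z) = g.1.map (Loop.eval z) * M := by
    ext d b
    have e1 := (c.framing p).val_res inf_le_right (e' p b) hz hzt d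
    rw [h4', (h2 p).eq_sum_matrix (inf_le_left : D ⊓ D' ≤ D)
      (fun b => (c.E p).res inf_le_right (e' p b)) b, (c.framing p).val_sum_smul _ _ hz hzt] at e1
    have e2 : (g'.1 d b).1 z = (z : ℂ) ^ (-expo p b) * ((z : ℂ) ^ expo p b * (g'.1 d b).1 z) := by
      rw [← mul_assoc, ← zpow_add₀ hz0, neg_add_cancel, zpow_zero, one_mul]
    refine e2.trans ?_
    rw [← e1, Finset.mul_sum, Matrix.mul_apply]
    refine Finset.sum_congr rfl fun a _ => ?_
    rw [(c.framing p).val_res inf_le_left (e p a) hz hzt, h4]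
    change _ = (g.1 d a).1 z * ((z : ℂ) ^ (expo p a - expo p b) * (N a b).1 ⟨(z : ℂ), hz⟩)
    rw [sub_eq_add_neg, zpow_add₀ hz0]
    ring
  have key2 : (g⁻¹ * g' : LoopGL n).1.map (Loop.eval z) = M := by
    rw [LoopGL.eval_mul, key, ← mul_assoc, ← LoopGL.eval_mul, inv_mul_cancel, Units.val_one,
      Matrix.map_one _ (map_zero _) (map_one _), one_mul]
  have := congrFun (congrFun key2 a) b
  exact this.trans (congrArg (fun x => (z : ℂ) ^ (expo p a - expo p b) * x)
    (ext_of_mem (N a b).1 hz).symm)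

/-- Change of frame near the closed disc by a matrix of analytic functions. -/
lemma IsFrame.exists_mul_matrix {E : OMod} {D : Opens P1} (hD : ∀ z : ℂ, ‖z‖ ≤ 1 → (z : P1) ∈ D)
    {e : Fin n → E.sec D} (he : IsFrame E e) (t : Framing n E) (K : ℂ → Matrix (Fin n) (Fin n) ℂ)
    (hK : ∀ a b, AnalyticOnNhd ℂ (fun w => K w a b) (Metric.closedBall 0 1))
    (hdet : ∀ z ∈ Metric.closedBall (0 : ℂ) 1, (K z).det ≠ 0) :
    ∃ V : Opens P1, (∀ z : ℂ, ‖z‖ ≤ 1 → (z : P1) ∈ V) ∧ ∃ f : Fin n → E.sec V, IsFrame E f ∧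
      ∀ (z : Circle) c b, t.val (f b) (z : ℂ) c = ∑ a, K z a b * t.val (e a) (z : ℂ) c := by
  let S : Set ℂ := {z | ∀ᶠ w : ℂ in 𝓝 z, (w : P1) ∈ D ∧ (∀ a b, AnalyticAt ℂ (fun w => K w a b) w) ∧
    IsUnit (K w)}
  have hS : IsOpen S := isOpen_iff_eventually.2 fun z hz => eventually_eventually_nhds.2 hz
  have hSD : ∀ z ∈ S, (z : P1) ∈ D ∧ (∀ a b, AnalyticAt ℂ (fun w => K w a b) z) ∧ IsUnit (K z) :=
    fun z hz => hz.self_of_nhds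
  have hV : opensOf S hS ≤ D := by
    rintro x ⟨z, hz, rfl⟩
    exact (hSD z hz).1
  have hdisc : ∀ z : ℂ, ‖z‖ ≤ 1 → (z : P1) ∈ opensOf S hS := by
    intro z hz
    have hz' := mem_closedBall_zero_iff.2 hz
    refine coe_mem_opensOf.2 ?_
    change ∀ᶠ w : ℂ in 𝓝 z, _
    refine (eventually_coe (hD z hz)).and ((Filter.eventually_all.2 fun a =>
      Filter.eventually_all.2 fun b => (hK a b z hz').eventually_analyticAt).and ?_)
    have hc : ContinuousAt (fun w => (K w).det) z := by
      simp only [Matrix.det_apply]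
      refine tendsto_finsetSum _ fun σ _ => Filter.Tendsto.const_smul ?_ _
      exact tendsto_finsetProd _ fun i _ => (hK _ _ z hz').continuousAt
    filter_upwards [hc.eventually_ne (hdet z hz')] with w hw
    exact (Matrix.isUnit_iff_isUnit_det _).2 hw.isUnit
  refine ⟨_, hdisc, _, he.of_matrix_sum hV (M := holMatrix _ infty_notMem_opensOf K fun z hz =>
    (hSD z (coe_mem_opensOf.1 hz)).2.1) (isUnit_holMatrix_det fun z hz =>
      (hSD z (coe_mem_opensOf.1 hz)).2.2), fun z c b => ?_⟩
  have hz := hdisc z z.norm_coe.le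
  rw [t.val_sum_smul _ _ hz (t.circle_mem z)]
  refine Finset.sum_congr rfl fun a _ => ?_
  rw [t.val_res _ _ hz (t.circle_mem z)]
  rfl

/-- An element of the parabolic algebra, conjugated by the powers of `z` belonging to a member of
the chain, extends to the disc. -/
lemma InParabolicAlgebra.exists_extension {A : Matrix (Fin n) (Fin n) Loop}
    (hA : InParabolicAlgebra n Δ A) (p : Idx n Δ) :
    ∃ K : ℂ → Matrix (Fin n) (Fin n) ℂ,
      (∀ a b, AnalyticOnNhd ℂ (fun w => K w a b) (Metric.closedBall 0 1)) ∧
      ∀ (z : Circle) a b, (z : ℂ) ^ expo p a * K z a b = (A a b).1 z * (z : ℂ) ^ expo p b := by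
  choose m hm H hH hHA using hA
  refine ⟨fun w a b => w ^ (m a b - (expo p a - expo p b)).toNat * H a b w, fun a b w hw =>
    (analyticAt_id.pow _).fun_mul (hH a b w hw), fun z a b => ?_⟩
  have := expo_sub_le_of_chi_nonneg (hm a b) p
  have hz := z.coe_ne_zero
  change (z : ℂ) ^ expo p a * ((z : ℂ) ^ (m a b - (expo p a - expo p b)).toNat * H a b z) = _
  rw [hHA, ← mul_assoc, ← zpow_natCast, Int.toNat_of_nonneg (by omega), ← zpow_add₀ hz, mul_right_comm,
    ← zpow_add₀ hz]
  congr 2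
  ring

/-- Conjugated by the powers of `z` of a member `p`, the matrices `g⁻¹ g'` and `g'⁻¹ g` extend to
holomorphic `K` and `L` on the disc. As `K L = 1` on the circle, it holds on the disc, and the frame
of `c` changed by `K` has the same values on the circle as the frame of `c'`. -/
theorem Chain.HasTransition.iso_of_mem [NeZero n] {c c' : Chain n Δ} {g g' : LoopGL n}
    (h : c.HasTransition g) (h' : c'.HasTransition g')
    (hP : InParabolicAlgebra n Δ (g⁻¹ * g' : LoopGL n).1)
    (hP' : InParabolicAlgebra n Δ (g'⁻¹ * g : LoopGL n).1) : c.Iso c' := by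
  obtain ⟨D, hD, e, h1, h2, -, h4⟩ := Chain.hasTransition_iff.1 h
  obtain ⟨D', hD', e', h1', h2', -, h4'⟩ := Chain.hasTransition_iff.1 h'
  have key : ∀ p, ∃ φ : Hom (c.E p) (c'.E p), φ.IsIso ∧ φ.Respects (c.framing p) (c'.framing p) := by
    intro p
    obtain ⟨K, hK, hKA⟩ := hP.exists_extension p
    obtain ⟨L, hL, hLA⟩ := hP'.exists_extension p
    have hKL : ∀ z : ℂ, ‖z‖ = 1 → K z * L z = 1 := by
      intro w hw
      obtain ⟨z, rfl⟩ : ∃ z : Circle, (z : ℂ) = w := ⟨⟨w, mem_sphere_zero_iff_norm.2 hw⟩, rfl⟩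
      have hz : ∀ k : ℤ, (z : ℂ) ^ k ≠ 0 := fun k => zpow_ne_zero _ z.coe_ne_zero
      let T : Matrix (Fin n) (Fin n) ℂ := Matrix.diagonal fun a => (z : ℂ) ^ expo p a
      have hT : IsUnit T := by
        rw [Matrix.isUnit_iff_isUnit_det, Matrix.det_diagonal, isUnit_iff_ne_zero]
        exact Finset.prod_ne_zero_iff.2 fun a _ => hz _
      have t1 : T * K z = (g⁻¹ * g' : LoopGL n).1.map (Loop.eval z) * T := by
        ext a b
        rw [Matrix.diagonal_mul, Matrix.mul_diagonal]
        exact hKA z a b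
      have t2 : T * L z = (g'⁻¹ * g : LoopGL n).1.map (Loop.eval z) * T := by
        ext a b
        rw [Matrix.diagonal_mul, Matrix.mul_diagonal]
        exact hLA z a b
      have t3 : T * (K z * L z) = T * 1 := by
        rw [← mul_assoc, t1, mul_assoc, t2, ← mul_assoc, ← LoopGL.eval_mul, mul_assoc g⁻¹,
          mul_inv_cancel_left, inv_mul_cancel, Units.val_one,
          Matrix.map_one _ (map_zero _) (map_one _), one_mul, mul_one]
      exact hT.mul_left_cancel t3
    have hKL' : ∀ z ∈ Metric.closedBall (0 : ℂ) 1, K z * L z = 1 := by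
      intro z hz
      ext a b
      refine eqOn_closedBall_of_circle (f := fun z => (K z * L z) a b)
        (g := fun _ => (1 : Matrix (Fin n) (Fin n) ℂ) a b) (fun w hw => ?_)
        (fun _ _ => analyticAt_const) (fun w hw => by simp only [hKL w hw]) hz
      simp only [Matrix.mul_apply]
      exact Finset.analyticAt_fun_sum _ fun i _ => (hK a i w hw).fun_mul (hL i b w hw)
    obtain ⟨V, hV, f, hf, hval⟩ := (h2 p).exists_mul_matrix h1 (c.framing p) K hK fun z hz h0 => by
      have := congrArg Matrix.det (hKL' z hz)
      rw [Matrix.det_mul, h0, zero_mul, Matrix.det_one] at this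
      exact zero_ne_one this
    obtain ⟨φ, hφ, hr, -⟩ := exists_iso_of_val (t := c.framing p) (u := c'.framing p) hV hf h1' (h2' p) (by
      intro z d b
      rw [hval, h4']
      have e1 : g'.1.map (Loop.eval z) = g.1.map (Loop.eval z) *
          (g⁻¹ * g' : LoopGL n).1.map (Loop.eval z) := by
        rw [← LoopGL.eval_mul, mul_inv_cancel_left]
      have e2 : (g'.1 d b).1 z = ∑ a, (g.1 d a).1 z * ((g⁻¹ * g' : LoopGL n).1 a b).1 z :=
        congrFun (congrFun e1 d) b
      rw [e2, Finset.mul_sum]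
      refine Finset.sum_congr rfl fun a _ => ?_
      rw [h4, ← mul_assoc, mul_comm (K z a b), hKA]
      ring)
    exact ⟨φ, hφ, hr⟩
  choose φ hφ hr using key
  -- The isomorphisms were chosen separately for each `p`; they commute with the inclusions by
  -- rigidity.
  refine ⟨φ, fun p => ⟨hφ p, hr p⟩, fun p q hpq U s => ?_⟩
  exact Hom.eq_of_respects (φ := (c.incl p q hpq).comp (φ q)) (ψ := (φ p).comp (c'.incl p q hpq))
    ((c.incl_framing p q hpq).comp (hr q)) ((hr p).comp (c'.incl_framing p q hpq)) h1 (h2 p) h1' (h2' q) U s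

lemma Chain.HasTransition.mem_parabolic_iff [NeZero n] (hJ : (Finset.Icc 1 n \ Δ).Nonempty)
    {c c' : Chain n Δ} {g g' : LoopGL n} (h : c.HasTransition g) (h' : c'.HasTransition g') :
    g⁻¹ * g' ∈ parabolic n Δ ↔ c.Iso c' := by
  have hinv : (g⁻¹ * g')⁻¹ = g'⁻¹ * g := by rw [mul_inv_rev, inv_inv]
  constructor
  · rintro ⟨k1, k2⟩
    rw [hinv] at k2
    exact h.iso_of_mem h' k1 k2
  · intro hi
    have h2 := h.of_iso hi
    refine ⟨h2.inParabolicAlgebra hJ h', ?_⟩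
    rw [hinv]
    exact h'.inParabolicAlgebra hJ h2

end Classes

/-- A relation between the elements of two types induces a bijection between their quotients. -/
lemma exists_equiv_of_relation {α : Type*} {β : Type*} {s : Setoid α} {t : Setoid β} (R : α → β → Prop)
    (h₁ : ∀ a, ∃ b, R a b) (h₂ : ∀ b, ∃ a, R a b)
    (h₃ : ∀ a b a' b', R a b → R a' b' → (s a a' ↔ t b b'))
    (h₄ : ∀ a b b', R a b → t b b' → R a b') :
    ∃ Φ : Quotient s ≃ Quotient t, ∀ a b, Φ (Quotient.mk s a) = Quotient.mk t b ↔ R a b := by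
  choose F hF using h₁
  let f : Quotient s → Quotient t := Quotient.lift (fun a => Quotient.mk t (F a)) fun a a' h =>
    Quotient.sound ((h₃ _ _ _ _ (hF a) (hF a')).1 h)
  have hf : Function.Bijective f := by
    constructor
    · rintro ⟨a⟩ ⟨a'⟩ h
      exact Quotient.sound ((h₃ _ _ _ _ (hF a) (hF a')).2 (Quotient.exact h))
    · rintro ⟨b⟩
      obtain ⟨a, ha⟩ := h₂ b
      exact ⟨Quotient.mk s a, Quotient.sound ((h₃ _ _ _ _ (hF a) ha).1 (s.refl a))⟩
  refine ⟨Equiv.ofBijective f hf, fun a b => ⟨fun h => ?_, fun h => ?_⟩⟩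
  · exact h₄ a _ b (hF a) (Quotient.exact h)
  · exact Quotient.sound ((h₃ _ _ _ _ (hF a) h).1 (s.refl a))

end LoopFlag
end

noncomputable section
namespace LoopFlag

/-! ### Chains and flagged bundles -/

section Base

variable {n : ℕ} {Δ : Finset ℕ}

/-- The dimensions `l - j` belong to the sheaves `E^{i-1,l}` with `l > j`, the dimensions `n + l -
j` to the sheaves `E^{i,l}` with `l < j`. -/
lemma Idx.mem_flagDims {p : Idx n Δ} {d : ℕ} : d ∈ flagDims n Δ p.j ↔
    ∃ q : Idx n Δ, p.pred.pos < q.pos ∧ q.pos < p.pos ∧ q.pos = p.pred.pos + d := by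
  have k1 := p.one_le_j
  have k2 := p.j_le
  simp only [flagDims, Finset.mem_union, Finset.mem_image, Finset.mem_filter]
  constructor
  · rintro (⟨l, ⟨hl, hlj⟩, rfl⟩ | ⟨l, ⟨hl, hlj⟩, rfl⟩)
    · have hl' := (Finset.mem_Icc.1 (Finset.mem_sdiff.1 hl).1)
      refine ⟨⟨p.i - 1, l, hl⟩, ?_⟩
      simp only [Idx.pos, Idx.pred, mul_sub, mul_one]
      omega
    · have hl' := (Finset.mem_Icc.1 (Finset.mem_sdiff.1 hl).1)
      refine ⟨⟨p.i, l, hl⟩, ?_⟩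
      simp only [Idx.pos, Idx.pred, mul_sub, mul_one]
      omega
  · rintro ⟨q, h1, h2, h3⟩
    have i1 := Idx.i_le h1.le
    have i2 := Idx.i_le h2.le
    have i3 : p.pred.i = p.i - 1 := rfl
    have i4 : p.pred.j = p.j := rfl
    have k3 := q.one_le_j
    have k4 := q.j_le
    rcases (show q.i = p.i ∨ q.i = p.i - 1 by omega) with h | h
    · refine Or.inr ⟨q.j, ⟨q.mem, ?_⟩, ?_⟩ <;> simp only [Idx.pos, h, i3, i4, mul_sub, mul_one] at * <;> omega
    · refine Or.inl ⟨q.j, ⟨q.mem, ?_⟩, ?_⟩ <;> simp only [Idx.pos, h, i3, i4, mul_sub, mul_one] at * <;> omega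

lemma Hom.surjective_fibreMap {E F : OMod} {f : Hom E F} (hf : f.IsIso) :
    Function.Surjective f.fibreMap := by
  intro x
  obtain ⟨U, hU, s, rfl⟩ := exists_fibreClass_eq x
  obtain ⟨r, rfl⟩ := (hf U).2 s
  exact ⟨fibreClass E hU r, f.fibreMap_fibreClass hU r⟩

variable {c c' : Chain n Δ} {p : Idx n Δ}

lemma Chain.map_fibreRange {φ : ∀ p, Hom (c.E p) (c'.E p)} (hφ : ∀ p, (φ p).IsIso)
    (hc : ∀ p q h U s, (φ q).map U ((c.incl p q h).map U s) = (c'.incl p q h).map U ((φ p).map U s))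
    {q : Idx n Δ} (h : q.pos ≤ p.pos) :
    (c.fibreRange h).map (φ p).fibreMap = c'.fibreRange h := by
  have hcomp : (φ p).fibreMap ∘ₗ (c.incl q p h).fibreMap = (c'.incl q p h).fibreMap ∘ₗ (φ q).fibreMap := by
    refine LinearMap.ext fun x => ?_
    obtain ⟨U, hU, s, rfl⟩ := exists_fibreClass_eq x
    simp only [LinearMap.comp_apply, Hom.fibreMap_fibreClass, hc]
  rw [Chain.fibreRange, ← LinearMap.range_comp, hcomp, LinearMap.range_comp_of_range_eq_top]
  · rfl
  · exact LinearMap.range_eq_top.2 (Hom.surjective_fibreMap (hφ q))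

/-- Compatible frames of a chain are adapted to the flags. -/
lemma Chain.range_fibreMap_eq_span {D : Opens P1} {hD : OnePoint.infty ∉ D} (h0 : zero ∈ D)
    {e : ∀ p : Idx n Δ, Fin n → (c.E p).sec D} (he : ∀ p, IsFrame (c.E p) (e p))
    (hc : ∀ p q h a, (c.incl p q h).map D (e p a) = coord D hD ^ (expo p a - expo q a).toNat • e q a)
    {q : Idx n Δ} (h : q.pos ≤ p.pos) : LinearMap.range (c.incl q p h).fibreMap =
      Submodule.span ℂ ((fun a => fibreClass (c.E p) h0 (e p a)) '' {a | expo q a = expo p a}) := by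
  have himg : ∀ a, (c.incl q p h).fibreMap (fibreClass (c.E q) h0 (e q a)) =
      if expo q a = expo p a then fibreClass (c.E p) h0 (e p a) else 0 := by
    intro a
    rw [Hom.fibreMap_fibreClass, hc]
    have := expo_le h a
    split_ifs with ha
    · rw [ha, sub_self, Int.toNat_zero, pow_zero, one_smul]
    · refine fibreClass_smul_eq_zero h0 ?_ _
      rw [Hol.pow_val, coord_zero, zero_pow]
      omega
  have htop : Submodule.span ℂ (Set.range fun a => fibreClass (c.E q) h0 (e q a)) = ⊤ := by
    obtain ⟨hn, hfd⟩ := (he q).finrank_fibre h0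
    refine LinearIndependent.span_eq_top_of_card_eq_finrank' ((he q).linearIndependent_fibreClass h0) ?_
    rw [hn, Fintype.card_fin]
  rw [LinearMap.range_eq_map, ← htop, Submodule.map_span, ← Set.range_comp]
  refine le_antisymm (Submodule.span_le.2 ?_) (Submodule.span_le.2 ?_)
  · rintro _ ⟨a, rfl⟩
    simp only [Function.comp_apply, himg]
    split_ifs with ha
    · exact Submodule.subset_span ⟨a, ha, rfl⟩
    · exact Submodule.zero_mem _
  · rintro _ ⟨a, ha, rfl⟩
    refine Submodule.subset_span ⟨a, ?_⟩
    simp only [Function.comp_apply, himg]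
    exact if_pos ha

/-- Each member of a chain is the base of a flagged bundle. -/
lemma Chain.exists_isBase (c : Chain n Δ) (p : Idx n Δ) :
    ∃ F : FlaggedBundle n (flagDims n Δ p.j), c.IsBase p F := by
  choose q h1 h2 h3 using fun d (hd : d ∈ flagDims n Δ p.j) => Idx.mem_flagDims.1 hd
  refine ⟨⟨c.E p, c.isLocallyFree p, c.framing p, fun d hd => c.fibreRange (h2 d hd).le,
    fun d hd => ?_, fun d hd d' hd' h => c.fibreRange_mono _ _ ?_⟩,
    Hom.id _, fun U => Function.bijective_id, Hom.Respects.refl _, fun r h d hd hr => ?_⟩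
  · have := c.finrank_fibreRange (h1 d hd).le (h2 d hd).le
    have h := h3 d hd
    change Module.finrank ℂ (c.fibreRange (h2 d hd).le) = d
    omega
  · rw [h3 d hd, h3 d' hd']
    omega
  · obtain rfl : q d hd = r := Idx.eq_of_pos ((h3 d hd).trans hr.symm)
    rw [Hom.fibreMap_id, Submodule.map_id]
    rfl

lemma Chain.IsBase.of_iso {F F' : FlaggedBundle n (flagDims n Δ p.j)} (h : c.IsBase p F)
    (hF : F.Iso F') : c.IsBase p F' := by
  obtain ⟨f, hf, hr, hfl⟩ := h
  obtain ⟨k, hk, kr, hkl⟩ := hF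
  refine ⟨(k.inv hk).comp f, fun U => (hf U).comp (k.isIso_inv hk U), (kr.inv hk).comp hr,
    fun q hq d hd hqd => ?_⟩
  rw [Hom.fibreMap_comp, Submodule.map_comp, ← hkl, ← Submodule.map_comp (f := k.fibreMap),
    Hom.inv_fibreMap, Submodule.map_id]
  exact hfl q hq d hd hqd

lemma Chain.IsBase.iso_of_iso {F F' : FlaggedBundle n (flagDims n Δ p.j)} (h : c.IsBase p F)
    (h' : c'.IsBase p F') (hc : c.Iso c') : F.Iso F' := by
  obtain ⟨f, hf, hr, hfl⟩ := h
  obtain ⟨f', hf', hr', hfl'⟩ := h'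
  obtain ⟨φ, hφ, hcomm⟩ := hc
  refine ⟨(f.comp (φ p)).comp (f'.inv hf'), fun U =>
    (f'.isIso_inv hf' U).comp (((hφ p).1 U).comp (hf U)), (hr.comp (hφ p).2).comp (hr'.inv hf'),
    fun d hd => ?_⟩
  obtain ⟨q, h1, h2, h3⟩ := Idx.mem_flagDims.1 hd
  rw [Hom.fibreMap_comp, Submodule.map_comp, Hom.fibreMap_comp, Submodule.map_comp,
    hfl q h2.le d hd h3]
  have := Chain.map_fibreRange (fun p => (hφ p).1) hcomm h2.le
  rw [Chain.fibreRange, Chain.fibreRange, ← hfl' q h2.le d hd h3] at this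
  rw [this, ← Submodule.map_comp, Hom.inv_fibreMap, Submodule.map_id]

/-- The isomorphism carries an adapted frame of `c` at `p` to an adapted frame of `c'` with the same
values on the circle. The two chains share a loop, hence are isomorphic. -/
lemma Chain.IsBase.chain_iso_of_iso [NeZero n] (hJ : (Finset.Icc 1 n \ Δ).Nonempty)
    {F F' : FlaggedBundle n (flagDims n Δ p.j)} (h : c.IsBase p F)
    (h' : c'.IsBase p F') (hF : F.Iso F') : c.Iso c' := by
  obtain ⟨f, hf, hr, hfl⟩ := h.of_iso hF
  obtain ⟨f', hf', hr', hfl'⟩ := h'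
  let ψ : Hom (c.E p) (c'.E p) := (f.inv hf).comp f'
  have hψ : ψ.IsIso := fun U => (hf' U).comp (f.isIso_inv hf U)
  have hψr : ψ.Respects (c.framing p) (c'.framing p) := (hr.inv hf).comp hr'
  obtain ⟨D, h0, e, hD, hdisc, he, hflag⟩ := c.exists_adapted_frame p
  obtain ⟨g, hg⟩ := (c.framing p).exists_loop (fun z => hdisc z z.norm_coe.le) he (expo p)
  have t1 := Chain.hasTransition_of_adapted hD h0 hdisc he hflag hg
  have t2 : c'.HasTransition g := by
    refine Chain.hasTransition_of_adapted hD h0 hdisc (he.map_of_isIso ψ hψ) (fun q h₁ h₂ => ?_)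
      fun z b a => ?_
    · have hmap : (c.fibreRange h₂).map ψ.fibreMap = c'.fibreRange h₂ := by
        rcases h₂.eq_or_lt with h | h
        · obtain rfl := Idx.eq_of_pos h
          rw [c.fibreRange_self, c'.fibreRange_self, Submodule.map_top]
          exact LinearMap.range_eq_top.2 (Hom.surjective_fibreMap hψ)
        · obtain ⟨d, hd⟩ : ∃ d : ℕ, q.pos = p.pred.pos + d := ⟨(q.pos - p.pred.pos).toNat, by omega⟩
          have hd' : d ∈ flagDims n Δ p.j := Idx.mem_flagDims.2 ⟨q, h₁, h, hd⟩
          rw [Chain.fibreRange, ← hfl q h₂ d hd' hd, ← Submodule.map_comp, ← Hom.fibreMap_comp,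
            Chain.fibreRange, ← hfl' q h₂ d hd' hd]
          have : (f.comp ((f.inv hf).comp f')).fibreMap = f'.fibreMap := by
            rw [Hom.fibreMap_comp, Hom.fibreMap_comp, LinearMap.comp_assoc, Hom.inv_fibreMap,
              LinearMap.comp_id]
          rw [this]
      rw [Chain.fibreRange, Chain.fibreRange, hflag q h₁ h₂, Submodule.map_span, ← Set.image_comp] at hmap
      rw [← hmap]
      congr 2
      funext a
      exact ψ.fibreMap_fibreClass h0 (e a)
    · rw [hψr.val_eq _ (hdisc z z.norm_coe.le) (circle_mem_outerDisc z), hg]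
  exact (t1.mem_parabolic_iff hJ t2).1 (by rw [inv_mul_cancel]; exact one_mem _)

lemma IsLocallyFree.exists_isFrame {E : OMod} (h : IsLocallyFree n E) (z : ℂ) :
    ∃ (V : Opens P1) (e : Fin n → E.sec V), (z : P1) ∈ V ∧ IsFrame E e := by
  obtain ⟨V, hV, e, he⟩ := h z
  exact ⟨V, e, hV, he⟩

/-- Every flagged bundle belongs to a chain. -/
lemma FlaggedBundle.exists_isBase [NeZero n] {p : Idx n Δ} (F : FlaggedBundle n (flagDims n Δ p.j)) :
    ∃ c : Chain n Δ, c.IsBase p F := by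
  obtain ⟨D, h0, f, hD, hdisc, hf, hflag⟩ := exists_adapted_frame F.locallyFree.exists_isFrame
    (ι := {d // d ∈ flagDims n Δ p.j}) (fun d => F.flag d.1 d.2) (fun d => d.1)
    (fun d => F.finrank_flag d.1 d.2) (fun d d' h => F.flag_mono _ _ _ _ h) p.cyc_injective
  -- The chain is built from the loop of an adapted frame of `F`. Its member `p` has the same
  -- transition values as `F`, and its flag is spanned by the corresponding frame vectors.
  obtain ⟨g, hg⟩ := F.framing.exists_loop (fun z => hdisc z z.norm_coe.le) hf (expo p)
  obtain ⟨c, hc⟩ := exists_chain (Δ := Δ) g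
  obtain ⟨D', hD', e, h1, h2, h3, h4⟩ := Chain.hasTransition_iff.1 hc
  obtain ⟨φ, hφ, hr, W, hW, hW', hWd, hφe⟩ := exists_iso_of_val (t := F.framing) (u := c.framing p)
    hdisc hf h1 (h2 p) (fun z b a => by rw [hg, h4])
  have h0W : zero ∈ W := hWd 0 (by simp)
  refine ⟨c, φ, hφ, hr, fun q hq d hd hqd => ?_⟩
  have hlt : p.pred.pos < q.pos ∧ q.pos ≤ p.pos := by
    obtain ⟨r, k1, k2, k3⟩ := Idx.mem_flagDims.1 hd
    omega
  rw [Chain.range_fibreMap_eq_span (h1 0 (by simp)) h2 h3 hq, hflag ⟨d, hd⟩, Submodule.map_span,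
    ← Set.image_comp]
  congr 1
  have hset : {a | (p.cyc a : ℕ) < d} = {a | expo q a = expo p a} := by
    ext a
    have := Idx.expo_eq_iff hlt.1 hlt.2 a
    rw [hqd, add_sub_cancel_left, Nat.cast_lt] at this
    exact this.symm
  rw [hset]
  congr 1
  funext a
  change φ.fibreMap (fibreClass F.E h0 (f a)) = fibreClass (c.E p) (hW' h0W) (e p a)
  rw [← fibreClass_res hW h0W, ← fibreClass_res hW' h0W, Hom.fibreMap_fibreClass, hφe]

end Base

end LoopFlag
end

noncomputable section
namespace LoopFlag

/-! ### Winding numbers -/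

section Winding

lemma continuous_loop (f : Loop) : Continuous f.1 := by
  obtain ⟨F, hF, hf⟩ := f.2
  have : f.1 = fun z : Circle => F z := funext hf
  rw [this]
  refine continuous_iff_continuousAt.2 fun z => ?_
  exact ContinuousAt.comp (f := fun z : Circle => (z : ℂ)) (g := F)
    (hF z (mem_sphere_zero_iff_norm.2 z.norm_coe)).continuousAt (by fun_prop : Continuous fun z : Circle => (z : ℂ)).continuousAt

/-- The two exponents differ by a lift of `z ^ (w' - w)` through `exp`. Along `θ ↦ e^{iθ}` it equals
`i (w' - w) θ` up to a constant, by uniqueness of lifts, but it is a function on the circle, so it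
takes the same value at `0` and `2π`. -/
lemma HasWinding.unique {f : Loop} {w w' : ℤ} (h : HasWinding f w) (h' : HasWinding f w') : w = w' := by
  obtain ⟨k, hk⟩ := h
  obtain ⟨k', hk'⟩ := h'
  have key : ∀ z : Circle, Complex.exp (k.1 z - k'.1 z) = (z : ℂ) ^ (w' - w) := by
    intro z
    have hz := z.coe_ne_zero
    have := (hk z).symm.trans (hk' z)
    rw [Complex.exp_sub, zpow_sub₀ hz, div_eq_div_iff (Complex.exp_ne_zero _) (zpow_ne_zero _ hz)]
    rw [mul_comm, this, mul_comm]
  have h1 : Complex.exp (k.1 1 - k'.1 1) = 1 := by simpa using key 1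
  let g₁ : ℝ → ℂ := fun θ => k.1 (Circle.exp θ) - k'.1 (Circle.exp θ) - (k.1 1 - k'.1 1)
  let g₂ : ℝ → ℂ := fun θ => ((w' - w : ℤ) : ℂ) * (θ * Complex.I)
  have hg₁ : Continuous g₁ :=
    (((continuous_loop k).comp Circle.exp.continuous).sub ((continuous_loop k').comp Circle.exp.continuous)).sub
      continuous_const
  have hg₂ : Continuous g₂ := by fun_prop
  have heq : g₁ = g₂ := by
    refine Complex.isCoveringMap_exp.eq_of_comp_eq hg₁ hg₂ (funext fun θ => Subtype.ext ?_) 0 ?_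
    · change Complex.exp (_ - (k.1 1 - k'.1 1)) = Complex.exp (_ * (θ * Complex.I))
      rw [Complex.exp_sub, h1, div_one, key, Circle.coe_exp, Complex.exp_int_mul]
    · simp [g₁, g₂]
  have h2 := congrFun heq (2 * Real.pi)
  simp only [g₁, g₂, Circle.exp_two_pi, sub_self] at h2
  have h3 : ((w' - w : ℤ) : ℂ) = 0 := by
    rcases mul_eq_zero.1 h2.symm with h | h
    · exact h
    · simp [Complex.I_ne_zero, Real.pi_ne_zero] at h
  have := Int.cast_eq_zero.1 h3
  omega

lemma HasWinding.mul {f f' : Loop} {w w' : ℤ} (h : HasWinding f w) (h' : HasWinding f' w') :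
    HasWinding (f * f') (w + w') := by
  obtain ⟨k, hk⟩ := h
  obtain ⟨k', hk'⟩ := h'
  refine ⟨k + k', fun z => ?_⟩
  have e1 : (f * f').1 z = f.1 z * f'.1 z := rfl
  have e2 : (k + k').1 z = k.1 z + k'.1 z := rfl
  rw [e1, e2, hk, hk', zpow_add₀ z.coe_ne_zero, Complex.exp_add]
  ring

lemma HasWinding.congr {f f' : Loop} {w : ℤ} (h : HasWinding f w) (e : f = f') : HasWinding f' w := e ▸ h

lemma hasWinding_zero_of_slitPlane {f : Loop} (h : ∀ z, f.1 z ∈ Complex.slitPlane) : HasWinding f 0 := by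
  obtain ⟨F, hF, hf⟩ := f.2
  have hF' : ∀ z ∈ Metric.sphere (0 : ℂ) 1, F z ∈ Complex.slitPlane := fun z hz =>
    (hf ⟨z, hz⟩) ▸ h ⟨z, hz⟩
  refine ⟨⟨fun z => Complex.log (f.1 z), fun z => Complex.log (F z), fun z hz =>
    (hF z hz).clog (hF' z hz), fun z => congrArg Complex.log (hf z)⟩, fun z => ?_⟩
  rw [zpow_zero, one_mul, Complex.exp_log (Complex.slitPlane_ne_zero (h z))]

/-- The coordinate on the circle. -/
def Loop.coord : Loop := ⟨fun z => z, id, analyticOnNhd_id, fun _ => rfl⟩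

/-- The inverse of the coordinate on the circle. -/
def Loop.coordInv : Loop := ⟨fun z => (z : ℂ)⁻¹, fun z => z⁻¹, fun z hz => by
  refine analyticAt_id.fun_inv ?_
  rintro rfl
  simp at hz, fun _ => rfl⟩

lemma hasWinding_coord : HasWinding Loop.coord 1 := ⟨0, fun z => by
  have : (0 : Loop).1 z = 0 := rfl
  rw [this, zpow_one, Complex.exp_zero, mul_one]
  rfl⟩

lemma hasWinding_coordInv : HasWinding Loop.coordInv (-1) := ⟨0, fun z => by
  have : (0 : Loop).1 z = 0 := rfl
  rw [this, zpow_neg_one, Complex.exp_zero, mul_one]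
  rfl⟩

lemma hasWinding_const {c : ℂ} (hc : c ≠ 0) : HasWinding (algebraMap ℂ Loop c) 0 :=
  ⟨algebraMap ℂ Loop (Complex.log c), fun z => by
    have e1 : (algebraMap ℂ Loop c).1 z = c := rfl
    have e2 : (algebraMap ℂ Loop (Complex.log c)).1 z = Complex.log c := rfl
    rw [e1, e2, zpow_zero, one_mul, Complex.exp_log hc]⟩

/-- Write `z - a` as `z (1 - a / z)` if `|a| < 1` and as `-a (1 - z / a)` if `|a| > 1`; the bracket
stays within distance less than one of `1` and has a logarithm. -/
lemma exists_hasWinding_sub {a : ℂ} (ha : ‖a‖ ≠ 1) :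
    ∃ w, HasWinding (Loop.coord - algebraMap ℂ Loop a) w := by
  rcases lt_or_gt_of_ne ha with h | h
  · have h1 : HasWinding (1 - algebraMap ℂ Loop a * Loop.coordInv) 0 := by
      refine hasWinding_zero_of_slitPlane fun z => ?_
      have : (1 - algebraMap ℂ Loop a * Loop.coordInv).1 z = 1 + -(a * (z : ℂ)⁻¹) := sub_eq_add_neg _ _
      rw [this]
      refine Complex.mem_slitPlane_of_norm_lt_one ?_
      rwa [norm_neg, norm_mul, norm_inv, z.norm_coe, inv_one, mul_one]
    refine ⟨_, (hasWinding_coord.mul h1).congr ?_⟩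
    refine Loop.ext' fun z => ?_
    change (z : ℂ) * (1 - a * (z : ℂ)⁻¹) = z - a
    have := z.coe_ne_zero
    field_simp
  · have ha0 : a ≠ 0 := fun h0 => by simp [h0] at h; linarith
    have h1 : HasWinding (1 - algebraMap ℂ Loop a⁻¹ * Loop.coord) 0 := by
      refine hasWinding_zero_of_slitPlane fun z => ?_
      have : (1 - algebraMap ℂ Loop a⁻¹ * Loop.coord).1 z = 1 + -(a⁻¹ * (z : ℂ)) := sub_eq_add_neg _ _
      rw [this]
      refine Complex.mem_slitPlane_of_norm_lt_one ?_
      rw [norm_neg, norm_mul, norm_inv, z.norm_coe, mul_one]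
      exact inv_lt_one_of_one_lt₀ h
    refine ⟨_, ((hasWinding_const (neg_ne_zero.2 ha0)).mul h1).congr ?_⟩
    refine Loop.ext' fun z => ?_
    change -a * (1 - a⁻¹ * z) = z - a
    field_simp
    ring

lemma exists_hasWinding_aeval {P : Polynomial ℂ} (hP : ∀ z : Circle, P.eval (z : ℂ) ≠ 0) :
    ∃ w, HasWinding (Polynomial.aeval Loop.coord P) w := by
  have hP0 : P ≠ 0 := fun h => hP 1 (by simp [h])
  have key : ∀ s : Multiset ℂ, (∀ a ∈ s, ‖a‖ ≠ 1) →
      ∃ w, HasWinding (s.map fun a => Loop.coord - algebraMap ℂ Loop a).prod w := by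
    intro s
    induction s using Multiset.induction with
    | empty =>
      intro _
      refine ⟨0, ?_⟩
      have := hasWinding_const one_ne_zero
      rwa [map_one] at this
    | cons a s ih =>
      intro hs
      obtain ⟨w, hw⟩ := exists_hasWinding_sub (hs a (Multiset.mem_cons_self a s))
      obtain ⟨w', hw'⟩ := ih fun b hb => hs b (Multiset.mem_cons_of_mem hb)
      rw [Multiset.map_cons, Multiset.prod_cons]
      exact ⟨_, hw.mul hw'⟩
  obtain ⟨w, hw⟩ := key P.roots fun a ha h =>
    hP ⟨a, mem_sphere_zero_iff_norm.2 h⟩ ((Polynomial.mem_roots hP0).1 ha)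
  refine ⟨_, ((hasWinding_const (Polynomial.leadingCoeff_ne_zero.2 hP0)).mul hw).congr ?_⟩
  conv_rhs => rw [(IsAlgClosed.splits P).eq_prod_roots]
  rw [map_mul, Polynomial.aeval_C, map_multiset_prod, Multiset.map_map]
  congr 3
  funext a
  simp

/-- Uniform approximation of continuous functions on the circle by Laurent polynomials. -/
lemma exists_laurent_approx {f : Circle → ℂ} (hf : Continuous f) {ε : ℝ} (hε : 0 < ε) :
    ∃ (N : ℕ) (P : Polynomial ℂ), ∀ z : Circle, ‖f z - ((z : ℂ) ^ N)⁻¹ * P.eval (z : ℂ)‖ < ε := by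
  have : Fact (0 < 2 * Real.pi) := ⟨Real.two_pi_pos⟩
  let F : C(AddCircle (2 * Real.pi), ℂ) := ⟨fun x => f x.toCircle, hf.comp AddCircle.continuous_toCircle⟩
  have hF : F ∈ (Submodule.span ℂ (Set.range (@fourier (2 * Real.pi)))).topologicalClosure := by
    rw [span_fourier_closure_eq_top]
    trivial
  obtain ⟨G, hG, hFG⟩ := Metric.mem_closure_iff.1 hF ε hε
  have hGP : ∃ (N : ℕ) (P : Polynomial ℂ), ∀ x, G x * (x.toCircle : ℂ) ^ N = P.eval (x.toCircle : ℂ) := by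
    refine Submodule.span_induction (p := fun G _ => ∃ (N : ℕ) (P : Polynomial ℂ), ∀ x,
      G x * (AddCircle.toCircle x : ℂ) ^ N = P.eval (AddCircle.toCircle x : ℂ)) ?_ ?_ ?_ ?_ hG
    · rintro _ ⟨m, rfl⟩
      refine ⟨(-m).toNat, Polynomial.X ^ m.toNat, fun x => ?_⟩
      rw [fourier_apply, AddCircle.toCircle_zsmul, Circle.coe_zpow, ← zpow_natCast,
        ← zpow_add₀ (Circle.coe_ne_zero _), Polynomial.eval_pow, Polynomial.eval_X, ← zpow_natCast]
      congr 1
      omega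
    · exact ⟨0, 0, fun x => by simp⟩
    · rintro G₁ G₂ - - ⟨N₁, P₁, h₁⟩ ⟨N₂, P₂, h₂⟩
      refine ⟨N₁ + N₂, P₁ * Polynomial.X ^ N₂ + P₂ * Polynomial.X ^ N₁, fun x => ?_⟩
      simp only [ContinuousMap.add_apply, Polynomial.eval_add, Polynomial.eval_mul, Polynomial.eval_pow,
        Polynomial.eval_X, ← h₁, ← h₂]
      ring
    · rintro r G₁ - ⟨N₁, P₁, h₁⟩
      refine ⟨N₁, r • P₁, fun x => ?_⟩
      rw [ContinuousMap.smul_apply, Polynomial.eval_smul, smul_mul_assoc, h₁]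
  obtain ⟨N, P, hP⟩ := hGP
  refine ⟨N, P, fun z => ?_⟩
  let x : AddCircle (2 * Real.pi) := ((Complex.arg z : ℝ) : AddCircle (2 * Real.pi))
  have hx : x.toCircle = z := by
    rw [AddCircle.toCircle_apply_mk, div_self Real.two_pi_pos.ne', one_mul, Circle.exp_arg]
  have h1 : F x = f z := congrArg f hx
  have h2 := hP x
  rw [hx] at h2
  rw [← h2, mul_comm, mul_inv_cancel_right₀ (pow_ne_zero _ z.coe_ne_zero), ← h1, ← dist_eq_norm]
  exact (ContinuousMap.dist_apply_le_dist x).trans_lt hFG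

/-- Up to a power of `z`, a Laurent polynomial is a product of factors `z - a`, so it has a winding
number if it has no zeros on the circle. Approximate `f` within half of its minimum modulus: the
quotient stays within distance less than one of `1` and has a logarithm. -/
theorem exists_hasWinding {f : Loop} (hf : ∀ z, f.1 z ≠ 0) : ∃ w, HasWinding f w := by
  obtain ⟨δ, hδ, hfδ⟩ : ∃ δ > 0, ∀ z, δ ≤ ‖f.1 z‖ := by
    obtain ⟨z₀, -, hz₀⟩ := isCompact_univ.exists_isMinOn (s := (Set.univ : Set Circle)) ⟨1, trivial⟩
      (continuous_loop f).norm.continuousOn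
    exact ⟨_, norm_pos_iff.2 (hf z₀), fun z => hz₀ (Set.mem_univ z)⟩
  obtain ⟨N, P, hP⟩ := exists_laurent_approx (continuous_loop f) (half_pos hδ)
  have hq : ∀ z : Circle, δ / 2 < ‖((z : ℂ) ^ N)⁻¹ * P.eval (z : ℂ)‖ := fun z => by
    have h1 := hP z
    have h2 := hfδ z
    have h3 := norm_sub_norm_le (f.1 z) (((z : ℂ) ^ N)⁻¹ * P.eval (z : ℂ))
    linarith
  have hP0 : ∀ z : Circle, P.eval (z : ℂ) ≠ 0 := fun z h => by
    have := hq z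
    rw [h, mul_zero, norm_zero] at this
    linarith
  obtain ⟨w, hw⟩ := exists_hasWinding_aeval hP0
  have hpow : ∀ N : ℕ, HasWinding (Loop.coordInv ^ N) (-N) := by
    intro N
    induction N with
    | zero =>
      have := hasWinding_const one_ne_zero
      rw [map_one] at this
      simpa using this
    | succ N ih =>
      rw [pow_succ, Nat.cast_succ, neg_add]
      exact ih.mul hasWinding_coordInv
  have hp := (hpow N).mul hw
  obtain ⟨k, hk⟩ : IsUnit (Loop.coordInv ^ N * Polynomial.aeval Loop.coord P) := by
    refine Loop.isUnit_of_ne_zero _ fun z => ?_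
    obtain ⟨h, hh⟩ := hp
    rw [hh]
    exact mul_ne_zero (zpow_ne_zero _ z.coe_ne_zero) (Complex.exp_ne_zero _)
  have hval : ∀ z : Circle, k.1.1 z = ((z : ℂ) ^ N)⁻¹ * P.eval (z : ℂ) := by
    intro z
    rw [hk]
    have e1 : Loop.eval z (Polynomial.aeval Loop.coord P) = P.eval (z : ℂ) := by
      rw [Polynomial.aeval_def, Polynomial.hom_eval₂]
      have : (Loop.eval z).comp (algebraMap ℂ Loop) = RingHom.id ℂ := by ext; rfl
      rw [this]
      exact Polynomial.eval₂_id
    have e2 : Loop.eval z (Loop.coordInv ^ N) = ((z : ℂ) ^ N)⁻¹ := by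
      rw [map_pow, ← inv_pow]
      rfl
    rw [← e1, ← e2, ← map_mul]
    rfl
  have hr : HasWinding (f * k⁻¹.1) 0 := by
    refine hasWinding_zero_of_slitPlane fun z => ?_
    have hk0 : k.1.1 z ≠ 0 := fun h => by
      have := hq z
      rw [← hval, h, norm_zero] at this
      linarith
    have h1 : k⁻¹.1.1 z = (k.1.1 z)⁻¹ := by
      have : (k.1 * k⁻¹.1).1 z = 1 := by rw [Units.mul_inv]; rfl
      exact eq_inv_of_mul_eq_one_right this
    have h2 : (f * k⁻¹.1).1 z = 1 + (f.1 z - k.1.1 z) * (k.1.1 z)⁻¹ := by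
      have : (f * k⁻¹.1).1 z = f.1 z * k⁻¹.1.1 z := rfl
      rw [this, h1]
      field_simp
      ring
    rw [h2]
    refine Complex.mem_slitPlane_of_norm_lt_one ?_
    rw [norm_mul, norm_inv, ← div_eq_mul_inv, div_lt_one (norm_pos_iff.2 hk0), hval]
    exact (hP z).trans (hq z)
  have := hr.mul hp
  rw [← hk, mul_assoc, Units.inv_mul, mul_one] at this
  exact ⟨_, this⟩

lemma LoopGL.existsUnique_hasWinding {n : ℕ} (g : LoopGL n) : ∃! w : ℤ, HasWinding (g.1.det) w := by
  obtain ⟨w, hw⟩ := exists_hasWinding (f := g.1.det) fun z => by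
    have h1 := (Loop.eval z).map_det g.1
    have h2 := (Matrix.isUnit_iff_isUnit_det _).1 (g.isUnit_eval z)
    exact (h1 ▸ h2.ne_zero :)
  exact ⟨w, hw, fun w' hw' => hw'.unique hw⟩

end Winding

end LoopFlag
end

noncomputable section
namespace LoopFlag

/-! ### Laurent splitting -/

section Laurent

/-- Inversion turns the inner circle of an annulus into a circle of radius greater than one. The
part of a Laurent expansion in negative powers thereby becomes an ordinary Cauchy integral in `1 /
z`. -/
lemma circleIntegral_inversion {r : ℝ} (hr : 0 < r) (f : ℂ → ℂ) :
    (∮ ζ in C(0, r), f ζ) = ∮ ζ in C(0, r⁻¹), (ζ ^ 2)⁻¹ * f ζ⁻¹ := by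
  let Φ : ℝ → ℂ := fun θ => deriv (circleMap 0 r) θ • f (circleMap 0 r θ)
  have hper : Function.Periodic Φ (2 * Real.pi) := by
    intro θ
    simp only [Φ, deriv_circleMap]
    rw [periodic_circleMap 0 r θ]
  have h1 : ∀ θ, deriv (circleMap 0 r⁻¹) θ • ((circleMap 0 r⁻¹ θ ^ 2)⁻¹ * f (circleMap 0 r⁻¹ θ)⁻¹) =
      Φ (-θ) := by
    intro θ
    have hr' : (r : ℂ) ≠ 0 := Complex.ofReal_ne_zero.2 hr.ne'
    have e1 : (circleMap 0 r⁻¹ θ)⁻¹ = circleMap 0 r (-θ) := by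
      simp only [circleMap, zero_add, Complex.ofReal_inv, mul_inv, inv_inv, ← Complex.exp_neg,
        Complex.ofReal_neg, neg_mul]
    have e2 : circleMap 0 r⁻¹ θ ≠ 0 := by
      simp [circleMap, hr.ne']
    simp only [Φ, deriv_circleMap, e1, smul_eq_mul]
    rw [← e1]
    field_simp
  simp only [circleIntegral]
  simp only [h1]
  rw [intervalIntegral.integral_comp_neg, neg_zero]
  have := hper.intervalIntegral_add_eq (-(2 * Real.pi)) 0
  rw [neg_add_cancel, zero_add] at this
  exact this.symm

lemma analyticOnNhd_cauchy {f : ℂ → ℂ} {R : ℝ} (hR : 0 < R) (hf : ContinuousOn f (Metric.sphere 0 R)) :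
    AnalyticOnNhd ℂ (fun w => (2 * Real.pi * Complex.I : ℂ)⁻¹ • ∮ z in C(0, R), (z - w)⁻¹ • f z)
      (Metric.ball 0 R) := by
  have h := hasFPowerSeriesOn_cauchy_integral (R := ⟨R, hR.le⟩) (hf.circleIntegrable hR.le) hR
  have h2 := h.analyticOnNhd
  have : Metric.eball (0 : ℂ) (ENNReal.ofNNReal ⟨R, hR.le⟩) = Metric.ball 0 R := Metric.eball_coe
  rwa [this] at h2

/-- A loop is the sum of a function holomorphic near `|z| ≤ 1` and of a function holomorphic near
`|z| ≥ 1`, including `∞`. -/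
theorem Loop.exists_splitting (h : Loop) : ∃ p q : ℂ → ℂ, AnalyticOnNhd ℂ p (Metric.closedBall 0 1) ∧
    AnalyticOnNhd ℂ q (Metric.closedBall 0 1) ∧ ∀ z : Circle, h.1 z = p z + q (z : ℂ)⁻¹ := by
  obtain ⟨F, hF, hhF⟩ := h.2
  obtain ⟨δ, hδ, hδF⟩ : ∃ δ > 0, ∀ z : ℂ, |‖z‖ - 1| < δ → AnalyticAt ℂ F z := by
    obtain ⟨δ, hδ, hsub⟩ := (isCompact_sphere (0 : ℂ) 1).exists_thickening_subset_open
      (isOpen_analyticAt ℂ F) hF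
    refine ⟨min δ 1, lt_min hδ one_pos, fun z hz => hsub (Metric.mem_thickening_iff.2
      ⟨z / ‖z‖, ?_, ?_⟩)⟩
    all_goals
      have hz0 : 0 < ‖z‖ := by
        have := (abs_lt.1 (hz.trans_le (min_le_right _ _))).1
        linarith
    · rw [mem_sphere_zero_iff_norm, norm_div, Complex.norm_real, norm_norm, div_self hz0.ne']
    · have : z - z / ‖z‖ = (‖z‖ - 1 : ℝ) * (z / ‖z‖) := by
        have : (‖z‖ : ℂ) ≠ 0 := Complex.ofReal_ne_zero.2 hz0.ne'
        push_cast
        field_simp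
      rw [dist_eq_norm, this, norm_mul, norm_div, Complex.norm_real, Complex.norm_real, norm_norm,
        div_self hz0.ne', mul_one]
      exact hz.trans_le (min_le_left _ _)
  obtain ⟨ε, hε, hεδ, hε1⟩ : ∃ ε : ℝ, 0 < ε ∧ ε < δ ∧ ε < 1 :=
    ⟨min δ 1 / 2, half_pos (lt_min hδ one_pos), (half_lt_self (lt_min hδ one_pos)).trans_le (min_le_left _ _),
      (half_lt_self (lt_min hδ one_pos)).trans_le (min_le_right _ _)⟩
  let R : ℝ := 1 + ε
  let r : ℝ := 1 - ε
  have hr : 0 < r := sub_pos.2 hε1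
  have hr1 : r < 1 := by simp [r, hε]
  have hR : 0 < R := by positivity
  have hR1 : 1 < R := by simp [R, hε]
  have hsR : ∀ z ∈ Metric.sphere (0 : ℂ) R, AnalyticAt ℂ F z := fun z hz => hδF z (by
    rw [mem_sphere_zero_iff_norm.1 hz, add_sub_cancel_left, abs_of_pos hε]; exact hεδ)
  have hsr : ∀ z ∈ Metric.sphere (0 : ℂ) r, AnalyticAt ℂ F z := fun z hz => hδF z (by
    rw [mem_sphere_zero_iff_norm.1 hz, show r - 1 = -ε by simp [r], abs_neg, abs_of_pos hε]; exact hεδ)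
  -- After inversion, the inner Cauchy integral at `w` is, up to sign, `w⁻¹` times the Cauchy
  -- integral of `G` at `w⁻¹`, which accounts for the factor `w` in the second function.
  let G : ℂ → ℂ := fun ζ => ζ⁻¹ * F ζ⁻¹
  have hinv : ∀ ζ ∈ Metric.sphere (0 : ℂ) r⁻¹, ζ⁻¹ ∈ Metric.sphere (0 : ℂ) r ∧ ζ ≠ 0 := by
    intro ζ hζ
    have h1 := mem_sphere_zero_iff_norm.1 hζ
    refine ⟨?_, ?_⟩
    · rw [mem_sphere_zero_iff_norm, norm_inv, h1, inv_inv]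
    · rw [← norm_pos_iff, h1]
      exact inv_pos.2 hr
  have hG : ContinuousOn G (Metric.sphere 0 r⁻¹) := by
    intro ζ hζ
    obtain ⟨h1, h2⟩ := hinv ζ hζ
    have h3 : AnalyticAt ℂ (fun ζ : ℂ => F ζ⁻¹) ζ := (hsr _ h1).fun_comp (analyticAt_inv h2)
    exact ((continuousAt_inv₀ h2).mul h3.continuousAt).continuousWithinAt
  have hp := analyticOnNhd_cauchy hR (f := F) fun z hz => (hsR z hz).continuousAt.continuousWithinAt
  have hq := analyticOnNhd_cauchy (inv_pos.2 hr) hG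
  refine ⟨_, fun w => w * _, hp.mono (Metric.closedBall_subset_ball hR1), fun w hw =>
    analyticAt_id.fun_mul (hq w (Metric.closedBall_subset_ball (one_lt_inv₀ hr |>.2 hr1) hw)), fun z => ?_⟩
  set w : ℂ := (z : ℂ) with hw
  have hwn : ‖w‖ = 1 := z.norm_coe
  have hw0 : w ≠ 0 := z.coe_ne_zero
  rw [hhF]
  have hpi : (2 * Real.pi * Complex.I : ℂ) ≠ 0 := Complex.two_pi_I_ne_zero
  have hopen : IsOpen {z : ℂ | |‖z‖ - 1| < δ} := isOpen_lt (by fun_prop) continuous_const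
  have hdsl : DifferentiableOn ℂ (dslope F w) {z : ℂ | |‖z‖ - 1| < δ} := by
    refine (Complex.differentiableOn_dslope (hopen.mem_nhds ?_)).2 fun z hz =>
      (hδF z hz).differentiableAt.differentiableWithinAt
    simp [hwn, hδ]
  have hann : Metric.closedBall (0 : ℂ) R \ Metric.ball 0 r ⊆ {z : ℂ | |‖z‖ - 1| < δ} := by
    rintro x ⟨h1, h2⟩
    rw [mem_closedBall_zero_iff] at h1
    rw [mem_ball_zero_iff, not_lt] at h2
    simp only [Set.mem_ofPred_eq, abs_lt]
    constructor <;> simp only [R, r] at h1 h2 <;> linarith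
  -- The difference quotient at `w` is holomorphic on the annulus, so its integrals over both
  -- circles agree. This is Cauchy's formula for the annulus, since only the outer circle surrounds
  -- `w`.
  have hcauchy := Complex.circleIntegral_eq_of_differentiable_on_annulus_off_countable hr (hr1.trans hR1).le
    (c := (0 : ℂ)) (s := ∅) (f := dslope F w) Set.countable_empty (hdsl.continuousOn.mono hann)
    (fun x hx => (hdsl x (hann ⟨Metric.ball_subset_closedBall hx.1.1, fun h =>
      hx.1.2 (Metric.ball_subset_closedBall h)⟩)).differentiableAt (hopen.mem_nhds
        (hann ⟨Metric.ball_subset_closedBall hx.1.1, fun h => hx.1.2 (Metric.ball_subset_closedBall h)⟩)))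
  have hval : ∀ ρ : ℝ, 0 < ρ → ρ ≠ 1 → ContinuousOn F (Metric.sphere 0 ρ) →
      (∮ ζ in C(0, ρ), dslope F w ζ) =
        (∮ ζ in C(0, ρ), (ζ - w)⁻¹ • F ζ) - (∮ ζ in C(0, ρ), (ζ - w)⁻¹) * F w := by
    intro ρ hρ hρ1 hFρ
    have hne : ∀ ζ ∈ Metric.sphere (0 : ℂ) ρ, ζ - w ≠ 0 := by
      intro ζ hζ h0
      rw [sub_eq_zero] at h0
      rw [mem_sphere_zero_iff_norm, h0, hwn] at hζ
      exact hρ1 hζ.symm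
    have hc : ContinuousOn (fun ζ : ℂ => (ζ - w)⁻¹) (Metric.sphere 0 ρ) :=
      (continuousOn_id.sub continuousOn_const).inv₀ hne
    rw [mul_comm, ← circleIntegral.integral_const_mul, ← circleIntegral.integral_sub]
    · refine circleIntegral.integral_congr hρ.le fun ζ hζ => ?_
      have := hne ζ hζ
      rw [dslope_of_ne _ (sub_ne_zero.1 this), slope_def_field]
      simp only [smul_eq_mul]
      field_simp
    · exact (hc.smul hFρ).circleIntegrable hρ.le
    · exact (continuousOn_const.mul hc).circleIntegrable hρ.le
  rw [hval R hR hR1.ne' fun z hz => (hsR z hz).continuousAt.continuousWithinAt,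
    hval r hr hr1.ne fun z hz => (hsr z hz).continuousAt.continuousWithinAt,
    circleIntegral.integral_sub_inv_of_mem_ball (by rw [mem_ball_zero_iff, hwn]; exact hR1)] at hcauchy
  have hzero : (∮ ζ in C(0, r), (ζ - w)⁻¹) = 0 := by
    refine Complex.circleIntegral_eq_zero_of_differentiable_on_off_countable hr.le Set.countable_empty ?_ ?_
    · refine (continuousOn_id.sub continuousOn_const).inv₀ fun ζ hζ h0 => ?_
      have h1 := mem_closedBall_zero_iff.1 hζ
      have h2 : ζ = w := sub_eq_zero.1 h0
      rw [h2, hwn] at h1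
      linarith
    · intro ζ hζ
      refine (differentiableAt_id.sub_const w).inv fun h0 => ?_
      have h1 := mem_ball_zero_iff.1 hζ.1
      have h2 : ζ = w := sub_eq_zero.1 h0
      rw [h2, hwn] at h1
      linarith
  rw [hzero, zero_mul, sub_zero, circleIntegral_inversion hr] at hcauchy
  have hsub : (∮ ζ in C(0, r⁻¹), (ζ ^ 2)⁻¹ * ((ζ⁻¹ - w)⁻¹ • F ζ⁻¹)) =
      -(w⁻¹ * ∮ ζ in C(0, r⁻¹), (ζ - w⁻¹)⁻¹ • G ζ) := by
    rw [← circleIntegral.integral_const_mul, ← neg_one_mul, ← circleIntegral.integral_const_mul]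
    refine circleIntegral.integral_congr (inv_pos.2 hr).le fun ζ hζ => ?_
    obtain ⟨h1, h2⟩ := hinv ζ hζ
    have h3 : ζ⁻¹ - w ≠ 0 := fun h0 => by
      rw [sub_eq_zero.1 h0, mem_sphere_zero_iff_norm, hwn] at h1
      exact hr1.ne' h1
    have h4 : ζ - w⁻¹ ≠ 0 := fun h0 => h3 (by rw [sub_eq_zero.1 h0, inv_inv, sub_self])
    have h5 : (ζ⁻¹ - w)⁻¹ = -(ζ * w⁻¹) * (ζ - w⁻¹)⁻¹ := by
      have h6 : ζ⁻¹ - w = -(ζ - w⁻¹) * (w * ζ⁻¹) := by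
        field_simp
        ring
      rw [h6, mul_inv, mul_inv, inv_neg, inv_inv]
      ring
    simp only [G, smul_eq_mul, h5]
    field_simp
  rw [hsub] at hcauchy
  simp only [smul_eq_mul] at hcauchy ⊢
  have h6 : (2 * Real.pi * Complex.I : ℂ) * F w = (∮ ζ in C(0, R), (ζ - w)⁻¹ * F ζ) +
      w⁻¹ * ∮ ζ in C(0, r⁻¹), (ζ - w⁻¹)⁻¹ * G ζ := by
    linear_combination -hcauchy
  rw [mul_left_comm, ← mul_add, ← h6, inv_mul_cancel_left₀ hpi]

end Laurent

end LoopFlag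
end

noncomputable section
namespace LoopFlag

/-! ### The degree -/

section FrameDet

variable {n : ℕ} {E : OMod} {W W' W'' : Opens P1} {e : Fin n → E.sec W} {e' : Fin n → E.sec W'}
  {e'' : Fin n → E.sec W''}

/-- The determinant of a family of sections with respect to a frame. -/
def IsFrame.holDet (he : IsFrame E e) (e' : Fin n → E.sec W') : Hol (W ⊓ W') :=
  (he.matrix (inf_le_left : W ⊓ W' ≤ W) (fun a => E.res inf_le_right (e' a))).det

/-- The value at a point of the determinant of a family of sections with respect to a frame. -/
def IsFrame.detAt (he : IsFrame E e) (e' : Fin n → E.sec W') (x : P1) : ℂ := ext (he.holDet e').1 x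

lemma IsFrame.detAt_eq (he : IsFrame E e) {V : Opens P1} (h : V ≤ W) (h' : V ≤ W')
    {M : Matrix (Fin n) (Fin n) (Hol V)} (hM : ∀ b, E.res h' (e' b) = ∑ a, M a b • E.res h (e a))
    {x : P1} (hx : x ∈ V) : he.detAt e' x = M.det.1 ⟨x, hx⟩ := by
  have hV : V ≤ W ⊓ W' := le_inf h h'
  have h1 : (Hol.res hV).mapMatrix (he.matrix (inf_le_left : W ⊓ W' ≤ W)
      (fun a => E.res inf_le_right (e' a))) = M := by
    ext1 a b
    have h2 := he.coords_res (inf_le_left : W ⊓ W' ≤ W) hV (E.res inf_le_right (e' b)) a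
    rw [E.res_res, he.coords_eq (c := fun a => M a b) (hV.trans inf_le_left) (hM b)] at h2
    exact h2.symm
  rw [← h1, ← AlgHom.map_det, IsFrame.detAt, ext_of_mem _ (hV hx)]
  rfl

/-- Cocycle rule for changes of frame; it makes the section of the determinant built below
independent of the reference frame. -/
lemma IsFrame.detAt_mul (he : IsFrame E e) (he' : IsFrame E e') {x : P1} (hx : x ∈ W) (hx' : x ∈ W')
    (hx'' : x ∈ W'') : he.detAt e' x * he'.detAt e'' x = he.detAt e'' x := by
  let V : Opens P1 := W ⊓ W' ⊓ W''
  have hV : V ≤ W := inf_le_left.trans inf_le_left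
  have hV' : V ≤ W' := inf_le_left.trans inf_le_right
  have hV'' : V ≤ W'' := inf_le_right
  have hxV : x ∈ V := ⟨⟨hx, hx'⟩, hx''⟩
  have h1 := he.eq_sum_matrix hV (fun a => E.res hV' (e' a))
  have h2 := he'.eq_sum_matrix hV' (fun a => E.res hV'' (e'' a))
  set M := he.matrix hV (fun a => E.res hV' (e' a))
  set N := he'.matrix hV' (fun a => E.res hV'' (e'' a))
  have h3 : ∀ b, E.res hV'' (e'' b) = ∑ a, (M * N) a b • E.res hV (e a) := by
    intro b
    rw [h2]
    simp only [h1, Matrix.mul_apply, Finset.smul_sum, Finset.sum_smul, smul_smul]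
    rw [Finset.sum_comm]
    simp only [mul_comm]
  rw [he.detAt_eq hV hV' h1 hxV, he'.detAt_eq hV' hV'' h2 hxV, he.detAt_eq hV hV'' h3 hxV,
    Matrix.det_mul]
  rfl

lemma IsFrame.detAt_ne_zero (he : IsFrame E e) (he' : IsFrame E e') {x : P1} (hx : x ∈ W)
    (hx' : x ∈ W') : he.detAt e' x ≠ 0 := by
  have h1 := he.isUnit_matrix_det (inf_le_left : W ⊓ W' ≤ W) (he'.res_frame inf_le_right)
  have h2 := Hol.ne_zero_of_isUnit h1 ⟨x, hx, hx'⟩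
  rw [IsFrame.detAt, ext_of_mem _ (⟨hx, hx'⟩ : x ∈ W ⊓ W')]
  exact h2

lemma Framing.detAt_eq (t : Framing n E) {x : P1} (hx : x ∈ W) (hx' : x ∈ t.dom) :
    t.isFrame.detAt e x = (Matrix.of fun b a => t.val (e a) x b).det := by
  rw [t.isFrame.detAt_eq inf_le_right inf_le_left (M := Matrix.of fun b a => t.isFrame.coords inf_le_right
    (E.res inf_le_left (e a)) b) (fun a => t.res_eq_sum (e a)) (⟨hx, hx'⟩ : x ∈ W ⊓ t.dom), Hol.det_val]
  congr 1
  ext b a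
  exact (ext_of_mem (U := W ⊓ t.dom) _ ⟨hx, hx'⟩).symm

/-- The degree, from a section of the determinant given on two open sets. -/
theorem hasDegree_of_frames {W₁ W₂ : Opens P1} (hW : W₁ ⊔ W₂ = ⊤) (h02 : zero ∈ W₂)
    (hi : OnePoint.infty ∉ W₂) {e₁ : Fin n → E.sec W₁} {e₂ : Fin n → E.sec W₂} (he₁ : IsFrame E e₁)
    (he₂ : IsFrame E e₂) (s : Hol W₁) (hs : ∀ x, s.1 x ≠ 0) (u : ℂ → ℂ)
    (hu : ∀ z : ℂ, (z : P1) ∈ W₂ → AnalyticAt ℂ u z) (hu0 : ∀ z, u z ≠ 0) (d : ℤ)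
    (hsu : ∀ z : ℂ, (z : P1) ∈ W₁ ⊓ W₂ → ext s.1 (z : P1) = he₁.detAt e₂ z * (z ^ d * u z)) :
    HasDegree n E d := by
  classical
  let v : P1 → ℂ := fun x => x.elim 0 fun z => z ^ d * u z
  have hsv : ∀ x ∈ W₁ ⊓ W₂, ext s.1 x = he₁.detAt e₂ x * v x := by
    intro x hx
    obtain ⟨z, rfl⟩ := exists_coe_eq hi hx.2
    exact hsu z hx
  have hcov : ∀ x, x ∈ W₁ ∨ x ∈ W₂ := fun x => by
    have : x ∈ W₁ ⊔ W₂ := by rw [hW]; trivial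
    exact this
  -- The section is `s` in the frame `e₁` and `z ^ d * u` in the frame `e₂`; the hypothesis `hsu`
  -- makes the two descriptions agree on the overlap.
  let σ : ∀ W : Opens P1, (Fin n → E.sec W) → P1 → ℂ := fun W e x =>
    if he : IsFrame E e then if x ∈ W₁ then he.detAt e₁ x * ext s.1 x else he.detAt e₂ x * v x else 0
  have hσ₁ : ∀ {W : Opens P1} {e : Fin n → E.sec W} (he : IsFrame E e) {x : P1}, x ∈ W₁ →
      σ W e x = he.detAt e₁ x * ext s.1 x := by
    intro W e he x hx
    simp only [σ, dif_pos he, if_pos hx]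
  have hσ₂ : ∀ {W : Opens P1} {e : Fin n → E.sec W} (he : IsFrame E e) {x : P1}, x ∈ W → x ∈ W₂ →
      σ W e x = he.detAt e₂ x * v x := by
    intro W e he x hxW hx
    by_cases h1 : x ∈ W₁
    · rw [hσ₁ he h1, hsv x ⟨h1, hx⟩, ← mul_assoc, he.detAt_mul he₁ hxW h1 hx]
    · simp only [σ, dif_pos he, if_neg h1]
  have hv0 : ∀ x ∈ W₂, x ≠ zero → v x ≠ 0 := by
    intro x hx hx0
    obtain ⟨z, rfl⟩ := exists_coe_eq hi hx
    refine mul_ne_zero (zpow_ne_zero _ ?_) (hu0 z)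
    rintro rfl
    exact hx0 rfl
  refine ⟨isLocallyFree_of_cover hW he₁ he₂, σ, ?_, fun W e he => ⟨?_, ?_, ?_⟩⟩
  · rintro W W' e e' he he' V h h' M hM ⟨x, hx⟩ -
    rw [← he.detAt_eq h h' hM hx]
    rcases hcov x with h1 | h2
    · rw [hσ₁ he h1, hσ₁ he' h1, ← mul_assoc, he.detAt_mul he' (h hx) (h' hx) h1]
    · rw [hσ₂ he (h hx) h2, hσ₂ he' (h' hx) h2, ← mul_assoc, he.detAt_mul he' (h hx) (h' hx) h2]
  · refine isHolo_of_local fun x hx => ?_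
    rcases hcov x with h1 | h2
    · refine ⟨_ ⊓ W₁, inf_le_left, ⟨hx, h1⟩, ?_⟩
      have hV : W ⊓ ⟨{zero}ᶜ, isClosed_singleton.isOpen_compl⟩ ⊓ W₁ ≤ W ⊓ W₁ :=
        inf_le_inf_right _ inf_le_left
      let k := Hol.res hV (he.holDet e₁) * Hol.res (hV.trans inf_le_right) s
      have hk : IsHolo k.1 := k.2
      refine (congrArg IsHolo (funext fun y => ?_)).mpr hk
      rw [hσ₁ he y.2.2, IsFrame.detAt, ext_of_mem _ (hV y.2), ext_of_mem _ y.2.2]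
      rfl
    · refine ⟨_ ⊓ W₂, inf_le_left, ⟨hx, h2⟩, ?_⟩
      have hV : W ⊓ ⟨{zero}ᶜ, isClosed_singleton.isOpen_compl⟩ ⊓ W₂ ≤ W ⊓ W₂ :=
        inf_le_inf_right _ inf_le_left
      let k := Hol.res hV (he.holDet e₂) * Hol.ofAnalytic
        (W ⊓ ⟨{zero}ᶜ, isClosed_singleton.isOpen_compl⟩ ⊓ W₂) (fun h => hi h.2) (fun z => z ^ d * u z)
        fun z hz => by
          have hz0 : z ≠ 0 := by
            rintro rfl
            exact hz.1.2 rfl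
          exact (analyticAt_id.fun_zpow hz0).fun_mul (hu z hz.2)
      have hk : IsHolo k.1 := k.2
      refine (congrArg IsHolo (funext fun y => ?_)).mpr hk
      rw [hσ₂ he y.2.1.1 y.2.2, IsFrame.detAt, ext_of_mem _ (hV y.2)]
      rfl
  · intro x hx hx0
    rcases hcov x with h1 | h2
    · rw [hσ₁ he h1, ext_of_mem _ h1]
      exact mul_ne_zero (he.detAt_ne_zero he₁ hx h1) (hs _)
    · rw [hσ₂ he hx h2]
      exact mul_ne_zero (he.detAt_ne_zero he₂ hx h2) (hv0 x h2 hx0)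
  · intro h0
    refine ⟨fun z => ext (he.holDet e₂).1 (z : P1) * u z,
      ((he.holDet e₂).2.1 0 ⟨h0, h02⟩).fun_mul (hu 0 h02),
      mul_ne_zero (he.detAt_ne_zero he₂ h0 h02) (hu0 0), ?_⟩
    refine nhdsWithin_le_nhds ?_
    filter_upwards [eventually_coe h0, eventually_coe h02] with z hz hz2
    rw [hσ₂ he hz hz2]
    exact mul_left_comm _ _ _

end FrameDet

section Degree

variable {n : ℕ} {E : OMod}

/-- In the chart `1 / z` the function `exp (q(1/z))` is `exp q`, so it is holomorphic and nowhere
zero near `|z| ≥ 1`, including `∞`. It supplies the outer half of the section of the determinant. -/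
lemma exists_outer_exp {q : ℂ → ℂ} (hq : AnalyticOnNhd ℂ q (Metric.closedBall 0 1)) :
    ∃ (U : Opens P1) (s : Hol U), outerDisc ⊆ U ∧ (∀ x, s.1 x ≠ 0) ∧
      ∀ z : ℂ, (z : P1) ∈ U → AnalyticAt ℂ q z⁻¹ ∧ ext s.1 (z : P1) = Complex.exp (q z⁻¹) := by
  let O : Set ℂ := {z | z ≠ 0 ∧ AnalyticAt ℂ q z⁻¹}
  have hO : IsOpen O := by
    refine isOpen_iff_mem_nhds.2 fun z hz => ?_
    have h1 : ∀ᶠ w in 𝓝 z, AnalyticAt ℂ q w⁻¹ :=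
      (continuousAt_inv₀ hz.1).eventually hz.2.eventually_analyticAt
    filter_upwards [isOpen_ne.mem_nhds hz.1, h1] with w h1 h2 using ⟨h1, h2⟩
  have hK : IsCompact Oᶜ := by
    refine Metric.isCompact_of_isClosed_isBounded hO.isClosed_compl
      (Metric.isBounded_closedBall.subset (?_ : Oᶜ ⊆ Metric.closedBall 0 1))
    intro z hz
    by_contra h
    rw [mem_closedBall_zero_iff, not_le] at h
    refine hz ⟨fun h0 => ?_, hq _ ?_⟩
    · rw [h0, norm_zero] at h
      linarith
    · rw [mem_closedBall_zero_iff, norm_inv]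
      exact inv_le_one_of_one_le₀ h.le
  let U : Opens P1 := ⟨((↑) '' Oᶜ : Set P1)ᶜ, (hK.image OnePoint.continuous_coe).isClosed.isOpen_compl⟩
  have hU : ∀ z : ℂ, (z : P1) ∈ U ↔ z ∈ O := by
    intro z
    have : (z : P1) ∈ ((↑) '' Oᶜ : Set P1) ↔ z ∈ Oᶜ := OnePoint.coe_injective.mem_set_image
    exact (not_congr this).trans not_not
  let f : P1 → ℂ := fun x => x.elim (Complex.exp (q 0)) fun z => Complex.exp (q z⁻¹)
  have hext : ∀ x ∈ U, ext (fun y : U => f y) x = f x := fun x hx => ext_of_mem _ hx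
  refine ⟨U, ⟨fun x => f x, fun z hz => ?_, fun hi => ?_⟩, ?_, ?_, fun z hz => ⟨((hU z).1 hz).2, ?_⟩⟩
  · have h1 := (hU z).1 hz
    refine (h1.2.fun_comp (analyticAt_inv h1.1)).cexp.congr ?_
    filter_upwards [eventually_coe hz] with w hw
    exact (hext _ hw).symm
  · have h0 : AnalyticAt ℂ q 0 := hq 0 (by simp)
    refine h0.cexp.congr ?_
    filter_upwards [eventually_chartInf hi] with w hw
    rw [hext _ hw]
    by_cases hw0 : w = 0
    · subst hw0
      simp [chartInf, f]
    · simp [chartInf, f, hw0]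
  · intro x hx
    induction x using OnePoint.rec with
    | infty =>
      rintro ⟨w, -, hw⟩
      exact OnePoint.coe_ne_infty w hw
    | coe z =>
      have hz := hx z rfl
      refine (hU z).2 ⟨fun h0 => ?_, hq _ ?_⟩
      · rw [h0, norm_zero] at hz
        linarith
      · rw [mem_closedBall_zero_iff, norm_inv]
        exact inv_le_one_of_one_le₀ hz
  · rintro ⟨x, hx⟩
    change f x ≠ 0
    induction x using OnePoint.rec with
    | infty => exact Complex.exp_ne_zero _
    | coe z => exact Complex.exp_ne_zero _
  · exact hext _ hz

/-- The degree is determined by the winding number of the determinant of the transition function. -/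
theorem hasDegree_of_val {t : Framing n E} {D : Opens P1} (hD : ∀ z : ℂ, ‖z‖ ≤ 1 → (z : P1) ∈ D)
    {e : Fin n → E.sec D} (he : IsFrame E e) {g : LoopGL n} {m : Fin n → ℤ}
    (hg : ∀ (z : Circle) b a, t.val (e a) (z : ℂ) b = (z : ℂ) ^ m a * (g.1 b a).1 z) {w : ℤ}
    (hw : HasWinding g.1.det w) : HasDegree n E (-(w + ∑ a, m a)) := by
  obtain ⟨h, hh⟩ := hw
  obtain ⟨p, q, hp, hq, hpq⟩ := Loop.exists_splitting h
  -- On the circle the determinant of the transition is `z ^ d · exp p · exp (q(1/z))`. With `exp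
  -- (q(1/z))` outside and `z ^ (-d) · exp (-p)` inside the section is consistent, and its order at
  -- the origin is `-d`.
  obtain ⟨U, s, hU, hs0, hsq⟩ := exists_outer_exp hq
  set d := w + ∑ a, m a with hd
  have hcirc : ∀ z : ℂ, ‖z‖ = 1 → t.isFrame.detAt e z = z ^ d * Complex.exp (p z + q z⁻¹) := by
    intro z₀ hz₀
    obtain ⟨z, rfl⟩ : ∃ z : Circle, (z : ℂ) = z₀ := ⟨⟨z₀, mem_sphere_zero_iff_norm.2 hz₀⟩, rfl⟩
    have h1 : (Matrix.of fun b a => t.val (e a) (z : ℂ) b) = g.1.map (Loop.eval z) *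
        Matrix.diagonal fun a => (z : ℂ) ^ m a := by
      ext b a
      rw [Matrix.mul_diagonal, Matrix.of_apply, hg, mul_comm]
      rfl
    have h2 : (g.1.map (Loop.eval z)).det = g.1.det.1 z := ((Loop.eval z).map_det g.1).symm
    have h3 : ∏ a, (z : ℂ) ^ m a = (z : ℂ) ^ ∑ a, m a := by
      refine Finset.induction_on (motive := fun s => ∏ a ∈ s, (z : ℂ) ^ m a = (z : ℂ) ^ ∑ a ∈ s, m a)
        Finset.univ (by simp) fun a s ha ih => ?_
      rw [Finset.prod_insert ha, Finset.sum_insert ha, zpow_add₀ z.coe_ne_zero, ih]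
    rw [t.detAt_eq (hD z hz₀.le) (t.circle_mem z), h1, Matrix.det_mul, Matrix.det_diagonal, h2, hh, hpq,
      h3, hd, zpow_add₀ z.coe_ne_zero]
    ring
  let S : Set ℂ := {z | ∀ᶠ w : ℂ in 𝓝 z, t.isFrame.detAt e w = w ^ d * Complex.exp (p w + q w⁻¹)}
  have hS : IsOpen S := isOpen_iff_eventually.2 fun z hz => eventually_eventually_nhds.2 hz
  let O : Set ℂ := {z | AnalyticAt ℂ p z}
  obtain ⟨W₁, W₂, l1, l2, hW, -, hin, hi, h0, hle⟩ := exists_cover_le (U₁ := t.dom ⊓ U)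
    (U₂ := D ⊓ opensOf O (isOpen_analyticAt ℂ p)) (V := opensOf S hS)
    (fun x hx => ⟨t.outer_sub hx, hU hx⟩)
    (fun z hz => ⟨hD z hz, coe_mem_opensOf.2 (hp z (mem_closedBall_zero_iff.2 hz))⟩) (fun z hz => by
      refine coe_mem_opensOf.2 ?_
      have hz0 : z ≠ 0 := fun h0 => by simp [h0] at hz
      refine eventually_eq_of_circle (f := fun w : ℂ => t.isFrame.detAt e (w : P1))
        (g := fun w => w ^ d * Complex.exp (p w + q w⁻¹)) hz ?_ ?_ hcirc
      · exact (t.isFrame.holDet e).2.1 z ⟨t.outer_sub (coe_mem_outerDisc hz.ge), hD z hz.le⟩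
      · refine (analyticAt_id.fun_zpow hz0).fun_mul ((hp z ?_).fun_add ?_).cexp
        · exact mem_closedBall_zero_iff.2 hz.le
        · exact (hsq z (hU (coe_mem_outerDisc hz.ge))).1.fun_comp (analyticAt_inv hz0))
  have k1 : W₁ ≤ t.dom := l1.trans inf_le_left
  have k2 : W₂ ≤ D := l2.trans inf_le_left
  refine hasDegree_of_frames hW (hin 0 (by simp)) hi (t.isFrame.res_frame k1) (he.res_frame k2)
    (Hol.res (l1.trans inf_le_right) s) (fun x => hs0 _) (fun z => Complex.exp (-p z))
    (fun z hz => ?_) (fun z => Complex.exp_ne_zero _) _ fun z hz => ?_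
  · have : AnalyticAt ℂ p z := coe_mem_opensOf.1 (l2 hz).2
    exact this.fun_neg.cexp
  · have hzU : (z : P1) ∈ U := (l1 hz.1).2
    have hzS : z ∈ S := coe_mem_opensOf.1 (hle hz)
    have hz0 : z ≠ 0 := by
      rintro rfl
      exact h0 hz.1
    have e1 : ext (Hol.res (l1.trans inf_le_right) s).1 (z : P1) = ext s.1 (z : P1) := by
      rw [ext_of_mem _ hz.1, ext_of_mem _ hzU]
      rfl
    have hR := t.isFrame.eq_sum_matrix (inf_le_left.trans k1 : W₁ ⊓ W₂ ≤ t.dom)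
      (fun a => E.res (inf_le_right.trans k2) (e a))
    have e2 : (t.isFrame.res_frame k1).detAt (fun a => E.res k2 (e a)) (z : P1) = t.isFrame.detAt e z := by
      rw [t.isFrame.detAt_eq (inf_le_left.trans k1 : W₁ ⊓ W₂ ≤ t.dom) (inf_le_right.trans k2) hR hz,
        (t.isFrame.res_frame k1).detAt_eq (inf_le_left : W₁ ⊓ W₂ ≤ W₁) inf_le_right
          (fun b => by simp only [E.res_res]; exact hR b) hz]
    rw [e1, (hsq z hzU).2, e2, hzS.self_of_nhds, Complex.exp_add, Complex.exp_neg, zpow_neg]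
    have := Complex.exp_ne_zero (p z)
    have := zpow_ne_zero d hz0
    field_simp

/-- The degree is unique. -/
lemma HasDegree.le {d d' : ℤ} (h : HasDegree n E d) (h' : HasDegree n E d') : d' ≤ d := by
  obtain ⟨hlf, σ, h1, h2⟩ := h
  obtain ⟨-, σ', h1', h2'⟩ := h'
  by_contra! hlt
  choose W hW e he using hlf
  have hO : ∀ {x : P1}, x ≠ zero → x ∈ (⟨{zero}ᶜ, isClosed_singleton.isOpen_compl⟩ : Opens P1) :=
    fun h => h
  -- Both sections are multiplied by the same determinant under a change of frame, so their ratio is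
  -- a function on the sphere without the origin.
  have indep : ∀ {V V' : Opens P1} {f : Fin n → E.sec V} {f' : Fin n → E.sec V'} (_ : IsFrame E f)
      (_ : IsFrame E f') {x : P1}, x ∈ V → x ∈ V' → x ≠ zero →
      σ' V f x / σ V f x = σ' V' f' x / σ V' f' x := by
    intro V V' f f' hf hf' x hx hx' hx0
    have hM := hf.eq_sum_matrix (inf_le_left : V ⊓ V' ≤ V) (fun a => E.res inf_le_right (f' a))
    have hu := Hol.ne_zero_of_isUnit (hf.isUnit_matrix_det (inf_le_left : V ⊓ V' ≤ V)
      (hf'.res_frame inf_le_right)) ⟨x, hx, hx'⟩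
    rw [h1 _ _ _ _ hf hf' _ _ _ _ hM ⟨x, hx, hx'⟩ hx0, h1' _ _ _ _ hf hf' _ _ _ _ hM ⟨x, hx, hx'⟩ hx0,
      mul_div_mul_left _ _ hu]
  let r : P1 → ℂ := fun x => σ' (W x) (e x) x / σ (W x) (e x) x
  have hr : ∀ x₀ x, x ∈ W x₀ → x ≠ zero → r x = σ' (W x₀) (e x₀) x / σ (W x₀) (e x₀) x :=
    fun x₀ x hx hx0 => indep (he x) (he x₀) (hW x) hx hx0
  -- Under the assumption `d < d'` the ratio vanishes at the origin to order `d' - d`, so the value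
  -- `0` there is its holomorphic extension.
  let R : ℂ → ℂ := fun z => if z = 0 then 0 else r z
  have hcoe0 : ∀ {z : ℂ}, z ≠ 0 → (z : P1) ≠ zero := fun hz h => hz (OnePoint.coe_injective h)
  have hdiff : Differentiable ℂ R := by
    intro z₀
    refine AnalyticAt.differentiableAt ?_
    by_cases hz₀ : z₀ = 0
    · subst hz₀
      obtain ⟨u, hu, hu0, hσ⟩ := (h2 _ _ (he zero)).2.2 (hW zero)
      obtain ⟨u', hu', -, hσ'⟩ := (h2' _ _ (he zero)).2.2 (hW zero)
      refine AnalyticAt.congr (f := fun z => z ^ (d' - d).toNat * (u' z / u z))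
        ((analyticAt_id.pow _).fun_mul (hu'.fun_div hu hu0)) ?_
      rw [eventually_nhdsWithin_iff] at hσ hσ'
      filter_upwards [hσ, hσ', eventually_coe (hW zero)] with z hz hz' hzW
      by_cases hz0 : z = 0
      · simp only [R, hz0, if_true]
        rw [zero_pow (by omega), zero_mul]
      · simp only [R, if_neg hz0]
        rw [hr zero z hzW (hcoe0 hz0), hz hz0, hz' hz0, mul_div_mul_comm, ← zpow_sub₀ hz0, ← zpow_natCast,
          Int.toNat_of_nonneg (by omega)]
    · have hx0 := hcoe0 hz₀
      have a1 := (h2 _ _ (he z₀)).1.1 z₀ ⟨hW z₀, hO hx0⟩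
      have a2 := (h2' _ _ (he z₀)).1.1 z₀ ⟨hW z₀, hO hx0⟩
      refine (a2.fun_div a1 ?_).congr ?_
      · rw [ext_of_mem _ (⟨hW z₀, hO hx0⟩ : (z₀ : P1) ∈ W z₀ ⊓ ⟨{zero}ᶜ, _⟩)]
        exact (h2 _ _ (he z₀)).2.1 _ (hW z₀) hx0
      · filter_upwards [eventually_coe (hW z₀), isOpen_ne.mem_nhds hz₀] with z hz hz0
        have hzz := hcoe0 hz0
        rw [ext_of_mem _ (⟨hz, hO hzz⟩ : (z : P1) ∈ W z₀ ⊓ ⟨{zero}ᶜ, _⟩),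
          ext_of_mem _ (⟨hz, hO hzz⟩ : (z : P1) ∈ W z₀ ⊓ ⟨{zero}ᶜ, _⟩)]
        simp only [R, if_neg hz0]
        exact (hr z₀ z hz hzz).symm
  have hi : OnePoint.infty ≠ zero := (OnePoint.coe_ne_infty 0).symm
  let x := (OnePoint.infty : P1)
  have hxO : x ∈ W x ⊓ ⟨{zero}ᶜ, isClosed_singleton.isOpen_compl⟩ := ⟨hW x, hO hi⟩
  have c1 := ((h2 _ _ (he x)).1.2 hxO).continuousAt
  have c2 := ((h2' _ _ (he x)).1.2 hxO).continuousAt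
  have hne := (h2 _ _ (he x)).2.1 _ (hW x) hi
  have hne' := (h2' _ _ (he x)).2.1 _ (hW x) hi
  have hext0 : ∀ τ : P1 → ℂ, ext (U := W x ⊓ ⟨{zero}ᶜ, isClosed_singleton.isOpen_compl⟩)
      (fun y => τ y) (chartInf 0) = τ x := fun τ => by
    rw [chartInf_zero]
    exact ext_of_mem _ hxO
  have hlim := (c2.div c1 (by rw [hext0]; exact hne)).tendsto.comp
    (Filter.tendsto_inv₀_cobounded (α := ℂ))
  simp only [Pi.div_apply, hext0] at hlim
  have hR : Filter.Tendsto R (Filter.cocompact ℂ) (𝓝 (σ' (W x) (e x) x / σ (W x) (e x) x)) := by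
    rw [← Metric.cobounded_eq_cocompact]
    refine hlim.congr' ?_
    filter_upwards [Filter.tendsto_inv₀_cobounded.eventually (eventually_chartInf hxO),
      Bornology.eventually_ne_cobounded (0 : ℂ)] with z hz hz0
    have hc : chartInf z⁻¹ = (z : P1) := by simp [chartInf, hz0]
    rw [hc] at hz
    simp only [Function.comp_apply, Pi.div_apply, hc]
    rw [ext_of_mem _ hz, ext_of_mem _ hz]
    simp only [R, if_neg hz0]
    exact (hr x z hz.1 (hcoe0 hz0)).symm
  -- Liouville: an entire function with a limit at infinity is constant. The limit is non-zero while
  -- the value at the origin is zero.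
  have h0 := hdiff.apply_eq_of_tendsto_cocompact 0 hR
  have : R 0 = 0 := if_pos rfl
  rw [this] at h0
  exact div_ne_zero hne' hne h0.symm

end Degree

end LoopFlag
end

/-! ### The degree of the base bundle and the assembly of the theorem. -/

noncomputable section
namespace LoopFlag

variable {n : ℕ} {Δ : Finset ℕ}

/-- The degree of the base bundle of a chain, in terms of its transition function. -/
lemma Chain.IsBase.hasDegree {c : Chain n Δ} {p : Idx n Δ} {F : FlaggedBundle n (flagDims n Δ p.j)}
    (h : c.IsBase p F) {g : LoopGL n} (hg : c.HasTransition g) {w : ℤ} (hw : HasWinding g.1.det w) :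
    HasDegree n F.E (n * (p.i - 1) + p.j - w) := by
  obtain ⟨f, hf, hr, -⟩ := h
  obtain ⟨D, -, e, h1, h2, -, h4⟩ := Chain.hasTransition_iff.1 hg
  have := hasDegree_of_val (t := F.framing) h1 ((h2 p).map_of_isIso _ (f.isIso_inv hf))
    (fun z b a => ((hr.inv hf).val_eq _ (h1 z z.norm_coe.le) (circle_mem_outerDisc z) b).trans
      (h4 p z b a)) hw
  rw [sum_expo, Idx.pos] at this
  convert this using 1
  ring

end LoopFlag
end


theorem mainTheorem11 (n : ℕ) (Δ : Finset ℕ) (hΔ : Δ ⊂ Finset.Icc 1 n) :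
    (∀ g : LoopGL n, ∃! w : ℤ, HasWinding (g.1.det) w) ∧
    ∃ Φ : (LoopGL n ⧸ parabolic n Δ) ≃ Quotient (chainSetoid n Δ),
      (∀ (g : LoopGL n) (c : Chain n Δ),
        Φ (QuotientGroup.mk g) = Quotient.mk (chainSetoid n Δ) c ↔ c.HasTransition g) ∧
      ∀ p : Idx n Δ,
        ∃ Ψ : Quotient (chainSetoid n Δ) ≃ Quotient (flaggedSetoid n (flagDims n Δ p.j)),
          (∀ (c : Chain n Δ) (F : FlaggedBundle n (flagDims n Δ p.j)),
            Ψ (Quotient.mk (chainSetoid n Δ) c) = Quotient.mk (flaggedSetoid n _) F ↔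
              c.IsBase p F) ∧
          ∀ (g : LoopGL n) (w : ℤ) (F : FlaggedBundle n (flagDims n Δ p.j)),
            HasWinding (g.1.det) w →
            Ψ (Φ (QuotientGroup.mk g)) = Quotient.mk (flaggedSetoid n _) F →
            ∀ d : ℤ, HasDegree n F.E d ↔ d = n * (p.i - 1) + p.j - w := by
  -- Properness of `Δ` provides an index `j`; it ensures `n ≠ 0` and a member of the chain from
  -- which to read off a loop.
  have hJ : (Finset.Icc 1 n \ Δ).Nonempty := Finset.sdiff_nonempty.2 hΔ.2
  obtain ⟨j, hj⟩ := hJ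
  have hj' := Finset.mem_Icc.1 (Finset.mem_sdiff.1 hj).1
  have : NeZero n := ⟨by omega⟩
  refine ⟨fun g => g.existsUnique_hasWinding, ?_⟩
  obtain ⟨Φ, hΦ⟩ := exists_equiv_of_relation (s := QuotientGroup.leftRel (parabolic n Δ))
    (t := chainSetoid n Δ) (fun g c => c.HasTransition g) exists_chain
    (fun c => c.exists_hasTransition ⟨0, j, hj⟩)
    (fun g c g' c' h h' => QuotientGroup.leftRel_apply.trans (h.mem_parabolic_iff ⟨j, hj⟩ h'))
    (fun g c c' h hc => h.of_iso hc)
  refine ⟨Φ, hΦ, fun p => ?_⟩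
  obtain ⟨Ψ, hΨ⟩ := exists_equiv_of_relation (s := chainSetoid n Δ)
    (t := flaggedSetoid n (flagDims n Δ p.j)) (fun c F => c.IsBase p F)
    (fun c => c.exists_isBase p) (fun F => F.exists_isBase)
    (fun c F c' F' h h' => ⟨h.iso_of_iso h', h.chain_iso_of_iso ⟨j, hj⟩ h'⟩)
    (fun c F F' h hF => h.of_iso hF)
  refine ⟨Ψ, hΨ, fun g w F hw hF => ?_⟩
  -- The class of `g` is represented by the chain built from it, so `F` becomes the base of a chain
  -- with known transition function.
  obtain ⟨c, hc⟩ := exists_chain (Δ := Δ) g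
  have hcF : c.IsBase p F := by
    rw [← hΨ, ← (hΦ g c).2 hc]
    exact hF
  have key := hcF.hasDegree hc hw
  exact fun d => ⟨fun h => le_antisymm (key.le h) (h.le key), fun h => h ▸ key⟩
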